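/- Let $(\Omega,\mathcal M,\mu)$ be a probability space, $\Sigma$ an index set and $(d_\sigma)_{\sigma\in\Sigma}$ a family of positive integers. Let $\Phi=\{\varphi^\sigma:\Omega\to M_{d_\sigma}\}_{\sigma\in\Sigma}$ be a uniformly bounded quantized orthonormal system, i.e. a collection of matrix-valued functions with measurable entries such that $$\int_\Omega \varphi^\sigma_{ij}\,\overline{\varphi^{\sigma'}_{i'j'}}\,d\mu=\frac1{d_\sigma}\,\delta_{\sigma\sigma'}\delta_{ii'}\delta_{jj'},\qquad \mathrm M_\Phi:=\sup_{\sigma\in\Sigma}\ \operatorname*{ess\,sup}_{\omega\in\Omega}\ \|\varphi^\sigma(\omega)\|_{S^\infty_{d_\sigma}}<\infty .$$ For $1\le r<\infty$ let $\mathcal L^r(\Sigma)$ be the space of all $A\in\prod_\sigma M_{d_\sigma}$ with $\|A\|_{\mathcal L^r(\Sigma)}=\big(\sum_\sigma d_\sigma\|A^\sigma\|_{S^r_{d_\sigma}}^r\big)^{1/r}<\infty$, where $S^r_d$ is the Schatten $r$-class over $M_d$, and let $\mathcal L^\infty(\Sigma)$ be the space of all $A$ with $\sup_\sigma\|A^\sigma\|_{S^\infty_{d_\sigma}}<\infty$.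 The spaces $L^r(\Omega)$ and $\mathcal L^r(\Sigma)$ carry their natural operator space structures: $L^\infty(\Omega)$ and $\mathcal L^\infty(\Sigma)$ are normed as von Neumann algebras; $L^1(\Omega)$ and $\mathcal L^1(\Sigma)$ are normed by duality with $L^\infty(\Omega)$ and with the $c_0$-sum of the $M_{d_\sigma}$, through the pairings $\int fg\,d\mu$ and $\sum_\sigma d_\sigma\sum_{a,b}A^\sigma_{ab}B^\sigma_{ab}$ respectively; and for $1<r<\infty$ they are the complex interpolation spaces $L^r(\Omega)=(L^\infty(\Omega),L^1(\Omega))_{1/r}$ and $\mathcal L^r(\Sigma)=(\mathcal L^\infty(\Sigma),\mathcal L^1(\Sigma))_{1/r}$. Put $$\mathcal F_\Phi(f)^\sigma=\int_\Omega f(\omega)\,\varphi^\sigma(\omega)^{\star}\,d\mu(\omega),\qquad \mathcal F_\Phi^{-1}(A)(\omega)=\sum_{\sigma\in\Sigma}d_\sigma\operatorname{tr}\big(A^\sigma\varphi^\sigma(\omega)\big).$$ Let $1\le p\le 2$ and let $p'$ be its conjugate exponent. Then $\mathcal F_\Phi$ maps $L^p(\Omega)$ into $\mathcal L^{p'}(\Sigma)$;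 for every $A\in\mathcal L^p(\Sigma)$ the series defining $\mathcal F_\Phi^{-1}(A)$ is unconditionally summable in $L^{p'}(\Omega)$; both maps are completely bounded, and $$\|\mathcal F_\Phi\|_{cb(L^p(\Omega),\,\mathcal L^{p'}(\Sigma))}\le \mathrm M_\Phi^{2/p-1},\qquad \|\mathcal F_\Phi^{-1}\|_{cb(\mathcal L^p(\Sigma),\,L^{p'}(\Omega))}\le \mathrm M_\Phi^{2/p-1}.$$ -/

import Mathlib

open MeasureTheory Filter Topology
open scoped ENNReal Matrix Matrix.Norms.L2Operator

noncomputable section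

namespace QOS

/-! Throughout, `Matrix m n ℂ` carries the operator norm on Euclidean spaces
(scoped instance `Matrix.Norms.L2Operator`), that is, the norm of `S^∞`. -/

/-- A uniformly bounded quantized orthonormal system on `(Ω, μ)` with parameters `(S, d)`. -/
structure UBQOS {Ω : Type*} [MeasurableSpace Ω] (μ : Measure Ω) {S : Type*} (d : S → ℕ) where
  /-- the matrix-valued functions of the system -/
  φ : (σ : S) → Ω → Matrix (Fin (d σ)) (Fin (d σ)) ℂ
  d_pos : ∀ σ, 0 < d σ
  measurable_entry : ∀ σ i j, Measurable fun ω => φ σ ω i j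
  orthogonal : ∀ σ τ, σ ≠ τ → ∀ i j k l,
    ∫ ω, φ σ ω i j * starRingEnd ℂ (φ τ ω k l) ∂μ = 0
  orthonormal : ∀ σ i j k l,
    ∫ ω, φ σ ω i j * starRingEnd ℂ (φ σ ω k l) ∂μ = if i = k ∧ j = l then 1 / (d σ : ℂ) else 0
  bounded : (⨆ σ, essSup (fun ω => ‖φ σ ω‖ₑ) μ) < ∞

/-! ### Complex interpolation -/

section Interpolation

variable {V : Type*} [NormedAddCommGroup V] [NormedSpace ℂ V]

/-- `V` is (a copy, up to an equivalent norm, of) the sum of two compatible Banach spaces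
`X_j = {v | N_j v < ∞}`, whose norms are `N_j` (`j = 0, 1`).
Calderon's class: functions on the strip `0 ≤ Re z ≤ 1` with values in `X_0 + X_1`, bounded and
continuous, analytic inside, and such that `t ↦ f (j + i t)` is continuous into `X_j`. -/
structure IsCalderon (N₀ N₁ : V → ℝ≥0∞) (f : ℂ → V) : Prop where
  diffContOnCl : DiffContOnCl ℂ f {z : ℂ | 0 < z.re ∧ z.re < 1}
  isBounded : Bornology.IsBounded (f '' {z : ℂ | 0 ≤ z.re ∧ z.re ≤ 1})
  finite₀ : ∀ t : ℝ, N₀ (f (t * Complex.I)) < ∞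
  finite₁ : ∀ t : ℝ, N₁ (f (1 + t * Complex.I)) < ∞
  continuous₀ : ∀ t₀ : ℝ, Tendsto (fun t : ℝ => N₀ (f (t * Complex.I) - f (t₀ * Complex.I)))
    (𝓝 t₀) (𝓝 0)
  continuous₁ : ∀ t₀ : ℝ,
    Tendsto (fun t : ℝ => N₁ (f (1 + t * Complex.I) - f (1 + t₀ * Complex.I))) (𝓝 t₀) (𝓝 0)

/-- The norm of the complex interpolation space `(X_0, X_1)_θ`, `0 < θ < 1`
(equal to `∞` outside of that space). -/
def interpNorm (N₀ N₁ : V → ℝ≥0∞) (θ : ℝ) (v : V) : ℝ≥0∞ :=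
  ⨅ (f : ℂ → V) (_ : IsCalderon N₀ N₁ f) (_ : f θ = v),
    max (⨆ t : ℝ, N₀ (f (t * Complex.I))) (⨆ t : ℝ, N₁ (f (1 + t * Complex.I)))

end Interpolation

/-! ### The operator space `L^p(Ω)`

An operator space structure is given by its matrix norms, with values in `[0, ∞]`. -/

section Lebesgue

variable {Ω : Type*} [MeasurableSpace Ω] (μ : Measure Ω)

/-- The norm of `M_n(L^∞(Ω)) = L^∞(Ω; M_n)`. -/
def matNormLinf (n : ℕ) (x : Fin n → Fin n → Ω → ℂ) : ℝ≥0∞ :=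
  essSup (fun ω => ‖(Matrix.of fun i j => x i j ω : Matrix (Fin n) (Fin n) ℂ)‖ₑ) μ

/-- The norm of `M_n(L^1(Ω))`, where `L^1(Ω)` is embedded in the dual operator space of
`L^∞(Ω)`: an `n × n` matrix over the dual of `X` is normed as the completely bounded map
`X → M_n` that it induces, that is, by its action on the unit balls of all `M_m(X)`. -/
def matNormLone (n : ℕ) (x : Fin n → Fin n → Ω → ℂ) : ℝ≥0∞ :=
  ⨆ (m : ℕ) (y : Fin m → Fin m → Lp ℂ ∞ μ) (_ : matNormLinf μ m (fun k l => y k l) ≤ 1),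
    ‖(Matrix.of fun a b => ∫ ω, x a.1 b.1 ω * y a.2 b.2 ω ∂μ :
      Matrix (Fin n × Fin m) (Fin n × Fin m) ℂ)‖ₑ

/-- The norm of `M_n(L^p(Ω))`, `1 ≤ p ≤ ∞`, for a finite measure:
`L^p(Ω) = (L^∞(Ω), L^1(Ω))_{1/p}` as operator spaces, that is,
`M_n(L^p(Ω)) = (M_n(L^∞(Ω)), M_n(L^1(Ω)))_{1/p}` for all `n`. As `L^∞(Ω) ⊆ L^1(Ω)`, the sum of
the two spaces is `L^1(Ω)`. -/
def matNormLp (p : ℝ≥0∞) (n : ℕ) (x : Matrix (Fin n) (Fin n) (Lp ℂ p μ)) : ℝ≥0∞ :=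
  if p = ∞ then matNormLinf μ n (fun i j => x i j)
  else if p = 1 then matNormLone μ n (fun i j => x i j)
  else ⨅ (v : Fin n → Fin n → Lp ℂ 1 μ) (_ : ∀ i j, (v i j : Ω → ℂ) =ᵐ[μ] x i j),
    interpNorm (fun w : Fin n → Fin n → Lp ℂ 1 μ => matNormLinf μ n (fun i j => w i j))
      (fun w : Fin n → Fin n → Lp ℂ 1 μ => matNormLone μ n (fun i j => w i j)) (p.toReal)⁻¹ v

end Lebesgue

/-! ### The operator space `ℒ^p(Σ)` -/

section Sequences

variable {S : Type*} (d : S → ℕ)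

/-- The product of the matrix algebras `M_{d_σ}`. -/
abbrev Fam : Type _ := (σ : S) → Matrix (Fin (d σ)) (Fin (d σ)) ℂ

/-- The norm of the Schatten class `S_k^p` (the `ℓ^p` norm of the singular values). -/
def schattenNorm {k : ℕ} (p : ℝ≥0∞) (A : Matrix (Fin k) (Fin k) ℂ) : ℝ≥0∞ :=
  if p = ∞ then ‖A‖ₑ
  else (∑ i ∈ Finset.range k,
    ENNReal.ofReal ((Matrix.toEuclideanLin A).singularValues i) ^ p.toReal) ^ (1 / p.toReal)

/-- The norm of `ℒ^p(Σ)` (equal to `∞` outside of that space). -/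
def famNorm (p : ℝ≥0∞) (A : Fam d) : ℝ≥0∞ :=
  if p = ∞ then ⨆ σ, schattenNorm ∞ (A σ)
  else (∑' σ, (d σ : ℝ≥0∞) * schattenNorm p (A σ) ^ p.toReal) ^ (1 / p.toReal)

/-- The norm of `M_n(ℒ^∞(Σ))`, the `ℓ^∞`-sum over `σ` of `M_n(M_{d_σ}) = M_{n d_σ}`. -/
def matNormFamInf (n : ℕ) (x : Fin n → Fin n → Fam d) : ℝ≥0∞ :=
  ⨆ σ, ‖(Matrix.of fun a b => x a.1 b.1 σ a.2 b.2 :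
    Matrix (Fin n × Fin (d σ)) (Fin n × Fin (d σ)) ℂ)‖ₑ

/-- The norm of `M_n(ℒ^1(Σ))`, where `ℒ^1(Σ)` is the dual operator space of the `c_0`-sum of the
`M_{d_σ}` (so finitely supported test families suffice) in the parallel duality
`⟨A, B⟩ = ∑_σ d_σ ∑_{a,b} A^σ_{ab} B^σ_{ab}`. This is the duality for which complex
interpolation between `S^∞` and `S^1` gives the natural operator space structure of `S^p`. -/
def matNormFamOne (n : ℕ) (x : Fin n → Fin n → Fam d) : ℝ≥0∞ :=
  ⨆ (F : Finset S) (m : ℕ) (y : Fin m → Fin m → Fam d) (_ : matNormFamInf d m y ≤ 1),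
    ‖(Matrix.of fun a b => ∑ σ ∈ F, (d σ : ℂ) *
        ∑ s, ∑ t, x a.1 b.1 σ s t * y a.2 b.2 σ s t :
      Matrix (Fin n × Fin m) (Fin n × Fin m) ℂ)‖ₑ

/-- The Banach space `ℒ^∞(Σ)` of bounded families. -/
abbrev FamInf : Type _ := lp (fun σ : S => Matrix (Fin (d σ)) (Fin (d σ)) ℂ) ∞

/-- The norm of `M_n(ℒ^p(Σ))`, `1 ≤ p ≤ ∞`: `ℒ^p(Σ) = (ℒ^∞(Σ), ℒ^1(Σ))_{1/p}` as operator spaces.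
As `d_σ ≥ 1`, `ℒ^1(Σ) ⊆ ℒ^∞(Σ)` and the sum of the two spaces is `ℒ^∞(Σ)`. -/
def matNormFam (p : ℝ≥0∞) (n : ℕ) (x : Matrix (Fin n) (Fin n) (Fam d)) : ℝ≥0∞ :=
  if p = ∞ then matNormFamInf d n (fun i j => x i j)
  else if p = 1 then matNormFamOne d n (fun i j => x i j)
  else ⨅ (v : Fin n → Fin n → FamInf d) (_ : ∀ i j σ, v i j σ = x i j σ),
    interpNorm (fun w : Fin n → Fin n → FamInf d => matNormFamInf d n (fun i j σ => w i j σ))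
      (fun w : Fin n → Fin n → FamInf d => matNormFamOne d n (fun i j σ => w i j σ))
      (p.toReal)⁻¹ v

end Sequences

/-- The completely bounded norm `sup_n ‖u_n : M_n(E) → M_n(F)‖` of a map `u : E → F`, where `N` and
`N'` are the matrix norms of `E` and `F` (`u` is only looked at on the matrices of finite norm). -/
def cbNorm {V W : Type*} (N : (n : ℕ) → Matrix (Fin n) (Fin n) V → ℝ≥0∞)
    (N' : (n : ℕ) → Matrix (Fin n) (Fin n) W → ℝ≥0∞) (u : V → W) : ℝ≥0∞ :=
  ⨆ (n : ℕ) (x : Matrix (Fin n) (Fin n) V) (_ : N n x ≤ 1), N' n (x.map u)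

/-! ### The transform and its inverse -/

lemma norm_entry_le {k : ℕ} (A : Matrix (Fin k) (Fin k) ℂ) (i j : Fin k) : ‖A i j‖ ≤ ‖A‖ := by
  have h := Matrix.l2_opNorm_mulVec A (EuclideanSpace.single j (1 : ℂ))
  have h2 := PiLp.norm_apply_le (WithLp.toLp 2 (A *ᵥ (EuclideanSpace.single j (1 : ℂ)).ofLp)) i
  simp at h h2
  exact h2.trans h

namespace UBQOS

variable {Ω : Type*} [MeasurableSpace Ω] {μ : Measure Ω} {S : Type*} {d : S → ℕ} (Φ : UBQOS μ d)

/-- The uniform bound `M_Φ`. -/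
def M : ℝ≥0∞ := ⨆ σ, essSup (fun ω => ‖Φ.φ σ ω‖ₑ) μ

/-- The transform `F_Φ(f)^σ = ∫ f(ω) φ^σ(ω)^⋆ dμ(ω)`, on `L^p(Ω)`. -/
def transform (p : ℝ≥0∞) (f : Lp ℂ p μ) : Fam d :=
  fun σ => Matrix.of fun i j => ∫ ω, f ω * (Φ.φ σ ω)ᴴ i j ∂μ

lemma memLp_entry [IsFiniteMeasure μ] (q : ℝ≥0∞) (σ : S) (i j : Fin (d σ)) :
    MemLp (fun ω => Φ.φ σ ω i j) q μ := by
  refine MemLp.mono_exponent (q := ∞) ⟨(Φ.measurable_entry σ i j).aestronglyMeasurable, ?_⟩ le_top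
  rw [eLpNorm_exponent_top]
  refine lt_of_le_of_lt ?_ Φ.bounded
  refine le_trans ?_ (le_iSup (fun σ => essSup (fun ω => ‖Φ.φ σ ω‖ₑ) μ) σ)
  refine essSup_mono_ae (Eventually.of_forall fun ω => ?_)
  exact enorm_le_iff_norm_le.2 (norm_entry_le _ i j)

lemma memLp_term [IsFiniteMeasure μ] (q : ℝ≥0∞) (A : Fam d) (σ : S) :
    MemLp (fun ω => (d σ : ℂ) * Matrix.trace (A σ * Φ.φ σ ω)) q μ := by
  simp only [Matrix.trace, Matrix.diag, Matrix.mul_apply]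
  refine MemLp.const_mul ?_ _
  refine memLp_finsetSum _ fun i _ => memLp_finsetSum _ fun j _ => ?_
  exact (Φ.memLp_entry q σ j i).const_mul _

/-- The function `d_σ tr(A^σ φ^σ)`, as an element of `L^q(Ω)`. -/
def term [IsFiniteMeasure μ] (q : ℝ≥0∞) (A : Fam d) (σ : S) : Lp ℂ q μ :=
  (Φ.memLp_term q A σ).toLp

/-- The inverse transform `F_Φ⁻¹(A) = ∑_σ d_σ tr(A^σ φ^σ)`, the series being (unconditionally)
summed in `L^q(Ω)`. -/
def invTransform [IsFiniteMeasure μ] (q : ℝ≥0∞) [Fact (1 ≤ q)] (A : Fam d) : Lp ℂ q μ :=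
  ∑' σ, Φ.term q A σ

end UBQOS

end QOS

end

set_option linter.unusedSectionVars false

noncomputable section

/-! The plan is to replace the interpolation norms by a test form in which the transform can be
interpolated directly. Let 1 < r < ∞ and u = 1/(2r). For an n × n matrix over a finite weighted sum
of matrix algebras (finitely many coefficients on the Σ side, averages over disjoint sets on the Ω
side) put `theta` c a b X Y = ∑ c_j tr((a ⊗ 1) X_j (b ⊗ 1) Y_j). An element of M_n(L^r) or M_n(ℒ^r)
has norm at most C exactly when |`theta`| ≤ C for all a, b in the unit ball of the Schatten class
S^{2r}_n and all Y in the unit ball of the weighted sum ℓ^{r'}(S^{r'}). This is the formula ‖x‖ =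
sup ‖a x b‖, the norm on the right being that of the vector-valued space S^r_n[L^r].

Granted this, the Hausdorff-Young inequality is one application of the three lines theorem. Take an
almost optimal Calderon function for the given matrix and look only at the strip 1/2 ≤ Re z ≤ 1. On
Re z = 1/2 the test form with r = 2 is a pairing of Hilbert spaces, and orthonormality of the
normalized entries of the φ^σ (Parseval or Bessel) transports the bound with constant 1. On Re z = 1
the transform is completely bounded from exponent 1 to exponent ∞ with constant M, directly from the
duality that defines the L^1 norms. With θ = 2/p - 1 the point 1/p is 1/2 + θ/2, and the outcome is
a test bound M^θ for the exponent q (`famTest_transformFun`, `omTest_partialSum`).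

One half of the characterization is easy: a Calderon function satisfies the test bound, because a, b
and Y can be deformed along their singular value decompositions (`theta_three_lines`).

The other half constructs a Calderon function from a test bound (`exists_analytic_family`). Let w be
the finite family. Maximize Re `theta` c a b w Y times a small power ε of |det a| |det b|; the balls
are compact, and the determinants force the maximizers a, b to be invertible. By unitary invariance
a and b may be taken positive; write a w b = U σ^{1/r} V. Perturbing a by 1 + t η η^* and comparing
derivatives at t = 0 gives a domination: the partial trace of ∑ c_j U_j σ_j U_j^* is at most (1 + ε
n) Λ a^{2r}, where Λ = ∑ c_j tr σ_j, and similarly for b. The perturbed matrix is compared with the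
unit ball through an inequality of Araki-Lieb-Thirring type. Now W(z) = C' a^{-rz} U (σ/κ)^z V
b^{-rz} equals w at z = 1/r, is bounded by C' on Re z = 0, and on Re z = 1 splits as C' P Q, where
the domination says precisely that P and Q are contractive enough for the M_n(L^1) norm
(`norm_pairing_le`).

The passage from finite families and simple functions to general elements uses countable
subadditivity of interpolation norms (`interpNorm_tsum_le`): a general element is a first finite
piece carrying the norm C plus a series of pieces of geometrically small norm. The case p = 1 is
treated by hand. -/

namespace QOS

/-! ### Complex powers of nonnegative reals -/

/-- The complex power `s ^ z` of a nonnegative real `s`, equal to `0` for `s = 0` and all `z`. -/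
def zp (s : ℝ) (z : ℂ) : ℂ := if s = 0 then 0 else Complex.exp (z * Real.log s)

lemma zp_zero (z : ℂ) : zp 0 z = 0 := by simp [zp]

lemma differentiable_zp (s : ℝ) : Differentiable ℂ (zp s) := by
  unfold zp
  split_ifs
  · exact differentiable_const _
  · fun_prop

lemma zp_add (s : ℝ) (z w : ℂ) : zp s (z + w) = zp s z * zp s w := by
  unfold zp
  split_ifs
  · simp
  · rw [← Complex.exp_add, add_mul]

lemma norm_zp {s : ℝ} (hs : 0 < s) (z : ℂ) : ‖zp s z‖ = s ^ z.re := by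
  rw [zp, if_neg hs.ne', Complex.norm_exp, Real.rpow_def_of_pos hs]
  simp [mul_comm]

lemma norm_zp_le {s : ℝ} (hs : 0 ≤ s) (z : ℂ) : ‖zp s z‖ ≤ s ^ z.re := by
  rcases hs.eq_or_lt with rfl | hs
  · simp [zp_zero, Real.rpow_nonneg]
  · exact (norm_zp hs z).le

lemma norm_zp_le_one {s : ℝ} (hs : 0 ≤ s) {z : ℂ} (hz : z.re = 0) : ‖zp s z‖ ≤ 1 := by
  simpa [hz] using norm_zp_le hs z

lemma zp_ofReal_of_pos {s : ℝ} (hs : 0 < s) (x : ℝ) : zp s x = ((s ^ x : ℝ) : ℂ) := by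
  rw [zp, if_neg hs.ne', Real.rpow_def_of_pos hs]
  push_cast
  rw [mul_comm]

lemma zp_ofReal {s : ℝ} (hs : 0 ≤ s) {x : ℝ} (hx : x ≠ 0) : zp s x = ((s ^ x : ℝ) : ℂ) := by
  rcases hs.eq_or_lt with rfl | hs
  · simp [zp_zero, Real.zero_rpow hx]
  · exact zp_ofReal_of_pos hs x

lemma zp_one {s : ℝ} (hs : 0 ≤ s) : zp s 1 = s := by
  simpa using zp_ofReal hs (one_ne_zero)

/-- The phase of `s ^ z`. -/
def zphase (s : ℝ) (z : ℂ) : ℂ := Complex.exp (z.im * Real.log s * Complex.I)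

lemma zp_eq_phase_mul (s : ℝ) (z : ℂ) : zp s z = zphase s z * zp s z.re := by
  unfold zp zphase
  split_ifs
  · simp
  · rw [← Complex.exp_add]
    congr 1
    conv_lhs => rw [← Complex.re_add_im z]
    ring

lemma norm_zphase (s : ℝ) (z : ℂ) : ‖zphase s z‖ = 1 := by
  rw [zphase, ← Complex.ofReal_mul, Complex.norm_exp_ofReal_mul_I]

lemma zp_mul {s t : ℝ} (hs : 0 ≤ s) (ht : 0 ≤ t) (z : ℂ) : zp (s * t) z = zp s z * zp t z := by
  rcases hs.eq_or_lt with rfl | hs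
  · simp [zp_zero]
  rcases ht.eq_or_lt with rfl | ht
  · simp [zp_zero]
  rw [zp, zp, zp, if_neg (mul_pos hs ht).ne', if_neg hs.ne', if_neg ht.ne', ← Complex.exp_add,
    Real.log_mul hs.ne' ht.ne']
  push_cast
  ring_nf

/-! ### Operator norms and bilinear forms -/

section Bilin

variable {m n : Type*} [Fintype m] [Fintype n] [DecidableEq n]

/-- The Euclidean norm of a finite family. -/
def l2 {m : Type*} [Fintype m] (x : m → ℂ) : ℝ := √(∑ i, ‖x i‖ ^ 2)

lemma l2_nonneg {m : Type*} [Fintype m] (x : m → ℂ) : 0 ≤ l2 x := Real.sqrt_nonneg _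

lemma l2_sq {m : Type*} [Fintype m] (x : m → ℂ) : l2 x ^ 2 = ∑ i, ‖x i‖ ^ 2 :=
  Real.sq_sqrt (Finset.sum_nonneg fun _ _ => by positivity)

lemma norm_sum_mul_le_l2 {m : Type*} [Fintype m] (x y : m → ℂ) :
    ‖∑ i, x i * y i‖ ≤ l2 x * l2 y := by
  refine (norm_sum_le _ _).trans ?_
  simp only [norm_mul]
  exact Real.sum_mul_le_sqrt_mul_sqrt _ _ _

lemma l2_mulVec_le (A : Matrix m n ℂ) (y : n → ℂ) : l2 (A *ᵥ y) ≤ ‖A‖ * l2 y := by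
  have h := Matrix.l2_opNorm_mulVec A (WithLp.toLp 2 y)
  rw [EuclideanSpace.norm_eq, EuclideanSpace.norm_eq] at h
  exact h

lemma norm_bilin_le (A : Matrix m n ℂ) (x : m → ℂ) (y : n → ℂ) :
    ‖∑ i, ∑ j, x i * A i j * y j‖ ≤ ‖A‖ * (l2 x * l2 y) := by
  have : ∑ i, ∑ j, x i * A i j * y j = ∑ i, x i * (A *ᵥ y) i := by
    simp only [Matrix.mulVec, dotProduct, Finset.mul_sum, mul_assoc]
  rw [this]
  refine (norm_sum_mul_le_l2 _ _).trans ?_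
  calc l2 x * l2 (A *ᵥ y) ≤ l2 x * (‖A‖ * l2 y) :=
        mul_le_mul_of_nonneg_left (l2_mulVec_le A y) (l2_nonneg x)
    _ = _ := by ring

/-- With `x` the conjugate of `A *ᵥ y` the form equals ‖A y‖², and one factor ‖A y‖ cancels. -/
lemma opNorm_le_of_bilin (A : Matrix m n ℂ) {C : ℝ} (hC : 0 ≤ C)
    (h : ∀ (x : m → ℂ) (y : n → ℂ), ‖∑ i, ∑ j, x i * A i j * y j‖ ≤ C * (l2 x * l2 y)) :
    ‖A‖ ≤ C := by
  rw [Matrix.l2_opNorm_def]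
  refine ContinuousLinearMap.opNorm_le_bound _ hC fun y => ?_
  have h1 := h (fun i => star ((A *ᵥ y.ofLp) i)) y.ofLp
  have h2 : ∑ i, ∑ j, star ((A *ᵥ y.ofLp) i) * A i j * y.ofLp j
      = ((∑ i, ‖(A *ᵥ y.ofLp) i‖ ^ 2 : ℝ) : ℂ) := by
    push_cast
    refine Finset.sum_congr rfl fun i _ => ?_
    rw [← Complex.conj_mul', ← starRingEnd_apply]
    conv_rhs => rw [Matrix.mulVec, dotProduct]
    simp only [Matrix.mulVec, dotProduct, Finset.mul_sum, mul_assoc]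
  have h3 : l2 (fun i => star ((A *ᵥ y.ofLp) i)) = l2 (A *ᵥ y.ofLp) := by simp [l2]
  rw [h2, h3, ← l2_sq, Complex.norm_real, Real.norm_of_nonneg (by positivity)] at h1
  have h4 : ‖((Matrix.toEuclideanLin.trans LinearMap.toContinuousLinearMap) A) y‖
      = l2 (A *ᵥ y.ofLp) := by
    rw [EuclideanSpace.norm_eq]; rfl
  have h5 : ‖y‖ = l2 y.ofLp := by rw [EuclideanSpace.norm_eq]; rfl
  rw [h4, h5]
  rcases (l2_nonneg (A *ᵥ y.ofLp)).eq_or_lt with h0 | h0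
  · rw [← h0]; exact mul_nonneg hC (l2_nonneg _)
  · nlinarith

lemma opNorm_transpose_le [DecidableEq m] (A : Matrix m n ℂ) : ‖Aᵀ‖ ≤ ‖A‖ := by
  refine opNorm_le_of_bilin _ (norm_nonneg _) fun x y => ?_
  rw [Finset.sum_comm]
  have := norm_bilin_le A y x
  rw [mul_comm (l2 x)]
  refine le_of_eq_of_le (congrArg _ ?_) this
  refine Finset.sum_congr rfl fun i _ => Finset.sum_congr rfl fun j _ => ?_
  rw [Matrix.transpose_apply]; ring

end Bilin

/-! ### Matrices given by a singular value decomposition -/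

section Pw

variable {ι κ : Type*} [Fintype ι] [DecidableEq ι] [Fintype κ] [DecidableEq κ]

/-- The matrix with singular value decomposition `U s ^ z V`. -/
def pw (U V : Matrix ι ι ℂ) (s : ι → ℝ) (z : ℂ) : Matrix ι ι ℂ :=
  U * Matrix.diagonal (fun i => zp (s i) z) * V

lemma pw_apply (U V : Matrix ι ι ℂ) (s : ι → ℝ) (z : ℂ) (i j : ι) :
    pw U V s z i j = ∑ k, U i k * zp (s k) z * V k j := by
  simp [pw, Matrix.mul_apply, Matrix.diagonal_apply]

lemma norm_unitary_le {U : Matrix ι ι ℂ} (hU : U ∈ Matrix.unitaryGroup ι ℂ) : ‖U‖ ≤ 1 := by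
  have h1 : Uᴴ * U = 1 := (Matrix.mem_unitaryGroup_iff').1 hU
  have h2 := Matrix.l2_opNorm_conjTranspose_mul_self U
  rw [h1] at h2
  have h3 : ‖(1 : Matrix ι ι ℂ)‖ ≤ 1 := by
    rw [← Matrix.diagonal_one, Matrix.l2_opNorm_diagonal]
    exact (pi_norm_le_iff_of_nonneg zero_le_one).2 fun i => by simp
  nlinarith [norm_nonneg U]

lemma norm_diagonal_le {v : ι → ℂ} {C : ℝ} (hC : 0 ≤ C) (h : ∀ i, ‖v i‖ ≤ C) :
    ‖Matrix.diagonal v‖ ≤ C := by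
  rw [Matrix.l2_opNorm_diagonal]
  exact (pi_norm_le_iff_of_nonneg hC).2 h

lemma norm_mul_mul_le {U V A : Matrix ι ι ℂ} (hU : ‖U‖ ≤ 1) (hV : ‖V‖ ≤ 1) :
    ‖U * A * V‖ ≤ ‖A‖ := by
  refine (Matrix.l2_opNorm_mul _ _).trans ?_
  have := Matrix.l2_opNorm_mul U A
  have h1 : ‖U * A‖ ≤ ‖A‖ := this.trans (mul_le_of_le_one_left (norm_nonneg _) hU)
  exact (mul_le_of_le_one_right (norm_nonneg _) hV).trans h1

lemma norm_pw_le {U V : Matrix ι ι ℂ} (hU : U ∈ Matrix.unitaryGroup ι ℂ)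
    (hV : V ∈ Matrix.unitaryGroup ι ℂ) {s : ι → ℝ} (hs : ∀ i, 0 ≤ s i) {z : ℂ} (hz : z.re = 0) :
    ‖pw U V s z‖ ≤ 1 :=
  (norm_mul_mul_le (norm_unitary_le hU) (norm_unitary_le hV)).trans
    (norm_diagonal_le zero_le_one fun i => norm_zp_le_one (hs i) hz)

lemma diagonal_mem_unitaryGroup {v : ι → ℂ} (hv : ∀ i, ‖v i‖ = 1) :
    Matrix.diagonal v ∈ Matrix.unitaryGroup ι ℂ := by
  rw [Matrix.mem_unitaryGroup_iff, Matrix.star_eq_conjTranspose, Matrix.diagonal_conjTranspose,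
    Matrix.diagonal_mul_diagonal, ← Matrix.diagonal_one]
  congr 1
  ext i
  simp [Complex.mul_conj', hv i]

/-- The imaginary part of the exponent only contributes phases, which a unitary factor absorbs.
Hence membership of `pw U V s z` in a Schatten ball depends on Re z alone, which is what makes `pw`
a good analytic family. -/
lemma pw_eq_pw_re (U V : Matrix ι ι ℂ) (s : ι → ℝ) (z : ℂ) :
    pw U V s z = pw (U * Matrix.diagonal fun i => zphase (s i) z) V s z.re := by
  rw [pw, pw, Matrix.mul_assoc U (Matrix.diagonal _) (Matrix.diagonal _),
    Matrix.diagonal_mul_diagonal]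
  simp_rw [← zp_eq_phase_mul]

/-- The sum of the squared absolute values of the entries. -/
lemma sum_norm_sq_unitary_mul {U : Matrix ι ι ℂ} (hU : U ∈ Matrix.unitaryGroup ι ℂ)
    (A : Matrix ι κ ℂ) : ∑ i, ∑ j, ‖(U * A) i j‖ ^ 2 = ∑ i, ∑ j, ‖A i j‖ ^ 2 := by
  have h (B : Matrix ι κ ℂ) : ((∑ i, ∑ j, ‖B i j‖ ^ 2 : ℝ) : ℂ) = (Bᴴ * B).trace := by
    rw [Finset.sum_comm]
    simp [Matrix.trace, Matrix.mul_apply, Complex.conj_mul']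
  apply_fun ((↑) : ℝ → ℂ) using Complex.ofReal_injective
  rw [h, h, Matrix.conjTranspose_mul, Matrix.mul_assoc, ← Matrix.mul_assoc Uᴴ,
    show Uᴴ * U = 1 from (Matrix.mem_unitaryGroup_iff').1 hU, Matrix.one_mul]

lemma sum_norm_sq_mul_unitary {U : Matrix κ κ ℂ} (hU : U ∈ Matrix.unitaryGroup κ ℂ)
    (A : Matrix ι κ ℂ) : ∑ i, ∑ j, ‖(A * U) i j‖ ^ 2 = ∑ i, ∑ j, ‖A i j‖ ^ 2 := by
  have h := sum_norm_sq_unitary_mul (Matrix.transpose_mem_unitaryGroup_iff.2 hU) Aᵀ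
  rw [← Matrix.transpose_mul] at h
  rw [Finset.sum_comm, Finset.sum_comm (f := fun i j => ‖A i j‖ ^ 2)]
  exact h

/-- The Hilbert-Schmidt norm is unitarily invariant, and |s ^ z|² = s when Re z = 1/2. -/
lemma sum_norm_sq_pw {U V : Matrix ι ι ℂ} (hU : U ∈ Matrix.unitaryGroup ι ℂ)
    (hV : V ∈ Matrix.unitaryGroup ι ℂ) {s : ι → ℝ} (hs : ∀ i, 0 ≤ s i) {z : ℂ}
    (hz : z.re = 1 / 2) : ∑ i, ∑ j, ‖pw U V s z i j‖ ^ 2 = ∑ i, s i := by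
  rw [pw, sum_norm_sq_mul_unitary hV, sum_norm_sq_unitary_mul hU]
  refine Finset.sum_congr rfl fun i _ => ?_
  rw [Finset.sum_eq_single i (fun j _ hj => by simp [Matrix.diagonal_apply_ne' _ hj]) (by simp),
    Matrix.diagonal_apply_eq]
  rcases (hs i).eq_or_lt with h | h
  · simp [← h, zp_zero]
  · rw [norm_zp h, hz, ← Real.rpow_natCast, ← Real.rpow_mul h.le]
    norm_num

/-- Trace duality between the operator norm and the trace norm. -/
lemma norm_trace_mul_pw_le {U V : Matrix ι ι ℂ} (hU : U ∈ Matrix.unitaryGroup ι ℂ)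
    (hV : V ∈ Matrix.unitaryGroup ι ℂ) {s : ι → ℝ} (hs : ∀ i, 0 ≤ s i) {z : ℂ} (hz : z.re = 1)
    (X : Matrix ι ι ℂ) : ‖(X * pw U V s z).trace‖ ≤ ‖X‖ * ∑ i, s i := by
  have h1 : (X * pw U V s z).trace = ((V * X * U) * Matrix.diagonal fun i => zp (s i) z).trace := by
    rw [pw, ← Matrix.mul_assoc, Matrix.trace_mul_comm, ← Matrix.mul_assoc, ← Matrix.mul_assoc]
  rw [h1, Matrix.trace, Finset.mul_sum]
  refine (norm_sum_le _ _).trans (Finset.sum_le_sum fun i _ => ?_)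
  rw [Matrix.diag_apply, Matrix.mul_diagonal, norm_mul]
  refine mul_le_mul ?_ (by simpa [hz] using norm_zp_le (hs i) z) (norm_nonneg _) (norm_nonneg _)
  have h2 := norm_bilin_le (V * X * U) (Pi.single i 1) (Pi.single i 1)
  have h3 : l2 (Pi.single i (1 : ℂ)) = 1 := by
    rw [l2, Finset.sum_eq_single i (fun j _ hj => by simp [hj]) (by simp)]
    simp
  rw [h3, mul_one, mul_one] at h2
  refine le_trans (le_of_eq ?_) (h2.trans (norm_mul_mul_le (norm_unitary_le hV) (norm_unitary_le hU)))
  congr 1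
  simp [Pi.single_apply]

end Pw

/-! ### Existence of singular value decompositions -/

lemma exists_svd_fin {k : ℕ} (A : Matrix (Fin k) (Fin k) ℂ) :
    ∃ U ∈ Matrix.unitaryGroup (Fin k) ℂ, ∃ V ∈ Matrix.unitaryGroup (Fin k) ℂ,
      A = U * Matrix.diagonal (fun i : Fin k =>
        ((Matrix.toEuclideanLin A).singularValues i : ℂ)) * V := by
  set T := Matrix.toEuclideanLin A with hTdef
  have hn : Module.finrank ℂ (EuclideanSpace ℂ (Fin k)) = k := by simp
  have hT := T.isSymmetric_adjoint_comp_self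
  let f := hT.eigenvectorBasis hn
  have hin (i j : Fin k) : inner ℂ (T (f i)) (T (f j))
      = if i = j then ((T.singularValues j : ℂ)) ^ 2 else 0 := by
    rw [← LinearMap.adjoint_inner_right]
    have h1 : (LinearMap.adjoint T) (T (f j)) = (LinearMap.adjoint T ∘ₗ T) (f j) := rfl
    rw [h1, hT.apply_eigenvectorBasis hn j, inner_smul_right]
    have h2 := orthonormal_iff_ite.1 f.orthonormal i j
    rw [h2, ← T.sq_singularValues_fin hn j]
    split_ifs <;> simp
  have horth : Pairwise fun i j => inner ℂ (T (f i)) (T (f j)) = 0 := fun i j hij => by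
    show inner ℂ (T (f i)) (T (f j)) = 0
    rw [hin, if_neg hij]
  have hnorm (i : Fin k) : ‖T (f i)‖ = T.singularValues i := by
    have h1 := hin i i
    rw [if_pos rfl, inner_self_eq_norm_sq_to_K] at h1
    have h2 : ‖T (f i)‖ ^ 2 = T.singularValues i ^ 2 := by
      apply Complex.ofReal_injective
      push_cast
      exact h1
    exact (sq_eq_sq₀ (norm_nonneg _) (T.singularValues_nonneg i)).1 h2
  -- The images of the right singular vectors are orthogonal, so Gram-Schmidt merely normalizes the
  -- nonzero ones; it also completes them to a basis, which takes care of the kernel.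
  let e := InnerProductSpace.gramSchmidtOrthonormalBasis (𝕜 := ℂ) (by simp) (fun i => T (f i))
  have he (i : Fin k) : T (f i) = (T.singularValues i : ℂ) • e i := by
    by_cases h : T (f i) = 0
    · have : T.singularValues i = 0 := by rw [← hnorm, h, norm_zero]
      rw [h, this]; simp
    · have h1 := InnerProductSpace.gramSchmidtOrthonormalBasis_apply_of_orthogonal
        (𝕜 := ℂ) (E := EuclideanSpace ℂ (Fin k)) (ι := Fin k) (by simp) horth h
      have h2 : e i = (‖T (f i)‖⁻¹ : ℂ) • T (f i) := h1
      rw [h2, smul_smul, ← hnorm, mul_inv_cancel₀, one_smul]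
      simpa using h
  let b := EuclideanSpace.basisFun (Fin k) ℂ
  let U : Matrix (Fin k) (Fin k) ℂ := b.toBasis.toMatrix e
  let W : Matrix (Fin k) (Fin k) ℂ := b.toBasis.toMatrix f
  have hU : U ∈ Matrix.unitaryGroup (Fin k) ℂ := b.toMatrix_orthonormalBasis_mem_unitary e
  have hW : W ∈ Matrix.unitaryGroup (Fin k) ℂ := b.toMatrix_orthonormalBasis_mem_unitary f
  have hUa (i j) : U i j = (e j).ofLp i := by simp [U, b, Module.Basis.toMatrix_apply]
  have hWa (i j) : W i j = (f j).ofLp i := by simp [W, b, Module.Basis.toMatrix_apply]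
  refine ⟨U, hU, Wᴴ, ?_, ?_⟩
  · rw [Matrix.mem_unitaryGroup_iff'] at *
    rw [Matrix.star_eq_conjTranspose, Matrix.conjTranspose_conjTranspose]
    exact (Matrix.mem_unitaryGroup_iff.1 ((Matrix.mem_unitaryGroup_iff').2 hW))
  · have hAW : A * W = U * Matrix.diagonal (fun i : Fin k => (T.singularValues i : ℂ)) := by
      ext i j
      rw [Matrix.mul_diagonal, hUa]
      have h1 := congrArg (fun v => v.ofLp i) (he j)
      simp only [WithLp.ofLp_smul, Pi.smul_apply, smul_eq_mul] at h1
      rw [mul_comm, ← h1, Matrix.mul_apply]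
      simp only [hWa]
      rfl
    rw [← hAW, Matrix.mul_assoc, show W * Wᴴ = 1 from Matrix.mem_unitaryGroup_iff.1 hW,
      Matrix.mul_one]

lemma reindex_mem_unitaryGroup {ι κ : Type*} [Fintype ι] [DecidableEq ι] [Fintype κ]
    [DecidableEq κ] (e : ι ≃ κ) {U : Matrix ι ι ℂ} (hU : U ∈ Matrix.unitaryGroup ι ℂ) :
    U.submatrix e.symm e.symm ∈ Matrix.unitaryGroup κ ℂ := by
  rw [Matrix.mem_unitaryGroup_iff, Matrix.star_eq_conjTranspose, Matrix.conjTranspose_submatrix,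
    Matrix.submatrix_mul_equiv, show U * Uᴴ = 1 from Matrix.mem_unitaryGroup_iff.1 hU,
    Matrix.submatrix_one_equiv]

lemma pw_submatrix {ι κ : Type*} [Fintype ι] [DecidableEq ι] [Fintype κ]
    [DecidableEq κ] (e : ι ≃ κ) (U V : Matrix ι ι ℂ) (s : ι → ℝ) (z : ℂ) :
    (pw U V s z).submatrix e.symm e.symm
      = pw (U.submatrix e.symm e.symm) (V.submatrix e.symm e.symm) (s ∘ e.symm) z := by
  rw [pw, pw, ← Matrix.submatrix_mul_equiv _ _ _ e.symm, ← Matrix.submatrix_mul_equiv _ _ _ e.symm,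
    Matrix.submatrix_diagonal_equiv]
  rfl

/-- Storing the powers of the singular values with exponent 1/x makes ∑ s_i the (1/x)-th power of
the Schatten norm of exponent 1/x, and puts `A` at the point x of the analytic family `pw U V s`. -/
lemma exists_pw_fin {k : ℕ} (A : Matrix (Fin k) (Fin k) ℂ) {x : ℝ} (hx : 0 < x) :
    ∃ U ∈ Matrix.unitaryGroup (Fin k) ℂ, ∃ V ∈ Matrix.unitaryGroup (Fin k) ℂ,
      A = pw U V (fun i => (Matrix.toEuclideanLin A).singularValues i ^ x⁻¹) x := by
  obtain ⟨U, hU, V, hV, h⟩ := exists_svd_fin A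
  refine ⟨U, hU, V, hV, h.trans ?_⟩
  rw [pw]
  congr 3
  ext i
  have h0 := (Matrix.toEuclideanLin A).singularValues_nonneg i
  rw [zp_ofReal (Real.rpow_nonneg h0 _) hx.ne', ← Real.rpow_mul h0, inv_mul_cancel₀ hx.ne',
    Real.rpow_one]

lemma exists_pw {ι : Type*} [Fintype ι] [DecidableEq ι] (A : Matrix ι ι ℂ) {x : ℝ} (hx : 0 < x) :
    ∃ U ∈ Matrix.unitaryGroup ι ℂ, ∃ V ∈ Matrix.unitaryGroup ι ℂ, ∃ s : ι → ℝ, (∀ i, 0 ≤ s i) ∧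
      A = pw U V s x := by
  let e := Fintype.equivFin ι
  obtain ⟨U, hU, V, hV, h⟩ := exists_pw_fin (A.submatrix e.symm e.symm) hx
  have h1 := congrArg (fun B => B.submatrix e e) h
  simp only [Matrix.submatrix_submatrix, Equiv.symm_comp_self, Matrix.submatrix_id_id] at h1
  exact ⟨U.submatrix e e, reindex_mem_unitaryGroup e.symm hU, V.submatrix e e,
    reindex_mem_unitaryGroup e.symm hV, _,
    fun i => Real.rpow_nonneg (LinearMap.singularValues_nonneg _ _) _,
    h1.trans (pw_submatrix e.symm U V _ _)⟩

/-! ### Bounded holomorphic functions on the strip -/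

/-- Bounded functions on the closed strip `0 ≤ Re z ≤ 1`, continuous and holomorphic inside. -/
def StripFn {E : Type*} [NormedAddCommGroup E] [NormedSpace ℂ E] (h : ℂ → E) : Prop :=
  DiffContOnCl ℂ h {z : ℂ | 0 < z.re ∧ z.re < 1} ∧
    ∃ C : ℝ, ∀ z : ℂ, 0 ≤ z.re → z.re ≤ 1 → ‖h z‖ ≤ C

lemma StripFn.const {E : Type*} [NormedAddCommGroup E] [NormedSpace ℂ E] (w : E) :
    StripFn fun _ : ℂ => w :=
  ⟨diffContOnCl_const, ‖w‖, fun _ _ _ => le_rfl⟩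

lemma StripFn.add {E : Type*} [NormedAddCommGroup E] [NormedSpace ℂ E] {f g : ℂ → E}
    (hf : StripFn f) (hg : StripFn g) : StripFn fun z => f z + g z := by
  obtain ⟨hf, C, hC⟩ := hf
  obtain ⟨hg, D, hD⟩ := hg
  exact ⟨hf.add hg, C + D, fun z h0 h1 =>
    (norm_add_le _ _).trans (add_le_add (hC z h0 h1) (hD z h0 h1))⟩

lemma StripFn.mul {f g : ℂ → ℂ} (hf : StripFn f) (hg : StripFn g) :
    StripFn fun z => f z * g z := by
  obtain ⟨hf, C, hC⟩ := hf
  obtain ⟨hg, D, hD⟩ := hg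
  refine ⟨hf.smul hg, C * D, fun z h0 h1 => ?_⟩
  rw [norm_mul]
  exact mul_le_mul (hC z h0 h1) (hD z h0 h1) (norm_nonneg _) ((norm_nonneg _).trans (hC z h0 h1))

lemma StripFn.sum {E : Type*} [NormedAddCommGroup E] [NormedSpace ℂ E] {ι : Type*} (s : Finset ι)
    {f : ι → ℂ → E} (hf : ∀ i, StripFn (f i)) : StripFn fun z => ∑ i ∈ s, f i z := by
  classical
  induction s using Finset.induction_on with
  | empty => simpa using StripFn.const (0 : E)
  | insert a s ha ih => simpa [Finset.sum_insert ha] using (hf a).add ih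

lemma StripFn.clm {E F : Type*} [NormedAddCommGroup E] [NormedSpace ℂ E] [NormedAddCommGroup F]
    [NormedSpace ℂ F] {f : ℂ → E} (hf : StripFn f) (L : E →L[ℂ] F) : StripFn fun z => L (f z) := by
  obtain ⟨hf, C, hC⟩ := hf
  refine ⟨L.differentiable.comp_diffContOnCl hf, ‖L‖ * C, fun z h0 h1 => ?_⟩
  exact (L.le_opNorm _).trans (mul_le_mul_of_nonneg_left (hC z h0 h1) (norm_nonneg _))

lemma StripFn.zp {s : ℝ} (hs : 0 ≤ s) (α β : ℝ) : StripFn fun z => zp s (α * z + β) := by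
  refine ⟨((differentiable_zp s).comp (by fun_prop)).diffContOnCl, ?_⟩
  rcases hs.eq_or_lt with rfl | hs
  · exact ⟨0, fun z _ _ => by simp [zp_zero]⟩
  obtain ⟨C, hC⟩ := isCompact_Icc.exists_bound_of_continuousOn (s := Set.Icc (0 : ℝ) 1)
    (f := fun y : ℝ => s ^ (α * y + β))
    (Continuous.continuousOn (Continuous.rpow continuous_const (by fun_prop)
      fun _ => Or.inl hs.ne'))
  refine ⟨C, fun z h0 h1 => ?_⟩
  have := hC z.re ⟨h0, h1⟩
  rw [norm_zp hs]
  simpa [abs_of_nonneg, Real.rpow_nonneg hs.le] using this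

lemma three_lines {h : ℂ → ℂ} (H : StripFn h) {C₀ C₁ : ℝ} (h0 : ∀ t : ℝ, ‖h (t * Complex.I)‖ ≤ C₀)
    (h1 : ∀ t : ℝ, ‖h (1 + t * Complex.I)‖ ≤ C₁) {θ : ℝ} (hθ0 : 0 ≤ θ) (hθ1 : θ ≤ 1) :
    ‖h θ‖ ≤ C₀ ^ (1 - θ) * C₁ ^ θ := by
  obtain ⟨hd, C, hC⟩ := H
  have := Complex.HadamardThreeLines.norm_le_interp_of_mem_verticalClosedStrip₀₁' h
    (z := θ) (a := C₀) (b := C₁) ⟨by simpa using hθ0, by simpa using hθ1⟩ hd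
    ⟨C, by rintro _ ⟨z, hz, rfl⟩; exact hC z hz.1 hz.2⟩
    (fun z hz => by
      have : z = (z.im : ℂ) * Complex.I := by
        apply Complex.ext <;> simp
        exact hz
      rw [this]; exact h0 _)
    (fun z hz => by
      have : z = 1 + (z.im : ℂ) * Complex.I := by
        apply Complex.ext <;> simp
        exact hz
      rw [this]; exact h1 _)
  simpa using this

/-- Matrix-valued functions whose entries are bounded and holomorphic on the strip. -/
def StripM {m n : Type*} (A : ℂ → Matrix m n ℂ) : Prop := ∀ i j, StripFn fun z => A z i j

lemma StripM.const {m n : Type*} (A : Matrix m n ℂ) : StripM fun _ => A :=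
  fun _ _ => StripFn.const _

lemma StripM.mul {l m n : Type*} [Fintype m] {A : ℂ → Matrix l m ℂ} {B : ℂ → Matrix m n ℂ}
    (hA : StripM A) (hB : StripM B) : StripM fun z => A z * B z := fun i j => by
  simp only [Matrix.mul_apply]
  exact StripFn.sum _ fun k => (hA i k).mul (hB k j)

lemma StripM.trace {m : Type*} [Fintype m] {A : ℂ → Matrix m m ℂ} (hA : StripM A) :
    StripFn fun z => (A z).trace := StripFn.sum _ fun i => hA i i

section

variable {ι : Type*} [Fintype ι] [DecidableEq ι]

lemma StripM.pw (U V : Matrix ι ι ℂ) {s : ι → ℝ} (hs : ∀ i, 0 ≤ s i) (α β : ℝ) :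
    StripM fun z => pw U V s (α * z + β) := fun i j => by
  simp only [pw_apply]
  exact StripFn.sum _ fun k => ((StripFn.const _).mul (StripFn.zp (hs k) α β)).mul (StripFn.const _)

/-- The unit ball of the Schatten class with exponent `1 / x`. -/
def SB (ι : Type*) [Fintype ι] [DecidableEq ι] (x : ℝ) : Set (Matrix ι ι ℂ) :=
  {a | ∃ U ∈ Matrix.unitaryGroup ι ℂ, ∃ V ∈ Matrix.unitaryGroup ι ℂ, ∃ s : ι → ℝ,
    (∀ i, 0 ≤ s i) ∧ ∑ i, s i ≤ 1 ∧ a = QOS.pw U V s x}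

lemma pw_mem_SB {U V : Matrix ι ι ℂ} (hU : U ∈ Matrix.unitaryGroup ι ℂ)
    (hV : V ∈ Matrix.unitaryGroup ι ℂ) {s : ι → ℝ} (hs : ∀ i, 0 ≤ s i) (hs1 : ∑ i, s i ≤ 1)
    {z : ℂ} {x : ℝ} (hx : z.re = x) : QOS.pw U V s z ∈ SB ι x := by
  rw [pw_eq_pw_re, hx]
  exact ⟨_, mul_mem hU (diagonal_mem_unitaryGroup fun i => norm_zphase _ _), V, hV, s, hs, hs1, rfl⟩

lemma sum_norm_sq_le_of_mem_SB_half {a : Matrix ι ι ℂ} (ha : a ∈ SB ι (1 / 2)) :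
    ∑ i, ∑ j, ‖a i j‖ ^ 2 ≤ 1 := by
  obtain ⟨U, hU, V, hV, s, hs, hs1, rfl⟩ := ha
  rwa [sum_norm_sq_pw hU hV hs (by simp)]

end

/-! ### Finite families of matrices -/

section Families

variable {ι J : Type*} [Fintype ι] [DecidableEq ι] [Fintype J]
  {κ : J → Type*} [∀ j, Fintype (κ j)] [∀ j, DecidableEq (κ j)]

/-- The unit ball of the `ℓ^r`-sum, `r = 1 / x`, with weights `c`, of Schatten `r`-classes. -/
def FB {J : Type*} [Fintype J] {κ : J → Type*} [∀ j, Fintype (κ j)] [∀ j, DecidableEq (κ j)]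
    (c : J → ℝ) (x : ℝ) : Set ((j : J) → Matrix (κ j) (κ j) ℂ) :=
  {Y | ∃ U V : (j : J) → Matrix (κ j) (κ j) ℂ, ∃ s : (j : J) → κ j → ℝ,
    (∀ j, U j ∈ Matrix.unitaryGroup (κ j) ℂ) ∧ (∀ j, V j ∈ Matrix.unitaryGroup (κ j) ℂ) ∧
    (∀ j i, 0 ≤ s j i) ∧ ∑ j, c j * ∑ i, s j i ≤ 1 ∧ ∀ j, Y j = QOS.pw (U j) (V j) (s j) x}

lemma pw_mem_FB {c : J → ℝ} {U V : (j : J) → Matrix (κ j) (κ j) ℂ} {s : (j : J) → κ j → ℝ}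
    (hU : ∀ j, U j ∈ Matrix.unitaryGroup (κ j) ℂ) (hV : ∀ j, V j ∈ Matrix.unitaryGroup (κ j) ℂ)
    (hs : ∀ j i, 0 ≤ s j i) (hs1 : ∑ j, c j * ∑ i, s j i ≤ 1) {z : ℂ} {x : ℝ} (hx : z.re = x) :
    (fun j => QOS.pw (U j) (V j) (s j) z) ∈ FB c x :=
  ⟨fun j => U j * Matrix.diagonal fun i => zphase (s j i) z, V, s,
    fun j => mul_mem (hU j) (diagonal_mem_unitaryGroup fun i => norm_zphase _ _), hV, hs, hs1,
    fun j => (pw_eq_pw_re _ _ _ _).trans (by rw [hx])⟩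

lemma norm_le_of_mem_FB_zero {c : J → ℝ} {Y : (j : J) → Matrix (κ j) (κ j) ℂ} (hY : Y ∈ FB c 0)
    (j : J) : ‖Y j‖ ≤ 1 := by
  obtain ⟨U, V, s, hU, hV, hs, -, h⟩ := hY
  rw [h]
  exact norm_pw_le (hU j) (hV j) (hs j) (by simp)

lemma norm_sum_trace_le_of_mem_FB_one {c : J → ℝ} (hc : ∀ j, 0 ≤ c j)
    {Y : (j : J) → Matrix (κ j) (κ j) ℂ} (hY : Y ∈ FB c 1) {X : (j : J) → Matrix (κ j) (κ j) ℂ}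
    {K : ℝ} (hK : 0 ≤ K) (hX : ∀ j, ‖X j‖ ≤ K) : ‖∑ j, (c j : ℂ) * (X j * Y j).trace‖ ≤ K := by
  obtain ⟨U, V, s, hU, hV, hs, hs1, h⟩ := hY
  calc ‖∑ j, (c j : ℂ) * (X j * Y j).trace‖ ≤ ∑ j, c j * (K * ∑ i, s j i) := by
        refine (norm_sum_le _ _).trans (Finset.sum_le_sum fun j _ => ?_)
        rw [norm_mul, Complex.norm_real, Real.norm_of_nonneg (hc j), h j]
        refine mul_le_mul_of_nonneg_left ?_ (hc j)
        refine (norm_trace_mul_pw_le (hU j) (hV j) (hs j) (by simp) (X j)).trans ?_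
        exact mul_le_mul_of_nonneg_right (hX j) (Finset.sum_nonneg fun i _ => hs j i)
    _ = K * ∑ j, c j * ∑ i, s j i := by
        rw [Finset.mul_sum]; exact Finset.sum_congr rfl fun j _ => by ring
    _ ≤ K := mul_le_of_le_one_right hK hs1

/-- Hölder's inequality for Schatten classes. -/
lemma norm_sum_trace_le_rpow {c : J → ℝ} (hc : ∀ j, 0 ≤ c j) {x : ℝ} (hx0 : 0 ≤ x) (hx1 : x ≤ 1)
    {Y : (j : J) → Matrix (κ j) (κ j) ℂ} (hY : Y ∈ FB c (1 - x))
    {U V A B : (j : J) → Matrix (κ j) (κ j) ℂ} {s : (j : J) → κ j → ℝ}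
    (hU : ∀ j, U j ∈ Matrix.unitaryGroup (κ j) ℂ) (hV : ∀ j, V j ∈ Matrix.unitaryGroup (κ j) ℂ)
    (hs : ∀ j i, 0 ≤ s j i) (hA : ∀ j, ‖A j‖ ≤ 1) (hB : ∀ j, ‖B j‖ ≤ 1) :
    ‖∑ j, (c j : ℂ) * (A j * pw (U j) (V j) (s j) x * B j * Y j).trace‖
      ≤ (∑ j, c j * ∑ i, s j i) ^ x := by
  obtain ⟨U', V', s', hU', hV', hs', hs1', h⟩ := hY
  -- The exponents of the two factors move in opposite directions: z and 1 - z. At Re z = 0 the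
  -- first is a contraction and the second has trace norm at most 1; at Re z = 1 the roles are
  -- exchanged.
  let f : ℂ → ℂ := fun z => ∑ j, (c j : ℂ) *
    (A j * pw (U j) (V j) (s j) ((1 : ℝ) * z + (0 : ℝ)) * B j *
      pw (U' j) (V' j) (s' j) ((-1 : ℝ) * z + (1 : ℝ))).trace
  have hf : StripFn f := StripFn.sum _ fun j => (StripFn.const _).mul
    ((((StripM.const _).mul (StripM.pw _ _ (hs j) _ _)).mul (StripM.const _)).mul
      (StripM.pw _ _ (hs' j) _ _)).trace
  have key := three_lines hf (C₀ := 1) (C₁ := ∑ j, c j * ∑ i, s j i) (θ := x) ?_ ?_ hx0 hx1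
  · rw [Real.one_rpow, one_mul] at key
    convert key using 5 with j
    rw [h j]
    congr 3
    · simp
    · push_cast; ring
  · intro t
    have hm : (fun j => pw (U' j) (V' j) (s' j) ((-1 : ℝ) * (t * Complex.I) + (1 : ℝ))) ∈ FB c 1 :=
      pw_mem_FB hU' hV' hs' hs1' (by simp)
    refine norm_sum_trace_le_of_mem_FB_one hc hm zero_le_one fun j => ?_
    exact (norm_mul_mul_le (hA j) (hB j)).trans (norm_pw_le (hU j) (hV j) (hs j) (by simp))
  · intro t
    refine (norm_sum_le _ _).trans (Finset.sum_le_sum fun j _ => ?_)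
    rw [norm_mul, Complex.norm_real, Real.norm_of_nonneg (hc j)]
    refine mul_le_mul_of_nonneg_left ?_ (hc j)
    -- Cyclicity of the trace brings the factor with exponent of real part 1 to the end, where trace
    -- duality applies.
    have e : (A j * pw (U j) (V j) (s j) ((1 : ℝ) * (1 + t * Complex.I) + (0 : ℝ)) * B j *
        pw (U' j) (V' j) (s' j) ((-1 : ℝ) * (1 + t * Complex.I) + (1 : ℝ))).trace
        = ((B j * pw (U' j) (V' j) (s' j) ((-1 : ℝ) * (1 + t * Complex.I) + (1 : ℝ)) * A j) *
          pw (U j) (V j) (s j) ((1 : ℝ) * (1 + t * Complex.I) + (0 : ℝ))).trace := by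
      rw [Matrix.mul_assoc (A j * _), Matrix.trace_mul_comm, ← Matrix.mul_assoc]
    rw [e]
    refine (norm_trace_mul_pw_le (hU j) (hV j) (hs j) (by simp) _).trans ?_
    refine mul_le_of_le_one_left (Finset.sum_nonneg fun i _ => hs j i) ?_
    exact (norm_mul_mul_le (hB j) (hA j)).trans (norm_pw_le (hU' j) (hV' j) (hs' j) (by simp))

/-- The amplification `a ⊗ 1`. -/
def amp (κ : Type*) [Fintype κ] [DecidableEq κ] (a : Matrix ι ι ℂ) : Matrix (ι × κ) (ι × κ) ℂ :=
  Matrix.kroneckerMap (· * ·) a 1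

section

variable {κ : Type*} [Fintype κ] [DecidableEq κ]

lemma amp_mul (a b : Matrix ι ι ℂ) : amp κ (a * b) = amp κ a * amp κ b := by
  rw [amp, amp, amp, ← Matrix.mul_kronecker_mul, Matrix.one_mul]

lemma amp_one : amp κ (1 : Matrix ι ι ℂ) = 1 := Matrix.one_kronecker_one

lemma amp_apply (a : Matrix ι ι ℂ) (p q : ι × κ) :
    amp κ a p q = if p.2 = q.2 then a p.1 q.1 else 0 := by
  simp [amp, Matrix.kroneckerMap_apply, Matrix.one_apply]

lemma amp_conjTranspose (a : Matrix ι ι ℂ) : (amp κ a)ᴴ = amp κ aᴴ := by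
  ext p q
  simp only [Matrix.conjTranspose_apply, amp_apply, eq_comm (a := q.2)]
  split_ifs <;> simp

lemma amp_mem_unitaryGroup {U : Matrix ι ι ℂ} (hU : U ∈ Matrix.unitaryGroup ι ℂ) :
    amp κ U ∈ Matrix.unitaryGroup (ι × κ) ℂ := by
  rw [Matrix.mem_unitaryGroup_iff, Matrix.star_eq_conjTranspose, amp_conjTranspose, ← amp_mul,
    show U * Uᴴ = 1 from Matrix.mem_unitaryGroup_iff.1 hU, amp_one]

lemma amp_pw (U V : Matrix ι ι ℂ) (s : ι → ℝ) (z : ℂ) :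
    amp κ (pw U V s z) = pw (amp κ U) (amp κ V) (fun p => s p.1) z := by
  rw [pw, amp_mul, amp_mul, pw]
  congr 2
  ext p q
  rw [amp_apply, Matrix.diagonal_apply, Matrix.diagonal_apply]
  split_ifs with h1 h2 h3 h3 h4 <;> simp_all [Prod.ext_iff]

lemma norm_amp_le_of_mem_SB_zero {a : Matrix ι ι ℂ} (ha : a ∈ SB ι 0) : ‖amp κ a‖ ≤ 1 := by
  obtain ⟨U, hU, V, hV, s, hs, -, rfl⟩ := ha
  rw [amp_pw]
  exact norm_pw_le (amp_mem_unitaryGroup hU) (amp_mem_unitaryGroup hV) (fun p => hs p.1) (by simp)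

end

lemma StripM.amp {κ : Type*} [Fintype κ] [DecidableEq κ] {a : ℂ → Matrix ι ι ℂ} (ha : StripM a) :
    StripM fun z => amp κ (a z) := fun p q => by
  simp only [amp_apply]
  split_ifs
  · exact ha _ _
  · exact StripFn.const _

/-- The form `∑_j c_j tr ((a ⊗ 1) X_j (b ⊗ 1) Y_j)`. -/
def theta (c : J → ℝ) (a b : Matrix ι ι ℂ) (X Y : (j : J) → Matrix (ι × κ j) (ι × κ j) ℂ) : ℂ :=
  ∑ j, (c j : ℂ) * (amp (κ j) a * X j * amp (κ j) b * Y j).trace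

/-- Stein interpolation: `a`, `b` and `Y` lie in balls whose exponents are affine in θ, so each is
the value at θ of its own analytic family `pw`, which stays in the boundary balls on both lines. -/
lemma theta_three_lines {c : J → ℝ} {α β α' β' : ℝ}
    {g : ℂ → (j : J) → Matrix (ι × κ j) (ι × κ j) ℂ} (hg : ∀ j, StripM fun z => g z j)
    {C₀ C₁ : ℝ}
    (h0 : ∀ t : ℝ, ∀ a ∈ SB ι β, ∀ b ∈ SB ι β, ∀ Y ∈ FB c β',
      ‖theta c a b (g (t * Complex.I)) Y‖ ≤ C₀)
    (h1 : ∀ t : ℝ, ∀ a ∈ SB ι (α + β), ∀ b ∈ SB ι (α + β), ∀ Y ∈ FB c (α' + β'),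
      ‖theta c a b (g (1 + t * Complex.I)) Y‖ ≤ C₁)
    {θ : ℝ} (hθ0 : 0 ≤ θ) (hθ1 : θ ≤ 1) {a b : Matrix ι ι ℂ}
    {Y : (j : J) → Matrix (ι × κ j) (ι × κ j) ℂ}
    (ha : a ∈ SB ι (α * θ + β)) (hb : b ∈ SB ι (α * θ + β)) (hY : Y ∈ FB c (α' * θ + β')) :
    ‖theta c a b (g θ) Y‖ ≤ C₀ ^ (1 - θ) * C₁ ^ θ := by
  obtain ⟨U, hU, V, hV, s, hs, hs1, rfl⟩ := ha
  obtain ⟨U', hU', V', hV', s', hs', hs1', rfl⟩ := hb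
  obtain ⟨U'', V'', s'', hU'', hV'', hs'', hs1'', h⟩ := hY
  let f : ℂ → ℂ := fun z => theta c (pw U V s (α * z + β)) (pw U' V' s' (α * z + β)) (g z)
    (fun j => pw (U'' j) (V'' j) (s'' j) (α' * z + β'))
  have hf : StripFn f := StripFn.sum _ fun j => (StripFn.const _).mul
    (((((StripM.pw _ _ hs _ _).amp).mul (hg j)).mul (StripM.pw _ _ hs' _ _).amp).mul
      (StripM.pw _ _ (hs'' j) _ _)).trace
  have hYe : Y = fun j => pw (U'' j) (V'' j) (s'' j) ((α' * θ + β' : ℝ) : ℂ) := funext h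
  have key := three_lines hf (C₀ := C₀) (C₁ := C₁) (θ := θ) ?_ ?_ hθ0 hθ1
  · rw [hYe]
    push_cast
    exact key
  · intro t
    exact h0 t _ (pw_mem_SB hU hV hs hs1 (by simp)) _ (pw_mem_SB hU' hV' hs' hs1' (by simp)) _
      (pw_mem_FB hU'' hV'' hs'' hs1'' (by simp))
  · intro t
    exact h1 t _ (pw_mem_SB hU hV hs hs1 (by simp)) _ (pw_mem_SB hU' hV' hs' hs1' (by simp)) _
      (pw_mem_FB hU'' hV'' hs'' hs1'' (by simp))

lemma norm_theta_le_of_norm_le {c : J → ℝ} (hc : ∀ j, 0 ≤ c j) {a b : Matrix ι ι ℂ}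
    (ha : a ∈ SB ι 0) (hb : b ∈ SB ι 0) {X Y : (j : J) → Matrix (ι × κ j) (ι × κ j) ℂ}
    (hY : Y ∈ FB c 1) {K : ℝ} (hK : 0 ≤ K) (hX : ∀ j, ‖X j‖ ≤ K) : ‖theta c a b X Y‖ ≤ K :=
  norm_sum_trace_le_of_mem_FB_one hc hY hK fun j =>
    (norm_mul_mul_le (norm_amp_le_of_mem_SB_zero ha) (norm_amp_le_of_mem_SB_zero hb)).trans (hX j)

end Families

/-! ### Rank one perturbations of diagonal matrices -/

section RankOne

variable {ι : Type*} [Fintype ι] [DecidableEq ι]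

/-- The matrix `1 + (lam - 1) η η^*`. -/
def rankOne (η : ι → ℂ) (lam : ℂ) : Matrix ι ι ℂ :=
  Matrix.of fun i j => (if i = j then 1 else 0) + (lam - 1) * (η i * star (η j))

lemma sum_norm_sq_rankOne_mul_diagonal {η : ι → ℂ} (hη : ∑ i, ‖η i‖ ^ 2 = 1) (lam : ℂ)
    (v : ι → ℂ) : ∑ i, ∑ j, ‖(rankOne η lam * Matrix.diagonal v) i j‖ ^ 2
      = ∑ j, ‖v j‖ ^ 2 * (1 + (‖lam‖ ^ 2 - 1) * ‖η j‖ ^ 2) := by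
  rw [Finset.sum_comm]
  refine Finset.sum_congr rfl fun j _ => ?_
  have h1 (i : ι) : ‖(rankOne η lam * Matrix.diagonal v) i j‖ ^ 2
      = ‖v j‖ ^ 2 * ((if i = j then 1 + 2 * (lam - 1).re * ‖η j‖ ^ 2 else 0)
        + ‖lam - 1‖ ^ 2 * ‖η j‖ ^ 2 * ‖η i‖ ^ 2) := by
    rw [Matrix.mul_diagonal, norm_mul, mul_pow, mul_comm]
    congr 1
    simp only [rankOne, Matrix.of_apply]
    split_ifs with h
    · subst h
      have : η i * star (η i) = ((‖η i‖ ^ 2 : ℝ) : ℂ) := by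
        push_cast; exact Complex.mul_conj' _
      rw [this, ← Complex.normSq_eq_norm_sq, Complex.normSq_add, ← Complex.normSq_eq_norm_sq (lam - 1),
        Complex.normSq_mul, Complex.normSq_ofReal]
      generalize ‖η i‖ ^ 2 = r
      simp
      ring
    · rw [zero_add, zero_add, norm_mul, norm_mul, norm_star]; ring
  rw [Finset.sum_congr rfl fun i _ => h1 i, ← Finset.mul_sum, Finset.sum_add_distrib,
    ← Finset.mul_sum, hη]
  simp only [Finset.sum_ite_eq', Finset.mem_univ, if_true]
  rw [← Complex.normSq_eq_norm_sq lam, ← Complex.normSq_eq_norm_sq (lam - 1), Complex.normSq_apply,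
    Complex.normSq_apply]
  simp only [Complex.sub_re, Complex.one_re, Complex.sub_im, Complex.one_im]
  ring

lemma norm_rankOne_le {η : ι → ℂ} (hη : ∑ i, ‖η i‖ ^ 2 = 1) {lam : ℂ} (hl : ‖lam‖ = 1) :
    ‖rankOne η lam‖ ≤ 1 := by
  refine norm_unitary_le ?_
  have hs : ∑ i, star (η i) * η i = 1 := by
    have : (((∑ i, ‖η i‖ ^ 2 : ℝ)) : ℂ) = 1 := by rw [hη]; simp
    push_cast at this
    rw [← this]
    exact Finset.sum_congr rfl fun i _ => Complex.conj_mul' _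
  have hl' : star lam * lam = 1 := by
    have := Complex.conj_mul' lam
    rw [hl] at this; simpa using this
  rw [Matrix.mem_unitaryGroup_iff']
  ext i j
  rw [Matrix.mul_apply]
  simp only [rankOne, Matrix.star_apply, Matrix.of_apply, star_add, star_mul, star_sub, star_one,
    star_star]
  have h2 : ∀ x, (star (if x = i then (1:ℂ) else 0) + η i * star (η x) * (star lam - 1)) *
      ((if x = j then 1 else 0) + (lam - 1) * (η x * star (η j)))
      = (if x = i then (if x = j then 1 else 0) else 0)
        + (if x = i then (lam - 1) * (η x * star (η j)) else 0)
        + (if x = j then η i * star (η x) * (star lam - 1) else 0)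
        + (η i * star (η j) * (star lam - 1) * (lam - 1)) * (star (η x) * η x) := by
    intro x
    split_ifs <;> simp <;> ring
  rw [Finset.sum_congr rfl fun x _ => h2 x]
  simp only [Finset.sum_add_distrib, ← Finset.mul_sum, hs, Finset.sum_ite_eq', Finset.mem_univ,
    if_true, Matrix.one_apply]
  linear_combination (η i * star (η j)) * hl'

lemma StripM.rankOne (η : ι → ℂ) {t : ℝ} (ht : 0 ≤ t) (α β : ℝ) :
    StripM fun z => rankOne η (zp t (α * z + β)) := fun i j => by
  simp only [QOS.rankOne, Matrix.of_apply, sub_eq_add_neg]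
  exact (StripFn.const _).add (((StripFn.zp ht α β).add (StripFn.const _)).mul (StripFn.const _))

lemma norm_trace_mul_le_of_sum_norm_sq {A B : Matrix ι ι ℂ} {a b : ℝ} (ha : 0 ≤ a) (hb : 0 ≤ b)
    (hA : ∑ i, ∑ j, ‖A i j‖ ^ 2 ≤ a ^ 2) (hB : ∑ i, ∑ j, ‖B i j‖ ^ 2 ≤ b ^ 2) :
    ‖(A * B).trace‖ ≤ a * b := by
  have h1 : (A * B).trace = ∑ p : ι × ι, A p.1 p.2 * B p.2 p.1 := by
    rw [Fintype.sum_prod_type]; simp [Matrix.trace, Matrix.mul_apply]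
  rw [h1]
  refine (norm_sum_mul_le_l2 _ _).trans (mul_le_mul ?_ ?_ (l2_nonneg _) ha)
  · refine Real.sqrt_le_iff.2 ⟨ha, ?_⟩
    rwa [Fintype.sum_prod_type]
  · refine Real.sqrt_le_iff.2 ⟨hb, ?_⟩
    rwa [Fintype.sum_prod_type, Finset.sum_comm]

/-- An inequality of Araki-Lieb-Thirring type for rank one perturbations. -/
lemma rankOne_mul_diagonal_mem_SB {η : ι → ℂ} (hη : ∑ i, ‖η i‖ ^ 2 = 1) {s : ι → ℝ}
    (hs : ∀ i, 0 ≤ s i) (hs1 : ∑ i, s i ≤ 1) {x : ℝ} (hx0 : 0 < x) (hx1 : x ≤ 1 / 2) {t : ℝ}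
    (ht : 1 ≤ t) :
    (((1 + (t ^ x⁻¹ - 1) * ∑ i, s i * ‖η i‖ ^ 2) ^ (-x) : ℝ) : ℂ) •
      (rankOne η t * Matrix.diagonal fun i => zp (s i) x) ∈ SB ι x := by
  have ht0 : 0 < t := by linarith
  set T : ℝ := 1 + (t ^ x⁻¹ - 1) * ∑ i, s i * ‖η i‖ ^ 2 with hT
  have hT1 : 1 ≤ T := by
    have h1 : 1 ≤ t ^ x⁻¹ := Real.one_le_rpow ht (by positivity)
    have h2 : 0 ≤ ∑ i, s i * ‖η i‖ ^ 2 := Finset.sum_nonneg fun i _ => mul_nonneg (hs i) (by positivity)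
    nlinarith
  have hT0 : 0 < T := by linarith
  set A := ((T ^ (-x) : ℝ) : ℂ) • (rankOne η t * Matrix.diagonal fun i => zp (s i) x) with hA
  obtain ⟨U, hU, V, hV, τ, hτ, hAe⟩ := exists_pw A hx0
  refine ⟨U, hU, V, hV, τ, hτ, ?_, hAe⟩
  set P := ∑ i, τ i with hP
  have hP0 : 0 ≤ P := Finset.sum_nonneg fun i _ => hτ i
  have hU' : Uᴴ ∈ Matrix.unitaryGroup ι ℂ := by
    rw [Matrix.mem_unitaryGroup_iff, Matrix.star_eq_conjTranspose, Matrix.conjTranspose_conjTranspose]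
    exact (Matrix.mem_unitaryGroup_iff').1 hU
  have hV' : Vᴴ ∈ Matrix.unitaryGroup ι ℂ := by
    rw [Matrix.mem_unitaryGroup_iff, Matrix.star_eq_conjTranspose, Matrix.conjTranspose_conjTranspose]
    exact (Matrix.mem_unitaryGroup_iff').1 hV
  -- At z = 2x this is the trace of `A` against the matrix norming it, that is `P`. At Re z = 0 the
  -- first factor is a phase and the second a contraction; at Re z = 1 both matrices are measured in
  -- the Hilbert-Schmidt norm. The assumption x ≤ 1/2 places 2x in the strip.
  let f : ℂ → ℂ := fun z => zp T ((-(1 / 2) : ℝ) * z + (0 : ℝ)) *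
    ((rankOne η (zp t (((2 * x)⁻¹ : ℝ) * z + (0 : ℝ))) *
      pw 1 1 s ((1 / 2 : ℝ) * z + (0 : ℝ))) *
      pw Vᴴ Uᴴ τ ((-(1 / 2) : ℝ) * z + (1 : ℝ))).trace
  have hf : StripFn f := (StripFn.zp hT0.le _ _).mul
    (((StripM.rankOne η ht0.le _ _).mul (StripM.pw _ _ hs _ _)).mul (StripM.pw _ _ hτ _ _)).trace
  have key := three_lines hf (C₀ := P) (C₁ := P ^ (1 / 2 : ℝ)) (θ := 2 * x) ?_ ?_ (by linarith)
    (by linarith)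
  · have e1 : f ((2 * x : ℝ) : ℂ) = P := by
      have e2 : f ((2 * x : ℝ) : ℂ) = (A * pw Vᴴ Uᴴ τ ((1 - x : ℝ) : ℂ)).trace := by
        simp only [f, hA]
        rw [Matrix.smul_mul, Matrix.trace_smul, smul_eq_mul]
        have z1 : ((-(1 / 2) : ℝ) : ℂ) * ((2 * x : ℝ) : ℂ) + ((0 : ℝ) : ℂ) = ((-x : ℝ) : ℂ) := by
          push_cast; ring
        have z2 : (((2 * x)⁻¹ : ℝ) : ℂ) * ((2 * x : ℝ) : ℂ) + ((0 : ℝ) : ℂ) = ((1 : ℝ) : ℂ) := by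
          have : (x : ℂ) ≠ 0 := by exact_mod_cast hx0.ne'
          push_cast; field_simp; simp
        have z3 : ((1 / 2 : ℝ) : ℂ) * ((2 * x : ℝ) : ℂ) + ((0 : ℝ) : ℂ) = ((x : ℝ) : ℂ) := by
          push_cast; ring
        have z4 : ((-(1 / 2) : ℝ) : ℂ) * ((2 * x : ℝ) : ℂ) + ((1 : ℝ) : ℂ) = ((1 - x : ℝ) : ℂ) := by
          push_cast; ring
        rw [z1, z2, z3, z4, zp_ofReal hT0.le (by linarith), zp_ofReal ht0.le one_ne_zero,
          Real.rpow_one, pw, Matrix.one_mul, Matrix.mul_one]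
      rw [e2, hAe, pw, pw]
      have e3 : (U * (Matrix.diagonal fun i => zp (τ i) x) * V *
          (Vᴴ * (Matrix.diagonal fun i => zp (τ i) ((1 - x : ℝ) : ℂ)) * Uᴴ)).trace
          = ((Matrix.diagonal fun i => zp (τ i) x) *
            (Matrix.diagonal fun i => zp (τ i) ((1 - x : ℝ) : ℂ))).trace := by
        have hVV : V * Vᴴ = 1 := Matrix.mem_unitaryGroup_iff.1 hV
        have hUU : Uᴴ * U = 1 := (Matrix.mem_unitaryGroup_iff').1 hU
        rw [Matrix.mul_assoc Vᴴ, Matrix.mul_assoc _ V, ← Matrix.mul_assoc V, hVV, Matrix.one_mul,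
          Matrix.mul_assoc U, Matrix.trace_mul_comm, Matrix.mul_assoc, Matrix.mul_assoc _ Uᴴ, hUU,
          Matrix.mul_one]
      rw [e3, Matrix.diagonal_mul_diagonal, Matrix.trace_diagonal, hP]
      push_cast
      refine Finset.sum_congr rfl fun i _ => ?_
      rw [← zp_add]
      rw [add_sub_cancel, zp_one (hτ i)]
    rw [e1, Complex.norm_real, Real.norm_of_nonneg hP0, ← Real.rpow_mul hP0] at key
    -- The three lines bound reads P ≤ P^(1 - x), which is impossible for P > 1.
    by_contra hlt
    have hP1 : 1 < P := not_le.1 hlt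
    have hPp : 0 < P := by linarith
    rw [← Real.rpow_add hPp] at key
    have h2 : P ^ (1 - 2 * x + 1 / 2 * (2 * x)) < P ^ (1 : ℝ) :=
      Real.rpow_lt_rpow_of_exponent_lt hP1 (by linarith)
    rw [Real.rpow_one] at h2
    linarith
  · intro t'
    simp only [f]
    rw [norm_mul, norm_zp hT0]
    have e0 : T ^ (((-(1 / 2) : ℝ) : ℂ) * (t' * Complex.I) + ((0 : ℝ) : ℂ)).re = 1 := by simp
    rw [e0, one_mul]
    refine (norm_trace_mul_pw_le hV' hU' hτ (by simp) _).trans ?_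
    refine mul_le_of_le_one_left hP0 ((Matrix.l2_opNorm_mul _ _).trans ?_)
    refine mul_le_one₀ (norm_rankOne_le hη ?_) (norm_nonneg _)
      (norm_pw_le (one_mem _) (one_mem _) hs (by simp))
    rw [norm_zp ht0]; simp
  · intro t'
    simp only [f]
    rw [norm_mul, norm_zp hT0]
    have e0 : (((-(1 / 2) : ℝ) : ℂ) * (1 + t' * Complex.I) + ((0 : ℝ) : ℂ)).re = -(1/2) := by simp
    rw [e0]
    have h1 := norm_trace_mul_le_of_sum_norm_sq (a := T ^ (1 / 2 : ℝ)) (b := P ^ (1 / 2 : ℝ))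
      (A := rankOne η (zp t (((2 * x)⁻¹ : ℝ) * (1 + t' * Complex.I) + (0 : ℝ))) *
        pw 1 1 s ((1 / 2 : ℝ) * (1 + t' * Complex.I) + (0 : ℝ)))
      (B := pw Vᴴ Uᴴ τ ((-(1 / 2) : ℝ) * (1 + t' * Complex.I) + (1 : ℝ)))
      (by positivity) (by positivity) ?_ ?_
    · calc _ ≤ T ^ (-(1 / 2) : ℝ) * (T ^ (1 / 2 : ℝ) * P ^ (1 / 2 : ℝ)) :=
            mul_le_mul_of_nonneg_left h1 (by positivity)
        _ = P ^ (1 / 2 : ℝ) := by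
            rw [← mul_assoc, ← Real.rpow_add hT0]; simp
    · rw [pw, Matrix.one_mul, Matrix.mul_one, sum_norm_sq_rankOne_mul_diagonal hη]
      have e4 : (T ^ (1 / 2 : ℝ)) ^ 2 = T := by
        rw [← Real.rpow_natCast, ← Real.rpow_mul hT0.le]; norm_num
      rw [e4]
      have e5 : ‖zp t (((2 * x)⁻¹ : ℝ) * (1 + t' * Complex.I) + (0 : ℝ))‖ ^ 2 = t ^ x⁻¹ := by
        have e7 : ((((2 * x)⁻¹ : ℝ) : ℂ) * (1 + t' * Complex.I) + ((0 : ℝ) : ℂ)).re = x⁻¹ / 2 := by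
          rw [Complex.add_re, Complex.re_ofReal_mul]
          simp
          ring
        rw [norm_zp ht0, e7, ← Real.rpow_natCast, ← Real.rpow_mul ht0.le]
        congr 1
        push_cast; ring
      have e6 (j : ι) : ‖zp (s j) ((1 / 2 : ℝ) * (1 + t' * Complex.I) + (0 : ℝ))‖ ^ 2 = s j := by
        rcases (hs j).eq_or_lt with h | h
        · simp [← h, zp_zero]
        · have e7 : (((1 / 2 : ℝ) : ℂ) * (1 + t' * Complex.I) + ((0 : ℝ) : ℂ)).re = 1 / 2 := by
            rw [Complex.add_re, Complex.re_ofReal_mul]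
            simp
          rw [norm_zp h, e7, ← Real.rpow_natCast, ← Real.rpow_mul h.le]
          norm_num
      rw [e5]
      simp only [e6]
      -- The squared Hilbert-Schmidt norm on Re z = 1 is at most `T`; this is what determines the
      -- normalizing constant `T`.
      rw [hT, Finset.mul_sum]
      calc _ = ∑ j, s j + ∑ j, (t ^ x⁻¹ - 1) * (s j * ‖η j‖ ^ 2) := by
            rw [← Finset.sum_add_distrib]; exact Finset.sum_congr rfl fun j _ => by ring
        _ ≤ _ := by linarith
    · rw [sum_norm_sq_pw hV' hU' hτ (by simp; norm_num), ← Real.rpow_natCast, ← Real.rpow_mul hP0]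
      simp [hP]

end RankOne

/-! ### Compactness of the unit balls -/

section Compact

variable {ι : Type*} [Fintype ι] [DecidableEq ι]

lemma isCompact_unitaryGroup : IsCompact (Matrix.unitaryGroup ι ℂ : Set (Matrix ι ι ℂ)) := by
  have : ProperSpace (Matrix ι ι ℂ) := FiniteDimensional.proper ℂ _
  refine Metric.isCompact_of_isClosed_isBounded ?_ ?_
  · have : (Matrix.unitaryGroup ι ℂ : Set (Matrix ι ι ℂ)) = {U | U * Uᴴ = 1} := by
      ext U; exact Matrix.mem_unitaryGroup_iff
    rw [this]
    exact isClosed_eq (continuous_id.matrix_mul continuous_id.matrix_conjTranspose)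
      continuous_const
  · exact (isBounded_iff_forall_norm_le).2 ⟨1, fun U hU => norm_unitary_le hU⟩

/-- The matrix `U s ^ x V`, with real powers. -/
def rpw (U V : Matrix ι ι ℂ) (s : ι → ℝ) (x : ℝ) : Matrix ι ι ℂ :=
  U * Matrix.diagonal (fun i => ((s i ^ x : ℝ) : ℂ)) * V

/-- For a positive exponent the convention that powers of 0 vanish agrees with `Real.rpow`, which is
continuous in `s` up to 0; compactness of the balls rests on this. -/
lemma pw_eq_rpw (U V : Matrix ι ι ℂ) {s : ι → ℝ} (hs : ∀ i, 0 ≤ s i) {x : ℝ} (hx : 0 < x) :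
    pw U V s x = rpw U V s x := by
  rw [pw, rpw]
  congr 3
  ext i
  exact zp_ofReal (hs i) hx.ne'

lemma Continuous.rpw {X : Type*} [TopologicalSpace X] {f g : X → Matrix ι ι ℂ} {s : X → ι → ℝ}
    (hf : Continuous f) (hg : Continuous g) (hs : Continuous s) {x : ℝ} (hx : 0 < x) :
    Continuous fun p => rpw (f p) (g p) (s p) x := by
  unfold QOS.rpw
  refine (hf.matrix_mul (Continuous.matrix_diagonal ?_)).matrix_mul hg
  refine continuous_pi fun i => Complex.continuous_ofReal.comp ?_
  exact Continuous.rpow_const ((continuous_apply i).comp hs) fun _ => Or.inr hx.le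

lemma isCompact_SB {x : ℝ} (hx : 0 < x) : IsCompact (SB ι x) := by
  have hS : IsCompact {s : ι → ℝ | (∀ i, 0 ≤ s i) ∧ ∑ i, s i ≤ 1} := by
    refine (isCompact_Icc (a := (0 : ι → ℝ)) (b := 1)).of_isClosed_subset ?_ ?_
    · rw [Set.ofPred_and]
      refine IsClosed.inter ?_ (isClosed_le (by fun_prop) continuous_const)
      rw [Set.ofPred_forall]
      exact isClosed_iInter fun i => isClosed_le continuous_const (continuous_apply i)
    · rintro s ⟨h0, h1⟩
      exact ⟨h0, fun i => (Finset.single_le_sum (fun j _ => h0 j) (Finset.mem_univ i)).trans h1⟩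
  have h := (isCompact_unitaryGroup.prod (isCompact_unitaryGroup.prod hS)).image
    (Continuous.rpw continuous_fst (continuous_fst.comp continuous_snd)
      (continuous_snd.comp continuous_snd) hx)
  convert h using 1
  ext a
  constructor
  · rintro ⟨U, hU, V, hV, s, hs, hs1, rfl⟩
    exact ⟨(U, V, s), ⟨hU, hV, hs, hs1⟩, (pw_eq_rpw U V hs hx).symm⟩
  · rintro ⟨⟨U, V, s⟩, ⟨hU, hV, hs, hs1⟩, rfl⟩
    exact ⟨U, hU, V, hV, s, hs, hs1, (pw_eq_rpw U V hs hx).symm⟩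

section

variable {J : Type*} [Fintype J] {κ : J → Type*} [∀ j, Fintype (κ j)] [∀ j, DecidableEq (κ j)]

/-- Strict positivity of the weights bounds every coordinate by 1 / c_j. -/
lemma isCompact_weights {c : J → ℝ} (hc : ∀ j, 0 < c j) :
    IsCompact {s : (j : J) → κ j → ℝ | (∀ j i, 0 ≤ s j i) ∧ ∑ j, c j * ∑ i, s j i ≤ 1} := by
  have hK : IsCompact (Set.pi Set.univ fun j : J => Set.pi Set.univ fun _ : κ j =>
      Set.Icc (0 : ℝ) (c j)⁻¹) :=
    isCompact_univ_pi fun j => isCompact_univ_pi fun _ => isCompact_Icc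
  refine hK.of_isClosed_subset ?_ ?_
  · refine IsClosed.inter (s₁ := {s : (j : J) → κ j → ℝ | ∀ j i, 0 ≤ s j i}) ?_
      (isClosed_le (by fun_prop : Continuous fun s : (j : J) → κ j → ℝ => ∑ j, c j * ∑ i, s j i)
        continuous_const)
    simp only [Set.ofPred_forall]
    exact isClosed_iInter fun j => isClosed_iInter fun i =>
      isClosed_le continuous_const (by fun_prop)
  · rintro s ⟨h0, h1⟩ j - i -
    refine ⟨h0 j i, ?_⟩
    have h2 : c j * s j i ≤ 1 := by
      refine le_trans ?_ h1
      refine le_trans (mul_le_mul_of_nonneg_left (Finset.single_le_sum (fun k _ => h0 j k)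
        (Finset.mem_univ i)) (hc j).le) ?_
      exact Finset.single_le_sum (f := fun j => c j * ∑ i, s j i)
        (fun k _ => mul_nonneg (hc k).le (Finset.sum_nonneg fun i _ => h0 k i)) (Finset.mem_univ j)
    rw [← one_div, le_div_iff₀ (hc j)]
    linarith

lemma continuous_pi_rpw {x : ℝ} (hx : 0 < x) :
    Continuous fun p : ((j : J) → Matrix (κ j) (κ j) ℂ) × ((j : J) → Matrix (κ j) (κ j) ℂ)
      × ((j : J) → κ j → ℝ) => fun j => rpw (p.1 j) (p.2.1 j) (p.2.2 j) x := by
  refine continuous_pi fun j => ?_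
  exact Continuous.rpw ((continuous_apply j).comp continuous_fst)
    ((continuous_apply j).comp (continuous_fst.comp continuous_snd))
    ((continuous_apply j).comp (continuous_snd.comp continuous_snd)) hx

lemma isCompact_FB {c : J → ℝ} (hc : ∀ j, 0 < c j) {x : ℝ} (hx : 0 < x) :
    IsCompact (FB (κ := κ) c x) := by
  have hU : IsCompact (Set.pi Set.univ fun j : J =>
      (Matrix.unitaryGroup (κ j) ℂ : Set (Matrix (κ j) (κ j) ℂ))) :=
    isCompact_univ_pi fun j => isCompact_unitaryGroup
  have h := (hU.prod (hU.prod (isCompact_weights hc))).image (continuous_pi_rpw hx)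
  convert h using 1
  ext Y
  constructor
  · rintro ⟨U, V, s, hU, hV, hs, hs1, h⟩
    exact ⟨(U, V, s), ⟨fun j _ => hU j, fun j _ => hV j, hs, hs1⟩,
      funext fun j => ((h j).trans (pw_eq_rpw _ _ (hs j) hx)).symm⟩
  · rintro ⟨⟨U, V, s⟩, ⟨hU, hV, hs, hs1⟩, rfl⟩
    exact ⟨U, V, s, fun j => hU j trivial, fun j => hV j trivial, hs, hs1,
      fun j => (pw_eq_rpw _ _ (hs j) hx).symm⟩

end

end Compact

/-! ### The first order condition at an extremal matrix -/

section Variation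

variable {ι : Type*} [Fintype ι] [DecidableEq ι]

lemma conjTranspose_mem_unitaryGroup {U : Matrix ι ι ℂ} (hU : U ∈ Matrix.unitaryGroup ι ℂ) :
    Uᴴ ∈ Matrix.unitaryGroup ι ℂ := by
  rw [Matrix.mem_unitaryGroup_iff, Matrix.star_eq_conjTranspose, Matrix.conjTranspose_conjTranspose]
  exact (Matrix.mem_unitaryGroup_iff').1 hU

lemma mul_conjTranspose_of_mem {U : Matrix ι ι ℂ} (hU : U ∈ Matrix.unitaryGroup ι ℂ) :
    U * Uᴴ = 1 := Matrix.mem_unitaryGroup_iff.1 hU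

lemma conjTranspose_mul_of_mem {U : Matrix ι ι ℂ} (hU : U ∈ Matrix.unitaryGroup ι ℂ) :
    Uᴴ * U = 1 := (Matrix.mem_unitaryGroup_iff').1 hU

lemma unitary_mul_mem_SB {U V a : Matrix ι ι ℂ} {x : ℝ} (hU : U ∈ Matrix.unitaryGroup ι ℂ)
    (hV : V ∈ Matrix.unitaryGroup ι ℂ) (ha : a ∈ SB ι x) : U * a * V ∈ SB ι x := by
  obtain ⟨U', hU', V', hV', s, hs, hs1, rfl⟩ := ha
  refine ⟨U * U', mul_mem hU hU', V' * V, mul_mem hV' hV, s, hs, hs1, ?_⟩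
  simp only [pw, Matrix.mul_assoc]

lemma transpose_mem_SB {a : Matrix ι ι ℂ} {x : ℝ} (ha : a ∈ SB ι x) : aᵀ ∈ SB ι x := by
  obtain ⟨U, hU, V, hV, s, hs, hs1, rfl⟩ := ha
  refine ⟨Vᵀ, Matrix.transpose_mem_unitaryGroup_iff.2 hV, Uᵀ,
    Matrix.transpose_mem_unitaryGroup_iff.2 hU, s, hs, hs1, ?_⟩
  simp only [pw, Matrix.transpose_mul, Matrix.diagonal_transpose, Matrix.mul_assoc]

lemma norm_det_of_mem_unitaryGroup {U : Matrix ι ι ℂ} (hU : U ∈ Matrix.unitaryGroup ι ℂ) :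
    ‖U.det‖ = 1 := by
  have h := congrArg Matrix.det (mul_conjTranspose_of_mem hU)
  rw [Matrix.det_mul, Matrix.det_conjTranspose, Matrix.det_one] at h
  have h2 := congrArg norm h
  rw [norm_mul, norm_star, norm_one] at h2
  nlinarith [norm_nonneg U.det]

lemma rankOne_eq (η : ι → ℂ) (lam : ℂ) :
    rankOne η lam = 1 + (lam - 1) • Matrix.vecMulVec η (star η) := by
  ext i j
  simp [rankOne, Matrix.one_apply, Matrix.vecMulVec_apply]

lemma det_rankOne {η : ι → ℂ} (hη : ∑ i, ‖η i‖ ^ 2 = 1) (lam : ℂ) : (rankOne η lam).det = lam := by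
  have h1 : rankOne η lam = 1 + Matrix.replicateCol Unit ((lam - 1) • η) *
      Matrix.replicateRow Unit (star η) := by
    rw [rankOne_eq, ← Matrix.vecMulVec_eq, Matrix.smul_vecMulVec]
  rw [h1, Matrix.det_one_add_replicateCol_mul_replicateRow, dotProduct_smul]
  have hs : star η ⬝ᵥ η = 1 := by
    have : (((∑ i, ‖η i‖ ^ 2 : ℝ)) : ℂ) = 1 := by rw [hη]; simp
    push_cast at this
    rw [← this]
    exact Finset.sum_congr rfl fun i _ => Complex.conj_mul' _
  rw [hs]
  simp

/-- Both sides equal 1 at t = 0, so their right derivatives at 0 are ordered. -/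
lemma le_of_one_add_mul_le_rpow {ρ e x y : ℝ}
    (h : ∀ t : ℝ, 0 < t → 1 + t * ρ ≤ (1 + ((1 + t) ^ x⁻¹ - 1) * e) ^ y) : ρ ≤ y * x⁻¹ * e := by
  have h1 : HasDerivAt (fun t : ℝ => 1 + ((1 + t) ^ x⁻¹ - 1) * e) (x⁻¹ * e) 0 := by
    have h2 : HasDerivAt (fun t : ℝ => (1 + t) ^ x⁻¹) (1 * x⁻¹ * (1 + 0 : ℝ) ^ (x⁻¹ - 1)) 0 :=
      ((hasDerivAt_id (0 : ℝ)).const_add 1).rpow_const (Or.inl (by norm_num))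
    have h3 := ((h2.sub_const 1).mul_const e).const_add 1
    simpa using h3
  have h4 : HasDerivAt (fun t : ℝ => (1 + ((1 + t) ^ x⁻¹ - 1) * e) ^ y - t * ρ)
      (y * x⁻¹ * e - ρ) 0 := by
    have h5 := (h1.rpow_const (p := y) (Or.inl (by norm_num))).sub
      ((hasDerivAt_id (0 : ℝ)).mul_const ρ)
    have h6 : x⁻¹ * e * y * (1 + ((1 + (0 : ℝ)) ^ x⁻¹ - 1) * e) ^ (y - 1) - 1 * ρ
        = y * x⁻¹ * e - ρ := by simp; ring
    rw [h6] at h5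
    exact h5
  have h7 := h4.tendsto_slope_zero_right
  have h8 : 0 ≤ y * x⁻¹ * e - ρ := by
    refine ge_of_tendsto h7 ?_
    filter_upwards [self_mem_nhdsWithin] with t ht
    have := h t ht
    simp only [smul_eq_mul]
    refine mul_nonneg (inv_nonneg.2 (le_of_lt ht)) ?_
    simp
    linarith
  linarith

/-- First order condition for a positive definite maximiser of `Re L(a) |det a| ^ ε` on the unit
ball of a Schatten class. -/
lemma first_order_condition {x : ℝ} (hx0 : 0 < x) (hx1 : x ≤ 1 / 2) {V : Matrix ι ι ℂ}
    (hV : V ∈ Matrix.unitaryGroup ι ℂ) {s : ι → ℝ} (hs : ∀ i, 0 ≤ s i) (hs1 : ∑ i, s i ≤ 1)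
    (L : Matrix ι ι ℂ →ₗ[ℂ] ℂ) {ε : ℝ} (hε : 0 ≤ ε)
    (hmax : ∀ a ∈ SB ι x, (L a).re * ‖a.det‖ ^ ε
      ≤ (L (pw Vᴴ V s x)).re * ‖(pw Vᴴ V s x).det‖ ^ ε)
    (hpos : 0 < (L (pw Vᴴ V s x)).re) (hdet : (pw Vᴴ V s x).det ≠ 0)
    {η : ι → ℂ} (hη : ∑ i, ‖η i‖ ^ 2 = 1) :
    (L (Vᴴ * Matrix.vecMulVec η (star η) * V * pw Vᴴ V s x)).re
      ≤ (1 + ε * Fintype.card ι) * (L (pw Vᴴ V s x)).re * ∑ i, s i * ‖η i‖ ^ 2 := by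
  set a₀ := pw Vᴴ V s x with ha₀
  set ℓ := (L a₀).re with hℓ
  set e := ∑ i, s i * ‖η i‖ ^ 2 with he
  have he0 : 0 ≤ e := Finset.sum_nonneg fun i _ => mul_nonneg (hs i) (by positivity)
  have hVV := mul_conjTranspose_of_mem hV
  have hVV' := conjTranspose_mul_of_mem hV
  set ρ := (L (Vᴴ * Matrix.vecMulVec η (star η) * V * a₀)).re with hρ
  set n : ℝ := (Fintype.card ι : ℝ) with hn
  have hfin : ρ / ℓ ≤ (x * (1 + ε * n)) * x⁻¹ * e := by
    refine le_of_one_add_mul_le_rpow fun t ht => ?_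
    set T := 1 + ((1 + t) ^ x⁻¹ - 1) * e with hT
    have hT1 : 1 ≤ T := by
      have h1 : 1 ≤ (1 + t) ^ x⁻¹ := Real.one_le_rpow (by linarith) (by positivity)
      nlinarith
    have hT0 : 0 < T := by linarith
    -- The competitor is the maximizer multiplied by 1 + t times a rank one projection, divided by
    -- T^x to return to the unit ball.
    have hm := rankOne_mul_diagonal_mem_SB hη hs hs1 hx0 hx1 (t := 1 + t) (by linarith)
    have hm2 := unitary_mul_mem_SB (conjTranspose_mem_unitaryGroup hV) hV hm
    set D := Vᴴ * rankOne η ((1 + t : ℝ) : ℂ) * V with hD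
    have hDa : Vᴴ * (((T ^ (-x) : ℝ) : ℂ) • (rankOne η ((1 + t : ℝ) : ℂ) *
        Matrix.diagonal fun i => zp (s i) x)) * V = ((T ^ (-x) : ℝ) : ℂ) • (D * a₀) := by
      rw [Matrix.mul_smul, Matrix.smul_mul, hD, ha₀, pw]
      congr 1
      simp only [Matrix.mul_assoc]
      rw [← Matrix.mul_assoc V Vᴴ, hVV, Matrix.one_mul]
    rw [hDa] at hm2
    have h1 := hmax _ hm2
    have hDe : D * a₀ = a₀ + (t : ℂ) • (Vᴴ * Matrix.vecMulVec η (star η) * V * a₀) := by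
      rw [hD, rankOne_eq, Matrix.mul_add, Matrix.mul_one, Matrix.add_mul, Matrix.add_mul, hVV',
        Matrix.one_mul, Matrix.mul_smul, Matrix.smul_mul, Matrix.smul_mul]
      congr 2
      push_cast; ring
    have hLre : (L (((T ^ (-x) : ℝ) : ℂ) • (D * a₀))).re = T ^ (-x) * (ℓ + t * ρ) := by
      rw [hDe, map_smul, map_add, map_smul, smul_eq_mul, Complex.re_ofReal_mul, Complex.add_re,
        smul_eq_mul, Complex.re_ofReal_mul]
    have hdetD : D.det = ((1 + t : ℝ) : ℂ) := by
      rw [hD, Matrix.det_mul, Matrix.det_mul, det_rankOne hη, mul_right_comm, ← Matrix.det_mul, hVV',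
        Matrix.det_one, one_mul]
    -- Normalizing multiplies the determinant by T^(-x n). This is the source of the factor 1 + ε n,
    -- which tends to 1 with ε.
    have hdn : ‖(((T ^ (-x) : ℝ) : ℂ) • (D * a₀)).det‖ = T ^ (-x * n) * (1 + t) * ‖a₀.det‖ := by
      rw [Matrix.det_smul, Matrix.det_mul, hdetD, norm_mul, norm_mul, norm_pow, Complex.norm_real,
        Complex.norm_real, Real.norm_of_nonneg (by positivity : (0:ℝ) ≤ 1 + t),
        Real.norm_of_nonneg (by positivity), ← Real.rpow_natCast, ← Real.rpow_mul hT0.le, hn]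
      ring
    rw [hLre, hdn] at h1
    have hd0 : 0 < ‖a₀.det‖ := norm_pos_iff.2 hdet
    rw [Real.mul_rpow (by positivity) hd0.le, Real.mul_rpow (by positivity) (by positivity),
      ← Real.rpow_mul hT0.le] at h1
    have hde : 0 < ‖a₀.det‖ ^ ε := by positivity
    have h2 : T ^ (-x) * (ℓ + t * ρ) * (T ^ (-x * n * ε) * (1 + t) ^ ε) ≤ ℓ :=
      le_of_mul_le_mul_right (by linarith) hde
    -- If ℓ + t ρ is not positive, the inequality to be proved has a nonpositive left side.
    by_cases hneg : ℓ + t * ρ ≤ 0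
    · have : 1 + t * (ρ / ℓ) ≤ 0 := by
        have : 1 + t * (ρ / ℓ) = (ℓ + t * ρ) / ℓ := by field_simp
        rw [this]; exact div_nonpos_of_nonpos_of_nonneg hneg hpos.le
      exact this.trans (by positivity)
    push Not at hneg
    -- The gain 1 + t in the determinant has a favourable sign and is dropped.
    have h3 : 1 ≤ (1 + t) ^ ε := Real.one_le_rpow (by linarith) hε
    have h4 : T ^ (-x) * (ℓ + t * ρ) * T ^ (-x * n * ε) ≤ ℓ := by
      refine le_trans ?_ h2
      rw [← mul_assoc]
      exact le_mul_of_one_le_right (by positivity) h3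
    have h5 : T ^ (-x) * T ^ (-x * n * ε) * T ^ (x * (1 + ε * n)) = 1 := by
      rw [← Real.rpow_add hT0, ← Real.rpow_add hT0]
      convert Real.rpow_zero T using 2
      ring
    have h6 : ℓ + t * ρ ≤ ℓ * T ^ (x * (1 + ε * n)) := by
      calc ℓ + t * ρ = (T ^ (-x) * (ℓ + t * ρ) * T ^ (-x * n * ε)) * T ^ (x * (1 + ε * n)) := by
            linear_combination (-(ℓ + t * ρ)) * h5
        _ ≤ _ := mul_le_mul_of_nonneg_right h4 (by positivity)
    have h7 : 1 + t * (ρ / ℓ) = (ℓ + t * ρ) / ℓ := by field_simp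
    rw [h7, div_le_iff₀ hpos]
    linarith
  rw [div_le_iff₀ hpos] at hfin
  have hxx : x * (1 + ε * n) * x⁻¹ = 1 + ε * n := by field_simp
  rw [hxx] at hfin
  linarith

end Variation

/-! ### Norming functionals of finite families -/

section Norming

variable {ι : Type*} [Fintype ι] [DecidableEq ι]

lemma pw_mul_pw {U V W : Matrix ι ι ℂ} (hV : V ∈ Matrix.unitaryGroup ι ℂ) (s : ι → ℝ) (z w : ℂ) :
    pw U V s z * pw Vᴴ W s w = pw U W s (z + w) := by
  rw [pw, pw, pw, Matrix.mul_assoc Vᴴ, Matrix.mul_assoc _ V, ← Matrix.mul_assoc V,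
    mul_conjTranspose_of_mem hV, Matrix.one_mul, Matrix.mul_assoc U, ← Matrix.mul_assoc _ _ W,
    Matrix.diagonal_mul_diagonal, ← Matrix.mul_assoc U]
  simp_rw [zp_add]

lemma pw_const_mul (U V : Matrix ι ι ℂ) {s : ι → ℝ} (hs : ∀ i, 0 ≤ s i) {k : ℝ} (hk : 0 ≤ k)
    (z : ℂ) : pw U V (fun i => k * s i) z = zp k z • pw U V s z := by
  ext i j
  simp only [pw_apply, Matrix.smul_apply, smul_eq_mul, Finset.mul_sum, zp_mul hk (hs _)]
  exact Finset.sum_congr rfl fun l _ => by ring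

lemma trace_pw_one {U : Matrix ι ι ℂ} (hU : U ∈ Matrix.unitaryGroup ι ℂ) {s : ι → ℝ}
    (hs : ∀ i, 0 ≤ s i) : (pw U Uᴴ s 1).trace = ((∑ i, s i : ℝ) : ℂ) := by
  rw [pw, Matrix.trace_mul_comm, ← Matrix.mul_assoc, conjTranspose_mul_of_mem hU, Matrix.one_mul,
    Matrix.trace_diagonal]
  push_cast
  exact Finset.sum_congr rfl fun i _ => zp_one (hs i)

variable {J : Type*} [Fintype J] {κ : J → Type*} [∀ j, Fintype (κ j)] [∀ j, DecidableEq (κ j)]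

/-- A functional norming the family of the `U_j σ_j ^ x V_j`. -/
def norming (c : J → ℝ) (U V : (j : J) → Matrix (κ j) (κ j) ℂ) (σ : (j : J) → κ j → ℝ) (x : ℝ)
    (j : J) : Matrix (κ j) (κ j) ℂ :=
  zp (∑ j, c j * ∑ i, σ j i)⁻¹ ((1 - x : ℝ) : ℂ) • pw (V j)ᴴ (U j)ᴴ (σ j) ((1 - x : ℝ) : ℂ)

lemma weight_nonneg {c : J → ℝ} (hc : ∀ j, 0 ≤ c j) {σ : (j : J) → κ j → ℝ}
    (hσ : ∀ j i, 0 ≤ σ j i) : 0 ≤ ∑ j, c j * ∑ i, σ j i :=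
  Finset.sum_nonneg fun j _ => mul_nonneg (hc j) (Finset.sum_nonneg fun i _ => hσ j i)

lemma norming_mem_FB {c : J → ℝ} (hc : ∀ j, 0 ≤ c j) {U V : (j : J) → Matrix (κ j) (κ j) ℂ}
    {σ : (j : J) → κ j → ℝ} (hU : ∀ j, U j ∈ Matrix.unitaryGroup (κ j) ℂ)
    (hV : ∀ j, V j ∈ Matrix.unitaryGroup (κ j) ℂ) (hσ : ∀ j i, 0 ≤ σ j i) (x : ℝ) :
    norming c U V σ x ∈ FB c (1 - x) := by
  have h0 := weight_nonneg hc hσ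
  refine ⟨fun j => (V j)ᴴ, fun j => (U j)ᴴ, fun j i => (∑ j, c j * ∑ i, σ j i)⁻¹ * σ j i,
    fun j => conjTranspose_mem_unitaryGroup (hV j), fun j => conjTranspose_mem_unitaryGroup (hU j),
    fun j i => mul_nonneg (inv_nonneg.2 h0) (hσ j i), ?_, fun j => ?_⟩
  · simp only [← Finset.mul_sum, mul_left_comm (c _)]
    exact inv_mul_le_one
  · rw [norming, pw_const_mul _ _ (hσ j) (inv_nonneg.2 h0)]

/-- The exponents x and 1 - x add up to 1, so the product is a scalar multiple of the positive
matrix U σ U^*. Positivity is what turns the first order condition into an inequality of quadratic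
forms. -/
lemma pw_mul_norming (c : J → ℝ) (U : (j : J) → Matrix (κ j) (κ j) ℂ)
    {V : (j : J) → Matrix (κ j) (κ j) ℂ} (σ : (j : J) → κ j → ℝ)
    (hV : ∀ j, V j ∈ Matrix.unitaryGroup (κ j) ℂ) (x : ℝ) (j : J) :
    pw (U j) (V j) (σ j) x * norming c U V σ x j
      = zp (∑ j, c j * ∑ i, σ j i)⁻¹ ((1 - x : ℝ) : ℂ) • pw (U j) (U j)ᴴ (σ j) 1 := by
  rw [norming, Matrix.mul_smul, pw_mul_pw (hV j)]
  congr 2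
  push_cast; ring

lemma norming_mul_pw (c : J → ℝ) {U : (j : J) → Matrix (κ j) (κ j) ℂ}
    (V : (j : J) → Matrix (κ j) (κ j) ℂ) (σ : (j : J) → κ j → ℝ)
    (hU : ∀ j, U j ∈ Matrix.unitaryGroup (κ j) ℂ) (x : ℝ) (j : J) :
    norming c U V σ x j * pw (U j) (V j) (σ j) x
      = zp (∑ j, c j * ∑ i, σ j i)⁻¹ ((1 - x : ℝ) : ℂ) • pw (V j)ᴴ (V j) (σ j) 1 := by
  have h := pw_mul_pw (U := (V j)ᴴ) (W := V j) (conjTranspose_mem_unitaryGroup (hU j)) (σ j)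
    ((1 - x : ℝ) : ℂ) x
  rw [Matrix.conjTranspose_conjTranspose] at h
  rw [norming, Matrix.smul_mul, h]
  congr 2
  push_cast; ring

lemma sum_trace_pw_mul_norming {c : J → ℝ} (hc : ∀ j, 0 ≤ c j)
    {U V : (j : J) → Matrix (κ j) (κ j) ℂ}
    {σ : (j : J) → κ j → ℝ} (hU : ∀ j, U j ∈ Matrix.unitaryGroup (κ j) ℂ)
    (hV : ∀ j, V j ∈ Matrix.unitaryGroup (κ j) ℂ) (hσ : ∀ j i, 0 ≤ σ j i) {x : ℝ} (hx0 : 0 < x) :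
    ∑ j, (c j : ℂ) * (pw (U j) (V j) (σ j) x * norming c U V σ x j).trace
      = (((∑ j, c j * ∑ i, σ j i) ^ x : ℝ) : ℂ) := by
  have h0 := weight_nonneg hc hσ
  have h1 (j : J) : (c j : ℂ) * (pw (U j) (V j) (σ j) x * norming c U V σ x j).trace
      = zp (∑ j, c j * ∑ i, σ j i)⁻¹ ((1 - x : ℝ) : ℂ) * ((c j * ∑ i, σ j i : ℝ) : ℂ) := by
    rw [pw_mul_norming c U σ hV, Matrix.trace_smul, trace_pw_one (hU j) (hσ j), smul_eq_mul]
    push_cast; ring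
  rw [Finset.sum_congr rfl fun j _ => h1 j, ← Finset.mul_sum, ← Complex.ofReal_sum]
  set Λ := ∑ j, c j * ∑ i, σ j i
  -- For the zero family the inverse weight is 0 and its power is 0 by convention, so the identity
  -- persists.
  rcases h0.eq_or_lt with h | h
  · rw [← h, Real.zero_rpow hx0.ne', Complex.ofReal_zero, mul_zero]
  · rw [zp_ofReal_of_pos (inv_pos.2 h), ← Complex.ofReal_mul]
    congr 1
    rw [Real.inv_rpow h.le, ← Real.rpow_neg h.le]
    nth_rewrite 2 [← Real.rpow_one Λ]
    rw [← Real.rpow_add h]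
    congr 1
    ring

end Norming

section AmpTrace

variable {ι κ : Type*} [Fintype ι] [DecidableEq ι] [Fintype κ] [DecidableEq κ]

/-- Pairing a rank one matrix on the first tensor factor with a matrix on the product computes a
matrix coefficient of the partial trace over the second factor, expanded here along the
decomposition `U σ W`. -/
lemma trace_amp_vecMulVec_mul_pw_one (p q : ι → ℂ) (U W : Matrix (ι × κ) (ι × κ) ℂ)
    {σ : ι × κ → ℝ} (hσ : ∀ e, 0 ≤ σ e) :
    (amp κ (Matrix.vecMulVec p q) * pw U W σ 1).trace
      = ∑ e, (σ e : ℂ) * ∑ k, (∑ i, q i * U (i, k) e) * (∑ i, W e (i, k) * p i) := by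
  have h1 : (amp κ (Matrix.vecMulVec p q) * pw U W σ 1).trace
      = ((Matrix.diagonal fun e => (σ e : ℂ)) * (W * amp κ (Matrix.vecMulVec p q) * U)).trace := by
    have : (fun e => zp (σ e) 1) = fun e => (σ e : ℂ) := funext fun e => zp_one (hσ e)
    rw [pw, this, ← Matrix.mul_assoc, ← Matrix.mul_assoc, Matrix.trace_mul_comm,
      ← Matrix.mul_assoc, ← Matrix.mul_assoc, Matrix.trace_mul_comm]
  rw [h1, Matrix.trace]
  refine Finset.sum_congr rfl fun e _ => ?_
  rw [Matrix.diag_apply, Matrix.diagonal_mul]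
  congr 1
  rw [Matrix.mul_apply, Fintype.sum_prod_type, Finset.sum_comm]
  refine Finset.sum_congr rfl fun k _ => ?_
  rw [Finset.sum_mul]
  refine Finset.sum_congr rfl fun i _ => ?_
  rw [Matrix.mul_apply, Fintype.sum_prod_type, Finset.sum_comm, Finset.sum_eq_single k]
  · simp only [amp_apply, if_true, Matrix.vecMulVec_apply, Finset.sum_mul, Finset.mul_sum]
    exact Finset.sum_congr rfl fun l _ => by ring
  · intro l _ hl
    simp [amp_apply, hl]
  · simp

end AmpTrace

/-! ### Factorization bound for the operator space norm at exponent 1 -/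

section NormOne

variable {ι J : Type*} [Fintype ι] [DecidableEq ι] [Fintype J]
  {κ : J → Type*} [∀ j, Fintype (κ j)] [∀ j, DecidableEq (κ j)]

/-- The parallel pairing `∑_j c_j ∑_{k,l} X_j[k,l] ⊗ Y_j[k,l]`. -/
def pairing {m : Type*} (c : J → ℝ) (X : (j : J) → Matrix (ι × κ j) (ι × κ j) ℂ)
    (Y : (j : J) → Matrix (m × κ j) (m × κ j) ℂ) : Matrix (ι × m) (ι × m) ℂ :=
  Matrix.of fun p q => ∑ j, (c j : ℂ) *
    ∑ k, ∑ l, X j (p.1, k) (q.1, l) * Y j (p.2, k) (q.2, l)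

lemma sum_prod_contract {ι m κ : Type*} [Fintype ι] [Fintype m] [Fintype κ] (x : ι × m → ℂ)
    (a : ι → κ → ℂ) (F : m → κ → ℂ) :
    ∑ p, x p * ∑ k, a p.1 k * F p.2 k
      = ∑ u : m × κ, (∑ i, x (i, u.1) * a i u.2) * F u.1 u.2 := by
  rw [Fintype.sum_prod_type, Fintype.sum_prod_type, Finset.sum_comm]
  refine Finset.sum_congr rfl fun k' _ => ?_
  simp only [Finset.mul_sum, Finset.sum_mul]
  rw [Finset.sum_comm]
  exact Finset.sum_congr rfl fun k _ => Finset.sum_congr rfl fun i _ => by ring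

/-- The hypotheses say that the partial traces of ∑ c_j P_j P_j^* and ∑ c_j Q_j^* Q_j are at most 1.
Contracting the test vectors x and y with P and Q leaves a sum of forms ⟨α, Y_j β⟩, and
Cauchy-Schwarz over all indices closes the estimate. The bound holds for every size m, as the norm
of M_n(L^1) requires. -/
lemma norm_pairing_le {m : Type*} [Fintype m] [DecidableEq m] {c : J → ℝ} (hc : ∀ j, 0 ≤ c j)
    {P Q : (j : J) → Matrix (ι × κ j) (ι × κ j) ℂ}
    (hP : ∀ ξ : ι → ℂ, ∑ j, c j * ∑ e, ∑ k, ‖∑ i, ξ i * P j (i, k) e‖ ^ 2 ≤ ∑ i, ‖ξ i‖ ^ 2)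
    (hQ : ∀ ξ : ι → ℂ, ∑ j, c j * ∑ e, ∑ k, ‖∑ i, Q j e (i, k) * ξ i‖ ^ 2 ≤ ∑ i, ‖ξ i‖ ^ 2)
    {Y : (j : J) → Matrix (m × κ j) (m × κ j) ℂ} (hY : ∀ j, ‖Y j‖ ≤ 1) :
    ‖pairing c (fun j => P j * Q j) Y‖ ≤ 1 := by
  refine opNorm_le_of_bilin _ zero_le_one fun x y => ?_
  rw [one_mul]
  let α : (j : J) → ι × κ j → m × κ j → ℂ := fun j e u => ∑ i, x (i, u.1) * P j (i, u.2) e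
  let β : (j : J) → ι × κ j → m × κ j → ℂ := fun j e u => ∑ i, Q j e (i, u.2) * y (i, u.1)
  have hsum : ∑ p, ∑ q, x p * pairing c (fun j => P j * Q j) Y p q * y q
      = ∑ j, (c j : ℂ) * ∑ e, ∑ u, ∑ v, α j e u * Y j u v * β j e v := by
    have h1 (p q : ι × m) : x p * pairing c (fun j => P j * Q j) Y p q * y q
        = ∑ j, (c j : ℂ) * ∑ e, x p * ∑ k, P j (p.1, k) e *
          (y q * ∑ l, Q j e (q.1, l) * Y j (p.2, k) (q.2, l)) := by
      simp only [pairing, Matrix.of_apply, Matrix.mul_apply, Finset.mul_sum, Finset.sum_mul]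
      refine Finset.sum_congr rfl fun j _ => ?_
      calc ∑ k, ∑ l, ∑ e, x p * ((c j : ℂ) * (P j (p.1, k) e * Q j e (q.1, l) *
              Y j (p.2, k) (q.2, l))) * y q
          = ∑ k, ∑ e, ∑ l, x p * ((c j : ℂ) * (P j (p.1, k) e * Q j e (q.1, l) *
              Y j (p.2, k) (q.2, l))) * y q :=
            Finset.sum_congr rfl fun k _ => Finset.sum_comm
        _ = ∑ e, ∑ k, ∑ l, x p * ((c j : ℂ) * (P j (p.1, k) e * Q j e (q.1, l) *
              Y j (p.2, k) (q.2, l))) * y q := Finset.sum_comm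
        _ = _ := Finset.sum_congr rfl fun e _ => Finset.sum_congr rfl fun k _ =>
              Finset.sum_congr rfl fun l _ => by ring
    simp only [h1]
    have h2 : ∑ p, ∑ q, ∑ j, (c j : ℂ) * ∑ e, x p * ∑ k, P j (p.1, k) e *
          (y q * ∑ l, Q j e (q.1, l) * Y j (p.2, k) (q.2, l))
        = ∑ j, (c j : ℂ) * ∑ e, ∑ p, ∑ q, x p * ∑ k, P j (p.1, k) e *
          (y q * ∑ l, Q j e (q.1, l) * Y j (p.2, k) (q.2, l)) := by
      have h3 (p : ι × m) : ∑ q, ∑ j, (c j : ℂ) * ∑ e, x p * ∑ k, P j (p.1, k) e *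
          (y q * ∑ l, Q j e (q.1, l) * Y j (p.2, k) (q.2, l))
          = ∑ j, (c j : ℂ) * ∑ e, ∑ q, x p * ∑ k, P j (p.1, k) e *
          (y q * ∑ l, Q j e (q.1, l) * Y j (p.2, k) (q.2, l)) := by
        rw [Finset.sum_comm]
        refine Finset.sum_congr rfl fun j _ => ?_
        rw [← Finset.mul_sum, Finset.sum_comm]
      rw [Finset.sum_congr rfl fun p _ => h3 p, Finset.sum_comm]
      refine Finset.sum_congr rfl fun j _ => ?_
      rw [← Finset.mul_sum, Finset.sum_comm]
    rw [h2]
    refine Finset.sum_congr rfl fun j _ => ?_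
    congr 1
    refine Finset.sum_congr rfl fun e _ => ?_
    have h4 (p : ι × m) : ∑ q, x p * ∑ k, P j (p.1, k) e *
          (y q * ∑ l, Q j e (q.1, l) * Y j (p.2, k) (q.2, l))
        = x p * ∑ k, P j (p.1, k) e * ∑ v : m × κ j, β j e v * Y j (p.2, k) v := by
      rw [← Finset.mul_sum, Finset.sum_comm]
      congr 1
      refine Finset.sum_congr rfl fun k _ => ?_
      rw [← Finset.mul_sum, sum_prod_contract y (fun i l => Q j e (i, l))
        (fun l' l => Y j (p.2, k) (l', l))]
      congr 1
      refine Finset.sum_congr rfl fun v _ => ?_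
      simp only [β]
      congr 1
      exact Finset.sum_congr rfl fun i _ => mul_comm _ _
    rw [Finset.sum_congr rfl fun p _ => h4 p,
      sum_prod_contract x (fun i k => P j (i, k) e) (fun k' k => ∑ v, β j e v * Y j (k', k) v)]
    refine Finset.sum_congr rfl fun u _ => ?_
    rw [Finset.mul_sum]
    exact Finset.sum_congr rfl fun v _ => by simp only [α]; ring
  rw [hsum]
  have hα : ∑ j, c j * ∑ e, l2 (α j e) ^ 2 ≤ l2 x ^ 2 := by
    have h1 (k' : m) := hP fun i => x (i, k')
    rw [l2_sq, Fintype.sum_prod_type, Finset.sum_comm]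
    refine le_trans (le_of_eq ?_) (Finset.sum_le_sum fun k' _ => h1 k')
    rw [Finset.sum_comm]
    refine Finset.sum_congr rfl fun j _ => ?_
    rw [← Finset.mul_sum, Finset.sum_comm]
    congr 1
    refine Finset.sum_congr rfl fun e _ => ?_
    rw [l2_sq, Fintype.sum_prod_type]
  have hβ : ∑ j, c j * ∑ e, l2 (β j e) ^ 2 ≤ l2 y ^ 2 := by
    have h1 (k' : m) := hQ fun i => y (i, k')
    rw [l2_sq, Fintype.sum_prod_type, Finset.sum_comm]
    refine le_trans (le_of_eq ?_) (Finset.sum_le_sum fun k' _ => h1 k')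
    rw [Finset.sum_comm]
    refine Finset.sum_congr rfl fun j _ => ?_
    rw [← Finset.mul_sum, Finset.sum_comm]
    congr 1
    refine Finset.sum_congr rfl fun e _ => ?_
    rw [l2_sq, Fintype.sum_prod_type]
  calc ‖∑ j, (c j : ℂ) * ∑ e, ∑ u, ∑ v, α j e u * Y j u v * β j e v‖
      ≤ ∑ j, c j * ∑ e, l2 (α j e) * l2 (β j e) := by
        refine (norm_sum_le _ _).trans (Finset.sum_le_sum fun j _ => ?_)
        rw [norm_mul, Complex.norm_real, Real.norm_of_nonneg (hc j)]
        refine mul_le_mul_of_nonneg_left ?_ (hc j)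
        refine (norm_sum_le _ _).trans (Finset.sum_le_sum fun e _ => ?_)
        refine (norm_bilin_le _ _ _).trans ?_
        exact mul_le_of_le_one_left (mul_nonneg (l2_nonneg _) (l2_nonneg _)) (hY j)
    _ = ∑ p : (j : J) × (ι × κ j), (√(c p.1) * l2 (α p.1 p.2)) * (√(c p.1) * l2 (β p.1 p.2)) := by
        rw [Fintype.sum_sigma]
        refine Finset.sum_congr rfl fun j _ => ?_
        rw [Finset.mul_sum]
        refine Finset.sum_congr rfl fun e _ => ?_
        have := Real.mul_self_sqrt (hc j)
        linear_combination (-(l2 (α j e) * l2 (β j e))) * this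
    _ ≤ √(∑ p : (j : J) × (ι × κ j), (√(c p.1) * l2 (α p.1 p.2)) ^ 2) *
        √(∑ p : (j : J) × (ι × κ j), (√(c p.1) * l2 (β p.1 p.2)) ^ 2) :=
        Real.sum_mul_le_sqrt_mul_sqrt _ _ _
    _ ≤ l2 x * l2 y := by
        have hgen (γ : (j : J) → ι × κ j → m × κ j → ℂ) (z : ι × m → ℂ)
            (h : ∑ j, c j * ∑ e, l2 (γ j e) ^ 2 ≤ l2 z ^ 2) :
            √(∑ p : (j : J) × (ι × κ j), (√(c p.1) * l2 (γ p.1 p.2)) ^ 2) ≤ l2 z := by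
          refine Real.sqrt_le_iff.2 ⟨l2_nonneg _, le_trans (le_of_eq ?_) h⟩
          rw [Fintype.sum_sigma]
          refine Finset.sum_congr rfl fun j _ => ?_
          rw [Finset.mul_sum]
          refine Finset.sum_congr rfl fun e _ => ?_
          rw [mul_pow, Real.sq_sqrt (hc j)]
        exact mul_le_mul (hgen α x hα) (hgen β y hβ) (Real.sqrt_nonneg _) (l2_nonneg _)

end NormOne

/-! ### Extremals of the regularized test form -/

section Extremal

variable {ι J : Type*} [Fintype ι] [DecidableEq ι] [Fintype J]
  {κ : J → Type*} [∀ j, Fintype (κ j)] [∀ j, DecidableEq (κ j)]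

lemma Continuous.amp {X : Type*} [TopologicalSpace X] {κ : Type*} [Fintype κ] [DecidableEq κ]
    {f : X → Matrix ι ι ℂ} (hf : Continuous f) : Continuous fun p => amp κ (f p) := by
  refine continuous_matrix fun i j => ?_
  simp only [amp_apply]
  split_ifs
  · exact hf.matrix_elem _ _
  · exact continuous_const

lemma Continuous.theta {X : Type*} [TopologicalSpace X] (c : J → ℝ) {a b : X → Matrix ι ι ℂ}
    (w : (j : J) → Matrix (ι × κ j) (ι × κ j) ℂ) {Y : X → (j : J) → Matrix (ι × κ j) (ι × κ j) ℂ}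
    (ha : Continuous a) (hb : Continuous b) (hY : Continuous Y) :
    Continuous fun p => theta c (a p) (b p) w (Y p) := by
  unfold QOS.theta
  refine continuous_finsetSum _ fun j _ => continuous_const.mul (Continuous.matrix_trace ?_)
  exact ((((Continuous.amp ha).matrix_mul continuous_const).matrix_mul (Continuous.amp hb))).matrix_mul
    ((continuous_apply j).comp hY)

lemma scalar_mem_SB [Nonempty ι] {x : ℝ} (hx : 0 < x) :
    (((Fintype.card ι : ℝ)⁻¹ ^ x : ℝ) : ℂ) • (1 : Matrix ι ι ℂ) ∈ SB ι x := by
  refine ⟨1, one_mem _, 1, one_mem _, fun _ => (Fintype.card ι : ℝ)⁻¹, fun _ => by positivity, ?_, ?_⟩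
  · simp
  · rw [pw, Matrix.one_mul, Matrix.mul_one, Matrix.smul_one_eq_diagonal]
    congr 1
    ext i
    rw [zp_ofReal (by positivity) hx.ne']

lemma theta_smul_one (c : J → ℝ) (k : ℂ) (w Y : (j : J) → Matrix (ι × κ j) (ι × κ j) ℂ) :
    theta c (k • 1) (k • 1) w Y = k ^ 2 * ∑ j, (c j : ℂ) * (w j * Y j).trace := by
  have h (j : J) : amp (κ j) (k • (1 : Matrix ι ι ℂ)) = k • 1 := by
    ext p q
    simp only [amp_apply, Matrix.smul_apply, Matrix.one_apply, Prod.ext_iff]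
    split_ifs <;> simp_all
  rw [theta, Finset.mul_sum]
  refine Finset.sum_congr rfl fun j _ => ?_
  rw [h, Matrix.smul_mul, Matrix.one_mul, Matrix.mul_smul, Matrix.mul_one, Matrix.smul_mul,
    Matrix.smul_mul, Matrix.trace_smul, Matrix.trace_smul, smul_eq_mul, smul_eq_mul]
  ring

lemma exists_family_pw (v : (j : J) → Matrix (κ j) (κ j) ℂ) {x : ℝ} (hx : 0 < x) :
    ∃ U V : (j : J) → Matrix (κ j) (κ j) ℂ, ∃ σ : (j : J) → κ j → ℝ,
      (∀ j, U j ∈ Matrix.unitaryGroup (κ j) ℂ) ∧ (∀ j, V j ∈ Matrix.unitaryGroup (κ j) ℂ) ∧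
      (∀ j i, 0 ≤ σ j i) ∧ ∀ j, v j = pw (U j) (V j) (σ j) x := by
  choose U hU V hV σ hσ h using fun j => exists_pw (v j) hx
  exact ⟨U, V, σ, hU, hV, hσ, h⟩

lemma weight_pos {c : J → ℝ} (hc : ∀ j, 0 < c j) {U V : (j : J) → Matrix (κ j) (κ j) ℂ}
    {σ : (j : J) → κ j → ℝ} (hσ : ∀ j i, 0 ≤ σ j i) {x : ℝ}
    {j : J} (h : pw (U j) (V j) (σ j) x ≠ 0) : 0 < ∑ j, c j * ∑ i, σ j i := by
  refine (weight_nonneg (fun j => (hc j).le) hσ).lt_of_ne fun h0 => h ?_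
  have h1 := (Finset.sum_eq_zero_iff_of_nonneg fun j _ =>
    mul_nonneg (hc j).le (Finset.sum_nonneg fun i _ => hσ j i)).1 h0.symm j (Finset.mem_univ j)
  have h2 := (Finset.sum_eq_zero_iff_of_nonneg fun i _ => hσ j i).1
    ((mul_eq_zero.1 h1).resolve_left (hc j).ne')
  ext p q
  rw [pw_apply, Matrix.zero_apply]
  exact Finset.sum_eq_zero fun k hk => by rw [h2 k hk, zp_zero]; simp

/-- Existence of positive definite extremals for the (regularised) trilinear form. -/
lemma exists_extremal {c : J → ℝ} (hc : ∀ j, 0 < c j) {x : ℝ} (hx0 : 0 < x) (hx1 : x < 1 / 2)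
    {w : (j : J) → Matrix (ι × κ j) (ι × κ j) ℂ} (hw : w ≠ 0) {ε : ℝ} (hε : 0 < ε) :
    ∃ V ∈ Matrix.unitaryGroup ι ℂ, ∃ V' ∈ Matrix.unitaryGroup ι ℂ, ∃ s s' : ι → ℝ,
      (∀ i, 0 ≤ s i) ∧ ∑ i, s i ≤ 1 ∧ (∀ i, 0 ≤ s' i) ∧ ∑ i, s' i ≤ 1 ∧
      ∃ U'' V'' : (j : J) → Matrix (ι × κ j) (ι × κ j) ℂ, ∃ σ : (j : J) → ι × κ j → ℝ,
      (∀ j, U'' j ∈ Matrix.unitaryGroup _ ℂ) ∧ (∀ j, V'' j ∈ Matrix.unitaryGroup _ ℂ) ∧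
      (∀ j i, 0 ≤ σ j i) ∧ (pw Vᴴ V s x).det ≠ 0 ∧ (pw V'ᴴ V' s' x).det ≠ 0 ∧
      0 < ∑ j, c j * ∑ i, σ j i ∧
      (∀ j, amp (κ j) (pw Vᴴ V s x) * w j * amp (κ j) (pw V'ᴴ V' s' x)
        = pw (U'' j) (V'' j) (σ j) ((2 * x : ℝ) : ℂ)) ∧
      ∀ a ∈ SB ι x, ∀ b ∈ SB ι x,
        (theta c a b w (norming c U'' V'' σ (2 * x))).re * (‖a.det‖ ^ ε * ‖b.det‖ ^ ε) ≤
        (∑ j, c j * ∑ i, σ j i) ^ (2 * x) *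
          (‖(pw Vᴴ V s x).det‖ ^ ε * ‖(pw V'ᴴ V' s' x).det‖ ^ ε) := by
  have hc0 : ∀ j, 0 ≤ c j := fun j => (hc j).le
  obtain ⟨j₀, hj₀⟩ := Function.ne_iff.1 hw
  have hne : Nonempty ι := by
    by_contra h
    rw [not_nonempty_iff] at h
    exact hj₀ (by ext p; exact h.elim p.1)
  -- The determinant factors vanish on singular matrices, so a maximizer with positive value has
  -- invertible `a` and `b`.
  let G : Matrix ι ι ℂ × Matrix ι ι ℂ × ((j : J) → Matrix (ι × κ j) (ι × κ j) ℂ) → ℝ :=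
    fun p => (theta c p.1 p.2.1 w p.2.2).re * (‖p.1.det‖ ^ ε * ‖p.2.1.det‖ ^ ε)
  have hG : Continuous G := by
    refine (Complex.continuous_re.comp (Continuous.theta c w continuous_fst
      (continuous_fst.comp continuous_snd) (continuous_snd.comp continuous_snd))).mul ?_
    exact (Continuous.rpow_const (continuous_fst.matrix_det.norm) fun _ => Or.inr hε.le).mul
      (Continuous.rpow_const ((continuous_fst.comp continuous_snd).matrix_det.norm)
        fun _ => Or.inr hε.le)
  obtain ⟨U₀, V₀, σ₀, hU₀, hV₀, hσ₀, hw₀⟩ := exists_family_pw w (x := 2 * x) (by linarith)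
  have hY₀ := norming_mem_FB hc0 hU₀ hV₀ hσ₀ (2 * x)
  have hK : IsCompact (SB ι x ×ˢ (SB ι x ×ˢ FB (κ := fun j => ι × κ j) c (1 - 2 * x))) :=
    (isCompact_SB hx0).prod ((isCompact_SB hx0).prod (isCompact_FB hc (by linarith)))
  set k₀ : ℝ := (Fintype.card ι : ℝ)⁻¹ ^ x with hk₀
  have hk₀pos : 0 < k₀ := by positivity
  have hmem₀ : ((k₀ : ℂ) • (1 : Matrix ι ι ℂ), (k₀ : ℂ) • (1 : Matrix ι ι ℂ),
      norming c U₀ V₀ σ₀ (2 * x)) ∈ (SB ι x ×ˢ (SB ι x ×ˢ FB (κ := fun j => ι × κ j) c (1 - 2 * x))) :=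
    ⟨scalar_mem_SB hx0, scalar_mem_SB hx0, hY₀⟩
  obtain ⟨⟨a, b, Y⟩, ⟨ha, hb, hY⟩, hmax⟩ := hK.exists_isMaxOn ⟨_, hmem₀⟩ hG.continuousOn
  have hmax' : ∀ a' ∈ SB ι x, ∀ b' ∈ SB ι x, ∀ Y' ∈ FB (κ := fun j => ι × κ j) c (1 - 2 * x),
      G (a', b', Y') ≤ G (a, b, Y) := fun a' ha' b' hb' Y' hY' => hmax ⟨ha', hb', hY'⟩
  -- The maximum is positive: normalized scalar matrices for `a`, `b` and the norming family of `w`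
  -- already give a positive value.
  have hGpos : 0 < G (a, b, Y) := by
    refine lt_of_lt_of_le ?_ (hmax hmem₀)
    simp only [G]
    rw [theta_smul_one]
    have h1 : ∑ j, (c j : ℂ) * (w j * norming c U₀ V₀ σ₀ (2 * x) j).trace
        = (((∑ j, c j * ∑ i, σ₀ j i) ^ (2 * x) : ℝ) : ℂ) := by
      rw [← sum_trace_pw_mul_norming hc0 hU₀ hV₀ hσ₀ (by linarith : 0 < 2 * x)]
      simp only [← hw₀]
    rw [h1, ← Complex.ofReal_pow, ← Complex.ofReal_mul, Complex.ofReal_re, Matrix.det_smul,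
      Matrix.det_one, mul_one, norm_pow, Complex.norm_real, Real.norm_of_nonneg hk₀pos.le]
    have : 0 < ∑ j, c j * ∑ i, σ₀ j i := weight_pos hc hσ₀ (j := j₀) (by rw [← hw₀]; exact hj₀)
    positivity
  obtain ⟨U, hU, V, hV, s, hs, hs1, rfl⟩ := ha
  obtain ⟨U', hU', V', hV', s', hs', hs1', rfl⟩ := hb
  have hVV := mul_conjTranspose_of_mem hV
  have hUU' := conjTranspose_mul_of_mem hU'
  -- Polar decompositions: the unitary parts of `a` and `b` are split off on the outer sides,
  -- leaving positive matrices next to `w`. Neither the moduli of the determinants nor the Schatten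
  -- norm of a w b changes.
  have ea : pw U V s x = (U * V) * pw Vᴴ V s x := by
    simp only [pw, Matrix.mul_assoc]
    rw [← Matrix.mul_assoc V Vᴴ, hVV, Matrix.one_mul]
  have eb : pw U' V' s' x = pw U'ᴴᴴ U'ᴴ s' x * (U' * V') := by
    rw [Matrix.conjTranspose_conjTranspose]
    simp only [pw, Matrix.mul_assoc]
    rw [← Matrix.mul_assoc U'ᴴ U', hUU', Matrix.one_mul]
  have hda : ‖(pw U V s x).det‖ = ‖(pw Vᴴ V s x).det‖ := by
    rw [ea, Matrix.det_mul, norm_mul, norm_det_of_mem_unitaryGroup (mul_mem hU hV), one_mul]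
  have hdb : ‖(pw U' V' s' x).det‖ = ‖(pw U'ᴴᴴ U'ᴴ s' x).det‖ := by
    rw [eb, Matrix.det_mul, norm_mul, norm_det_of_mem_unitaryGroup (mul_mem hU' hV'), mul_one]
  obtain ⟨U'', V'', σ, hU'', hV'', hσ, hv⟩ := exists_family_pw
    (fun j => amp (κ j) (pw Vᴴ V s x) * w j * amp (κ j) (pw U'ᴴᴴ U'ᴴ s' x)) (x := 2 * x)
    (by linarith)
  -- Hölder's inequality bounds the old maximum by the norm of the family built from the positive
  -- parts; the norming functional attains that norm, so it may replace the maximizing `Y`.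
  have hθ : ‖theta c (pw U V s x) (pw U' V' s' x) w Y‖ ≤ (∑ j, c j * ∑ i, σ j i) ^ (2 * x) := by
    have h1 := norm_sum_trace_le_rpow hc0 (by linarith : 0 ≤ 2 * x) (by linarith) hY hU'' hV'' hσ
      (A := fun j => amp (κ j) (U * V)) (B := fun j => amp (κ j) (U' * V'))
      (fun j => norm_unitary_le (amp_mem_unitaryGroup (mul_mem hU hV)))
      (fun j => norm_unitary_le (amp_mem_unitaryGroup (mul_mem hU' hV')))
    have h2 (j : J) : amp (κ j) (pw U V s x) * w j * amp (κ j) (pw U' V' s' x) * Y j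
        = amp (κ j) (U * V) * pw (U'' j) (V'' j) (σ j) ((2 * x : ℝ) : ℂ) * amp (κ j) (U' * V')
          * Y j := by
      rw [← hv j, ea, eb, amp_mul (U * V) (pw Vᴴ V s x), amp_mul _ (U' * V')]
      simp only [Matrix.mul_assoc]
    have h3 : theta c (pw U V s x) (pw U' V' s' x) w Y = ∑ j, (c j : ℂ) *
        (amp (κ j) (U * V) * pw (U'' j) (V'' j) (σ j) ((2 * x : ℝ) : ℂ) * amp (κ j) (U' * V')
          * Y j).trace := Finset.sum_congr rfl fun j _ => by rw [h2 j]
    rw [h3]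
    exact h1
  set d : ℝ := ‖(pw Vᴴ V s x).det‖ ^ ε * ‖(pw U'ᴴᴴ U'ᴴ s' x).det‖ ^ ε with hd
  have hd0 : 0 ≤ d := by positivity
  have hGle : G (pw U V s x, pw U' V' s' x, Y) ≤ (∑ j, c j * ∑ i, σ j i) ^ (2 * x) * d := by
    simp only [G]
    rw [hda, hdb]
    exact mul_le_mul_of_nonneg_right ((Complex.re_le_norm _).trans hθ) hd0
  have hprod : 0 < (∑ j, c j * ∑ i, σ j i) ^ (2 * x) * d := hGpos.trans_le hGle
  have hdne : d ≠ 0 := fun h => by rw [h, mul_zero] at hprod; exact lt_irrefl _ hprod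
  have hΛ : 0 < ∑ j, c j * ∑ i, σ j i := by
    refine (weight_nonneg hc0 hσ).lt_of_ne fun h => ?_
    rw [← h, Real.zero_rpow (by linarith), zero_mul] at hprod
    exact lt_irrefl _ hprod
  refine ⟨V, hV, U'ᴴ, conjTranspose_mem_unitaryGroup hU', s, s', hs, hs1, hs', hs1', U'', V'', σ,
    hU'', hV'', hσ, ?_, ?_, hΛ, hv, ?_⟩
  · intro h
    rw [h, norm_zero, Real.zero_rpow hε.ne', zero_mul] at hd
    exact hdne hd
  · intro h
    rw [h, norm_zero, Real.zero_rpow hε.ne', mul_zero] at hd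
    exact hdne hd
  · intro a' ha' b' hb'
    exact (hmax' a' ha' b' hb' _ (norming_mem_FB hc0 hU'' hV'' hσ _)).trans hGle

end Extremal

/-! ### Domination of partial traces by the extremal densities -/

section Domination

variable {ι J : Type*} [Fintype ι] [DecidableEq ι] [Fintype J]
  {κ : J → Type*} [∀ j, Fintype (κ j)] [∀ j, DecidableEq (κ j)]

lemma pos_of_det_pw_ne_zero {U V : Matrix ι ι ℂ} {s : ι → ℝ} (hs : ∀ i, 0 ≤ s i) {z : ℂ}
    (h : (pw U V s z).det ≠ 0) (i : ι) : 0 < s i := by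
  refine (hs i).lt_of_ne fun h0 => h ?_
  rw [pw, Matrix.det_mul, Matrix.det_mul, Matrix.det_diagonal,
    Finset.prod_eq_zero (Finset.mem_univ i) (by rw [← h0, zp_zero])]
  simp

/-- `theta` as a linear function of its first argument. -/
def thetaLeft (c : J → ℝ) (b : Matrix ι ι ℂ) (X Y : (j : J) → Matrix (ι × κ j) (ι × κ j) ℂ) :
    Matrix ι ι ℂ →ₗ[ℂ] ℂ where
  toFun a := theta c a b X Y
  map_add' a a' := by
    simp only [theta, ← Finset.sum_add_distrib, ← mul_add, ← Matrix.trace_add, ← Matrix.add_mul]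
    congr! 7
    ext p q
    simp only [amp_apply, Matrix.add_apply]
    split_ifs <;> simp
  map_smul' k a := by
    have h (j : J) : amp (κ j) (k • a) = k • amp (κ j) a := by
      ext p q
      simp only [amp_apply, Matrix.smul_apply]
      split_ifs <;> simp
    simp only [theta, h, Matrix.smul_mul, Matrix.trace_smul, smul_eq_mul, RingHom.id_apply,
      Finset.mul_sum]
    exact Finset.sum_congr rfl fun j _ => by ring

/-- `theta` as a linear function of the transpose of its second argument. -/
def thetaRight (c : J → ℝ) (a : Matrix ι ι ℂ) (X Y : (j : J) → Matrix (ι × κ j) (ι × κ j) ℂ) :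
    Matrix ι ι ℂ →ₗ[ℂ] ℂ where
  toFun b := theta c a bᵀ X Y
  map_add' b b' := by
    have h (j : J) : amp (κ j) (b + b')ᵀ = amp (κ j) bᵀ + amp (κ j) b'ᵀ := by
      ext p q
      simp only [amp_apply, Matrix.add_apply, Matrix.transpose_apply]
      split_ifs <;> simp
    simp only [theta, ← Finset.sum_add_distrib, ← mul_add, ← Matrix.trace_add, ← Matrix.add_mul, h]
  map_smul' k b := by
    have h (j : J) : amp (κ j) (k • b)ᵀ = k • amp (κ j) bᵀ := by
      ext p q
      simp only [amp_apply, Matrix.smul_apply, Matrix.transpose_apply]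
      split_ifs <;> simp
    simp only [theta, h, Matrix.smul_mul, Matrix.mul_smul, Matrix.trace_smul, smul_eq_mul,
      RingHom.id_apply, Finset.mul_sum]
    exact Finset.sum_congr rfl fun j _ => by ring

/-- Removing the normalisation of the vector in a quadratic inequality. -/
lemma le_of_forall_unit {A B : (ι → ℂ) → ℝ} (hA : ∀ (k : ℂ) ξ, A (k • ξ) = ‖k‖ ^ 2 * A ξ)
    (hB : ∀ (k : ℂ) ξ, B (k • ξ) = ‖k‖ ^ 2 * B ξ)
    (h : ∀ ξ, ∑ i, ‖ξ i‖ ^ 2 = 1 → A ξ ≤ B ξ) (ξ : ι → ℂ) : A ξ ≤ B ξ := by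
  by_cases h0 : ξ = 0
  · have h1 := hA 0 0
    have h2 := hB 0 0
    simp at h1 h2
    rw [h0, h1, h2]
  · have hpos : 0 < l2 ξ := by
      obtain ⟨i, hi⟩ := Function.ne_iff.1 h0
      refine Real.sqrt_pos.2 (Finset.sum_pos' (fun _ _ => by positivity) ⟨i, Finset.mem_univ i, ?_⟩)
      have := norm_pos_iff.2 hi
      positivity
    have h1 := h (((l2 ξ)⁻¹ : ℂ) • ξ) (by
      simp only [Pi.smul_apply, smul_eq_mul, norm_mul, mul_pow, ← Finset.mul_sum, ← l2_sq]
      rw [norm_inv, Complex.norm_real, Real.norm_of_nonneg hpos.le]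
      field_simp)
    rw [hA, hB] at h1
    exact le_of_mul_le_mul_left h1 (by
      rw [norm_inv, Complex.norm_real, Real.norm_of_nonneg hpos.le]; positivity)

end Domination

section Domination

variable {ι J : Type*} [Fintype ι] [DecidableEq ι] [Fintype J]
  {κ : J → Type*} [∀ j, Fintype (κ j)] [∀ j, DecidableEq (κ j)]

lemma sum_norm_sq_vecMul_unitary {U : Matrix ι ι ℂ} (hU : U ∈ Matrix.unitaryGroup ι ℂ)
    (ξ : ι → ℂ) : ∑ l, ‖(ξ ᵥ* U) l‖ ^ 2 = ∑ i, ‖ξ i‖ ^ 2 := by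
  have h := sum_norm_sq_mul_unitary hU (Matrix.replicateRow Unit ξ)
  simpa [← Matrix.replicateRow_vecMul] using h

lemma sum_norm_sq_mulVec_unitary {U : Matrix ι ι ℂ} (hU : U ∈ Matrix.unitaryGroup ι ℂ)
    (ξ : ι → ℂ) : ∑ l, ‖(U *ᵥ ξ) l‖ ^ 2 = ∑ i, ‖ξ i‖ ^ 2 := by
  rw [← sum_norm_sq_vecMul_unitary (Matrix.transpose_mem_unitaryGroup_iff.2 hU) ξ,
    Matrix.vecMul_transpose]

lemma unitary_conj_vecMulVec {V : Matrix ι ι ℂ} (hV : V ∈ Matrix.unitaryGroup ι ℂ) (ξ : ι → ℂ) :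
    Vᴴ * Matrix.vecMulVec (star (ξ ᵥ* Vᴴ)) (star (star (ξ ᵥ* Vᴴ))) * V
      = Matrix.vecMulVec (star ξ) ξ := by
  have h1 : (ξ ᵥ* Vᴴ) ᵥ* V = ξ := by
    rw [Matrix.vecMul_vecMul, conjTranspose_mul_of_mem hV, Matrix.vecMul_one]
  rw [star_star, Matrix.mul_vecMulVec, Matrix.vecMulVec_mul, h1]
  congr 1
  rw [Matrix.star_vecMul, Matrix.conjTranspose_conjTranspose, Matrix.mulVec_mulVec,
    conjTranspose_mul_of_mem hV, Matrix.one_mulVec]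

/-- This is the first order condition in `a` for the functional given by the norming family, tested
on a projection onto an arbitrary unit vector. In operator terms the partial trace of ∑ c_j U_j σ_j
U_j^* is at most Λ (1 + ε n) a^{1/x}, where a^{1/x} is the density with eigenvalues `s`. -/
lemma domination_left {c : J → ℝ} (hc : ∀ j, 0 ≤ c j) {x : ℝ} (hx0 : 0 < x) (hx1 : x < 1 / 2)
    {w : (j : J) → Matrix (ι × κ j) (ι × κ j) ℂ} {ε : ℝ} (hε : 0 < ε)
    {V : Matrix ι ι ℂ} (hV : V ∈ Matrix.unitaryGroup ι ℂ) {s : ι → ℝ}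
    (hs : ∀ i, 0 ≤ s i) (hs1 : ∑ i, s i ≤ 1) {b : Matrix ι ι ℂ}
    {U'' V'' : (j : J) → Matrix (ι × κ j) (ι × κ j) ℂ} {σ : (j : J) → ι × κ j → ℝ}
    (hU'' : ∀ j, U'' j ∈ Matrix.unitaryGroup _ ℂ) (hV'' : ∀ j, V'' j ∈ Matrix.unitaryGroup _ ℂ)
    (hσ : ∀ j i, 0 ≤ σ j i) (hdet : (pw Vᴴ V s x).det ≠ 0)
    (hΛ : 0 < ∑ j, c j * ∑ i, σ j i)
    (hv : ∀ j, amp (κ j) (pw Vᴴ V s x) * w j * amp (κ j) b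
        = pw (U'' j) (V'' j) (σ j) ((2 * x : ℝ) : ℂ))
    (hmax : ∀ a ∈ SB ι x,
        (theta c a b w (norming c U'' V'' σ (2 * x))).re * ‖a.det‖ ^ ε ≤
        (∑ j, c j * ∑ i, σ j i) ^ (2 * x) * ‖(pw Vᴴ V s x).det‖ ^ ε) (ξ : ι → ℂ) :
    ∑ j, c j * ∑ e, σ j e * ∑ k, ‖∑ i, ξ i * U'' j (i, k) e‖ ^ 2 ≤
      (∑ j, c j * ∑ i, σ j i) * (1 + ε * Fintype.card ι) * ∑ l, s l * ‖(ξ ᵥ* Vᴴ) l‖ ^ 2 := by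
  set Λ := ∑ j, c j * ∑ i, σ j i with hΛdef
  set N := norming c U'' V'' σ (2 * x) with hN
  revert ξ
  refine le_of_forall_unit ?_ ?_ ?_
  · intro k ξ
    simp only [Pi.smul_apply, smul_eq_mul, mul_assoc, ← Finset.mul_sum, norm_mul, mul_pow]
    simp only [mul_left_comm _ (‖k‖ ^ 2), ← Finset.mul_sum]
  · intro k ξ
    simp only [Matrix.smul_vecMul, Pi.smul_apply, smul_eq_mul, norm_mul, mul_pow]
    simp only [mul_left_comm _ (‖k‖ ^ 2), ← Finset.mul_sum]
  · intro ξ hξ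
    have hL0 : thetaLeft c b w N (pw Vᴴ V s x) = ((Λ ^ (2 * x) : ℝ) : ℂ) := by
      rw [hΛdef, ← sum_trace_pw_mul_norming hc hU'' hV'' hσ (by linarith : 0 < 2 * x)]
      exact Finset.sum_congr rfl fun j _ => by rw [← hN, ← hv j]
    have hη : ∑ i, ‖(star (ξ ᵥ* Vᴴ)) i‖ ^ 2 = 1 := by
      simp only [Pi.star_apply, norm_star]
      rw [sum_norm_sq_vecMul_unitary (conjTranspose_mem_unitaryGroup hV), hξ]
    have h1 := first_order_condition hx0 hx1.le hV hs hs1 (thetaLeft c b w N) hε.le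
      (fun a ha => by rw [hL0, Complex.ofReal_re]; exact hmax a ha)
      (by rw [hL0, Complex.ofReal_re]; positivity) hdet hη
    rw [unitary_conj_vecMulVec hV, hL0, Complex.ofReal_re] at h1
    have h2 : thetaLeft c b w N (Matrix.vecMulVec (star ξ) ξ * pw Vᴴ V s x)
        = ((Λ⁻¹ ^ (1 - 2 * x) *
          ∑ j, c j * ∑ e, σ j e * ∑ k, ‖∑ i, ξ i * U'' j (i, k) e‖ ^ 2 : ℝ) : ℂ) := by
      have h3 (j : J) : (c j : ℂ) * (amp (κ j) (Matrix.vecMulVec (star ξ) ξ * pw Vᴴ V s x) * w j *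
          amp (κ j) b * N j).trace = zp Λ⁻¹ ((1 - 2 * x : ℝ) : ℂ) *
            ((c j * ∑ e, σ j e * ∑ k, ‖∑ i, ξ i * U'' j (i, k) e‖ ^ 2 : ℝ) : ℂ) := by
        have h4 : amp (κ j) (Matrix.vecMulVec (star ξ) ξ * pw Vᴴ V s x) * w j * amp (κ j) b * N j
            = amp (κ j) (Matrix.vecMulVec (star ξ) ξ) *
              (pw (U'' j) (V'' j) (σ j) ((2 * x : ℝ) : ℂ) * N j) := by
          rw [← hv j, amp_mul]
          simp only [Matrix.mul_assoc]
        rw [h4, hN, pw_mul_norming c U'' σ hV'', Matrix.mul_smul, Matrix.trace_smul,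
          trace_amp_vecMulVec_mul_pw_one _ _ _ _ (hσ j), smul_eq_mul, mul_left_comm]
        push_cast
        congr 2
        refine Finset.sum_congr rfl fun e _ => ?_
        congr 1
        refine Finset.sum_congr rfl fun k _ => ?_
        rw [← Complex.mul_conj', ← starRingEnd_apply, map_sum]
        congr 1
        refine Finset.sum_congr rfl fun i _ => ?_
        simp [Matrix.conjTranspose_apply, mul_comm]
      rw [Complex.ofReal_mul, Complex.ofReal_sum, ← zp_ofReal (inv_nonneg.2 hΛ.le) (by linarith),
        Finset.mul_sum]
      exact Finset.sum_congr rfl fun j _ => h3 j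
    rw [h2, Complex.ofReal_re] at h1
    simp only [Pi.star_apply, norm_star] at h1
    -- The normalization of the norming functional is the same on both sides and cancels.
    have h5 : Λ⁻¹ ^ (1 - 2 * x) * Λ = Λ ^ (2 * x) := by
      rw [Real.inv_rpow hΛ.le, ← Real.rpow_neg hΛ.le]
      nth_rewrite 2 [← Real.rpow_one Λ]
      rw [← Real.rpow_add hΛ]
      congr 1
      ring
    have h6 : 0 < Λ⁻¹ ^ (1 - 2 * x) := by positivity
    refine le_of_mul_le_mul_left ?_ h6
    refine h1.trans (le_of_eq ?_)
    rw [← h5]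
    ring

/-- The argument for the left factor is repeated for the transpose of `b`, which converts right
multiplication into left multiplication and leaves the Schatten ball and the determinant unchanged.
The partial trace is now that of ∑ c_j V_j^* σ_j V_j. -/
lemma domination_right {c : J → ℝ} (hc : ∀ j, 0 ≤ c j) {x : ℝ} (hx0 : 0 < x) (hx1 : x < 1 / 2)
    {w : (j : J) → Matrix (ι × κ j) (ι × κ j) ℂ} {ε : ℝ} (hε : 0 < ε)
    {V : Matrix ι ι ℂ} (hV : V ∈ Matrix.unitaryGroup ι ℂ) {s : ι → ℝ}
    (hs : ∀ i, 0 ≤ s i) (hs1 : ∑ i, s i ≤ 1) {a : Matrix ι ι ℂ}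
    {U'' V'' : (j : J) → Matrix (ι × κ j) (ι × κ j) ℂ} {σ : (j : J) → ι × κ j → ℝ}
    (hU'' : ∀ j, U'' j ∈ Matrix.unitaryGroup _ ℂ) (hV'' : ∀ j, V'' j ∈ Matrix.unitaryGroup _ ℂ)
    (hσ : ∀ j i, 0 ≤ σ j i) (hdet : (pw Vᴴ V s x).det ≠ 0)
    (hΛ : 0 < ∑ j, c j * ∑ i, σ j i)
    (hv : ∀ j, amp (κ j) a * w j * amp (κ j) (pw Vᴴ V s x)
        = pw (U'' j) (V'' j) (σ j) ((2 * x : ℝ) : ℂ))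
    (hmax : ∀ b ∈ SB ι x,
        (theta c a b w (norming c U'' V'' σ (2 * x))).re * ‖b.det‖ ^ ε ≤
        (∑ j, c j * ∑ i, σ j i) ^ (2 * x) * ‖(pw Vᴴ V s x).det‖ ^ ε) (ξ : ι → ℂ) :
    ∑ j, c j * ∑ e, σ j e * ∑ k, ‖∑ i, V'' j e (i, k) * ξ i‖ ^ 2 ≤
      (∑ j, c j * ∑ i, σ j i) * (1 + ε * Fintype.card ι) * ∑ l, s l * ‖(V *ᵥ ξ) l‖ ^ 2 := by
  set Λ := ∑ j, c j * ∑ i, σ j i with hΛdef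
  set N := norming c U'' V'' σ (2 * x) with hN
  revert ξ
  refine le_of_forall_unit ?_ ?_ ?_
  · intro k ξ
    simp only [Pi.smul_apply, smul_eq_mul, mul_left_comm _ k, ← Finset.mul_sum, norm_mul, mul_pow]
    simp only [mul_left_comm _ (‖k‖ ^ 2), ← Finset.mul_sum]
  · intro k ξ
    simp only [Matrix.mulVec_smul, Pi.smul_apply, smul_eq_mul, norm_mul, mul_pow]
    simp only [mul_left_comm _ (‖k‖ ^ 2), ← Finset.mul_sum]
  · intro ξ hξ
    set V' : Matrix ι ι ℂ := Vᴴᵀ with hV'def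
    have hV' : V' ∈ Matrix.unitaryGroup ι ℂ :=
      Matrix.transpose_mem_unitaryGroup_iff.2 (conjTranspose_mem_unitaryGroup hV)
    have hV'H : V'ᴴ = Vᵀ := by ext i j; simp [hV'def]
    have hb : pw V'ᴴ V' s x = (pw Vᴴ V s x)ᵀ := by
      rw [hV'H, pw, pw, Matrix.transpose_mul, Matrix.transpose_mul, Matrix.diagonal_transpose,
        Matrix.mul_assoc]
    have hL0 : thetaRight c a w N (pw V'ᴴ V' s x) = ((Λ ^ (2 * x) : ℝ) : ℂ) := by
      rw [hb, hΛdef,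
        ← sum_trace_pw_mul_norming hc hU'' hV'' hσ (by linarith : 0 < 2 * x)]
      exact Finset.sum_congr rfl fun j _ => by rw [← hN, ← hv j, Matrix.transpose_transpose]
    have hη : ∑ i, ‖(star (ξ ᵥ* V'ᴴ)) i‖ ^ 2 = 1 := by
      simp only [Pi.star_apply, norm_star]
      rw [sum_norm_sq_vecMul_unitary (conjTranspose_mem_unitaryGroup hV'), hξ]
    have h1 := first_order_condition hx0 hx1.le hV' hs hs1 (thetaRight c a w N) hε.le
      (fun b hb' => by
        rw [hL0, Complex.ofReal_re, hb, Matrix.det_transpose, ← Matrix.det_transpose b]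
        exact hmax _ (transpose_mem_SB hb'))
      (by rw [hL0, Complex.ofReal_re]; positivity) (by rwa [hb, Matrix.det_transpose]) hη
    rw [unitary_conj_vecMulVec hV', hL0, Complex.ofReal_re] at h1
    have h2 : thetaRight c a w N (Matrix.vecMulVec (star ξ) ξ * pw V'ᴴ V' s x)
        = ((Λ⁻¹ ^ (1 - 2 * x) *
          ∑ j, c j * ∑ e, σ j e * ∑ k, ‖∑ i, V'' j e (i, k) * ξ i‖ ^ 2 : ℝ) : ℂ) := by
      have h3 (j : J) : (c j : ℂ) * (amp (κ j) a * w j *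
          amp (κ j) (Matrix.vecMulVec (star ξ) ξ * pw V'ᴴ V' s x)ᵀ * N j).trace
          = zp Λ⁻¹ ((1 - 2 * x : ℝ) : ℂ) *
            ((c j * ∑ e, σ j e * ∑ k, ‖∑ i, V'' j e (i, k) * ξ i‖ ^ 2 : ℝ) : ℂ) := by
        -- Cyclicity places the norming family to the left of the matrix it norms, so that V^* σ V
        -- appears instead of U σ U^*.
        have h4 : (amp (κ j) a * w j *
            amp (κ j) (Matrix.vecMulVec (star ξ) ξ * pw V'ᴴ V' s x)ᵀ * N j).trace
            = (amp (κ j) (Matrix.vecMulVec ξ (star ξ)) *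
              (N j * pw (U'' j) (V'' j) (σ j) ((2 * x : ℝ) : ℂ))).trace := by
          rw [Matrix.transpose_mul, hb, Matrix.transpose_transpose, Matrix.transpose_vecMulVec,
            amp_mul, ← hv j, ← Matrix.mul_assoc, Matrix.mul_assoc, Matrix.trace_mul_comm,
            Matrix.mul_assoc]
        rw [h4, hN, norming_mul_pw c V'' σ hU'', Matrix.mul_smul, Matrix.trace_smul,
          trace_amp_vecMulVec_mul_pw_one _ _ _ _ (hσ j), smul_eq_mul, mul_left_comm]
        push_cast
        congr 2
        refine Finset.sum_congr rfl fun e _ => ?_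
        congr 1
        refine Finset.sum_congr rfl fun k _ => ?_
        rw [← Complex.conj_mul', ← starRingEnd_apply, map_sum]
        congr 1
        refine Finset.sum_congr rfl fun i _ => ?_
        simp [Matrix.conjTranspose_apply, mul_comm]
      rw [Complex.ofReal_mul, Complex.ofReal_sum, ← zp_ofReal (inv_nonneg.2 hΛ.le) (by linarith),
        Finset.mul_sum]
      exact Finset.sum_congr rfl fun j _ => h3 j
    rw [h2, Complex.ofReal_re] at h1
    simp only [Pi.star_apply, norm_star, hV'H, Matrix.vecMul_transpose] at h1
    have h5 : Λ⁻¹ ^ (1 - 2 * x) * Λ = Λ ^ (2 * x) := by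
      rw [Real.inv_rpow hΛ.le, ← Real.rpow_neg hΛ.le]
      nth_rewrite 2 [← Real.rpow_one Λ]
      rw [← Real.rpow_add hΛ]
      congr 1
      ring
    have h6 : 0 < Λ⁻¹ ^ (1 - 2 * x) := by positivity
    refine le_of_mul_le_mul_left ?_ h6
    refine h1.trans (le_of_eq ?_)
    rw [← h5]
    ring

lemma sum_mul_amp_mul {κ : Type*} [Fintype κ] [DecidableEq κ] (ξ : ι → ℂ) (A : Matrix ι ι ℂ)
    (B : Matrix (ι × κ) (ι × κ) ℂ) (k : κ) (e : ι × κ) :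
    ∑ i, ξ i * (amp κ A * B) (i, k) e = ∑ i, (ξ ᵥ* A) i * B (i, k) e := by
  have h (i : ι) : (amp κ A * B) (i, k) e = ∑ i', A i i' * B (i', k) e := by
    rw [Matrix.mul_apply, Fintype.sum_prod_type]
    refine Finset.sum_congr rfl fun i' _ => ?_
    rw [Finset.sum_eq_single k (fun l _ hl => by simp [amp_apply, Ne.symm hl]) (by simp)]
    simp [amp_apply]
  simp only [h, Matrix.vecMul, dotProduct, Finset.mul_sum, Finset.sum_mul]
  rw [Finset.sum_comm]
  exact Finset.sum_congr rfl fun i _ => Finset.sum_congr rfl fun j _ => by ring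

lemma sum_mul_amp_mul' {κ : Type*} [Fintype κ] [DecidableEq κ] (ξ : ι → ℂ) (A : Matrix ι ι ℂ)
    (B : Matrix (ι × κ) (ι × κ) ℂ) (k : κ) (e : ι × κ) :
    ∑ i, (B * amp κ A) e (i, k) * ξ i = ∑ i, B e (i, k) * (A *ᵥ ξ) i := by
  have h (i : ι) : (B * amp κ A) e (i, k) = ∑ i', B e (i', k) * A i' i := by
    rw [Matrix.mul_apply, Fintype.sum_prod_type]
    refine Finset.sum_congr rfl fun i' _ => ?_
    rw [Finset.sum_eq_single k (fun l _ hl => by simp [amp_apply, hl]) (by simp)]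
    simp [amp_apply]
  simp only [h, Matrix.mulVec, dotProduct, Finset.mul_sum, Finset.sum_mul]
  rw [Finset.sum_comm]
  exact Finset.sum_congr rfl fun i _ => Finset.sum_congr rfl fun j _ => by ring

lemma norm_zp_sq_neg_half {s : ℝ} (hs : 0 < s) {z : ℂ} (hz : z.re = -(1 / 2)) :
    s * ‖zp s z‖ ^ 2 = 1 := by
  rw [norm_zp hs, hz, ← Real.rpow_natCast, ← Real.rpow_mul hs.le]
  norm_num
  rw [Real.rpow_neg_one, mul_inv_cancel₀ hs.ne']

lemma norm_zp_sq_half {s : ℝ} (hs : 0 ≤ s) {z : ℂ} (hz : z.re = 1 / 2) : ‖zp s z‖ ^ 2 = s := by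
  rcases hs.eq_or_lt with h | h
  · simp [← h, zp_zero]
  · rw [norm_zp h, hz, ← Real.rpow_natCast, ← Real.rpow_mul h.le]
    norm_num

lemma StripM.smul {m n : Type*} {A : ℂ → Matrix m n ℂ} (hA : StripM A) (k : ℂ) :
    StripM fun z => k • A z := fun i j => by
  simp only [Matrix.smul_apply, smul_eq_mul]
  exact (StripFn.const k).mul (hA i j)

/-- A family of matrices in the unit ball given by the test form is the value of an analytic
family with good boundary values. -/
theorem exists_analytic_family {c : J → ℝ} (hc : ∀ j, 0 < c j) {x : ℝ} (hx0 : 0 < x)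
    (hx1 : x < 1 / 2) {w : (j : J) → Matrix (ι × κ j) (ι × κ j) ℂ} {C C' : ℝ} (hC : 0 ≤ C)
    (hCC' : C < C') (hw : ∀ a ∈ SB ι x, ∀ b ∈ SB ι x, ∀ Y ∈ FB c (1 - 2 * x),
      ‖theta c a b w Y‖ ≤ C) :
    ∃ W : ℂ → (j : J) → Matrix (ι × κ j) (ι × κ j) ℂ, (∀ j, StripM fun z => W z j) ∧
      W ((2 * x : ℝ) : ℂ) = w ∧ (∀ (t : ℝ) (j), ‖W (t * Complex.I) j‖ ≤ C') ∧
      ∀ (t : ℝ) (m : ℕ) (Y : (j : J) → Matrix (Fin m × κ j) (Fin m × κ j) ℂ), (∀ j, ‖Y j‖ ≤ 1) →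
        ‖pairing c (W (1 + t * Complex.I)) Y‖ ≤ C' := by
  have hc0 : ∀ j, 0 ≤ c j := fun j => (hc j).le
  have hC'0 : 0 < C' := hC.trans_lt hCC'
  by_cases hw0 : w = 0
  · refine ⟨fun _ => 0, fun j => StripM.const _, hw0.symm, fun t j => ?_, fun t m Y _ => ?_⟩
    · simpa using hC'0.le
    · have : pairing c (0 : (j : J) → Matrix (ι × κ j) (ι × κ j) ℂ) Y = 0 := by
        ext p q; simp [pairing]
      rw [this, norm_zero]; exact hC'0.le
  -- The strict inequality C < C' leaves room for the loss 1 + ε n: since Λ ≤ C₀, the choice of ε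
  -- gives Λ (1 + ε n) ≤ κ₀.
  set κ₀ : ℝ := C' ^ (2 * x)⁻¹ with hκ₀
  set C₀ : ℝ := C ^ (2 * x)⁻¹ with hC₀
  have hlt : C₀ < κ₀ := Real.rpow_lt_rpow hC hCC' (by positivity)
  have hC₀0 : 0 ≤ C₀ := Real.rpow_nonneg hC _
  have hκ₀0 : 0 < κ₀ := hC₀0.trans_lt hlt
  set n : ℝ := (Fintype.card ι : ℝ) with hn
  have hn0 : 0 ≤ n := Nat.cast_nonneg _
  set ε : ℝ := (κ₀ - C₀) / (C₀ * n + 1) with hε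
  have hε0 : 0 < ε := div_pos (by linarith) (by positivity)
  have hεb : C₀ * (1 + ε * n) ≤ κ₀ := by
    have h1 : ε * (C₀ * n + 1) = κ₀ - C₀ := div_mul_cancel₀ _ (by positivity)
    nlinarith
  obtain ⟨V, hV, V', hV', s, s', hs, hs1, hs', hs1', U'', V'', σ, hU'', hV'', hσ, hda, hdb, hΛ, hv,
    hmax⟩ := exists_extremal hc hx0 hx1 hw0 hε0
  set Λ := ∑ j, c j * ∑ i, σ j i with hΛdef
  have ha₀ : pw Vᴴ V s x ∈ SB ι x :=
    ⟨_, conjTranspose_mem_unitaryGroup hV, _, hV, s, hs, hs1, rfl⟩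
  have hb₀ : pw V'ᴴ V' s' x ∈ SB ι x :=
    ⟨_, conjTranspose_mem_unitaryGroup hV', _, hV', s', hs', hs1', rfl⟩
  have hΛC : Λ ≤ C₀ := by
    have h1 := hw _ ha₀ _ hb₀ _ (norming_mem_FB hc0 hU'' hV'' hσ (2 * x))
    have h2 : theta c (pw Vᴴ V s x) (pw V'ᴴ V' s' x) w (norming c U'' V'' σ (2 * x))
        = ((Λ ^ (2 * x) : ℝ) : ℂ) := by
      rw [hΛdef, ← sum_trace_pw_mul_norming hc0 hU'' hV'' hσ (by linarith : 0 < 2 * x)]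
      exact Finset.sum_congr rfl fun j _ => by rw [← hv j]
    rw [h2, Complex.norm_real, Real.norm_of_nonneg (by positivity)] at h1
    have h3 := Real.rpow_le_rpow (by positivity) h1 (inv_nonneg.2 (by linarith : 0 ≤ 2 * x))
    rwa [← Real.rpow_mul hΛ.le, mul_inv_cancel₀ (by linarith), Real.rpow_one] at h3
  have hΛκ : Λ * (1 + ε * n) ≤ κ₀ :=
    (mul_le_mul_of_nonneg_right hΛC (by positivity)).trans hεb
  have hGa := domination_left hc0 hx0 hx1 hε0 hV hs hs1 hU'' hV'' hσ hda hΛ hv fun a ha => by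
    have h1 := hmax a ha _ hb₀
    rw [← mul_assoc, ← mul_assoc] at h1
    exact le_of_mul_le_mul_right h1 (Real.rpow_pos_of_pos (norm_pos_iff.2 hdb) _)
  have hGb := domination_right hc0 hx0 hx1 hε0 hV' hs' hs1' hU'' hV'' hσ hdb hΛ hv fun b hb => by
    have h1 := hmax _ ha₀ b hb
    rw [mul_left_comm, mul_left_comm _ (‖(pw Vᴴ V s x).det‖ ^ ε)] at h1
    exact le_of_mul_le_mul_left h1 (Real.rpow_pos_of_pos (norm_pos_iff.2 hda) _)
  have hs0 := pos_of_det_pw_ne_zero hs hda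
  have hs0' := pos_of_det_pw_ne_zero hs' hdb
  have hσκ (j : J) (i) : 0 ≤ κ₀⁻¹ * σ j i := mul_nonneg (inv_nonneg.2 hκ₀0.le) (hσ j i)
  -- These are a^{-z/(2x)}, b^{-z/(2x)} and U'' (σ/κ₀)^z V''. At z = 2x they become the inverses of
  -- a and b and, up to the factor C', the family a w b.
  let A : ℂ → Matrix ι ι ℂ := fun z => pw Vᴴ V s ((-(1 / 2) : ℝ) * z + (0 : ℝ))
  let B : ℂ → Matrix ι ι ℂ := fun z => pw V'ᴴ V' s' ((-(1 / 2) : ℝ) * z + (0 : ℝ))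
  let D : ℂ → (j : J) → Matrix (ι × κ j) (ι × κ j) ℂ := fun z j =>
    pw (U'' j) (V'' j) (fun i => κ₀⁻¹ * σ j i) ((1 : ℝ) * z + (0 : ℝ))
  refine ⟨fun z j => (C' : ℂ) • (amp (κ j) (A z) * D z j * amp (κ j) (B z)), ?_, ?_, ?_, ?_⟩
  · intro j
    exact StripM.smul ((((StripM.pw _ _ hs _ _).amp).mul (StripM.pw _ _ (hσκ j) _ _)).mul
      (StripM.pw _ _ hs' _ _).amp) _
  · funext j
    have hinv {V : Matrix ι ι ℂ} (hV : V ∈ Matrix.unitaryGroup ι ℂ) {s : ι → ℝ}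
        (hs0 : ∀ i, 0 < s i) (z : ℂ) : pw Vᴴ V s (-z) * pw Vᴴ V s z = 1 := by
      rw [pw_mul_pw hV, neg_add_cancel, pw]
      have : (Matrix.diagonal fun i => zp (s i) 0) = (1 : Matrix ι ι ℂ) := by
        rw [← Matrix.diagonal_one]
        congr 1
        ext i
        simp [zp, (hs0 i).ne']
      rw [this, Matrix.mul_one, conjTranspose_mul_of_mem hV]
    have hz : ((-(1 / 2) : ℝ) : ℂ) * ((2 * x : ℝ) : ℂ) + ((0 : ℝ) : ℂ) = -(x : ℂ) := by
      push_cast; ring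
    have hA : A ((2 * x : ℝ) : ℂ) * pw Vᴴ V s x = 1 := by
      simp only [A]; rw [hz]; exact hinv hV hs0 x
    have hB : pw V'ᴴ V' s' x * B ((2 * x : ℝ) : ℂ) = 1 := by
      simp only [B]; rw [hz]
      have := hinv hV' hs0' (-(x : ℂ))
      rwa [neg_neg] at this
    have hD : (C' : ℂ) • D ((2 * x : ℝ) : ℂ) j = pw (U'' j) (V'' j) (σ j) ((2 * x : ℝ) : ℂ) := by
      simp only [D]
      rw [pw_const_mul _ _ (hσ j) (inv_nonneg.2 hκ₀0.le), smul_smul]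
      have hz' : ((1 : ℝ) : ℂ) * ((2 * x : ℝ) : ℂ) + ((0 : ℝ) : ℂ) = ((2 * x : ℝ) : ℂ) := by simp
      have hk : κ₀ ^ (2 * x) = C' := by
        rw [hκ₀, ← Real.rpow_mul hC'0.le, inv_mul_cancel₀ (by linarith), Real.rpow_one]
      rw [hz', zp_ofReal (inv_nonneg.2 hκ₀0.le) (by linarith), Real.inv_rpow hκ₀0.le, hk,
        ← Complex.ofReal_mul, mul_inv_cancel₀ hC'0.ne', Complex.ofReal_one, one_smul]
    beta_reduce
    rw [← Matrix.smul_mul, ← Matrix.mul_smul, hD, ← hv j]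
    simp only [Matrix.mul_assoc]
    rw [← amp_mul, hB, ← Matrix.mul_assoc, ← amp_mul, hA, amp_one, Matrix.one_mul,
      Matrix.mul_one]
  · intro t j
    rw [norm_smul, Complex.norm_real, Real.norm_of_nonneg hC'0.le]
    refine mul_le_of_le_one_right hC'0.le ?_
    refine (norm_mul_mul_le ?_ ?_).trans (norm_pw_le (hU'' j) (hV'' j) (hσκ j) (by simp))
    · simp only [A]
      rw [amp_pw]
      exact norm_pw_le (amp_mem_unitaryGroup (conjTranspose_mem_unitaryGroup hV))
        (amp_mem_unitaryGroup hV) (fun p => hs p.1) (by simp)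
    · simp only [B]
      rw [amp_pw]
      exact norm_pw_le (amp_mem_unitaryGroup (conjTranspose_mem_unitaryGroup hV'))
        (amp_mem_unitaryGroup hV') (fun p => hs' p.1) (by simp)
  · intro t m Y hY
    set z : ℂ := 1 + t * Complex.I with hz
    set z₁ : ℂ := (-(1 / 2) : ℝ) * z + (0 : ℝ) with hz₁
    have hz₁re : z₁.re = -(1 / 2) := by
      rw [hz₁, Complex.add_re, Complex.re_ofReal_mul, hz]; simp
    set z₂ : ℂ := (1 / 2 : ℝ) * z with hz₂
    have hz₂re : z₂.re = 1 / 2 := by rw [hz₂, Complex.re_ofReal_mul, hz]; simp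
    have hz₂₂ : z₂ + z₂ = (1 : ℝ) * z + (0 : ℝ) := by rw [hz₂]; push_cast; ring
    -- On Re z = 1 the power of σ is split into two halves, one for each side, so that the squared
    -- moduli produce σ itself as in the domination inequalities.
    let P : (j : J) → Matrix (ι × κ j) (ι × κ j) ℂ := fun j =>
      amp (κ j) (A z) * pw (U'' j) 1 (fun i => κ₀⁻¹ * σ j i) z₂
    let Q : (j : J) → Matrix (ι × κ j) (ι × κ j) ℂ := fun j =>
      pw 1 (V'' j) (fun i => κ₀⁻¹ * σ j i) z₂ * amp (κ j) (B z)
    have hPQ (j : J) : amp (κ j) (A z) * D z j * amp (κ j) (B z) = P j * Q j := by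
      have h1 := pw_mul_pw (U := U'' j) (W := V'' j) (one_mem (Matrix.unitaryGroup (ι × κ j) ℂ))
        (fun i => κ₀⁻¹ * σ j i) z₂ z₂
      rw [Matrix.conjTranspose_one, hz₂₂] at h1
      simp only [P, Q, D]
      rw [← h1]
      simp only [Matrix.mul_assoc]
    have hsmul : pairing c (fun j => (C' : ℂ) • (amp (κ j) (A z) * D z j * amp (κ j) (B z))) Y
        = (C' : ℂ) • pairing c (fun j => P j * Q j) Y := by
      ext p q
      simp only [pairing, Matrix.of_apply, Matrix.smul_apply, smul_eq_mul, hPQ, Finset.mul_sum]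
      exact Finset.sum_congr rfl fun j _ => Finset.sum_congr rfl fun k _ =>
        Finset.sum_congr rfl fun l _ => by ring
    rw [hsmul, norm_smul, Complex.norm_real, Real.norm_of_nonneg hC'0.le]
    refine mul_le_of_le_one_right hC'0.le (norm_pairing_le hc0 ?_ ?_ hY)
    · intro ξ
      have h1 (j : J) (e) (k) : ‖∑ i, ξ i * P j (i, k) e‖ ^ 2
          = κ₀⁻¹ * (σ j e * ‖∑ i, (ξ ᵥ* A z) i * U'' j (i, k) e‖ ^ 2) := by
        simp only [P]
        rw [sum_mul_amp_mul]
        have h2 (i : ι) : pw (U'' j) 1 (fun i => κ₀⁻¹ * σ j i) z₂ (i, k) e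
            = U'' j (i, k) e * zp (κ₀⁻¹ * σ j e) z₂ := by
          rw [pw, Matrix.mul_one, Matrix.mul_diagonal]
        simp only [h2, ← mul_assoc, ← Finset.sum_mul]
        rw [norm_mul, mul_pow, norm_zp_sq_half (hσκ j e) hz₂re]
        ring
      have h3 : ∑ j, c j * ∑ e, ∑ k, ‖∑ i, ξ i * P j (i, k) e‖ ^ 2
          = κ₀⁻¹ * ∑ j, c j * ∑ e, σ j e * ∑ k, ‖∑ i, (ξ ᵥ* A z) i * U'' j (i, k) e‖ ^ 2 := by
        simp only [h1, Finset.mul_sum]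
        exact Finset.sum_congr rfl fun j _ => Finset.sum_congr rfl fun k _ =>
          Finset.sum_congr rfl fun l _ => by ring
      -- The factor a^{-z/(2x)} cancels exactly the density a^{1/x} that dominates the partial
      -- trace.
      have h4 : ∑ l, s l * ‖((ξ ᵥ* A z) ᵥ* Vᴴ) l‖ ^ 2 = ∑ i, ‖ξ i‖ ^ 2 := by
        rw [← sum_norm_sq_vecMul_unitary (conjTranspose_mem_unitaryGroup hV) ξ]
        refine Finset.sum_congr rfl fun l _ => ?_
        have h5 : (ξ ᵥ* A z) ᵥ* Vᴴ = (ξ ᵥ* Vᴴ) ᵥ* Matrix.diagonal fun i => zp (s i) z₁ := by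
          simp only [A, pw]
          rw [Matrix.vecMul_vecMul, Matrix.vecMul_vecMul, Matrix.mul_assoc _ V,
            mul_conjTranspose_of_mem hV, Matrix.mul_one]
        rw [h5, Matrix.vecMul_diagonal, norm_mul, mul_pow]
        linear_combination (‖(ξ ᵥ* Vᴴ) l‖ ^ 2) * norm_zp_sq_neg_half (hs0 l) hz₁re
      rw [h3, inv_mul_le_iff₀ hκ₀0]
      refine (hGa (ξ ᵥ* A z)).trans ?_
      rw [h4]
      exact mul_le_mul_of_nonneg_right hΛκ (Finset.sum_nonneg fun _ _ => by positivity)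
    · intro ξ
      have h1 (j : J) (e) (k) : ‖∑ i, Q j e (i, k) * ξ i‖ ^ 2
          = κ₀⁻¹ * (σ j e * ‖∑ i, V'' j e (i, k) * (B z *ᵥ ξ) i‖ ^ 2) := by
        simp only [Q]
        rw [sum_mul_amp_mul']
        have h2 (i : ι) : pw 1 (V'' j) (fun i => κ₀⁻¹ * σ j i) z₂ e (i, k)
            = zp (κ₀⁻¹ * σ j e) z₂ * V'' j e (i, k) := by
          rw [pw, Matrix.one_mul, Matrix.diagonal_mul]
        simp only [h2, mul_assoc, ← Finset.mul_sum]
        rw [norm_mul, mul_pow, norm_zp_sq_half (hσκ j e) hz₂re]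
        ring
      have h3 : ∑ j, c j * ∑ e, ∑ k, ‖∑ i, Q j e (i, k) * ξ i‖ ^ 2
          = κ₀⁻¹ * ∑ j, c j * ∑ e, σ j e * ∑ k, ‖∑ i, V'' j e (i, k) * (B z *ᵥ ξ) i‖ ^ 2 := by
        simp only [h1, Finset.mul_sum]
        exact Finset.sum_congr rfl fun j _ => Finset.sum_congr rfl fun k _ =>
          Finset.sum_congr rfl fun l _ => by ring
      have h4 : ∑ l, s' l * ‖(V' *ᵥ (B z *ᵥ ξ)) l‖ ^ 2 = ∑ i, ‖ξ i‖ ^ 2 := by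
        rw [← sum_norm_sq_mulVec_unitary hV' ξ]
        refine Finset.sum_congr rfl fun l _ => ?_
        have h5 : V' *ᵥ (B z *ᵥ ξ) = (Matrix.diagonal fun i => zp (s' i) z₁) *ᵥ (V' *ᵥ ξ) := by
          simp only [B, pw]
          rw [Matrix.mulVec_mulVec, Matrix.mulVec_mulVec, ← Matrix.mul_assoc, ← Matrix.mul_assoc,
            mul_conjTranspose_of_mem hV', Matrix.one_mul]
        rw [h5, Matrix.mulVec_diagonal, norm_mul, mul_pow]
        linear_combination (‖(V' *ᵥ ξ) l‖ ^ 2) * norm_zp_sq_neg_half (hs0' l) hz₁re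
      rw [h3, inv_mul_le_iff₀ hκ₀0]
      refine (hGb (B z *ᵥ ξ)).trans ?_
      rw [h4]
      exact mul_le_mul_of_nonneg_right hΛκ (Finset.sum_nonneg fun _ _ => by positivity)

end Domination

/-! ### Countable subadditivity of interpolation norms -/

section Gauge

variable {V : Type*} [NormedAddCommGroup V] [NormedSpace ℂ V]

/-- Countably subadditive extended norms. -/
structure IsGauge (N : V → ℝ≥0∞) : Prop where
  sub_le : ∀ u v, N (u - v) ≤ N u + N v
  tsum_le : ∀ v : ℕ → V, Summable v → N (∑' k, v k) ≤ ∑' k, N (v k)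

lemma IsGauge.iSup {I : Sort*} {N : I → V → ℝ≥0∞} (h : ∀ i, IsGauge (N i)) :
    IsGauge fun v => ⨆ i, N i v where
  sub_le u v := iSup_le fun i => ((h i).sub_le u v).trans
    (add_le_add (le_iSup (fun i => N i u) i) (le_iSup (fun i => N i v) i))
  tsum_le v hv := iSup_le fun i => ((h i).tsum_le v hv).trans
    (ENNReal.tsum_le_tsum fun k => le_iSup (fun i => N i (v k)) i)

lemma IsGauge.clm {W : Type*} [NormedAddCommGroup W] [NormedSpace ℂ W] (T : V →L[ℂ] W) :
    IsGauge fun v => ‖T v‖ₑ where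
  sub_le u v := by rw [map_sub]; exact enorm_sub_le
  tsum_le v hv := by rw [T.map_tsum hv]; exact enorm_tsum_le_tsum_enorm

/-- The maximum principle on the strip. -/
lemma IsCalderon.norm_le {N₀ N₁ : V → ℝ≥0∞} {K : ℝ} (hK : 0 ≤ K)
    (h0 : ∀ v, ‖v‖ₑ ≤ ENNReal.ofReal K * N₀ v) (h1 : ∀ v, ‖v‖ₑ ≤ ENNReal.ofReal K * N₁ v)
    {f : ℂ → V} (hf : IsCalderon N₀ N₁ f) {r : ℝ} (hr : 0 ≤ r)
    (hr0 : ∀ t : ℝ, N₀ (f (t * Complex.I)) ≤ ENNReal.ofReal r)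
    (hr1 : ∀ t : ℝ, N₁ (f (1 + t * Complex.I)) ≤ ENNReal.ofReal r) {z : ℂ} (hz0 : 0 ≤ z.re)
    (hz1 : z.re ≤ 1) : ‖f z‖ ≤ K * r := by
  have key {v : V} {N : V → ℝ≥0∞} (h : ‖v‖ₑ ≤ ENNReal.ofReal K * N v)
      (hN : N v ≤ ENNReal.ofReal r) : ‖v‖ ≤ K * r := by
    have := h.trans (mul_le_mul_right hN (ENNReal.ofReal K))
    rw [← ENNReal.ofReal_mul hK, ← ofReal_norm] at this
    exact (ENNReal.ofReal_le_ofReal_iff (mul_nonneg hK hr)).1 this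
  have hb : BddAbove ((norm ∘ f) '' Complex.HadamardThreeLines.verticalClosedStrip 0 1) := by
    obtain ⟨C, hC⟩ := hf.isBounded.exists_norm_le
    refine ⟨C, ?_⟩
    rintro _ ⟨z, hz, rfl⟩
    exact hC _ ⟨z, ⟨hz.1, hz.2⟩, rfl⟩
  have := Complex.HadamardThreeLines.norm_le_interp_of_mem_verticalClosedStrip₀₁' f
    (z := z) (a := K * r) (b := K * r) ⟨hz0, hz1⟩ hf.diffContOnCl hb ?_ ?_
  · rwa [← Real.rpow_add_of_nonneg (mul_nonneg hK hr) (by linarith) hz0, sub_add_cancel,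
      Real.rpow_one] at this
  · intro w hw
    have h : w = w.im * Complex.I := by apply Complex.ext <;> simp_all
    rw [h]
    exact key (h0 _) (hr0 _)
  · intro w hw
    have h : w = 1 + w.im * Complex.I := by apply Complex.ext <;> simp_all
    rw [h]
    exact key (h1 _) (hr1 _)

/-- Dominated convergence for the counting measure. -/
lemma tendsto_tsum_ennreal {F : ℕ → ℝ → ℝ≥0∞} {t₀ : ℝ} {b : ℕ → ℝ≥0∞} (hb : ∑' k, b k ≠ ∞)
    (hF : ∀ k t, F k t ≤ b k) (h : ∀ k, Tendsto (F k) (𝓝 t₀) (𝓝 0)) :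
    Tendsto (fun t => ∑' k, F k t) (𝓝 t₀) (𝓝 0) := by
  have := tendsto_lintegral_filter_of_dominated_convergence (μ := Measure.count) (l := 𝓝 t₀)
    (F := fun t k => F k t) (f := fun _ => 0) b
    (Eventually.of_forall fun t => measurable_of_countable _)
    (Eventually.of_forall fun t => Eventually.of_forall fun k => hF k t)
    (by rwa [lintegral_count]) (Eventually.of_forall h)
  simpa [lintegral_count] using this

/-- Interpolation norms are countably subadditive. -/
theorem interpNorm_tsum_le [CompleteSpace V] {N₀ N₁ : V → ℝ≥0∞} (g0 : IsGauge N₀) (g1 : IsGauge N₁)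
    {K : ℝ} (hK : 0 ≤ K) (h0 : ∀ v, ‖v‖ₑ ≤ ENNReal.ofReal K * N₀ v)
    (h1 : ∀ v, ‖v‖ₑ ≤ ENNReal.ofReal K * N₁ v) (θ : ℝ) (v : ℕ → V) :
    interpNorm N₀ N₁ θ (∑' k, v k) ≤ ∑' k, interpNorm N₀ N₁ θ (v k) := by
  by_cases hfin : ∑' k, interpNorm N₀ N₁ θ (v k) = ∞
  · rw [hfin]; exact le_top
  refine ENNReal.le_of_forall_pos_le_add fun ε hε _ => ?_
  -- Almost optimal Calderon functions are chosen for all terms, with errors of total size below ε;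
  -- their sum is the candidate.
  obtain ⟨ε', hε', hε'sum⟩ := ENNReal.exists_pos_sum_of_countable
    (ENNReal.coe_ne_zero.2 hε.ne') ℕ
  have hex (k : ℕ) : ∃ f : ℂ → V, IsCalderon N₀ N₁ f ∧ f θ = v k ∧
      (∀ t : ℝ, N₀ (f (t * Complex.I)) ≤ interpNorm N₀ N₁ θ (v k) + ε' k) ∧
      ∀ t : ℝ, N₁ (f (1 + t * Complex.I)) ≤ interpNorm N₀ N₁ θ (v k) + ε' k := by
    have hlt : interpNorm N₀ N₁ θ (v k) < interpNorm N₀ N₁ θ (v k) + ε' k :=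
      ENNReal.lt_add_right (ENNReal.ne_top_of_tsum_ne_top hfin k)
        (ENNReal.coe_ne_zero.2 (hε' k).ne')
    nth_rewrite 1 [interpNorm] at hlt
    simp only [iInf_lt_iff] at hlt
    obtain ⟨f, hf, hfv, hlt⟩ := hlt
    exact ⟨f, hf, hfv, fun t => ((le_iSup (fun t : ℝ => N₀ (f (t * Complex.I))) t).trans
      (le_max_left _ _)).trans hlt.le, fun t =>
      ((le_iSup (fun t : ℝ => N₁ (f (1 + t * Complex.I))) t).trans (le_max_right _ _)).trans hlt.le⟩
  choose f hf hfv hf0 hf1 using hex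
  set r : ℕ → ℝ≥0∞ := fun k => interpNorm N₀ N₁ θ (v k) + ε' k with hr
  have hrsum : ∑' k, r k ≤ ∑' k, interpNorm N₀ N₁ θ (v k) + ε := by
    rw [ENNReal.tsum_add]; exact add_le_add_right hε'sum.le _
  have hrfin : ∑' k, r k ≠ ∞ :=
    (hrsum.trans_lt (ENNReal.add_lt_top.2 ⟨Ne.lt_top hfin, ENNReal.coe_lt_top⟩)).ne
  have hrk (k : ℕ) : r k ≠ ∞ := ENNReal.ne_top_of_tsum_ne_top hrfin k
  have hrR : Summable fun k => (r k).toReal := ENNReal.summable_toReal hrfin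
  -- The maximum principle turns the boundary bounds into bounds on the whole strip, so the series
  -- converges uniformly there.
  have hbound (k : ℕ) {z : ℂ} (hz0 : 0 ≤ z.re) (hz1 : z.re ≤ 1) : ‖f k z‖ ≤ K * (r k).toReal :=
    (hf k).norm_le hK h0 h1 ENNReal.toReal_nonneg
      (fun t => by rw [ENNReal.ofReal_toReal (hrk k)]; exact hf0 k t)
      (fun t => by rw [ENNReal.ofReal_toReal (hrk k)]; exact hf1 k t) hz0 hz1
  have hus : Summable fun k => K * (r k).toReal := hrR.mul_left K
  have hsumm {z : ℂ} (hz0 : 0 ≤ z.re) (hz1 : z.re ≤ 1) : Summable fun k => f k z :=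
    Summable.of_norm_bounded hus fun k => hbound k hz0 hz1
  have hs0 (t : ℝ) : Summable fun k => f k (t * Complex.I) := hsumm (by simp) (by simp)
  have hs1 (t : ℝ) : Summable fun k => f k (1 + t * Complex.I) := hsumm (by simp) (by simp)
  have hb0 (t : ℝ) : N₀ (∑' k, f k (t * Complex.I)) ≤ ∑' k, r k :=
    (g0.tsum_le _ (hs0 t)).trans (ENNReal.tsum_le_tsum fun k => hf0 k t)
  have hb1 (t : ℝ) : N₁ (∑' k, f k (1 + t * Complex.I)) ≤ ∑' k, r k :=
    (g1.tsum_le _ (hs1 t)).trans (ENNReal.tsum_le_tsum fun k => hf1 k t)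
  have h2r : ∑' k, 2 * r k ≠ ∞ := by
    rw [ENNReal.tsum_mul_left]; exact ENNReal.mul_ne_top (by simp) hrfin
  have hcal : IsCalderon N₀ N₁ fun z => ∑' k, f k z := by
    refine ⟨⟨?_, ?_⟩, ?_, ?_, ?_, ?_, ?_⟩
    · refine Complex.differentiableOn_tsum_of_summable_norm hus
        (fun k => (hf k).diffContOnCl.differentiableOn) ?_ fun k w hw =>
          hbound k hw.1.le hw.2.le
      exact (isOpen_lt continuous_const Complex.continuous_re).inter
        (isOpen_lt Complex.continuous_re continuous_const)
    · have hcl : closure {z : ℂ | 0 < z.re ∧ z.re < 1} ⊆ {z : ℂ | 0 ≤ z.re ∧ z.re ≤ 1} := by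
        refine closure_minimal (fun z hz => ⟨hz.1.le, hz.2.le⟩) ?_
        exact (isClosed_le continuous_const Complex.continuous_re).inter
          (isClosed_le Complex.continuous_re continuous_const)
      exact continuousOn_tsum (fun k => (hf k).diffContOnCl.continuousOn) hus
        fun k z hz => hbound k (hcl hz).1 (hcl hz).2
    · refine isBounded_iff_forall_norm_le.2 ⟨∑' k, K * (r k).toReal, ?_⟩
      rintro _ ⟨z, hz, rfl⟩
      exact tsum_of_norm_bounded hus.hasSum fun k => hbound k hz.1 hz.2
    · exact fun t => (hb0 t).trans_lt hrfin.lt_top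
    · exact fun t => (hb1 t).trans_lt hrfin.lt_top
    -- Continuity in the boundary norm follows by subadditivity and dominated convergence, with
    -- majorant 2 r_k.
    · intro t₀
      refine tendsto_of_tendsto_of_tendsto_of_le_of_le tendsto_const_nhds
        (tendsto_tsum_ennreal (b := fun k => 2 * r k) h2r (F := fun k t =>
          N₀ (f k (t * Complex.I) - f k (t₀ * Complex.I))) (fun k t => ?_)
          fun k => (hf k).continuous₀ t₀) (fun _ => zero_le) fun t => ?_
      · rw [two_mul]
        exact (g0.sub_le _ _).trans (add_le_add (hf0 k t) (hf0 k t₀))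
      · simp only
        rw [← (hs0 t).tsum_sub (hs0 t₀)]
        exact g0.tsum_le _ ((hs0 t).sub (hs0 t₀))
    · intro t₀
      refine tendsto_of_tendsto_of_tendsto_of_le_of_le tendsto_const_nhds
        (tendsto_tsum_ennreal (b := fun k => 2 * r k) h2r (F := fun k t =>
          N₁ (f k (1 + t * Complex.I) - f k (1 + t₀ * Complex.I))) (fun k t => ?_)
          fun k => (hf k).continuous₁ t₀) (fun _ => zero_le) fun t => ?_
      · rw [two_mul]
        exact (g1.sub_le _ _).trans (add_le_add (hf1 k t) (hf1 k t₀))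
      · simp only
        rw [← (hs1 t).tsum_sub (hs1 t₀)]
        exact g1.tsum_le _ ((hs1 t).sub (hs1 t₀))
  refine le_trans ?_ hrsum
  refine iInf_le_of_le (fun z => ∑' k, f k z) (iInf_le_of_le hcal (iInf_le_of_le ?_ ?_))
  · exact tsum_congr hfv
  · exact max_le (iSup_le hb0) (iSup_le hb1)

/-- The maximum principle applied to every admissible Calderon function. It makes series with
summable interpolation norms converge in the ambient space. -/
lemma enorm_le_interpNorm {N₀ N₁ : V → ℝ≥0∞} {K : ℝ} (hK : 0 < K)
    (h0 : ∀ v, ‖v‖ₑ ≤ ENNReal.ofReal K * N₀ v) (h1 : ∀ v, ‖v‖ₑ ≤ ENNReal.ofReal K * N₁ v) {θ : ℝ}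
    (hθ0 : 0 ≤ θ) (hθ1 : θ ≤ 1) (v : V) : ‖v‖ₑ ≤ ENNReal.ofReal K * interpNorm N₀ N₁ θ v := by
  have hK' : ENNReal.ofReal K ≠ 0 := by simpa using hK
  simp only [interpNorm, ENNReal.mul_iInf_of_ne hK' ENNReal.ofReal_ne_top]
  refine le_iInf fun f => le_iInf fun hf => le_iInf fun hfv => ?_
  set R := max (⨆ t : ℝ, N₀ (f (t * Complex.I))) (⨆ t : ℝ, N₁ (f (1 + t * Complex.I))) with hR
  by_cases hRt : R = ∞
  · rw [hRt, ENNReal.mul_top hK']; exact le_top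
  have := hf.norm_le hK.le h0 h1 (r := R.toReal) ENNReal.toReal_nonneg
    (fun t => by
      rw [ENNReal.ofReal_toReal hRt]
      exact (le_iSup (fun t : ℝ => N₀ (f (t * Complex.I))) t).trans (le_max_left _ _))
    (fun t => by
      rw [ENNReal.ofReal_toReal hRt]
      exact (le_iSup (fun t : ℝ => N₁ (f (1 + t * Complex.I))) t).trans (le_max_right _ _))
    (z := θ) (by simpa using hθ0) (by simpa using hθ1)
  rw [hfv] at this
  rw [← ENNReal.ofReal_toReal hRt, ← ENNReal.ofReal_mul hK.le, ← ofReal_norm]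
  exact ENNReal.ofReal_le_ofReal this

/-- Vertical translation preserves the strip, so bounds proved at a real point hold along the whole
vertical line through it. The interpolation on half of the strip needs them there. -/
lemma IsCalderon.translate {N₀ N₁ : V → ℝ≥0∞} {f : ℂ → V} (hf : IsCalderon N₀ N₁ f) (τ : ℝ) :
    DiffContOnCl ℂ (fun z => f (z + τ * Complex.I)) {z : ℂ | 0 < z.re ∧ z.re < 1} ∧
    ∃ C : ℝ, ∀ z : ℂ, 0 ≤ z.re → z.re ≤ 1 → ‖f (z + τ * Complex.I)‖ ≤ C := by
  refine ⟨hf.diffContOnCl.comp (Differentiable.diffContOnCl (by fun_prop)) fun z hz => ?_, ?_⟩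
  · simpa using hz
  · obtain ⟨C, hC⟩ := hf.isBounded.exists_norm_le
    exact ⟨C, fun z h0 h1 => hC _ ⟨_, by simpa using And.intro h0 h1, rfl⟩⟩

section Push

variable {ι J : Type*} [Fintype ι] [DecidableEq ι] [Fintype J] [DecidableEq J]
  {κ : J → Type*} [∀ j, Fintype (κ j)] [∀ j, DecidableEq (κ j)]

lemma StripM.stripFn {W : ℂ → (j : J) → Matrix (ι × κ j) (ι × κ j) ℂ}
    (hW : ∀ j, StripM fun z => W z j) : StripFn W := by
  have h (z : ℂ) : W z = ∑ j, ∑ p, ∑ q, W z j p q •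
      (Pi.single j (Matrix.single p q (1 : ℂ)) : (j : J) → Matrix (ι × κ j) (ι × κ j) ℂ) := by
    funext j
    have h1 (j' : J) : (∑ p, ∑ q, W z j' p q • (Pi.single j' (Matrix.single p q (1 : ℂ)) :
        (j : J) → Matrix (ι × κ j) (ι × κ j) ℂ)) = Pi.single j' (W z j') := by
      conv_rhs => rw [Matrix.matrix_eq_sum_single (W z j')]
      rw [← AddMonoidHom.single_apply, map_sum]
      refine Finset.sum_congr rfl fun p _ => ?_
      rw [map_sum]
      refine Finset.sum_congr rfl fun q _ => ?_
      rw [AddMonoidHom.single_apply, ← Pi.single_smul, Matrix.smul_single, smul_eq_mul, mul_one]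
    rw [Finset.sum_congr rfl fun j' _ => h1 j', Finset.univ_sum_single]
  rw [show W = _ from funext h]
  exact StripFn.sum _ fun j => StripFn.sum _ fun p => StripFn.sum _ fun q =>
    (hW j p q).clm (ContinuousLinearMap.toSpanSingleton ℂ _)

/-- On a finite dimensional space of coefficients all the conditions reduce to crude continuity of
the embedding for both boundary norms; the value of the constant `K` is irrelevant. -/
lemma isCalderon_of_stripM {N₀ N₁ : V → ℝ≥0∞} {K : ℝ≥0∞} (hK : K ≠ ∞)
    (L : ((j : J) → Matrix (ι × κ j) (ι × κ j) ℂ) →ₗ[ℂ] V) (h0 : ∀ w, N₀ (L w) ≤ K * ‖w‖ₑ)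
    (h1 : ∀ w, N₁ (L w) ≤ K * ‖w‖ₑ) {W : ℂ → (j : J) → Matrix (ι × κ j) (ι × κ j) ℂ}
    (hW : ∀ j, StripM fun z => W z j) : IsCalderon N₀ N₁ fun z => L (W z) := by
  have hs := StripM.stripFn hW
  obtain ⟨hd, C, hC⟩ := hs.clm L.toContinuousLinearMap
  simp only [LinearMap.coe_toContinuousLinearMap'] at hd hC
  have hcl : {z : ℂ | 0 ≤ z.re ∧ z.re ≤ 1} ⊆ closure {z : ℂ | 0 < z.re ∧ z.re < 1} := by
    have := Complex.closure_reProdIm (Set.Ioo 0 1) Set.univ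
    rw [closure_Ioo zero_ne_one, closure_univ] at this
    have h2 : {z : ℂ | 0 < z.re ∧ z.re < 1} = Set.Ioo 0 1 ×ℂ Set.univ := by
      ext z; simp [Complex.mem_reProdIm]
    rw [h2, this]
    intro z hz
    simpa [Complex.mem_reProdIm] using hz
  have hWc : ContinuousOn W {z : ℂ | 0 ≤ z.re ∧ z.re ≤ 1} := hs.1.continuousOn.mono hcl
  have hcont (u : ℂ) (hu0 : 0 ≤ u.re) (hu1 : u.re ≤ 1) :
      Continuous fun t : ℝ => W (u + t * Complex.I) :=
    hWc.comp_continuous (by fun_prop) fun t => by simpa using And.intro hu0 hu1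
  have htend (N : V → ℝ≥0∞) (hN : ∀ w, N (L w) ≤ K * ‖w‖ₑ) (u : ℂ) (hu0 : 0 ≤ u.re)
      (hu1 : u.re ≤ 1) (t₀ : ℝ) : Tendsto (fun t : ℝ =>
        N (L (W (u + t * Complex.I)) - L (W (u + t₀ * Complex.I)))) (𝓝 t₀) (𝓝 0) := by
    have h2 : Tendsto (fun t : ℝ => K * ‖W (u + t * Complex.I) - W (u + t₀ * Complex.I)‖ₑ)
        (𝓝 t₀) (𝓝 (K * 0)) := by
      refine ENNReal.Tendsto.const_mul ?_ (Or.inr hK)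
      have h3 : Continuous fun t : ℝ => ‖W (u + t * Complex.I) - W (u + t₀ * Complex.I)‖ₑ :=
        ((hcont u hu0 hu1).sub continuous_const).enorm
      simpa using h3.tendsto t₀
    rw [mul_zero] at h2
    refine tendsto_of_tendsto_of_tendsto_of_le_of_le tendsto_const_nhds h2 (fun _ => zero_le)
      fun t => ?_
    simp only
    rw [← map_sub]
    exact hN _
  have hfin (w) : K * ‖(w : (j : J) → Matrix (ι × κ j) (ι × κ j) ℂ)‖ₑ < ∞ :=
    ENNReal.mul_lt_top hK.lt_top enorm_lt_top
  refine ⟨hd, ?_, fun t => (h0 _).trans_lt (hfin _), fun t => (h1 _).trans_lt (hfin _), ?_, ?_⟩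
  · refine isBounded_iff_forall_norm_le.2 ⟨C, ?_⟩
    rintro _ ⟨z, hz, rfl⟩
    exact hC z hz.1 hz.2
  · intro t₀
    have := htend N₀ h0 0 (by simp) (by simp) t₀
    simpa only [zero_add] using this
  · exact htend N₁ h1 1 (by simp) (by simp)

end Push

end Gauge

/-! ### What the test form controls -/

section TestBound

variable {ι J : Type*} [Fintype ι] [DecidableEq ι] [Fintype J]
  {κ : J → Type*} [∀ j, Fintype (κ j)] [∀ j, DecidableEq (κ j)]

/-- The test form in terms of the parallel pairing. -/
lemma theta_eq_sum_pairing (c : J → ℝ) (a b : Matrix ι ι ℂ)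
    (X Y : (j : J) → Matrix (ι × κ j) (ι × κ j) ℂ) :
    theta c a b X Y = ∑ p : ι × ι, ∑ q : ι × ι, a p.2 p.1 *
      pairing c X (fun j => (Y j)ᵀ) p q * b q.1 q.2 := by
  have h2 (j : J) : (amp (κ j) a * X j * amp (κ j) b * Y j).trace
      = ∑ p : ι × ι, ∑ q : ι × ι, ∑ k, ∑ l, a p.2 p.1 * X j (p.1, k) (q.1, l) * b q.1 q.2
        * Y j (q.2, l) (p.2, k) := by
    have h3 (u v : ι × κ j) : (amp (κ j) a * X j) u v = ∑ i, a u.1 i * X j (i, u.2) v := by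
      rw [Matrix.mul_apply, Fintype.sum_prod_type]
      refine Finset.sum_congr rfl fun i _ => ?_
      rw [Finset.sum_eq_single u.2 (fun l _ hl => by simp [amp_apply, Ne.symm hl]) (by simp)]
      simp [amp_apply]
    have h4 (u v : ι × κ j) : (amp (κ j) b * Y j) u v = ∑ i, b u.1 i * Y j (i, u.2) v := by
      rw [Matrix.mul_apply, Fintype.sum_prod_type]
      refine Finset.sum_congr rfl fun i _ => ?_
      rw [Finset.sum_eq_single u.2 (fun l _ hl => by simp [amp_apply, Ne.symm hl]) (by simp)]
      simp [amp_apply]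
    rw [Matrix.mul_assoc (amp (κ j) a * X j)]
    simp only [Matrix.trace, Matrix.diag_apply]
    simp_rw [Matrix.mul_apply (M := amp (κ j) a * X j), h3, h4, Finset.sum_mul_sum,
      Fintype.sum_prod_type]
    calc ∑ l, ∑ k, ∑ i', ∑ m, ∑ i, ∑ j', a l i * X j (i, k) (i', m) * (b i' j' * Y j (j', m) (l, k))
        = ∑ l, ∑ k, ∑ i', ∑ i, ∑ j', ∑ m, a l i * X j (i, k) (i', m) * (b i' j' * Y j (j', m) (l, k)) := by
          refine Finset.sum_congr rfl fun l _ => Finset.sum_congr rfl fun k _ =>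
            Finset.sum_congr rfl fun i' _ => ?_
          rw [Finset.sum_comm]
          exact Finset.sum_congr rfl fun i _ => Finset.sum_comm
      _ = ∑ l, ∑ i, ∑ k, ∑ i', ∑ j', ∑ m, a l i * X j (i, k) (i', m) * (b i' j' * Y j (j', m) (l, k)) := by
          refine Finset.sum_congr rfl fun l _ => ?_
          rw [Finset.sum_comm (γ := ι)]
          exact Finset.sum_congr rfl fun k _ => Finset.sum_comm
      _ = ∑ l, ∑ i, ∑ i', ∑ j', ∑ k, ∑ m, a l i * X j (i, k) (i', m) * (b i' j' * Y j (j', m) (l, k)) := by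
          refine Finset.sum_congr rfl fun l _ => Finset.sum_congr rfl fun i _ => ?_
          rw [Finset.sum_comm]
          exact Finset.sum_congr rfl fun i' _ => Finset.sum_comm
      _ = ∑ i, ∑ l, ∑ i', ∑ j', ∑ k, ∑ m, a l i * X j (i, k) (i', m) * (b i' j' * Y j (j', m) (l, k)) := Finset.sum_comm
      _ = _ := by simp only [mul_assoc]
  simp only [theta, h2, pairing, Matrix.of_apply, Matrix.transpose_apply, Finset.mul_sum,
    Finset.sum_mul]
  rw [Finset.sum_comm]
  refine Finset.sum_congr rfl fun p _ => ?_
  rw [Finset.sum_comm]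
  exact Finset.sum_congr rfl fun q _ => Finset.sum_congr rfl fun j _ =>
    Finset.sum_congr rfl fun k _ => Finset.sum_congr rfl fun l _ => by ring

/-- Pairing with Hilbert-Schmidt matrices is controlled by the norm of the parallel pairing. -/
lemma norm_theta_le_norm_pairing {c : J → ℝ} {a b : Matrix ι ι ℂ} (ha : a ∈ SB ι (1 / 2))
    (hb : b ∈ SB ι (1 / 2)) (X Y : (j : J) → Matrix (ι × κ j) (ι × κ j) ℂ) :
    ‖theta c a b X Y‖ ≤ ‖pairing c X fun j => (Y j)ᵀ‖ := by
  have hl {a : Matrix ι ι ℂ} (ha : a ∈ SB ι (1 / 2)) (x : ι × ι → ℂ)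
      (hx : ∑ p, ‖x p‖ ^ 2 = ∑ i, ∑ j, ‖a i j‖ ^ 2) : l2 x ≤ 1 := by
    rw [l2, hx]
    exact Real.sqrt_le_one.2 (sum_norm_sq_le_of_mem_SB_half ha)
  rw [theta_eq_sum_pairing]
  refine (norm_bilin_le _ _ _).trans (mul_le_of_le_one_right (norm_nonneg _) ?_)
  refine mul_le_one₀ (hl ha _ ?_) (l2_nonneg _) (hl hb (fun q => b q.1 q.2) ?_)
  · rw [Fintype.sum_prod_type, Finset.sum_comm]
  · rw [Fintype.sum_prod_type]

/-- Only the finiteness of the constant matters: it supplies the boundary continuity of Calderon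
functions on finite families. After normalizing X, the factorization bound applies to a multiple of
the identity times a multiple of X. -/
lemma norm_pairing_le_crude {m : Type*} [Fintype m] [DecidableEq m] {c : J → ℝ} (hc : ∀ j, 0 ≤ c j)
    (X : (j : J) → Matrix (ι × κ j) (ι × κ j) ℂ)
    {Y : (j : J) → Matrix (m × κ j) (m × κ j) ℂ} (hY : ∀ j, ‖Y j‖ ≤ 1) :
    ‖pairing c X Y‖ ≤ (∑ j, c j * Fintype.card (κ j) + 1) * ‖X‖ := by
  set D : ℝ := ∑ j, c j * Fintype.card (κ j) + 1 with hD
  have hD1 : 1 ≤ D := by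
    have : 0 ≤ ∑ j, c j * Fintype.card (κ j) :=
      Finset.sum_nonneg fun j _ => mul_nonneg (hc j) (Nat.cast_nonneg _)
    linarith
  have hD0 : 0 < D := by linarith
  -- With lam² = 1/D, a multiple lam of any family of contractions satisfies the hypothesis on
  -- partial traces.
  set lam : ℝ := (√D)⁻¹ with hlam
  have hlam2 : lam ^ 2 = D⁻¹ := by rw [hlam, inv_pow, Real.sq_sqrt hD0.le]
  have hlam0 : 0 < lam := by positivity
  have key (Q : (j : J) → Matrix (ι × κ j) (ι × κ j) ℂ) (hQ : ∀ j, ‖Q j‖ ≤ 1) (ξ : ι → ℂ) :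
      ∑ j, c j * ∑ e, ∑ k, ‖∑ i, ((lam : ℂ) • Q j) e (i, k) * ξ i‖ ^ 2 ≤ ∑ i, ‖ξ i‖ ^ 2 := by
    have h1 (j : J) (k : κ j) : ∑ e, ‖∑ i, ((lam : ℂ) • Q j) e (i, k) * ξ i‖ ^ 2
        ≤ D⁻¹ * ∑ i, ‖ξ i‖ ^ 2 := by
      let v : ι × κ j → ℂ := fun p => if p.2 = k then ξ p.1 else 0
      have h2 (e) : ∑ i, ((lam : ℂ) • Q j) e (i, k) * ξ i = lam * (Q j *ᵥ v) e := by
        rw [Matrix.mulVec, dotProduct, Fintype.sum_prod_type, Finset.mul_sum]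
        refine Finset.sum_congr rfl fun i _ => ?_
        rw [Finset.sum_eq_single k (fun l _ hl => by simp [v, hl]) (by simp)]
        simp [v, mul_assoc]
      have h3 : l2 v ^ 2 = ∑ i, ‖ξ i‖ ^ 2 := by
        rw [l2_sq, Fintype.sum_prod_type]
        refine Finset.sum_congr rfl fun i _ => ?_
        rw [Finset.sum_eq_single k (fun l _ hl => by simp [v, hl]) (by simp)]
        simp [v]
      simp only [h2, norm_mul, mul_pow, Complex.norm_real, Real.norm_of_nonneg hlam0.le, hlam2]
      rw [← Finset.mul_sum, ← l2_sq, ← h3]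
      refine mul_le_mul_of_nonneg_left (pow_le_pow_left₀ (l2_nonneg _) ?_ 2) (by positivity)
      exact (l2_mulVec_le _ _).trans (mul_le_of_le_one_left (l2_nonneg _) (hQ j))
    have hξ : 0 ≤ ∑ i, ‖ξ i‖ ^ 2 := Finset.sum_nonneg fun _ _ => by positivity
    calc ∑ j, c j * ∑ e, ∑ k, ‖∑ i, ((lam : ℂ) • Q j) e (i, k) * ξ i‖ ^ 2
        ≤ ∑ j, c j * (Fintype.card (κ j) * (D⁻¹ * ∑ i, ‖ξ i‖ ^ 2)) := by
          refine Finset.sum_le_sum fun j _ => mul_le_mul_of_nonneg_left ?_ (hc j)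
          rw [Finset.sum_comm]
          refine (Finset.sum_le_sum fun k _ => h1 j k).trans ?_
          simp
      _ = (∑ j, c j * Fintype.card (κ j)) * D⁻¹ * ∑ i, ‖ξ i‖ ^ 2 := by
          rw [Finset.sum_mul, Finset.sum_mul]
          exact Finset.sum_congr rfl fun j _ => by ring
      _ ≤ 1 * ∑ i, ‖ξ i‖ ^ 2 := by
          refine mul_le_mul_of_nonneg_right ?_ hξ
          rw [← div_eq_mul_inv, div_le_one hD0, hD]
          linarith
      _ = _ := one_mul _
  by_cases hX : ‖X‖ = 0
  · rw [norm_eq_zero] at hX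
    subst hX
    have : pairing c (0 : (j : J) → Matrix (ι × κ j) (ι × κ j) ℂ) Y = 0 := by
      ext p q; simp [pairing]
    simp [this]
  have hX0 : 0 < ‖X‖ := (norm_nonneg X).lt_of_ne (Ne.symm hX)
  have hkey := norm_pairing_le hc (P := fun j => (lam : ℂ) • 1)
    (Q := fun j => (lam : ℂ) • ((‖X‖⁻¹ : ℝ) : ℂ) • X j) (fun ξ => ?_) (key _ fun j => ?_) hY
  · have h1 : pairing c X Y = ((D * ‖X‖ : ℝ) : ℂ) • pairing c
        (fun j => ((lam : ℂ) • (1 : Matrix (ι × κ j) (ι × κ j) ℂ)) *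
          ((lam : ℂ) • ((‖X‖⁻¹ : ℝ) : ℂ) • X j)) Y := by
      have h2 (j : J) : X j = ((D * ‖X‖ : ℝ) : ℂ) •
          (((lam : ℂ) • (1 : Matrix (ι × κ j) (ι × κ j) ℂ)) *
          ((lam : ℂ) • ((‖X‖⁻¹ : ℝ) : ℂ) • X j)) := by
        simp only [Matrix.smul_mul, Matrix.one_mul, smul_smul]
        have : ((D * ‖X‖ : ℝ) : ℂ) * (lam * (lam * ((‖X‖⁻¹ : ℝ) : ℂ))) = 1 := by
          rw [← Complex.ofReal_mul, ← Complex.ofReal_mul, ← Complex.ofReal_mul,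
            ← Complex.ofReal_one]
          congr 1
          have : D * ‖X‖ * (lam * (lam * ‖X‖⁻¹)) = (D * lam ^ 2) * (‖X‖ * ‖X‖⁻¹) := by ring
          rw [this, hlam2, mul_inv_cancel₀ hX, mul_inv_cancel₀ hD0.ne', one_mul]
        simp only [← mul_assoc] at this ⊢
        rw [this, one_smul]
      ext p q
      simp only [pairing, Matrix.of_apply, Matrix.smul_apply, smul_eq_mul, Finset.mul_sum]
      refine Finset.sum_congr rfl fun j _ => Finset.sum_congr rfl fun k _ =>
        Finset.sum_congr rfl fun l _ => ?_
      conv_lhs => rw [h2 j]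
      simp only [Matrix.smul_apply, smul_eq_mul]
      ring
    rw [h1, norm_smul, Complex.norm_real, Real.norm_of_nonneg (by positivity)]
    exact mul_le_of_le_one_right (by positivity) hkey
  · refine (le_of_eq ?_).trans (key (fun j => 1) (fun j => norm_unitary_le (one_mem _)) ξ)
    refine Finset.sum_congr rfl fun j _ => ?_
    congr 1
    refine Finset.sum_congr rfl fun e _ => Finset.sum_congr rfl fun k _ => ?_
    congr 2
    refine Finset.sum_congr rfl fun i _ => ?_
    simp only [Matrix.smul_apply, Matrix.one_apply, eq_comm (a := e)]
    ring
  · rw [norm_smul, Complex.norm_real, Real.norm_of_nonneg (by positivity)]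
    rw [inv_mul_le_one₀ hX0]
    exact norm_le_pi_norm X j

/-- The Schatten norm of the whole family is controlled by the test form. -/
lemma weight_rpow_le_of_test [Nonempty ι] {c : J → ℝ} (hc : ∀ j, 0 ≤ c j) {u C : ℝ} (hu0 : 0 < u)
    {X : (j : J) → Matrix (ι × κ j) (ι × κ j) ℂ}
    (hX : ∀ a ∈ SB ι u, ∀ b ∈ SB ι u, ∀ Y ∈ FB c (1 - 2 * u), ‖theta c a b X Y‖ ≤ C)
    {U V : (j : J) → Matrix (ι × κ j) (ι × κ j) ℂ} {s : (j : J) → ι × κ j → ℝ}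
    (hU : ∀ j, U j ∈ Matrix.unitaryGroup _ ℂ) (hV : ∀ j, V j ∈ Matrix.unitaryGroup _ ℂ)
    (hs : ∀ j i, 0 ≤ s j i) (hXs : ∀ j, X j = pw (U j) (V j) (s j) ((2 * u : ℝ) : ℂ)) :
    (∑ j, c j * ∑ i, s j i) ^ (2 * u) ≤ C * (Fintype.card ι : ℝ) ^ (2 * u) := by
  -- Taking normalized scalars for `a` and `b` costs the factor n^(2u) but reduces the form to the
  -- plain trace pairing with a norming family.
  have h := hX _ (scalar_mem_SB hu0) _ (scalar_mem_SB hu0) _ (norming_mem_FB hc hU hV hs (2 * u))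
  rw [theta_smul_one] at h
  simp only [hXs] at h
  have h0 := weight_nonneg hc hs
  have hn : (0 : ℝ) < Fintype.card ι := by exact_mod_cast Fintype.card_pos
  rw [sum_trace_pw_mul_norming hc hU hV hs (by linarith), norm_mul, norm_pow,
    Complex.norm_real, Complex.norm_real, Real.norm_of_nonneg (by positivity),
    Real.norm_of_nonneg (by positivity), Real.inv_rpow hn.le, inv_pow, ← Real.rpow_natCast,
    ← Real.rpow_mul hn.le, Nat.cast_ofNat, mul_comm u 2, inv_mul_le_iff₀ (by positivity)] at h
  linarith

/-- A matrix unit is a permutation matrix times a rank one diagonal projection. -/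
lemma single_mem_SB (u : ℝ) (i i' : ι) : Matrix.single i' i (1 : ℂ) ∈ SB ι u := by
  refine ⟨(1 : Matrix ι ι ℂ).submatrix (Equiv.swap i i') id, ?_, 1, one_mem _,
    fun k => if k = i then 1 else 0, fun k => by beta_reduce; split_ifs <;> simp, by simp, ?_⟩
  · rw [Matrix.mem_unitaryGroup_iff, Matrix.star_eq_conjTranspose, Matrix.conjTranspose_submatrix,
      Matrix.conjTranspose_one, ← Matrix.submatrix_mul _ _ _ _ _ Function.bijective_id,
      Matrix.one_mul, Matrix.submatrix_one_equiv]
  · ext k l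
    have h1 : Matrix.diagonal (fun k => zp (if k = i then 1 else 0) u) = Matrix.single i i (1 : ℂ) := by
      ext k l
      rw [Matrix.diagonal_apply, Matrix.single_apply]
      by_cases h1 : k = i
      · by_cases h2 : k = l
        · simp [← h2, h1, zp]
        · simp [h2, ← h1]
      · simp [h1, Ne.symm h1, zp_zero]
    rw [pw, Matrix.mul_one, h1, Matrix.mul_apply, Finset.sum_eq_single i]
    · simp only [Matrix.submatrix_apply, id, Matrix.one_apply, Matrix.single_apply, true_and]
      have : (Equiv.swap i i') k = i ↔ i' = k := by
        rw [Equiv.swap_apply_eq_iff, Equiv.swap_apply_left, eq_comm]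
      simp only [this]
      by_cases h2 : i' = k <;> by_cases h3 : i = l <;> simp [h2, h3]
    · intro l' _ hl'
      simp [Ne.symm hl']
    · simp

/-- The test bound for a matrix passes to its entries. -/
lemma norm_sum_trace_entry_le_of_test {c : J → ℝ} {u C : ℝ}
    {X : (j : J) → Matrix (ι × κ j) (ι × κ j) ℂ}
    (hX : ∀ a ∈ SB ι u, ∀ b ∈ SB ι u, ∀ Y ∈ FB c (1 - 2 * u), ‖theta c a b X Y‖ ≤ C) (i i' : ι)
    {y : (j : J) → Matrix (κ j) (κ j) ℂ} (hy : y ∈ FB c (1 - 2 * u)) :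
    ‖∑ j, (c j : ℂ) * (Matrix.of (fun k l => X j (i, k) (i', l)) * y j).trace‖ ≤ C := by
  obtain ⟨U, V, s, hU, hV, hs, hs1, h⟩ := hy
  let lift (j : J) (A : Matrix (κ j) (κ j) ℂ) : Matrix (ι × κ j) (ι × κ j) ℂ :=
    Matrix.kroneckerMap (· * ·) 1 A
  have hlift {j : J} {A : Matrix (κ j) (κ j) ℂ} (hA : A ∈ Matrix.unitaryGroup (κ j) ℂ) :
      lift j A ∈ Matrix.unitaryGroup (ι × κ j) ℂ := by
    have h1 : (lift j A)ᴴ = lift j Aᴴ := by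
      rw [Matrix.conjTranspose_kronecker, Matrix.conjTranspose_one]
    rw [Matrix.mem_unitaryGroup_iff, Matrix.star_eq_conjTranspose, h1,
      ← Matrix.mul_kronecker_mul, mul_conjTranspose_of_mem hA, Matrix.one_mul,
      Matrix.one_kronecker_one]
  -- The test family is `y` placed in the corner (i, i); with `a` = E_{ii} and `b` = E_{i'i} the
  -- form picks out the block (i, i').
  let Y (j : J) : Matrix (ι × κ j) (ι × κ j) ℂ :=
    pw (lift j (U j)) (lift j (V j)) (fun p => if p.1 = i then s j p.2 else 0) ((1 - 2 * u : ℝ) : ℂ)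
  have hY : Y ∈ FB c (1 - 2 * u) := by
    refine ⟨_, _, _, fun j => hlift (hU j), fun j => hlift (hV j), fun j p => ?_, ?_,
      fun j => rfl⟩
    · split_ifs
      exacts [hs j p.2, le_rfl]
    · refine (le_of_eq ?_).trans hs1
      refine Finset.sum_congr rfl fun j _ => ?_
      rw [Fintype.sum_prod_type, Finset.sum_comm]
      simp
  have hYe (j : J) : Y j = Matrix.kroneckerMap (· * ·) (Matrix.single i i 1) (y j) := by
    have h1 : (Matrix.diagonal fun p : ι × κ j => zp (if p.1 = i then s j p.2 else 0)
        ((1 - 2 * u : ℝ) : ℂ)) = Matrix.kroneckerMap (· * ·) (Matrix.single i i 1)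
          (Matrix.diagonal fun k => zp (s j k) ((1 - 2 * u : ℝ) : ℂ)) := by
      ext p q
      rw [Matrix.diagonal_apply, Matrix.kroneckerMap_apply, Matrix.diagonal_apply,
        Matrix.single_apply]
      obtain ⟨p1, p2⟩ := p
      obtain ⟨q1, q2⟩ := q
      by_cases h1 : p1 = i
      · by_cases h2 : p1 = q1
        · by_cases h3 : p2 = q2
          · simp [← h2, h1, h3]
          · simp [h3]
        · simp [← h1, h2]
      · simp [h1, Ne.symm h1, zp_zero]
    simp only [Y]
    rw [pw, h1, ← Matrix.mul_kronecker_mul, ← Matrix.mul_kronecker_mul, Matrix.one_mul,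
      Matrix.mul_one, h j, pw]
  refine (le_of_eq ?_).trans (hX _ (single_mem_SB u i i) _ (single_mem_SB u i i') Y hY)
  rw [theta]
  congr 1
  refine Finset.sum_congr rfl fun j _ => ?_
  congr 1
  have h2 : amp (κ j) (Matrix.single i' i (1 : ℂ)) * Y j
      = Matrix.kroneckerMap (· * ·) (Matrix.single i' i 1) (y j) := by
    rw [hYe, amp, ← Matrix.mul_kronecker_mul, Matrix.one_mul, Matrix.single_mul_single_same,
      one_mul]
  have h3 : Matrix.kroneckerMap (· * ·) (Matrix.single i' i 1) (y j) *
      amp (κ j) (Matrix.single i i (1 : ℂ))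
      = Matrix.kroneckerMap (· * ·) (Matrix.single i' i 1) (y j) := by
    rw [amp, ← Matrix.mul_kronecker_mul, Matrix.mul_one, Matrix.single_mul_single_same, one_mul]
  rw [Matrix.mul_assoc, h2, Matrix.mul_assoc, Matrix.trace_mul_comm (amp _ _), Matrix.mul_assoc,
    h3]
  simp only [Matrix.trace, Matrix.diag_apply, Matrix.mul_apply, Matrix.of_apply,
    Fintype.sum_prod_type, Matrix.kroneckerMap_apply, Matrix.single_apply]
  rw [Finset.sum_eq_single i]
  · refine Finset.sum_congr rfl fun k _ => ?_
    rw [Finset.sum_eq_single i']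
    · simp
    · intro l _ hl
      simp [Ne.symm hl]
    · simp
  · intro l _ hl
    simp [Ne.symm hl]
  · simp

end TestBound

/-! ### The test form for `ℒ^p(Σ)` -/

lemma norm_block_le {ι κ : Type*} [Fintype ι] [DecidableEq ι] [Fintype κ] [DecidableEq κ]
    (X : Matrix (ι × κ) (ι × κ) ℂ) (i j : ι) :
    ‖(Matrix.of fun s t => X (i, s) (j, t) : Matrix κ κ ℂ)‖ ≤ ‖X‖ := by
  refine opNorm_le_of_bilin _ (norm_nonneg _) fun x y => ?_
  let ext (i : ι) (x : κ → ℂ) : ι × κ → ℂ := fun p => if p.1 = i then x p.2 else 0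
  have hext (i : ι) (x : κ → ℂ) : l2 (ext i x) = l2 x := by
    rw [l2, l2, Fintype.sum_prod_type, Finset.sum_eq_single i]
    · simp [ext]
    · intro k _ hk; simp [ext, hk]
    · simp
  have h := norm_bilin_le X (ext i x) (ext j y)
  rw [hext, hext] at h
  refine (le_of_eq ?_).trans h
  rw [Fintype.sum_prod_type, Finset.sum_eq_single i]
  · congr 1
    refine Finset.sum_congr rfl fun s _ => ?_
    rw [Fintype.sum_prod_type, Finset.sum_eq_single j]
    · simp [ext]
    · intro k _ hk; simp [ext, hk]
    · simp
  · intro k _ hk; simp [ext, hk]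
  · simp

lemma norm_pw_le_rpow {ι : Type*} [Fintype ι] [DecidableEq ι] {U V : Matrix ι ι ℂ}
    (hU : U ∈ Matrix.unitaryGroup ι ℂ) (hV : V ∈ Matrix.unitaryGroup ι ℂ) {s : ι → ℝ}
    (hs : ∀ i, 0 ≤ s i) {x : ℝ} (hx : 0 ≤ x) : ‖pw U V s x‖ ≤ (∑ i, s i) ^ x := by
  refine (norm_mul_mul_le (norm_unitary_le hU) (norm_unitary_le hV)).trans
    (norm_diagonal_le (Real.rpow_nonneg (Finset.sum_nonneg fun i _ => hs i) _) fun i => ?_)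
  refine (norm_zp_le (hs i) _).trans ?_
  rw [Complex.ofReal_re]
  exact Real.rpow_le_rpow (hs i) (Finset.single_le_sum (fun i _ => hs i) (Finset.mem_univ i)) hx

section FamTest

variable {S : Type*} (d : S → ℕ) {n : ℕ}

/-- The matrix over `M_{d_σ}` of an `n × n` matrix of families. -/
def famBlock (x : Fin n → Fin n → Fam d) (σ : S) : Matrix (Fin n × Fin (d σ)) (Fin n × Fin (d σ)) ℂ :=
  Matrix.of fun a b => x a.1 b.1 σ a.2 b.2

/-- The bound `C` for the test form of the space `M_n(ℒ^r(Σ))`, `u = 1 / (2 r)`. -/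
def FamTest (u C : ℝ) (x : Fin n → Fin n → Fam d) : Prop :=
  ∀ (F : Finset S), ∀ a ∈ SB (Fin n) u, ∀ b ∈ SB (Fin n) u,
    ∀ Y ∈ FB (κ := fun j : F => Fin n × Fin (d j)) (fun j : F => (d j : ℝ)) (1 - 2 * u),
      ‖theta (fun j : F => (d j : ℝ)) a b (fun j : F => famBlock d x j) Y‖ ≤ C

lemma matNormFamOne_matrix_eq {m : ℕ} (F : Finset S) (x : Fin n → Fin n → Fam d)
    (y : Fin m → Fin m → Fam d) :
    (Matrix.of fun a b => ∑ σ ∈ F, (d σ : ℂ) *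
        ∑ s, ∑ t, x a.1 b.1 σ s t * y a.2 b.2 σ s t : Matrix (Fin n × Fin m) (Fin n × Fin m) ℂ)
      = pairing (fun j : F => (d j : ℝ)) (fun j : F => famBlock d x j)
        (fun j : F => famBlock d y j) := by
  ext p q
  rw [Matrix.of_apply, ← Finset.sum_coe_sort F]
  simp [pairing, famBlock]

/-- At r = 1 the matrices `a`, `b` are unit vectors of Hilbert-Schmidt type and `Y` is a family of
contractions. The form is a matrix coefficient of the pairing that defines the M_n(ℒ^1) norm, taken
with m = n and the transposes of the `Y`. -/
lemma famTest_half_of_matNormFamOne_le {x : Fin n → Fin n → Fam d} {C : ℝ} (hC : 0 ≤ C)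
    (h : matNormFamOne d n x ≤ ENNReal.ofReal C) : FamTest d (1 / 2) C x := by
  classical
  intro F a ha b hb Y hY
  rw [show (1 : ℝ) - 2 * (1 / 2) = 0 by norm_num] at hY
  refine (norm_theta_le_norm_pairing ha hb _ _).trans ?_
  let y : Fin n → Fin n → Fam d := fun k l σ =>
    if h : σ ∈ F then Matrix.of fun s t => (Y ⟨σ, h⟩)ᵀ (k, s) (l, t) else 0
  have hyF (j : F) : famBlock d y j = (Y j)ᵀ := by
    ext p q
    simp [famBlock, y]
  have hy : matNormFamInf d n y ≤ 1 := by
    refine iSup_le fun σ => ?_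
    change ‖famBlock d y σ‖ₑ ≤ 1
    by_cases hσ : σ ∈ F
    · rw [hyF ⟨σ, hσ⟩, ← ofReal_norm, ← ENNReal.ofReal_one]
      exact ENNReal.ofReal_le_ofReal ((opNorm_transpose_le _).trans (norm_le_of_mem_FB_zero hY _))
    · have : famBlock d y σ = 0 := by ext p q; simp [famBlock, y, hσ]
      rw [this, enorm_zero]
      exact zero_le
  have h1 : ‖pairing (fun j : F => (d j : ℝ)) (fun j : F => famBlock d x j)
      (fun j : F => famBlock d y j)‖ₑ ≤ ENNReal.ofReal C := by
    rw [← matNormFamOne_matrix_eq]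
    refine le_trans ?_ h
    exact le_iSup_of_le F (le_iSup_of_le n (le_iSup_of_le y (le_iSup_of_le hy le_rfl)))
  rw [← ofReal_norm, ENNReal.ofReal_le_ofReal_iff hC] at h1
  simpa only [hyF] using h1

/-- The coordinate functionals. -/
def famEntry (i j : Fin n) (σ : S) (s t : Fin (d σ)) : (Fin n → Fin n → FamInf d) →L[ℂ] ℂ :=
  { toFun := fun w => w i j σ s t
    map_add' := fun v w => rfl
    map_smul' := fun k w => rfl
    cont := by
      have h1 : Continuous fun w : Fin n → Fin n → FamInf d => w i j :=
        (continuous_apply j).comp (continuous_apply i)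
      have h2 := (lp.evalCLM ℂ (fun σ : S => Matrix (Fin (d σ)) (Fin (d σ)) ℂ) ∞ σ).continuous
      exact (h2.comp h1).matrix_elem s t }

lemma famEntry_apply (i j : Fin n) (σ : S) (s t : Fin (d σ)) (w : Fin n → Fin n → FamInf d) :
    famEntry d i j σ s t w = w i j σ s t := rfl

variable {d}

/-- The easy half of the characterization: the test form is interpolated between r = ∞ and r = 1,
where the boundary norms bound it. The translation τ gives the bound on a vertical line and not only
at θ. -/
lemma famTest_of_isCalderon {f : ℂ → Fin n → Fin n → FamInf d}
    (hf : IsCalderon (fun w : Fin n → Fin n → FamInf d => matNormFamInf d n (fun i j σ => w i j σ))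
      (fun w : Fin n → Fin n → FamInf d => matNormFamOne d n (fun i j σ => w i j σ)) f)
    {η : ℝ} (hη : 0 ≤ η)
    (h0 : ∀ t : ℝ, matNormFamInf d n (fun i j σ => f (t * Complex.I) i j σ) ≤ ENNReal.ofReal η)
    (h1 : ∀ t : ℝ, matNormFamOne d n (fun i j σ => f (1 + t * Complex.I) i j σ) ≤ ENNReal.ofReal η)
    {θ : ℝ} (hθ0 : 0 ≤ θ) (hθ1 : θ ≤ 1) (τ : ℝ) :
    FamTest d (θ / 2) η (fun i j σ => f (θ + τ * Complex.I) i j σ) := by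
  intro F a ha b hb Y hY
  rw [show θ / 2 = 1 / 2 * θ + 0 by ring] at ha hb
  rw [show 1 - 2 * (θ / 2) = -1 * θ + 1 by ring] at hY
  have hg (j : F) : StripM fun z => famBlock d (fun i j σ => f (z + τ * Complex.I) i j σ) j :=
    fun p q => by
      have : StripFn fun z => f (z + τ * Complex.I) := hf.translate τ
      exact this.clm (famEntry d p.1 q.1 j p.2 q.2)
  have h2 (t : ℝ) : (t : ℂ) * Complex.I + τ * Complex.I = ((t + τ : ℝ) : ℂ) * Complex.I := by
    push_cast; ring
  have h3 (t : ℝ) : 1 + (t : ℂ) * Complex.I + τ * Complex.I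
      = 1 + ((t + τ : ℝ) : ℂ) * Complex.I := by
    push_cast; ring
  have key := theta_three_lines (c := fun j : F => (d j : ℝ))
    (g := fun z (j : F) => famBlock d (fun i j σ => f (z + τ * Complex.I) i j σ) j) hg
    (C₀ := η) (C₁ := η) (α := 1 / 2) (β := 0) (α' := -1) (β' := 1)
    ?_ ?_ hθ0 hθ1 ha hb hY
  · refine key.trans (le_of_eq ?_)
    rw [← Real.rpow_add_of_nonneg hη (by linarith) hθ0, sub_add_cancel, Real.rpow_one]
  · intro t a ha b hb Y hY
    refine norm_theta_le_of_norm_le (fun j => Nat.cast_nonneg _) ha hb hY hη fun j => ?_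
    have h4 := (le_iSup (fun σ => ‖famBlock d (fun i j σ => f (((t + τ : ℝ) : ℂ) * Complex.I) i j σ)
      σ‖ₑ) (j : S)).trans (h0 (t + τ))
    rw [← ofReal_norm, ENNReal.ofReal_le_ofReal_iff hη] at h4
    simpa only [h2] using h4
  · intro t a ha b hb Y hY
    rw [add_zero] at ha hb
    have h4 := famTest_half_of_matNormFamOne_le d hη (h1 (t + τ)) F a ha b hb Y
      (by rwa [show (1 : ℝ) - 2 * (1 / 2) = -1 + 1 by norm_num])
    simpa only [h3] using h4

variable (d)

lemma isGauge_matNormFamInf : IsGauge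
    fun w : Fin n → Fin n → FamInf d => matNormFamInf d n (fun i j σ => w i j σ) := by
  refine IsGauge.iSup fun σ => ?_
  let T : (Fin n → Fin n → FamInf d) →L[ℂ]
      Matrix (Fin n × Fin (d σ)) (Fin n × Fin (d σ)) ℂ :=
    { toFun := fun w => Matrix.of fun a b => famEntry d a.1 b.1 σ a.2 b.2 w
      map_add' := fun v w => by ext p q; simp
      map_smul' := fun k w => by ext p q; simp
      cont := continuous_matrix fun p q => (famEntry d p.1 q.1 σ p.2 q.2).continuous }
  exact IsGauge.clm T

lemma isGauge_matNormFamOne : IsGauge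
    fun w : Fin n → Fin n → FamInf d => matNormFamOne d n (fun i j σ => w i j σ) := by
  refine IsGauge.iSup fun F => IsGauge.iSup fun m => IsGauge.iSup fun y => IsGauge.iSup fun _ => ?_
  let E (a b : Fin n × Fin m) : (Fin n → Fin n → FamInf d) →L[ℂ] ℂ :=
    ∑ σ ∈ F, (d σ : ℂ) • ∑ s, ∑ t, y a.2 b.2 σ s t • famEntry d a.1 b.1 σ s t
  have hE (w : Fin n → Fin n → FamInf d) (a b : Fin n × Fin m) : E a b w
      = ∑ σ ∈ F, (d σ : ℂ) * ∑ s, ∑ t, w a.1 b.1 σ s t * y a.2 b.2 σ s t := by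
    simp only [E, sum_apply, smul_apply, famEntry_apply,
      smul_eq_mul, mul_comm (y _ _ _ _ _)]
  let T : (Fin n → Fin n → FamInf d) →L[ℂ] Matrix (Fin n × Fin m) (Fin n × Fin m) ℂ :=
    { toFun := fun w => Matrix.of fun a b => E a b w
      map_add' := fun v w => by ext p q; simp
      map_smul' := fun k w => by ext p q; simp
      cont := continuous_matrix fun p q => (E p q).continuous }
  have := IsGauge.clm T
  simpa only [T, ContinuousLinearMap.coe_mk', LinearMap.coe_mk, AddHom.coe_mk, hE] using this

variable {d}

/-- The test bound controls the Schatten norms of the entries. -/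
lemma FamTest.weight_rpow_le {u C : ℝ} (hu : 0 < u) {x : Fin n → Fin n → Fam d}
    (hx : FamTest d u C x) (i j : Fin n) (F : Finset S)
    {U V : (σ : F) → Matrix (Fin (d σ)) (Fin (d σ)) ℂ} {s : (σ : F) → Fin (d σ) → ℝ}
    (hU : ∀ σ, U σ ∈ Matrix.unitaryGroup _ ℂ) (hV : ∀ σ, V σ ∈ Matrix.unitaryGroup _ ℂ)
    (hs : ∀ σ k, 0 ≤ s σ k) (h : ∀ σ : F, x i j σ = pw (U σ) (V σ) (s σ) ((2 * u : ℝ) : ℂ)) :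
    (∑ σ : F, (d σ : ℝ) * ∑ k, s σ k) ^ (2 * u) ≤ C := by
  have hc (σ : F) : (0 : ℝ) ≤ d σ := Nat.cast_nonneg _
  have key := norm_sum_trace_entry_le_of_test (hx F) i j (norming_mem_FB hc hU hV hs (2 * u))
  have h1 (σ : F) : (Matrix.of fun k l => famBlock d x σ (i, k) (j, l)) = x i j σ := by
    ext k l; simp [famBlock]
  simp only [h1, h] at key
  rwa [sum_trace_pw_mul_norming hc hU hV hs (by linarith), Complex.norm_real,
    Real.norm_of_nonneg (Real.rpow_nonneg (weight_nonneg hc hs) _)] at key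

/-- The operator norm is at most the Schatten norm, and the weight d_σ ≥ 1 can only increase the
latter. -/
lemma FamTest.norm_le {u C : ℝ} (hu : 0 < u) (hd : ∀ σ, 0 < d σ)
    {x : Fin n → Fin n → Fam d} (hx : FamTest d u C x) (i j : Fin n) (σ : S) : ‖x i j σ‖ ≤ C := by
  obtain ⟨U, V, s, hU, hV, hs, h⟩ := exists_family_pw
    (fun τ : ({σ} : Finset S) => x i j τ) (by linarith : 0 < 2 * u)
  have key := hx.weight_rpow_le hu i j {σ} hU hV hs h
  have hσ : σ ∈ ({σ} : Finset S) := Finset.mem_singleton_self σ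
  rw [Finset.univ_unique, Finset.sum_singleton] at key
  have h1 := h ⟨σ, hσ⟩
  simp only at h1
  rw [h1]
  refine (norm_pw_le_rpow (hU _) (hV _) (hs _) (by linarith)).trans (le_trans ?_ key)
  have hs0 : 0 ≤ ∑ k, s ⟨σ, hσ⟩ k := Finset.sum_nonneg fun k _ => hs _ k
  refine Real.rpow_le_rpow hs0 ?_ (by linarith)
  have h2 : (1 : ℝ) ≤ d σ := Nat.one_le_cast.2 (hd σ)
  exact le_mul_of_one_le_left hs0 h2

end FamTest

lemma norm_amp_le_of_mem_SB {ι κ : Type*} [Fintype ι] [DecidableEq ι] [Fintype κ] [DecidableEq κ]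
    {u : ℝ} (hu : 0 ≤ u) {a : Matrix ι ι ℂ} (ha : a ∈ SB ι u) : ‖amp κ a‖ ≤ 1 := by
  obtain ⟨U, hU, V, hV, s, hs, hs1, rfl⟩ := ha
  rw [amp_pw]
  refine (norm_mul_mul_le (norm_unitary_le (amp_mem_unitaryGroup hU))
    (norm_unitary_le (amp_mem_unitaryGroup hV))).trans (norm_diagonal_le zero_le_one fun i => ?_)
  refine (norm_zp_le (hs _) _).trans ?_
  rw [Complex.ofReal_re]
  exact Real.rpow_le_one (hs _)
    ((Finset.single_le_sum (fun i _ => hs i) (Finset.mem_univ i.1)).trans hs1) hu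

/-! ### Interpolation norms on the Σ side -/

section FamInterp

variable {S : Type*} {d : S → ℕ} {n : ℕ}

variable (d) in
/-- The matrix norms of `ℒ^∞(Σ)`. -/
abbrev famN₀ (n : ℕ) : (Fin n → Fin n → FamInf d) → ℝ≥0∞ :=
  fun w => matNormFamInf d n (fun i j σ => w i j σ)

variable (d) in
/-- The matrix norms of `ℒ^1(Σ)`. -/
abbrev famN₁ (n : ℕ) : (Fin n → Fin n → FamInf d) → ℝ≥0∞ :=
  fun w => matNormFamOne d n (fun i j σ => w i j σ)

lemma enorm_le_of_entries {v : Fin n → Fin n → FamInf d} {N : ℝ≥0∞}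
    (h : ∀ r : ℝ, 0 ≤ r → N ≤ ENNReal.ofReal r → ∀ i j σ, ‖v i j σ‖ ≤ r) :
    ‖v‖ₑ ≤ ENNReal.ofReal 1 * N := by
  rw [ENNReal.ofReal_one, one_mul]
  by_cases hN : N = ∞
  · rw [hN]; exact le_top
  have h1 := h N.toReal ENNReal.toReal_nonneg (ENNReal.ofReal_toReal hN).ge
  rw [← ENNReal.ofReal_toReal hN, ← ofReal_norm]
  refine ENNReal.ofReal_le_ofReal ?_
  refine (pi_norm_le_iff_of_nonneg ENNReal.toReal_nonneg).2 fun i =>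
    (pi_norm_le_iff_of_nonneg ENNReal.toReal_nonneg).2 fun j =>
      lp.norm_le_of_forall_le ENNReal.toReal_nonneg fun σ => h1 i j σ

lemma enorm_le_famN₀ (v : Fin n → Fin n → FamInf d) : ‖v‖ₑ ≤ ENNReal.ofReal 1 * famN₀ d n v := by
  refine enorm_le_of_entries fun r hr h i j σ => ?_
  have h1 := (le_iSup (fun σ => ‖famBlock d (fun i j σ => v i j σ) σ‖ₑ) σ).trans h
  rw [← ofReal_norm, ENNReal.ofReal_le_ofReal_iff hr] at h1
  exact (norm_block_le (famBlock d (fun i j σ => v i j σ) σ) i j).trans h1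

lemma enorm_le_famN₁ (hd : ∀ σ, 0 < d σ) (v : Fin n → Fin n → FamInf d) :
    ‖v‖ₑ ≤ ENNReal.ofReal 1 * famN₁ d n v :=
  enorm_le_of_entries fun _ hr h i j σ =>
    (famTest_half_of_matNormFamOne_le d hr h).norm_le (by norm_num) hd i j σ

/-- Extension by zero of a finite family. -/
def famExtend (d : S → ℕ) (n : ℕ) (F : Finset S) :
    ((σ : F) → Matrix (Fin n × Fin (d σ)) (Fin n × Fin (d σ)) ℂ) →ₗ[ℂ]
      (Fin n → Fin n → FamInf d) := by
  classical
  exact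
  { toFun := fun w i j => ⟨fun σ => if h : σ ∈ F then Matrix.of fun s t => w ⟨σ, h⟩ (i, s) (j, t)
      else 0, memℓp_infty ⟨‖w‖, by
        rintro _ ⟨σ, rfl⟩
        beta_reduce
        split_ifs with h
        · exact (norm_block_le (w ⟨σ, h⟩) i j).trans (norm_le_pi_norm w _)
        · simp⟩⟩
    map_add' := fun v w => by
      ext i j σ s t
      simp only [Pi.add_apply, lp.coeFn_add]
      split_ifs <;> simp
    map_smul' := fun k w => by
      ext i j σ s t
      simp only [Pi.smul_apply, lp.coeFn_smul, RingHom.id_apply]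
      split_ifs <;> simp }

lemma famExtend_of_mem {F : Finset S}
    (w : (σ : F) → Matrix (Fin n × Fin (d σ)) (Fin n × Fin (d σ)) ℂ) (σ : F) :
    famBlock d (fun i j σ => famExtend d n F w i j σ) σ = w σ := by
  ext p q
  simp [famExtend, famBlock]

lemma famExtend_of_notMem {F : Finset S}
    (w : (σ : F) → Matrix (Fin n × Fin (d σ)) (Fin n × Fin (d σ)) ℂ) {σ : S} (hσ : σ ∉ F)
    (i j : Fin n) : famExtend d n F w i j σ = 0 := by
  simp [famExtend, hσ]

lemma famN₀_famExtend_le {F : Finset S}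
    (w : (σ : F) → Matrix (Fin n × Fin (d σ)) (Fin n × Fin (d σ)) ℂ) {C : ℝ}
    (h : ∀ σ, ‖w σ‖ ≤ C) : famN₀ d n (famExtend d n F w) ≤ ENNReal.ofReal C := by
  refine iSup_le fun σ => ?_
  change ‖famBlock d (fun i j σ => famExtend d n F w i j σ) σ‖ₑ ≤ _
  by_cases hσ : σ ∈ F
  · rw [famExtend_of_mem w ⟨σ, hσ⟩, ← ofReal_norm]
    exact ENNReal.ofReal_le_ofReal (h ⟨σ, hσ⟩)
  · have : famBlock d (fun i j σ => famExtend d n F w i j σ) σ = 0 := by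
      ext p q
      simp [famBlock, famExtend_of_notMem w hσ]
    rw [this, enorm_zero]
    exact zero_le

lemma famN₁_famExtend_le {F : Finset S}
    (w : (σ : F) → Matrix (Fin n × Fin (d σ)) (Fin n × Fin (d σ)) ℂ) {C : ℝ}
    (h : ∀ (m : ℕ) (Y : (σ : F) → Matrix (Fin m × Fin (d σ)) (Fin m × Fin (d σ)) ℂ),
      (∀ σ, ‖Y σ‖ ≤ 1) → ‖pairing (fun σ : F => (d σ : ℝ)) w Y‖ ≤ C) :
    famN₁ d n (famExtend d n F w) ≤ ENNReal.ofReal C := by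
  classical
  refine iSup_le fun F' => iSup_le fun m => iSup_le fun y => iSup_le fun hy => ?_
  have hy' (σ : S) : ‖famBlock d y σ‖ ≤ 1 := by
    have h1 := (le_iSup (fun σ => ‖famBlock d y σ‖ₑ) σ).trans hy
    rwa [← ofReal_norm, ← ENNReal.ofReal_one, ENNReal.ofReal_le_ofReal_iff zero_le_one] at h1
  -- Only indices in both finite sets contribute: outside `F` the extended family vanishes, and
  -- outside `F'` the test family is replaced by 0.
  let Y (σ : F) : Matrix (Fin m × Fin (d σ)) (Fin m × Fin (d σ)) ℂ :=
    if (σ : S) ∈ F' then famBlock d y σ else 0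
  have hY (σ : F) : ‖Y σ‖ ≤ 1 := by
    simp only [Y]
    split_ifs
    · exact hy' σ
    · simp
  have heq : (Matrix.of fun a b => ∑ σ ∈ F', (d σ : ℂ) *
      ∑ s, ∑ t, famExtend d n F w a.1 b.1 σ s t * y a.2 b.2 σ s t :
        Matrix (Fin n × Fin m) (Fin n × Fin m) ℂ) = pairing (fun σ : F => (d σ : ℝ)) w Y := by
    ext p q
    simp only [pairing, Matrix.of_apply]
    have h1 (σ : F) : ((d σ : ℝ) : ℂ) * ∑ s, ∑ t, w σ (p.1, s) (q.1, t) * Y σ (p.2, s) (q.2, t)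
        = if (σ : S) ∈ F' then (d σ : ℂ) * ∑ s, ∑ t, famExtend d n F w p.1 q.1 σ s t *
          y p.2 q.2 σ s t else 0 := by
      split_ifs with h2
      · simp only [Y, if_pos h2, Complex.ofReal_natCast]
        conv_lhs => rw [← famExtend_of_mem w σ]
        rfl
      · simp [Y, h2]
    rw [Finset.sum_congr rfl fun σ _ => h1 σ, Finset.sum_coe_sort F (fun σ => if σ ∈ F' then
      (d σ : ℂ) * ∑ s, ∑ t, famExtend d n F w p.1 q.1 σ s t * y p.2 q.2 σ s t else 0),
      Finset.sum_ite_mem]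
    refine (Finset.sum_subset Finset.inter_subset_right fun σ h2 h3 => ?_).symm
    have h4 : σ ∉ F := fun h => h3 (Finset.mem_inter.2 ⟨h, h2⟩)
    simp [famExtend_of_notMem w h4]
  rw [heq, ← ofReal_norm]
  exact ENNReal.ofReal_le_ofReal (h m Y hY)

/-- The analytic family produced by the extremals, extended by zero, is an admissible Calderon
function with both boundary norms at most C'. -/
lemma interpNorm_famExtend_le (hd : ∀ σ, 0 < d σ) (F : Finset S) {u : ℝ} (hu0 : 0 < u)
    (hu1 : u < 1 / 2) {C C' : ℝ} (hC : 0 ≤ C) (hCC' : C < C')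
    {w : (σ : F) → Matrix (Fin n × Fin (d σ)) (Fin n × Fin (d σ)) ℂ}
    (hw : ∀ a ∈ SB (Fin n) u, ∀ b ∈ SB (Fin n) u, ∀ Y ∈ FB (fun σ : F => (d σ : ℝ)) (1 - 2 * u),
      ‖theta (fun σ : F => (d σ : ℝ)) a b w Y‖ ≤ C) :
    interpNorm (famN₀ d n) (famN₁ d n) (2 * u) (famExtend d n F w) ≤ ENNReal.ofReal C' := by
  classical
  have hc (σ : F) : (0 : ℝ) < d σ := Nat.cast_pos.2 (hd σ)
  obtain ⟨W, hW, hWu, hW0, hW1⟩ := exists_analytic_family hc hu0 hu1 hC hCC' hw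
  set D : ℝ := ∑ σ : F, (d σ : ℝ) * Fintype.card (Fin (d σ)) + 1 with hD
  have hD1 : 1 ≤ D := by
    have : 0 ≤ ∑ σ : F, (d σ : ℝ) * Fintype.card (Fin (d σ)) :=
      Finset.sum_nonneg fun σ _ => mul_nonneg (hc σ).le (Nat.cast_nonneg _)
    linarith
  have hcal : IsCalderon (famN₀ d n) (famN₁ d n) fun z => famExtend d n F (W z) := by
    refine isCalderon_of_stripM (K := ENNReal.ofReal D) ENNReal.ofReal_ne_top (famExtend d n F)
      (fun w => ?_) (fun w => ?_) hW
    · rw [← ofReal_norm, ← ENNReal.ofReal_mul (by linarith)]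
      exact famN₀_famExtend_le w fun σ => (norm_le_pi_norm w σ).trans
        (le_mul_of_one_le_left (norm_nonneg _) hD1)
    · rw [← ofReal_norm, ← ENNReal.ofReal_mul (by linarith)]
      exact famN₁_famExtend_le w fun m Y hY => norm_pairing_le_crude (fun σ => (hc σ).le) w hY
  refine iInf_le_of_le _ (iInf_le_of_le hcal (iInf_le_of_le (by rw [hWu]) ?_))
  exact max_le (iSup_le fun t => famN₀_famExtend_le _ (hW0 t))
    (iSup_le fun t => famN₁_famExtend_le _ (hW1 t))

/-- The converse estimate to `weight_rpow_le_of_test`: by Hölder, a family of small Schatten norm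
has a small test form. This is how the tails are controlled. -/
lemma theta_le_weight_rpow {ι J : Type*} [Fintype ι] [DecidableEq ι] [Fintype J]
    {κ : J → Type*} [∀ j, Fintype (κ j)] [∀ j, DecidableEq (κ j)] {c : J → ℝ} (hc : ∀ j, 0 ≤ c j)
    {u : ℝ} (hu0 : 0 ≤ u) (hu1 : 2 * u ≤ 1) {a b : Matrix ι ι ℂ} (ha : a ∈ SB ι u)
    (hb : b ∈ SB ι u) {X Y : (j : J) → Matrix (ι × κ j) (ι × κ j) ℂ} (hY : Y ∈ FB c (1 - 2 * u))
    {U V : (j : J) → Matrix (ι × κ j) (ι × κ j) ℂ} {s : (j : J) → ι × κ j → ℝ}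
    (hU : ∀ j, U j ∈ Matrix.unitaryGroup _ ℂ) (hV : ∀ j, V j ∈ Matrix.unitaryGroup _ ℂ)
    (hs : ∀ j i, 0 ≤ s j i) (hX : ∀ j, X j = pw (U j) (V j) (s j) ((2 * u : ℝ) : ℂ)) :
    ‖theta c a b X Y‖ ≤ (∑ j, c j * ∑ i, s j i) ^ (2 * u) := by
  rw [theta]
  simp only [hX]
  exact norm_sum_trace_le_rpow hc (by linarith) hu1 hY hU hV hs
    (fun j => norm_amp_le_of_mem_SB hu0 ha) (fun j => norm_amp_le_of_mem_SB hu0 hb)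

/-- `T σ` is d_σ times the (1/(2u))-th power of the Schatten norm of the block at σ. Testing with
scalars bounds all its finite sums by one constant depending on n, which is harmless because only
summability is wanted. -/
lemma FamTest.exists_summable {u C : ℝ} (hu : 0 < u) {x : Fin n → Fin n → Fam d}
    (hx : FamTest d u C x) : ∃ T : S → ℝ, Summable T ∧ (∀ σ, 0 ≤ T σ) ∧
      (∀ σ, 0 < d σ → T σ = 0 → famBlock d x σ = 0) ∧
      ∃ U V : (σ : S) → Matrix (Fin n × Fin (d σ)) (Fin n × Fin (d σ)) ℂ,
      ∃ s : (σ : S) → Fin n × Fin (d σ) → ℝ, (∀ σ, U σ ∈ Matrix.unitaryGroup _ ℂ) ∧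
      (∀ σ, V σ ∈ Matrix.unitaryGroup _ ℂ) ∧ (∀ σ i, 0 ≤ s σ i) ∧
      (∀ σ, famBlock d x σ = pw (U σ) (V σ) (s σ) ((2 * u : ℝ) : ℂ)) ∧
      ∀ σ, T σ = d σ * ∑ i, s σ i := by
  choose U hU V hV s hs h using fun σ => exists_pw (famBlock d x σ) (by linarith : 0 < 2 * u)
  have hs' (σ) : 0 ≤ ∑ i, s σ i := Finset.sum_nonneg fun i _ => hs σ i
  refine ⟨fun σ => d σ * ∑ i, s σ i, ?_, fun σ => mul_nonneg (Nat.cast_nonneg _) (hs' σ),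
    fun σ hd hT => ?_, U, V, s, hU, hV, hs, h, fun σ => rfl⟩
  · refine summable_of_sum_le (c := (C * (n : ℝ) ^ (2 * u)) ^ (2 * u)⁻¹)
      (fun σ => mul_nonneg (Nat.cast_nonneg _) (hs' σ)) fun F => ?_
    rcases Nat.eq_zero_or_pos n with rfl | hn
    · simp only [Finset.univ_eq_empty, Finset.sum_empty, mul_zero, Finset.sum_const_zero]
      rw [CharP.cast_eq_zero, Real.zero_rpow (by linarith), mul_zero,
        Real.zero_rpow (by positivity)]
    · have : Nonempty (Fin n) := ⟨⟨0, hn⟩⟩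
      have hc (σ : F) : (0 : ℝ) ≤ d σ := Nat.cast_nonneg _
      have key := weight_rpow_le_of_test hc hu (hx F) (fun σ : F => hU σ) (fun σ : F => hV σ)
        (fun σ : F => hs σ) (fun σ : F => h σ)
      rw [Fintype.card_fin] at key
      have h0 := weight_nonneg hc (fun σ : F => hs σ)
      have := Real.rpow_le_rpow (Real.rpow_nonneg h0 _) key (inv_nonneg.2 (by linarith : 0 ≤ 2 * u))
      rw [← Real.rpow_mul h0, mul_inv_cancel₀ (by linarith), Real.rpow_one] at this
      rwa [← Finset.sum_coe_sort F]
  · have h1 : ∑ i, s σ i = 0 := by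
      have : (d σ : ℝ) ≠ 0 := Nat.cast_ne_zero.2 hd.ne'
      simpa [this] using hT
    have h2 (i) : s σ i = 0 := (Finset.sum_eq_zero_iff_of_nonneg fun i _ => hs σ i).1 h1 i
      (Finset.mem_univ i)
    rw [h]
    ext p q
    simp [pw_apply, h2, zp_zero]

/-- The test form bounds the interpolation norm of `M_n(ℒ^p(Σ))`. -/
theorem FamTest.matNormFam_le (hd : ∀ σ, 0 < d σ) {p : ℝ≥0∞} (hp1 : p ≠ 1) (hp : p ≠ ∞) {u : ℝ}
    (hu0 : 0 < u) (hu1 : u < 1 / 2) (hpu : p.toReal⁻¹ = 2 * u) {C : ℝ} (hC : 0 ≤ C)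
    {x : Matrix (Fin n) (Fin n) (Fam d)} (hx : FamTest d u C (fun i j => x i j)) :
    matNormFam d p n x ≤ ENNReal.ofReal C := by
  classical
  refine ENNReal.le_of_forall_pos_le_add fun ε hε _ => ?_
  obtain ⟨T, hT, hT0, hTx, U, V, s, hU, hV, hs, hXs, hTs⟩ := hx.exists_summable hu0
  set e : ℕ → ℝ := fun k => ε / 2 / 2 ^ k with he
  have hε' : (0 : ℝ) < ε := hε
  have he0 (k) : 0 < e k := by simp only [he]; positivity
  -- Finite sets of indices outside `G k` have so small a total weight that their test form is at
  -- most e_{k+1}/2.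
  have hG (k : ℕ) : ∃ G : Finset S, ∀ t : Finset S, Disjoint t G →
      (∑ σ ∈ t, T σ) ^ (2 * u) ≤ e (k + 1) / 2 := by
    have hδ : 0 < (e (k + 1) / 2) ^ (2 * u)⁻¹ := Real.rpow_pos_of_pos (half_pos (he0 _)) _
    obtain ⟨G, hG⟩ := summable_iff_vanishing_norm.1 hT _ hδ
    refine ⟨G, fun t ht => ?_⟩
    have h0 : 0 ≤ ∑ σ ∈ t, T σ := Finset.sum_nonneg fun σ _ => hT0 σ
    have h1 := (hG t ht).le
    rw [Real.norm_of_nonneg h0] at h1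
    have h2 := Real.rpow_le_rpow h0 h1 (by linarith : 0 ≤ 2 * u)
    rwa [← Real.rpow_mul (half_pos (he0 _)).le, inv_mul_cancel₀ (by linarith), Real.rpow_one] at h2
  choose G hG using hG
  -- The pieces are made disjoint. The first carries the bound C; each later one avoids the previous
  -- `G` and therefore has small norm.
  let P (k : ℕ) : Finset S := G k \ (Finset.range k).biUnion G
  let v (k : ℕ) : Fin n → Fin n → FamInf d :=
    famExtend d n (P k) fun σ => famBlock d (fun i j => x i j) σ
  have hP (k l : ℕ) (σ : S) (hk : σ ∈ P k) (hl : σ ∈ P l) : k = l := by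
    simp only [P, Finset.mem_sdiff, Finset.mem_biUnion, Finset.mem_range, not_exists, not_and]
      at hk hl
    by_contra hne
    rcases lt_or_gt_of_ne hne with h | h
    · exact hl.2 k h hk.1
    · exact hk.2 l h hl.1
  have hv (k : ℕ) : interpNorm (famN₀ d n) (famN₁ d n) (2 * u) (v k)
      ≤ ENNReal.ofReal (if k = 0 then C else 0) + ENNReal.ofReal (e k) := by
    rcases k with _ | k
    · rw [if_pos rfl, ← ENNReal.ofReal_add hC (he0 _).le]
      exact interpNorm_famExtend_le hd _ hu0 hu1 hC (by linarith [he0 0]) (hx (P 0))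
    · rw [if_neg (Nat.succ_ne_zero k), ENNReal.ofReal_zero, zero_add]
      have hk := he0 (k + 1)
      refine interpNorm_famExtend_le hd _ hu0 hu1 (half_pos hk).le (half_lt_self hk)
        fun a ha b hb Y hY => ?_
      refine (theta_le_weight_rpow (fun σ => Nat.cast_nonneg _) hu0.le (by linarith) ha hb hY
        (fun σ : P (k + 1) => hU σ) (fun σ : P (k + 1) => hV σ) (fun σ : P (k + 1) => hs σ)
        (fun σ : P (k + 1) => hXs σ)).trans ?_
      simp only [← hTs]
      rw [Finset.sum_coe_sort (P (k + 1)) T]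
      refine hG k _ (Finset.disjoint_left.2 fun σ h1 h2 => ?_)
      simp only [P, Finset.mem_sdiff, Finset.mem_biUnion, Finset.mem_range, not_exists,
        not_and] at h1
      exact h1.2 k (Nat.lt_succ_self k) h2
  have hsum : ∑' k, (ENNReal.ofReal (if k = 0 then C else 0) + ENNReal.ofReal (e k))
      = ENNReal.ofReal C + ε := by
    rw [ENNReal.tsum_add]
    congr 1
    · rw [tsum_eq_single 0 fun k hk => by simp [hk]]
      simp
    · rw [← ENNReal.ofReal_tsum_of_nonneg (fun k => (he0 k).le) (summable_geometric_two' _),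
        tsum_geometric_two', ENNReal.ofReal_coe_nnreal]
  have hfin : ∑' k, interpNorm (famN₀ d n) (famN₁ d n) (2 * u) (v k) ≤ ENNReal.ofReal C + ε :=
    (ENNReal.tsum_le_tsum hv).trans hsum.le
  have hvs : Summable v := by
    refine Summable.of_norm ?_
    have h1 : ∑' k, ‖v k‖ₑ ≠ ∞ := by
      refine ((ENNReal.tsum_le_tsum fun k => ?_).trans hfin).trans_lt
        (ENNReal.add_lt_top.2 ⟨ENNReal.ofReal_lt_top, ENNReal.coe_lt_top⟩) |>.ne
      have := enorm_le_interpNorm zero_lt_one enorm_le_famN₀ (enorm_le_famN₁ hd)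
        (by linarith : 0 ≤ 2 * u) (by linarith) (v k)
      rwa [ENNReal.ofReal_one, one_mul] at this
    simpa using ENNReal.summable_toReal h1
  have hvx (i j : Fin n) (σ : S) : (∑' k, v k) i j σ = x i j σ := by
    ext a b
    have h1 := (famEntry d i j σ a b).map_tsum hvs
    rw [famEntry_apply] at h1
    rw [h1]
    simp only [famEntry_apply]
    have hmem (k : ℕ) (hk : σ ∈ P k) : v k i j σ a b = x i j σ a b := by
      have := famExtend_of_mem (fun σ : P k => famBlock d (fun i j => x i j) σ) ⟨σ, hk⟩
      exact congr_fun (congr_fun this (i, a)) (j, b)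
    by_cases hσ : ∃ k, σ ∈ P k
    · obtain ⟨k, hk⟩ := hσ
      rw [tsum_eq_single k fun l hl => ?_, hmem k hk]
      have : σ ∉ P l := fun h => hl (hP l k σ h hk)
      simp only [v]
      rw [famExtend_of_notMem _ this]
      rfl
    · have hnot (k : ℕ) : σ ∉ G k := by
        intro hk
        have hex : ∃ k, σ ∈ G k := ⟨k, hk⟩
        refine hσ ⟨Nat.find hex, ?_⟩
        simp only [P, Finset.mem_sdiff, Finset.mem_biUnion, Finset.mem_range, not_exists, not_and]
        exact ⟨Nat.find_spec hex, fun l hl => Nat.find_min hex hl⟩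
      -- An index that lies in no `G k` has weight below every e_{k+1}/2, hence weight 0, and the
      -- matrix vanishes there; the sum of the pieces is thus all of `x`.
      have hTσ : T σ = 0 := by
        by_contra hne
        have hpos : 0 < T σ ^ (2 * u) := Real.rpow_pos_of_pos ((hT0 σ).lt_of_ne (Ne.symm hne)) _
        have hle (k : ℕ) : T σ ^ (2 * u) ≤ e (k + 1) / 2 := by
          simpa using hG k {σ} (Finset.disjoint_singleton_left.2 (hnot k))
        have hlim : Tendsto (fun k => e (k + 1) / 2) atTop (𝓝 (0 / 2)) :=
          ((tendsto_add_atTop_iff_nat 1).2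
            (summable_geometric_two' (ε : ℝ)).tendsto_atTop_zero).div_const 2
        rw [zero_div] at hlim
        exact absurd (ge_of_tendsto' hlim hle) (not_le.2 hpos)
      have hx0 : x i j σ a b = 0 := congr_fun (congr_fun (hTx σ (hd σ) hTσ) (i, a)) (j, b)
      rw [hx0]
      refine (tsum_congr fun k => ?_).trans tsum_zero
      have : σ ∉ P k := fun h => hσ ⟨k, h⟩
      simp only [v]
      rw [famExtend_of_notMem _ this]
      rfl
  rw [matNormFam, if_neg hp, if_neg hp1, hpu]
  refine iInf_le_of_le (∑' k, v k) (iInf_le_of_le hvx ?_)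
  exact (interpNorm_tsum_le (isGauge_matNormFamInf d) (isGauge_matNormFamOne d) zero_le_one
    enorm_le_famN₀ (enorm_le_famN₁ hd) _ v).trans hfin

lemma exists_isCalderon_of_matNormFam_lt {p : ℝ≥0∞} (hp1 : p ≠ 1) (hp : p ≠ ∞)
    {x : Matrix (Fin n) (Fin n) (Fam d)} {η : ℝ≥0∞} (h : matNormFam d p n x < η) :
    ∃ f : ℂ → Fin n → Fin n → FamInf d, IsCalderon (famN₀ d n) (famN₁ d n) f ∧
      (∀ i j σ, f ((p.toReal⁻¹ : ℝ) : ℂ) i j σ = x i j σ) ∧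
      (∀ t : ℝ, famN₀ d n (f (t * Complex.I)) ≤ η) ∧
      ∀ t : ℝ, famN₁ d n (f (1 + t * Complex.I)) ≤ η := by
  rw [matNormFam, if_neg hp, if_neg hp1] at h
  simp only [iInf_lt_iff, interpNorm] at h
  obtain ⟨v, hv, f, hf, hfv, hlt⟩ := h
  refine ⟨f, hf, fun i j σ => by rw [hfv]; exact hv i j σ, fun t => ?_, fun t => ?_⟩
  · exact ((le_iSup (fun t : ℝ => famN₀ d n (f (t * Complex.I))) t).trans
      (le_max_left _ _)).trans hlt.le
  · exact ((le_iSup (fun t : ℝ => famN₁ d n (f (1 + t * Complex.I))) t).trans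
      (le_max_right _ _)).trans hlt.le

end FamInterp

/-! ### The test form for `L^p(Ω)` -/

lemma norm_le_of_submatrix {ι κ : Type*} [Fintype ι] [DecidableEq ι] [Fintype κ] [DecidableEq κ]
    (e : κ ≃ ι) (A : Matrix ι ι ℂ) : ‖A.submatrix e e‖ ≤ ‖A‖ := by
  refine opNorm_le_of_bilin _ (norm_nonneg _) fun x y => ?_
  have h := norm_bilin_le A (x ∘ e.symm) (y ∘ e.symm)
  have hl (x : κ → ℂ) : l2 (x ∘ e.symm) = l2 x := by
    rw [l2, l2, ← Equiv.sum_comp e.symm fun i => ‖x i‖ ^ 2]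
    rfl
  rw [hl, hl] at h
  refine (le_of_eq ?_).trans h
  rw [← Equiv.sum_comp e]
  congr 1
  refine Finset.sum_congr rfl fun i _ => ?_
  rw [← Equiv.sum_comp e]
  simp

lemma norm_entry_le_opNorm {ι : Type*} [Fintype ι] [DecidableEq ι] (A : Matrix ι ι ℂ) (i j : ι) :
    ‖A i j‖ ≤ ‖A‖ := by
  have h := norm_bilin_le A (Pi.single i 1) (Pi.single j 1)
  have hl (i : ι) : l2 (Pi.single i (1 : ℂ)) = 1 := by
    rw [l2, Finset.sum_eq_single i] <;> simp +contextual
  rw [hl, hl, mul_one, mul_one] at h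
  simpa [Pi.single_apply] using h

section OmTest

variable {Ω : Type*} [MeasurableSpace Ω] (μ : Measure Ω) {n : ℕ}

/-- The average of a matrix-valued function. -/
def omAvg (x : Fin n → Fin n → Ω → ℂ) (E : Set Ω) : Matrix (Fin n × Unit) (Fin n × Unit) ℂ :=
  Matrix.of fun a b => ((μ.real E : ℝ) : ℂ)⁻¹ * ∫ ω in E, x a.1 b.1 ω ∂μ

/-- The bound `C` for the test form of the space `M_n(L^r(Ω))`, `u = 1 / (2 r)`. -/
def OmTest (u C : ℝ) (x : Fin n → Fin n → Ω → ℂ) : Prop :=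
  ∀ (J : Type) [Fintype J] (E : J → Set Ω), (∀ j, MeasurableSet (E j)) →
    Pairwise (Function.onFun Disjoint E) → (∀ j, μ (E j) ≠ 0) →
    ∀ a ∈ SB (Fin n) u, ∀ b ∈ SB (Fin n) u,
    ∀ Y ∈ FB (κ := fun _ : J => Fin n × Unit) (fun j => μ.real (E j)) (1 - 2 * u),
      ‖theta (κ := fun _ => Unit) (fun j => μ.real (E j)) a b (fun j => omAvg μ x (E j)) Y‖ ≤ C

variable {μ} [IsProbabilityMeasure μ]

lemma measureReal_pos {E : Set Ω} (h : μ E ≠ 0) : 0 < μ.real E :=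
  ENNReal.toReal_pos h (measure_ne_top _ _)

lemma matNormLinf_le_iff {x : Fin n → Fin n → Ω → ℂ} {C : ℝ} (hC : 0 ≤ C) :
    matNormLinf μ n x ≤ ENNReal.ofReal C ↔
      ∀ᵐ ω ∂μ, ‖(Matrix.of fun i j => x i j ω : Matrix (Fin n) (Fin n) ℂ)‖ ≤ C := by
  have h (A : Matrix (Fin n) (Fin n) ℂ) : ‖A‖ₑ ≤ ENNReal.ofReal C ↔ ‖A‖ ≤ C := by
    rw [← ofReal_norm, ENNReal.ofReal_le_ofReal_iff hC]
  constructor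
  · intro h1
    filter_upwards [ENNReal.ae_le_essSup (μ := μ) fun ω =>
      ‖(Matrix.of fun i j => x i j ω : Matrix (Fin n) (Fin n) ℂ)‖ₑ] with ω hω
    exact (h _).1 (hω.trans h1)
  · intro h1
    refine essSup_le_of_ae_le _ ?_
    filter_upwards [h1] with ω hω
    exact (h _).2 hω

/-- Testing against bounded measurable functions. -/
lemma enorm_integral_le_matNormLone (x : Fin n → Fin n → Ω → ℂ) {m : ℕ}
    {y : Fin m → Fin m → Ω → ℂ} (hy : ∀ k l, Measurable (y k l))
    (hy1 : ∀ᵐ ω ∂μ, ‖(Matrix.of fun k l => y k l ω : Matrix (Fin m) (Fin m) ℂ)‖ ≤ 1) :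
    ‖(Matrix.of fun a b => ∫ ω, x a.1 b.1 ω * y a.2 b.2 ω ∂μ :
      Matrix (Fin n × Fin m) (Fin n × Fin m) ℂ)‖ₑ ≤ matNormLone μ n x := by
  have hmem (k l : Fin m) : MemLp (y k l) ∞ μ := by
    refine memLp_top_of_bound (hy k l).aestronglyMeasurable 1 ?_
    filter_upwards [hy1] with ω hω
    exact (norm_entry_le (Matrix.of fun k l => y k l ω) k l).trans hω
  have hae : ∀ᵐ ω ∂μ, ∀ k l, (hmem k l).toLp (y k l) ω = y k l ω :=
    ae_all_iff.2 fun k => ae_all_iff.2 fun l => (hmem k l).coeFn_toLp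
  have h1 : matNormLinf μ m (fun k l => (hmem k l).toLp (y k l)) ≤ 1 := by
    rw [← ENNReal.ofReal_one, matNormLinf_le_iff zero_le_one]
    filter_upwards [hy1, hae] with ω hω hω'
    simpa only [hω'] using hω
  refine le_iSup_of_le m (le_iSup_of_le (fun k l => (hmem k l).toLp (y k l))
    (le_iSup_of_le h1 (le_of_eq ?_)))
  congr 2
  funext a b
  refine integral_congr_ae ?_
  filter_upwards [hae] with ω hω
  rw [hω]

lemma norm_setIntegral_matrix_le {x : Fin n → Fin n → Ω → ℂ} (hx : ∀ i j, Integrable (x i j) μ)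
    {C : ℝ} (hC : 0 ≤ C)
    (h : ∀ᵐ ω ∂μ, ‖(Matrix.of fun i j => x i j ω : Matrix (Fin n) (Fin n) ℂ)‖ ≤ C) (E : Set Ω) :
    ‖(Matrix.of fun i j => ∫ ω in E, x i j ω ∂μ : Matrix (Fin n) (Fin n) ℂ)‖ ≤ C * μ.real E := by
  refine opNorm_le_of_bilin _ (by positivity) fun ξ ζ => ?_
  have h1 : ∑ i, ∑ j, ξ i * (∫ ω in E, x i j ω ∂μ) * ζ j
      = ∫ ω in E, ∑ i, ∑ j, ξ i * x i j ω * ζ j ∂μ := by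
    have hint (i j : Fin n) : Integrable (fun ω => ξ i * x i j ω * ζ j) (μ.restrict E) :=
      (((hx i j).restrict).const_mul _).mul_const _
    rw [integral_finsetSum _ fun i _ => integrable_finsetSum _ fun j _ => hint i j]
    refine Finset.sum_congr rfl fun i _ => ?_
    rw [integral_finsetSum _ fun j _ => hint i j]
    refine Finset.sum_congr rfl fun j _ => ?_
    rw [integral_mul_const, integral_const_mul]
  simp only [Matrix.of_apply]
  rw [h1]
  refine (norm_setIntegral_le_of_norm_le_const_ae (C := C * (l2 ξ * l2 ζ)) (measure_lt_top _ _)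
    ?_).trans (le_of_eq (by ring))
  refine ae_restrict_of_ae ?_
  filter_upwards [h] with ω hω
  exact (norm_bilin_le (Matrix.of fun i j => x i j ω) ξ ζ).trans
    (mul_le_mul_of_nonneg_right hω (mul_nonneg (l2_nonneg _) (l2_nonneg _)))

/-- Averaging over a set of positive measure is a contraction for matrix-valued functions. -/
lemma norm_omAvg_le {x : Fin n → Fin n → Ω → ℂ} (hx : ∀ i j, Integrable (x i j) μ)
    {C : ℝ} (hC : 0 ≤ C)
    (h : ∀ᵐ ω ∂μ, ‖(Matrix.of fun i j => x i j ω : Matrix (Fin n) (Fin n) ℂ)‖ ≤ C) {E : Set Ω}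
    (hE : μ E ≠ 0) : ‖omAvg μ x E‖ ≤ C := by
  have h1 : omAvg μ x E = ((μ.real E : ℝ) : ℂ)⁻¹ •
      (Matrix.of fun i j => ∫ ω in E, x i j ω ∂μ : Matrix (Fin n) (Fin n) ℂ).submatrix
        (Equiv.prodPUnit (Fin n)) (Equiv.prodPUnit (Fin n)) := by
    ext a b
    simp [omAvg]
  have hpos := measureReal_pos hE
  rw [h1, norm_smul, norm_inv, Complex.norm_real, Real.norm_of_nonneg hpos.le,
    inv_mul_le_iff₀ hpos, mul_comm (μ.real E)]
  exact (norm_le_of_submatrix _ _).trans (norm_setIntegral_matrix_le hx hC h E)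

lemma sum_indicator_of_mem {J : Type*} [Fintype J] {E : J → Set Ω}
    (hE : Pairwise (Function.onFun Disjoint E)) {β : Type*} [AddCommMonoid β] (w : J → β) {j : J}
    {ω : Ω} (hω : ω ∈ E j) : ∑ k, (E k).indicator (fun _ => w k) ω = w j := by
  rw [Finset.sum_eq_single j]
  · exact Set.indicator_of_mem hω _
  · intro k _ hk
    exact Set.indicator_of_notMem (fun h => Set.disjoint_left.1 (hE hk) h hω) _
  · simp

lemma sum_indicator_of_notMem {J : Type*} [Fintype J] {E : J → Set Ω} {β : Type*}
    [AddCommMonoid β] (w : J → β) {ω : Ω} (hω : ∀ j, ω ∉ E j) :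
    ∑ k, (E k).indicator (fun _ => w k) ω = 0 :=
  Finset.sum_eq_zero fun k _ => Set.indicator_of_notMem (hω k) _

lemma norm_step_le {J : Type*} [Fintype J] {E : J → Set Ω}
    (hE : Pairwise (Function.onFun Disjoint E)) {w : J → Matrix (Fin n × Unit) (Fin n × Unit) ℂ}
    {C : ℝ} (hC : 0 ≤ C) (hw : ∀ j, ‖w j‖ ≤ C) (ω : Ω) :
    ‖(Matrix.of fun k l => ∑ j, (E j).indicator (fun _ => w j (k, ()) (l, ())) ω :
      Matrix (Fin n) (Fin n) ℂ)‖ ≤ C := by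
  by_cases hω : ∃ j, ω ∈ E j
  · obtain ⟨j, hj⟩ := hω
    have h1 : (Matrix.of fun k l => ∑ j, (E j).indicator (fun _ => w j (k, ()) (l, ())) ω :
        Matrix (Fin n) (Fin n) ℂ)
        = (w j).submatrix (Equiv.prodPUnit (Fin n)).symm (Equiv.prodPUnit (Fin n)).symm := by
      ext k l
      simp only [Matrix.of_apply]
      rw [sum_indicator_of_mem hE (fun j => w j (k, ()) (l, ())) hj]
      rfl
    rw [h1]
    exact (norm_le_of_submatrix _ _).trans (hw j)
  · push Not at hω
    have h1 : (Matrix.of fun k l => ∑ j, (E j).indicator (fun _ => w j (k, ()) (l, ())) ω :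
        Matrix (Fin n) (Fin n) ℂ) = 0 := by
      ext k l
      exact sum_indicator_of_notMem (fun j => w j (k, ()) (l, ())) hω
    rwa [h1, norm_zero]

lemma integral_mul_sum_indicator {J : Type*} [Fintype J] {E : J → Set Ω}
    (hE : ∀ j, MeasurableSet (E j)) {f : Ω → ℂ} (hf : Integrable f μ) (w : J → ℂ) :
    ∫ ω, f ω * ∑ j, (E j).indicator (fun _ => w j) ω ∂μ = ∑ j, (∫ ω in E j, f ω ∂μ) * w j := by
  have h1 (ω : Ω) : f ω * ∑ j, (E j).indicator (fun _ => w j) ω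
      = ∑ j, (E j).indicator (fun ω => f ω * w j) ω := by
    rw [Finset.mul_sum]
    refine Finset.sum_congr rfl fun j _ => ?_
    by_cases h : ω ∈ E j <;> simp [h]
  simp only [h1]
  rw [integral_finsetSum _ fun j _ => (hf.mul_const _).indicator (hE j)]
  refine Finset.sum_congr rfl fun j _ => ?_
  rw [integral_indicator (hE j), integral_mul_const]

/-- As on the Σ side: the step function with the values Y_j^T is an admissible test matrix over L^∞,
and pairing with it sees only the averages of `x`. -/
lemma omTest_half_of_matNormLone_le {x : Fin n → Fin n → Ω → ℂ} (hx : ∀ i j, Integrable (x i j) μ)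
    {C : ℝ} (hC : 0 ≤ C) (h : matNormLone μ n x ≤ ENNReal.ofReal C) : OmTest μ (1 / 2) C x := by
  classical
  intro J _ E hEm hEd hE0 a ha b hb Y hY
  rw [show (1 : ℝ) - 2 * (1 / 2) = 0 by norm_num] at hY
  refine (norm_theta_le_norm_pairing ha hb _ _).trans ?_
  let y : Fin n → Fin n → Ω → ℂ := fun k l ω =>
    ∑ j, (E j).indicator (fun _ => (Y j)ᵀ (k, ()) (l, ())) ω
  have hym (k l) : Measurable (y k l) :=
    Finset.measurable_fun_sum _ fun j _ => measurable_const.indicator (hEm j)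
  have hy1 (ω : Ω) : ‖(Matrix.of fun k l => y k l ω : Matrix (Fin n) (Fin n) ℂ)‖ ≤ 1 :=
    norm_step_le hEd zero_le_one
      (fun j => (opNorm_transpose_le _).trans (norm_le_of_mem_FB_zero hY j)) ω
  have h2 := (enorm_integral_le_matNormLone x hym (Eventually.of_forall hy1)).trans h
  rw [← ofReal_norm, ENNReal.ofReal_le_ofReal_iff hC] at h2
  refine (le_of_eq ?_).trans h2
  congr 1
  ext p q
  simp only [pairing, Matrix.of_apply, y, Finset.univ_unique, Finset.sum_singleton, omAvg]
  rw [integral_mul_sum_indicator hEm (hx _ _)]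
  refine Finset.sum_congr rfl fun j _ => ?_
  have hpos : ((μ.real (E j) : ℝ) : ℂ) ≠ 0 := Complex.ofReal_ne_zero.2 (measureReal_pos (hE0 j)).ne'
  rw [← mul_assoc, ← mul_assoc, mul_inv_cancel₀ hpos, one_mul]

variable (μ) in
/-- The matrix norms of `L^∞(Ω)` on the matrices over `L^1(Ω)`. -/
abbrev omN₀ (n : ℕ) : (Fin n → Fin n → Lp ℂ 1 μ) → ℝ≥0∞ :=
  fun w => matNormLinf μ n (fun i j => w i j)

variable (μ) in
/-- The matrix norms of `L^1(Ω)`. -/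
abbrev omN₁ (n : ℕ) : (Fin n → Fin n → Lp ℂ 1 μ) → ℝ≥0∞ :=
  fun w => matNormLone μ n (fun i j => w i j)

/-- Pairing an entry with a bounded function. -/
def omPair (i j : Fin n) (y : Lp ℂ ∞ μ) : (Fin n → Fin n → Lp ℂ 1 μ) →L[ℂ] ℂ :=
  (((ContinuousLinearMap.mul ℂ ℂ).lpPairing μ 1 ∞).flip y).comp
    ((ContinuousLinearMap.proj (R := ℂ) (φ := fun _ : Fin n => Lp ℂ 1 μ) j).comp
      (ContinuousLinearMap.proj (R := ℂ) (φ := fun _ : Fin n => Fin n → Lp ℂ 1 μ) i))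

lemma omPair_apply (i j : Fin n) (y : Lp ℂ ∞ μ) (w : Fin n → Fin n → Lp ℂ 1 μ) :
    omPair i j y w = ∫ ω, w i j ω * y ω ∂μ := by
  have := ContinuousLinearMap.lpPairing_eq_integral (ContinuousLinearMap.mul ℂ ℂ) (w i j) y
    (p := 1) (q := ∞) (μ := μ)
  simpa [omPair] using this

lemma omPair_indicator (i j : Fin n) {E : Set Ω} (hE : MeasurableSet E)
    (w : Fin n → Fin n → Lp ℂ 1 μ) :
    omPair i j (indicatorConstLp ∞ hE (measure_ne_top μ E) 1) w = ∫ ω in E, w i j ω ∂μ := by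
  rw [omPair_apply, ← integral_indicator hE]
  refine integral_congr_ae ?_
  filter_upwards [indicatorConstLp_coeFn (p := ∞) (hs := hE) (hμs := measure_ne_top μ E)
    (c := (1 : ℂ))] with ω hω
  rw [hω]
  by_cases h : ω ∈ E <;> simp [h]

lemma integrable_Lp (p : ℝ≥0∞) [Fact (1 ≤ p)] (f : Lp ℂ p μ) : Integrable f μ :=
  (Lp.memLp f).integrable Fact.out

/-- The easy half of the characterization on the Ω side. The averages over fixed sets are continuous
functionals on L^1, so they are bounded holomorphic functions of z. -/
lemma omTest_of_isCalderon {f : ℂ → Fin n → Fin n → Lp ℂ 1 μ}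
    (hf : IsCalderon (omN₀ μ n) (omN₁ μ n) f) {η : ℝ} (hη : 0 ≤ η)
    (h0 : ∀ t : ℝ, omN₀ μ n (f (t * Complex.I)) ≤ ENNReal.ofReal η)
    (h1 : ∀ t : ℝ, omN₁ μ n (f (1 + t * Complex.I)) ≤ ENNReal.ofReal η)
    {θ : ℝ} (hθ0 : 0 ≤ θ) (hθ1 : θ ≤ 1) (τ : ℝ) :
    OmTest μ (θ / 2) η (fun i j => f (θ + τ * Complex.I) i j) := by
  intro J _ E hEm hEd hE0 a ha b hb Y hY
  rw [show θ / 2 = 1 / 2 * θ + 0 by ring] at ha hb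
  rw [show 1 - 2 * (θ / 2) = -1 * θ + 1 by ring] at hY
  have hg (j : J) : StripM fun z => omAvg μ (fun i j => f (z + τ * Complex.I) i j) (E j) :=
    fun p q => by
      have : StripFn fun z => f (z + τ * Complex.I) := hf.translate τ
      have h2 := (StripFn.const ((μ.real (E j) : ℝ) : ℂ)⁻¹).mul
        (this.clm (omPair p.1 q.1 (indicatorConstLp ∞ (hEm j) (measure_ne_top μ _) 1)))
      simp only [omPair_indicator] at h2
      exact h2
  have h2 (t : ℝ) : (t : ℂ) * Complex.I + τ * Complex.I = ((t + τ : ℝ) : ℂ) * Complex.I := by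
    push_cast; ring
  have h3 (t : ℝ) : 1 + (t : ℂ) * Complex.I + τ * Complex.I
      = 1 + ((t + τ : ℝ) : ℂ) * Complex.I := by
    push_cast; ring
  have key := theta_three_lines (κ := fun _ : J => Unit) (c := fun j => μ.real (E j))
    (g := fun z j => omAvg μ (fun i j => f (z + τ * Complex.I) i j) (E j)) hg
    (C₀ := η) (C₁ := η) (α := 1 / 2) (β := 0) (α' := -1) (β' := 1)
    ?_ ?_ hθ0 hθ1 ha hb hY
  · refine key.trans (le_of_eq ?_)
    rw [← Real.rpow_add_of_nonneg hη (by linarith) hθ0, sub_add_cancel, Real.rpow_one]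
  · intro t a ha b hb Y hY
    refine norm_theta_le_of_norm_le (fun j => measureReal_nonneg) ha hb hY hη fun j => ?_
    rw [h2]
    exact norm_omAvg_le (fun i j => integrable_Lp 1 _) hη
      ((matNormLinf_le_iff hη).1 (h0 (t + τ))) (hE0 j)
  · intro t a ha b hb Y hY
    rw [add_zero] at ha hb
    rw [h3]
    exact omTest_half_of_matNormLone_le (fun i j => integrable_Lp 1 _) hη (h1 (t + τ)) J E hEm hEd
      hE0 a ha b hb Y (by rwa [show (1 : ℝ) - 2 * (1 / 2) = -1 + 1 by norm_num])

lemma enorm_le_of_omEntries {v : Fin n → Fin n → Lp ℂ 1 μ} {N : ℝ≥0∞}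
    (h : ∀ i j, ‖v i j‖ₑ ≤ N) : ‖v‖ₑ ≤ ENNReal.ofReal 1 * N := by
  rw [ENNReal.ofReal_one, one_mul]
  by_cases hN : N = ∞
  · rw [hN]; exact le_top
  rw [← ENNReal.ofReal_toReal hN, ← ofReal_norm]
  refine ENNReal.ofReal_le_ofReal ?_
  refine (pi_norm_le_iff_of_nonneg ENNReal.toReal_nonneg).2 fun i =>
    (pi_norm_le_iff_of_nonneg ENNReal.toReal_nonneg).2 fun j => ?_
  have := ENNReal.toReal_mono hN (h i j)
  rwa [toReal_enorm] at this

lemma enorm_entry_le_omN₀ (v : Fin n → Fin n → Lp ℂ 1 μ) (i j : Fin n) :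
    ‖v i j‖ₑ ≤ omN₀ μ n v := by
  rw [Lp.enorm_def]
  refine (eLpNorm_le_eLpNorm_of_exponent_le le_top (Lp.aestronglyMeasurable _)).trans ?_
  rw [eLpNorm_exponent_top]
  refine essSup_mono_ae (Eventually.of_forall fun ω => ?_)
  exact enorm_le_iff_norm_le.2 (norm_entry_le (Matrix.of fun i j => v i j ω) i j)

lemma enorm_le_omN₀ (v : Fin n → Fin n → Lp ℂ 1 μ) : ‖v‖ₑ ≤ ENNReal.ofReal 1 * omN₀ μ n v :=
  enorm_le_of_omEntries (enorm_entry_le_omN₀ v)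

lemma enorm_le_omN₁ (v : Fin n → Fin n → Lp ℂ 1 μ) : ‖v‖ₑ ≤ ENNReal.ofReal 1 * omN₁ μ n v := by
  refine enorm_le_of_omEntries fun i j => ?_
  let g : Ω → ℂ := (Lp.aestronglyMeasurable (v i j)).mk _
  have hg : StronglyMeasurable g := (Lp.aestronglyMeasurable (v i j)).stronglyMeasurable_mk
  have hgv : v i j =ᵐ[μ] g := (Lp.aestronglyMeasurable (v i j)).ae_eq_mk
  -- The 1 × 1 test function is the conjugate phase of the entry, with value 0 where the entry
  -- vanishes, so that the pairing gives its L^1 norm.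
  let y : Fin 1 → Fin 1 → Ω → ℂ := fun _ _ ω => starRingEnd ℂ (g ω) / ‖g ω‖
  have hy (k l) : Measurable (y k l) :=
    (Complex.continuous_conj.measurable.comp hg.measurable).div
      (Complex.continuous_ofReal.measurable.comp hg.measurable.norm)
  have hy1 (ω : Ω) : ‖(Matrix.of fun k l => y k l ω : Matrix (Fin 1) (Fin 1) ℂ)‖ ≤ 1 := by
    have : (Matrix.of fun k l => y k l ω : Matrix (Fin 1) (Fin 1) ℂ)
        = Matrix.diagonal fun _ => starRingEnd ℂ (g ω) / ‖g ω‖ := by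
      ext k l
      rw [Subsingleton.elim l k]
      simp [y]
    rw [this]
    refine norm_diagonal_le zero_le_one fun _ => ?_
    rw [norm_div, RCLike.norm_conj, Complex.norm_real, norm_norm]
    exact div_self_le_one _
  refine le_trans ?_ (enorm_integral_le_matNormLone (fun i j => v i j) hy (Eventually.of_forall hy1))
  have h1 : ∫ ω, v i j ω * y 0 0 ω ∂μ = ((∫ ω, ‖v i j ω‖ ∂μ : ℝ) : ℂ) := by
    rw [← integral_complex_ofReal]
    refine integral_congr_ae ?_
    filter_upwards [hgv] with ω hω
    simp only [y, hω]
    by_cases h0 : g ω = 0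
    · simp [h0]
    · have h2 : (‖g ω‖ : ℂ) ≠ 0 := Complex.ofReal_ne_zero.2 (norm_ne_zero_iff.2 h0)
      rw [mul_div_assoc', Complex.mul_conj', pow_two, mul_div_assoc, div_self h2, mul_one]
  have h2 := norm_entry_le_opNorm (Matrix.of fun a b => ∫ ω, v a.1 b.1 ω * y a.2 b.2 ω ∂μ :
      Matrix (Fin n × Fin 1) (Fin n × Fin 1) ℂ) (i, 0) (j, 0)
  rw [Matrix.of_apply, h1, Complex.norm_real] at h2
  rw [← ofReal_norm, ← ofReal_norm, L1.norm_eq_integral_norm]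
  exact ENNReal.ofReal_le_ofReal ((le_abs_self _).trans h2)

/-- The essential supremum is handled pointwise: finite total norm makes the entries absolutely
summable in L^1, so their series converges almost everywhere to its sum in L^1 and the matrix norms
add up pointwise. -/
lemma isGauge_omN₀ : IsGauge (omN₀ μ n) where
  sub_le u v := by
    have hae : ∀ᵐ ω ∂μ, ∀ i j, (u i j - v i j : Lp ℂ 1 μ) ω = u i j ω - v i j ω :=
      ae_all_iff.2 fun i => ae_all_iff.2 fun j => Lp.coeFn_sub _ _
    refine essSup_le_of_ae_le _ ?_
    filter_upwards [hae, ENNReal.ae_le_essSup (μ := μ) fun ω =>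
      ‖(Matrix.of fun i j => u i j ω : Matrix (Fin n) (Fin n) ℂ)‖ₑ,
      ENNReal.ae_le_essSup (μ := μ) fun ω =>
      ‖(Matrix.of fun i j => v i j ω : Matrix (Fin n) (Fin n) ℂ)‖ₑ] with ω h1 h2 h3
    have : (Matrix.of fun i j => (u - v) i j ω : Matrix (Fin n) (Fin n) ℂ)
        = (Matrix.of fun i j => u i j ω) - Matrix.of fun i j => v i j ω := by
      ext i j; exact h1 i j
    rw [this]
    exact enorm_sub_le.trans (add_le_add h2 h3)
  tsum_le v hv := by
    by_cases hfin : ∑' k, omN₀ μ n (v k) = ∞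
    · rw [hfin]; exact le_top
    have hsum (i j : Fin n) : ∑' k, ‖v k i j‖ₑ ≠ ∞ :=
      ((ENNReal.tsum_le_tsum fun k => enorm_entry_le_omN₀ (v k) i j).trans_lt
        (Ne.lt_top hfin)).ne
    have hae : ∀ᵐ ω ∂μ, ∀ i j, HasSum (fun k => v k i j ω) ((∑' k, v k i j : Lp ℂ 1 μ) ω) :=
      ae_all_iff.2 fun i => ae_all_iff.2 fun j => Lp.hasSum_coeFn_tsum (hsum i j)
    have hae2 : ∀ᵐ ω ∂μ, ∀ k, ‖(Matrix.of fun i j => v k i j ω : Matrix (Fin n) (Fin n) ℂ)‖ₑ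
        ≤ omN₀ μ n (v k) := ae_all_iff.2 fun k => ENNReal.ae_le_essSup _
    refine essSup_le_of_ae_le _ ?_
    filter_upwards [hae, hae2] with ω h1 h2
    have h3 : (Matrix.of fun i j => (∑' k, v k) i j ω : Matrix (Fin n) (Fin n) ℂ)
        = ∑' k, (Matrix.of fun i j => v k i j ω : Matrix (Fin n) (Fin n) ℂ) := by
      refine (HasSum.tsum_eq ?_).symm
      refine Pi.hasSum.2 fun i => Pi.hasSum.2 fun j => ?_
      have h4 : (∑' k, v k) i j = ∑' k, v k i j := by
        rw [tsum_apply hv, tsum_apply (Pi.summable.1 hv i)]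
      simp only [Matrix.of_apply, h4]
      exact h1 i j
    rw [h3]
    exact enorm_tsum_le_tsum_enorm.trans (ENNReal.tsum_le_tsum h2)

lemma isGauge_omN₁ : IsGauge (omN₁ μ n) := by
  refine IsGauge.iSup fun m => IsGauge.iSup fun y => IsGauge.iSup fun _ => ?_
  let T : (Fin n → Fin n → Lp ℂ 1 μ) →L[ℂ] Matrix (Fin n × Fin m) (Fin n × Fin m) ℂ :=
    { toFun := fun w => Matrix.of fun a b => omPair a.1 b.1 (y a.2 b.2) w
      map_add' := fun v w => by ext p q; simp
      map_smul' := fun k w => by ext p q; simp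
      cont := continuous_matrix fun p q => (omPair p.1 q.1 (y p.2 q.2)).continuous }
  have := IsGauge.clm T
  simpa only [T, ContinuousLinearMap.coe_mk', LinearMap.coe_mk, AddHom.coe_mk, omPair_apply]
    using this

end OmTest

/-! ### Step functions and Hölder's inequality on the Ω side -/

section OmInterp

variable {Ω : Type*} [MeasurableSpace Ω] {μ : Measure Ω} [IsProbabilityMeasure μ] {n : ℕ}

/-- Step functions with values in the matrices. -/
def omStep (μ : Measure Ω) [IsProbabilityMeasure μ] (n : ℕ) {J : Type*} [Fintype J] {E : J → Set Ω}
    (hE : ∀ j, MeasurableSet (E j)) :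
    (J → Matrix (Fin n × Unit) (Fin n × Unit) ℂ) →ₗ[ℂ] (Fin n → Fin n → Lp ℂ 1 μ) where
  toFun w i l := ∑ j, w j (i, ()) (l, ()) • indicatorConstLp 1 (hE j) (measure_ne_top μ _) 1
  map_add' v w := by
    ext1 i; ext1 l
    simp [add_smul, Finset.sum_add_distrib]
  map_smul' k w := by
    ext1 i; ext1 l
    simp [Finset.smul_sum, smul_smul]

lemma omStep_ae {J : Type*} [Fintype J] {E : J → Set Ω} (hE : ∀ j, MeasurableSet (E j))
    (w : J → Matrix (Fin n × Unit) (Fin n × Unit) ℂ) : ∀ᵐ ω ∂μ, ∀ i l,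
      omStep μ n hE w i l ω = ∑ j, (E j).indicator (fun _ => w j (i, ()) (l, ())) ω := by
  have h1 : ∀ᵐ ω ∂μ, ∀ i l j, (w j (i, ()) (l, ()) •
      indicatorConstLp 1 (hE j) (measure_ne_top μ (E j)) (1 : ℂ) : Lp ℂ 1 μ) ω
      = (E j).indicator (fun _ => w j (i, ()) (l, ())) ω := by
    refine ae_all_iff.2 fun i => ae_all_iff.2 fun l => ae_all_iff.2 fun j => ?_
    filter_upwards [Lp.coeFn_smul (w j (i, ()) (l, ()))
      (indicatorConstLp 1 (hE j) (measure_ne_top μ (E j)) (1 : ℂ)),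
      indicatorConstLp_coeFn (p := 1) (hs := hE j) (hμs := measure_ne_top μ (E j)) (c := (1 : ℂ))]
      with ω h2 h3
    rw [h2, Pi.smul_apply, h3]
    by_cases h : ω ∈ E j <;> simp [h]
  have h2 : ∀ᵐ ω ∂μ, ∀ i l, omStep μ n hE w i l ω = ∑ j, (w j (i, ()) (l, ()) •
      indicatorConstLp 1 (hE j) (measure_ne_top μ (E j)) (1 : ℂ) : Lp ℂ 1 μ) ω :=
    ae_all_iff.2 fun i => ae_all_iff.2 fun l => Lp.coeFn_fun_finsetSum _ _
  filter_upwards [h1, h2] with ω h3 h4 i l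
  rw [h4]
  exact Finset.sum_congr rfl fun j _ => h3 i l j

lemma omN₀_omStep_le {J : Type*} [Fintype J] {E : J → Set Ω} (hE : ∀ j, MeasurableSet (E j))
    (hEd : Pairwise (Function.onFun Disjoint E)) (w : J → Matrix (Fin n × Unit) (Fin n × Unit) ℂ)
    {C : ℝ} (hC : 0 ≤ C) (h : ∀ j, ‖w j‖ ≤ C) : omN₀ μ n (omStep μ n hE w) ≤ ENNReal.ofReal C := by
  rw [omN₀, matNormLinf_le_iff hC]
  filter_upwards [omStep_ae hE w] with ω hω
  simp only [hω]
  exact norm_step_le hEd hC h ω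

/-- A step function pairs with `y` through the averages of `y` only, and averaging preserves the
unit ball of test matrices. -/
lemma omN₁_omStep_le {J : Type*} [Fintype J] {E : J → Set Ω} (hE : ∀ j, MeasurableSet (E j))
    (hE0 : ∀ j, μ (E j) ≠ 0) (w : J → Matrix (Fin n × Unit) (Fin n × Unit) ℂ) {C : ℝ}
    (h : ∀ (m : ℕ) (Y : J → Matrix (Fin m × Unit) (Fin m × Unit) ℂ), (∀ j, ‖Y j‖ ≤ 1) →
      ‖pairing (κ := fun _ => Unit) (fun j => μ.real (E j)) w Y‖ ≤ C) :
    omN₁ μ n (omStep μ n hE w) ≤ ENNReal.ofReal C := by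
  refine iSup_le fun m => iSup_le fun y => iSup_le fun hy => ?_
  rw [← ENNReal.ofReal_one, matNormLinf_le_iff zero_le_one] at hy
  have hyi (k l : Fin m) : Integrable (y k l) μ := integrable_Lp ∞ _
  have h1 : (Matrix.of fun a b => ∫ ω, omStep μ n hE w a.1 b.1 ω * y a.2 b.2 ω ∂μ :
      Matrix (Fin n × Fin m) (Fin n × Fin m) ℂ) = pairing (κ := fun _ => Unit)
        (fun j => μ.real (E j)) w fun j => omAvg μ (fun k l => y k l) (E j) := by
    ext p q
    have h2 : ∫ ω, omStep μ n hE w p.1 q.1 ω * y p.2 q.2 ω ∂μ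
        = ∫ ω, y p.2 q.2 ω * ∑ j, (E j).indicator (fun _ => w j (p.1, ()) (q.1, ())) ω ∂μ := by
      refine integral_congr_ae ?_
      filter_upwards [omStep_ae hE w] with ω hω
      rw [hω, mul_comm]
    rw [Matrix.of_apply, h2, integral_mul_sum_indicator hE (hyi _ _)]
    simp only [pairing, Matrix.of_apply, Finset.univ_unique, Finset.sum_singleton, omAvg]
    refine Finset.sum_congr rfl fun j _ => ?_
    have hpos : ((μ.real (E j) : ℝ) : ℂ) ≠ 0 :=
      Complex.ofReal_ne_zero.2 (measureReal_pos (hE0 j)).ne'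
    rw [mul_left_comm, ← mul_assoc _ _⁻¹, mul_inv_cancel₀ hpos, one_mul, mul_comm]
  rw [h1, ← ofReal_norm]
  exact ENNReal.ofReal_le_ofReal (h m _ fun j => norm_omAvg_le hyi zero_le_one hy (hE0 j))

lemma interpNorm_omStep_le {J : Type*} [Fintype J] {E : J → Set Ω} (hE : ∀ j, MeasurableSet (E j))
    (hEd : Pairwise (Function.onFun Disjoint E)) (hE0 : ∀ j, μ (E j) ≠ 0) {u : ℝ} (hu0 : 0 < u)
    (hu1 : u < 1 / 2) {C C' : ℝ} (hC : 0 ≤ C) (hCC' : C < C')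
    {w : J → Matrix (Fin n × Unit) (Fin n × Unit) ℂ}
    (hw : ∀ a ∈ SB (Fin n) u, ∀ b ∈ SB (Fin n) u,
      ∀ Y ∈ FB (κ := fun _ : J => Fin n × Unit) (fun j => μ.real (E j)) (1 - 2 * u),
      ‖theta (κ := fun _ => Unit) (fun j => μ.real (E j)) a b w Y‖ ≤ C) :
    interpNorm (omN₀ μ n) (omN₁ μ n) (2 * u) (omStep μ n hE w) ≤ ENNReal.ofReal C' := by
  classical
  have hc (j : J) : 0 < μ.real (E j) := measureReal_pos (hE0 j)
  obtain ⟨W, hW, hWu, hW0, hW1⟩ := exists_analytic_family hc hu0 hu1 hC hCC' hw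
  set D : ℝ := ∑ j, μ.real (E j) * Fintype.card Unit + 1 with hD
  have hD1 : 1 ≤ D := by
    have : 0 ≤ ∑ j, μ.real (E j) * Fintype.card Unit :=
      Finset.sum_nonneg fun j _ => mul_nonneg (hc j).le (Nat.cast_nonneg _)
    linarith
  have hcal : IsCalderon (omN₀ μ n) (omN₁ μ n) fun z => omStep μ n hE (W z) := by
    refine isCalderon_of_stripM (κ := fun _ : J => Unit) (K := ENNReal.ofReal D)
      ENNReal.ofReal_ne_top (omStep μ n hE) (fun w => ?_) (fun w => ?_) hW
    · rw [← ofReal_norm, ← ENNReal.ofReal_mul (by linarith)]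
      exact omN₀_omStep_le hE hEd w (by positivity) fun j => (norm_le_pi_norm w j).trans
        (le_mul_of_one_le_left (norm_nonneg _) hD1)
    · rw [← ofReal_norm, ← ENNReal.ofReal_mul (by linarith)]
      exact omN₁_omStep_le hE hE0 w fun m Y hY =>
        norm_pairing_le_crude (κ := fun _ : J => Unit) (fun j => (hc j).le) w hY
  refine iInf_le_of_le _ (iInf_le_of_le hcal (iInf_le_of_le (by rw [hWu]) ?_))
  exact max_le (iSup_le fun t => omN₀_omStep_le hE hEd _ (by linarith) (hW0 t))
    (iSup_le fun t => omN₁_omStep_le hE hE0 _ (hW1 t))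

/-- Finitely many simple functions are constant on the pieces of a partition. -/
lemma exists_partition (s : Fin n → Fin n → SimpleFunc Ω ℂ) :
    ∃ (J : Type) (_ : Fintype J) (E : J → Set Ω) (w : J → Matrix (Fin n × Unit) (Fin n × Unit) ℂ),
      (∀ j, MeasurableSet (E j)) ∧ Pairwise (Function.onFun Disjoint E) ∧ (∀ j, μ (E j) ≠ 0) ∧
      (∀ᵐ ω ∂μ, ∃ j, ω ∈ E j) ∧ ∀ j, ∀ ω ∈ E j, ∀ i l, s i l ω = w j (i, ()) (l, ()) := by
  classical
  let P (y : Fin n → Fin n → ℂ) : Set Ω := {ω | ∀ i l, s i l ω = y i l}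
  have hP (y) : MeasurableSet (P y) := by
    have : P y = ⋂ i, ⋂ l, s i l ⁻¹' {y i l} := by ext ω; simp [P]
    rw [this]
    exact MeasurableSet.iInter fun i => MeasurableSet.iInter fun l =>
      (s i l).measurableSet_preimage _
  have hfin : (Set.range fun ω => fun i l => s i l ω).Finite := by
    refine Set.Finite.subset (Set.Finite.pi' fun i => Set.Finite.pi' fun l =>
      (s i l).finite_range) ?_
    rintro _ ⟨ω, rfl⟩ i l
    exact ⟨ω, rfl⟩
  -- Level sets of measure zero are discarded: averages and weights require positive measure.
  let R : Set (Fin n → Fin n → ℂ) := {y ∈ Set.range fun ω => fun i l => s i l ω | μ (P y) ≠ 0}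
  have hR : R.Finite := hfin.subset fun y hy => hy.1
  refine ⟨R, hR.fintype, fun y => P y, fun y => Matrix.of fun a b => (y : Fin n → Fin n → ℂ) a.1 b.1,
    fun y => hP y, fun y z hyz => ?_, fun y => y.2.2, ?_, fun y ω hω i l => hω i l⟩
  · refine Set.disjoint_left.2 fun ω h1 h2 => hyz (Subtype.ext ?_)
    funext i l
    exact (h1 i l).symm.trans (h2 i l)
  · have hnull : ∀ᵐ ω ∂μ, ∀ y ∈ Set.range fun ω => fun i l => s i l ω, μ (P y) = 0 → ω ∉ P y := by
      rw [ae_ball_iff hfin.countable]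
      intro y _
      by_cases h : μ (P y) = 0
      · filter_upwards [measure_eq_zero_iff_ae_notMem.1 h] with ω hω _ using hω
      · exact Eventually.of_forall fun ω h' => absurd h' h
    filter_upwards [hnull] with ω hω
    have hmem : ω ∈ P fun i l => s i l ω := fun i l => rfl
    exact ⟨⟨fun i l => s i l ω, ⟨ω, rfl⟩, fun h => hω _ ⟨ω, rfl⟩ h hmem⟩, hmem⟩

lemma omAvg_eq_of_const {x : Fin n → Fin n → Ω → ℂ} {E : Set Ω} (hE : MeasurableSet E)
    (hE0 : μ E ≠ 0) {w : Matrix (Fin n × Unit) (Fin n × Unit) ℂ}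
    (h : ∀ ω ∈ E, ∀ i l, x i l ω = w (i, ()) (l, ())) : omAvg μ x E = w := by
  ext a b
  have hpos : ((μ.real E : ℝ) : ℂ) ≠ 0 := Complex.ofReal_ne_zero.2 (measureReal_pos hE0).ne'
  rw [omAvg, Matrix.of_apply, setIntegral_congr_fun hE fun ω hω => h ω hω a.1 b.1,
    setIntegral_const, Complex.real_smul, ← mul_assoc, inv_mul_cancel₀ hpos, one_mul]

/-- On the partition where the simple functions are constant the averages are their values, so the
finite dimensional construction of a Calderon function applies. -/
lemma interpNorm_simple_le (s : Fin n → Fin n → SimpleFunc Ω ℂ) {u : ℝ} (hu0 : 0 < u)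
    (hu1 : u < 1 / 2) {C C' : ℝ} (hC : 0 ≤ C) (hCC' : C < C')
    (hs : OmTest μ u C (fun i j => s i j)) {v : Fin n → Fin n → Lp ℂ 1 μ}
    (hv : ∀ i j, v i j =ᵐ[μ] s i j) :
    interpNorm (omN₀ μ n) (omN₁ μ n) (2 * u) v ≤ ENNReal.ofReal C' := by
  obtain ⟨J, _, E, w, hE, hEd, hE0, hEu, hw⟩ := exists_partition (μ := μ) s
  have hvw : v = omStep μ n hE w := by
    funext i l
    refine Lp.ext ?_
    filter_upwards [hv i l, omStep_ae hE w, hEu] with ω h1 h2 ⟨j, hj⟩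
    rw [h1, h2, sum_indicator_of_mem hEd (fun j => w j (i, ()) (l, ())) hj, hw j ω hj]
  rw [hvw]
  refine interpNorm_omStep_le hE hEd hE0 hu0 hu1 hC hCC' ?_
  have h := hs J E hE hEd hE0
  have havg (j : J) : omAvg μ (fun i j => s i j) (E j) = w j :=
    omAvg_eq_of_const (hE j) (hE0 j) (hw j)
  simpa only [havg] using h

lemma OmTest.add {x y : Fin n → Fin n → Ω → ℂ} (hxi : ∀ i j, Integrable (x i j) μ)
    (hyi : ∀ i j, Integrable (y i j) μ) {u C C' : ℝ} (hx : OmTest μ u C x) (hy : OmTest μ u C' y) :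
    OmTest μ u (C + C') (fun i j ω => x i j ω + y i j ω) := by
  intro J _ E hE hEd hE0 a ha b hb Y hY
  have h1 (j : J) : omAvg μ (fun i j ω => x i j ω + y i j ω) (E j)
      = omAvg μ x (E j) + omAvg μ y (E j) := by
    ext p q
    simp only [omAvg, Matrix.of_apply, Matrix.add_apply]
    rw [integral_add (hxi _ _).restrict (hyi _ _).restrict, mul_add]
  have h2 : theta (κ := fun _ => Unit) (fun j => μ.real (E j)) a b
      (fun j => omAvg μ (fun i j ω => x i j ω + y i j ω) (E j)) Y
      = theta (κ := fun _ => Unit) (fun j => μ.real (E j)) a b (fun j => omAvg μ x (E j)) Y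
      + theta (κ := fun _ => Unit) (fun j => μ.real (E j)) a b (fun j => omAvg μ y (E j)) Y := by
    simp only [theta, h1, Matrix.add_mul, Matrix.trace_add, mul_add,
      Finset.sum_add_distrib]
  rw [h2]
  exact (norm_add_le _ _).trans
    (add_le_add (hx J E hE hEd hE0 a ha b hb Y hY) (hy J E hE hEd hE0 a ha b hb Y hY))

lemma OmTest.congr {x y : Fin n → Fin n → Ω → ℂ} (h : ∀ i j, x i j =ᵐ[μ] y i j) {u C : ℝ}
    (hx : OmTest μ u C x) : OmTest μ u C y := by
  intro J _ E hE hEd hE0 a ha b hb Y hY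
  have h1 (j : J) : omAvg μ y (E j) = omAvg μ x (E j) := by
    ext p q
    simp only [omAvg, Matrix.of_apply]
    rw [integral_congr_ae (ae_restrict_of_ae (h p.1 q.1))]
  simpa only [h1] using hx J E hE hEd hE0 a ha b hb Y hY

lemma OmTest.mono {x : Fin n → Fin n → Ω → ℂ} {u C C' : ℝ} (hx : OmTest μ u C x) (h : C ≤ C') :
    OmTest μ u C' x :=
  fun J _ E hE hEd hE0 a ha b hb Y hY => (hx J E hE hEd hE0 a ha b hb Y hY).trans h

lemma integral_step {J : Type*} [Fintype J] {E : J → Set Ω} (hE : ∀ j, MeasurableSet (E j))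
    (r : J → ℝ) :
    ∫ ω, ∑ j, (E j).indicator (fun _ => r j) ω ∂μ = ∑ j, μ.real (E j) * r j := by
  rw [integral_finsetSum _ fun j _ => (integrable_const _).indicator (hE j)]
  refine Finset.sum_congr rfl fun j _ => ?_
  rw [integral_indicator (hE j), setIntegral_const, smul_eq_mul]

lemma step_rpow {J : Type*} [Fintype J] {E : J → Set Ω}
    (hEd : Pairwise (Function.onFun Disjoint E)) (r : J → ℝ) {p : ℝ} (hp : p ≠ 0) (ω : Ω) :
    (∑ j, (E j).indicator (fun _ => r j) ω) ^ p = ∑ j, (E j).indicator (fun _ => r j ^ p) ω := by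
  by_cases hω : ∃ j, ω ∈ E j
  · obtain ⟨j, hj⟩ := hω
    rw [sum_indicator_of_mem hEd r hj, sum_indicator_of_mem hEd (fun j => r j ^ p) hj]
  · push Not at hω
    rw [sum_indicator_of_notMem r hω, sum_indicator_of_notMem (fun j => r j ^ p) hω,
      Real.zero_rpow hp]

/-- Hölder's inequality for the test form. -/
lemma omTest_of_memLp {p : ℝ≥0∞} (hp1 : 1 < p) (hp : p ≠ ∞) {u : ℝ} (hpu : p.toReal⁻¹ = 2 * u)
    {x : Fin n → Fin n → Ω → ℂ} (hx : ∀ i j, MemLp (x i j) p μ) :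
    OmTest μ u (∑ i, ∑ j, (eLpNorm (x i j) p μ).toReal) x := by
  intro J _ E hE hEd hE0 a ha b hb Y hY
  have hp1' : 1 < p.toReal := by
    rw [← ENNReal.toReal_one]
    exact (ENNReal.toReal_lt_toReal ENNReal.one_ne_top hp).2 hp1
  have hu0 : 0 < u := by
    have : 0 < p.toReal⁻¹ := by positivity
    linarith
  have hu1 : 2 * u < 1 := by rw [← hpu]; exact inv_lt_one_of_one_lt₀ hp1'
  have hxi (i j) : Integrable (x i j) μ := (hx i j).integrable hp1.le
  obtain ⟨U, V, s, hU, hV, hs, hs1, hYs⟩ := hY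
  have hS (j : J) : 0 ≤ ∑ i, s j i := Finset.sum_nonneg fun i _ => hs j i
  -- `a` and `b` are contractions and are absorbed into the dual family. Hölder is then used entry
  -- by entry; the resulting constant is not sharp but tends to 0 with the entries.
  let B (j : J) : Matrix (Fin n × Unit) (Fin n × Unit) ℂ := amp Unit b * Y j * amp Unit a
  have hB (j : J) (k l) : ‖B j k l‖ ≤ (∑ i, s j i) ^ (1 - 2 * u) := by
    refine (norm_entry_le_opNorm _ k l).trans ((norm_mul_mul_le (norm_amp_le_of_mem_SB hu0.le hb)
      (norm_amp_le_of_mem_SB hu0.le ha)).trans ?_)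
    rw [hYs]
    exact norm_pw_le_rpow (hU j) (hV j) (hs j) (by linarith)
  -- The step function majorizing the entries of the dual family; the normalization of `Y` says that
  -- its norm at the conjugate exponent is at most 1.
  let G (ω : Ω) : ℝ := ∑ j, (E j).indicator (fun _ => (∑ i, s j i) ^ (1 - 2 * u)) ω
  have hGm : Measurable G :=
    Finset.measurable_fun_sum _ fun j _ => measurable_const.indicator (hE j)
  have hG0 (ω) : 0 ≤ G ω := Finset.sum_nonneg fun j _ =>
    Set.indicator_nonneg (fun _ _ => Real.rpow_nonneg (hS j) _) _
  have hconj : p.toReal.HolderConjugate (1 - 2 * u)⁻¹ := by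
    refine Real.holderConjugate_iff.2 ⟨hp1', ?_⟩
    rw [inv_inv, hpu]
    ring
  have hGp : ∫ ω, G ω ^ (1 - 2 * u)⁻¹ ∂μ ≤ 1 := by
    have h0 : (1 - 2 * u)⁻¹ ≠ 0 := inv_ne_zero (by linarith)
    simp only [G, step_rpow hEd _ h0]
    rw [integral_step hE]
    refine (le_of_eq ?_).trans hs1
    refine Finset.sum_congr rfl fun j _ => ?_
    rw [← Real.rpow_mul (hS j), mul_inv_cancel₀ (by linarith), Real.rpow_one]
  have hGle (ω) : G ω ≤ ∑ j, (∑ i, s j i) ^ (1 - 2 * u) := by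
    refine Finset.sum_le_sum fun j _ => ?_
    exact Set.indicator_le_self' (fun _ _ => Real.rpow_nonneg (hS j) _) _
  have hGmem : MemLp G (ENNReal.ofReal (1 - 2 * u)⁻¹) μ := by
    refine MemLp.of_bound hGm.aestronglyMeasurable (∑ j, (∑ i, s j i) ^ (1 - 2 * u))
      (Eventually.of_forall fun ω => ?_)
    rw [Real.norm_of_nonneg (hG0 ω)]
    exact hGle ω
  have hkey (i l : Fin n) : ∑ j, ‖∫ ω in E j, x i l ω ∂μ‖ * (∑ i, s j i) ^ (1 - 2 * u)
      ≤ (eLpNorm (x i l) p μ).toReal := by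
    have h1 : ∑ j, ‖∫ ω in E j, x i l ω ∂μ‖ * (∑ i, s j i) ^ (1 - 2 * u)
        ≤ ∫ ω, ‖x i l ω‖ * G ω ∂μ := by
      have h2 (ω : Ω) : ‖x i l ω‖ * G ω
          = ∑ j, (E j).indicator (fun ω => ‖x i l ω‖ * (∑ i, s j i) ^ (1 - 2 * u)) ω := by
        simp only [G]
        rw [Finset.mul_sum]
        refine Finset.sum_congr rfl fun j _ => ?_
        by_cases h : ω ∈ E j <;> simp [h]
      simp only [h2]
      rw [integral_finsetSum _ fun j _ => ((hxi i l).norm.mul_const _).indicator (hE j)]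
      refine Finset.sum_le_sum fun j _ => ?_
      rw [integral_indicator (hE j), integral_mul_const]
      exact mul_le_mul_of_nonneg_right (norm_integral_le_integral_norm _)
        (Real.rpow_nonneg (hS j) _)
    have h3 := integral_mul_le_Lp_mul_Lq_of_nonneg (μ := μ) hconj
      (Eventually.of_forall fun ω => norm_nonneg (x i l ω)) (Eventually.of_forall hG0)
      (by rw [ENNReal.ofReal_toReal hp]; exact (hx i l).norm) hGmem
    refine h1.trans (h3.trans ?_)
    have h4 : (∫ ω, G ω ^ (1 - 2 * u)⁻¹ ∂μ) ^ (1 / (1 - 2 * u)⁻¹) ≤ 1 := by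
      refine Real.rpow_le_one (integral_nonneg fun ω => Real.rpow_nonneg (hG0 ω) _) hGp ?_
      rw [one_div, inv_inv]
      linarith
    refine (mul_le_of_le_one_right (Real.rpow_nonneg (integral_nonneg fun ω => by positivity) _)
      h4).trans (le_of_eq ?_)
    rw [(hx i l).eLpNorm_eq_integral_rpow_norm (by positivity) hp, ENNReal.toReal_ofReal
      (Real.rpow_nonneg (integral_nonneg fun ω => by positivity) _), one_div]
  have htr (j : J) : (μ.real (E j) : ℂ) * (amp Unit a * omAvg μ x (E j) * amp Unit b * Y j).trace
      = ∑ i, ∑ l, (∫ ω in E j, x i l ω ∂μ) * B j (l, ()) (i, ()) := by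
    have hpos : ((μ.real (E j) : ℝ) : ℂ) ≠ 0 :=
      Complex.ofReal_ne_zero.2 (measureReal_pos (hE0 j)).ne'
    have h1 : (amp Unit a * omAvg μ x (E j) * amp Unit b * Y j).trace
        = (omAvg μ x (E j) * B j).trace := by
      simp only [B]
      rw [Matrix.mul_assoc, Matrix.mul_assoc, Matrix.trace_mul_comm, Matrix.mul_assoc,
        Matrix.mul_assoc]
    rw [h1, Matrix.trace, Finset.mul_sum, Fintype.sum_prod_type]
    refine Finset.sum_congr rfl fun i _ => ?_
    rw [Finset.univ_unique, Finset.sum_singleton, Matrix.diag_apply, Matrix.mul_apply,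
      Fintype.sum_prod_type, Finset.mul_sum]
    refine Finset.sum_congr rfl fun l _ => ?_
    rw [Finset.univ_unique, Finset.sum_singleton, omAvg, Matrix.of_apply, ← mul_assoc, ← mul_assoc,
      mul_inv_cancel₀ hpos, one_mul]
  calc ‖theta (κ := fun _ => Unit) (fun j => μ.real (E j)) a b (fun j => omAvg μ x (E j)) Y‖
      = ‖∑ j, ∑ i, ∑ l, (∫ ω in E j, x i l ω ∂μ) * B j (l, ()) (i, ())‖ := by
        rw [theta, Finset.sum_congr rfl fun j _ => htr j]
    _ ≤ ∑ j, ∑ i, ∑ l, ‖∫ ω in E j, x i l ω ∂μ‖ * (∑ i, s j i) ^ (1 - 2 * u) := by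
        refine (norm_sum_le _ _).trans (Finset.sum_le_sum fun j _ => (norm_sum_le _ _).trans
          (Finset.sum_le_sum fun i _ => (norm_sum_le _ _).trans
            (Finset.sum_le_sum fun l _ => ?_)))
        rw [norm_mul]
        exact mul_le_mul_of_nonneg_left (hB j _ _) (norm_nonneg _)
    _ = ∑ i, ∑ l, ∑ j, ‖∫ ω in E j, x i l ω ∂μ‖ * (∑ i, s j i) ^ (1 - 2 * u) := by
        rw [Finset.sum_comm]
        exact Finset.sum_congr rfl fun i _ => Finset.sum_comm
    _ ≤ _ := Finset.sum_le_sum fun i _ => Finset.sum_le_sum fun l _ => hkey i l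

end OmInterp

/-! ### Interpolation norms on the Ω side -/

section OmMain

variable {Ω : Type*} [MeasurableSpace Ω] {μ : Measure Ω} [IsProbabilityMeasure μ] {n : ℕ}

lemma exists_simpleFunc_toReal_sub_le {p : ℝ≥0∞} (hp : p ≠ ∞) {f : Ω → ℂ} (hf : MemLp f p μ)
    {δ : ℝ} (hδ : 0 < δ) : ∃ g : SimpleFunc Ω ℂ, MemLp g p μ ∧
      (eLpNorm (fun ω => g ω - f ω) p μ).toReal ≤ δ := by
  obtain ⟨g, hg, hgm⟩ := hf.exists_simpleFunc_eLpNorm_sub_lt hp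
    (ε := ENNReal.ofReal δ) (by simpa using hδ)
  refine ⟨g, hgm, ?_⟩
  have h1 : eLpNorm (fun ω => g ω - f ω) p μ = eLpNorm (f - ⇑g) p μ := by
    rw [← eLpNorm_neg (f - ⇑g), neg_sub]
    rfl
  rw [h1]
  exact ENNReal.toReal_le_of_le_ofReal hδ.le hg.le

/-- The test form bounds the interpolation norm of `M_n(L^p(Ω))`. -/
theorem OmTest.matNormLp_le {p : ℝ≥0∞} (hp1 : 1 < p) (hp : p ≠ ∞) {u : ℝ}
    (hpu : p.toReal⁻¹ = 2 * u) {C : ℝ} (hC : 0 ≤ C) {x : Matrix (Fin n) (Fin n) (Lp ℂ p μ)}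
    (hx : OmTest μ u C (fun i j => x i j)) : matNormLp μ p n x ≤ ENNReal.ofReal C := by
  have hp1' : 1 < p.toReal := by
    rw [← ENNReal.toReal_one]
    exact (ENNReal.toReal_lt_toReal ENNReal.one_ne_top hp).2 hp1
  have hu0 : 0 < u := by
    have : 0 < p.toReal⁻¹ := by positivity
    linarith
  have hu1 : u < 1 / 2 := by
    have : 2 * u < 1 := by rw [← hpu]; exact inv_lt_one_of_one_lt₀ hp1'
    linarith
  have hxm (i j) : MemLp (x i j) p μ := Lp.memLp _
  have hxi (i j) : Integrable (x i j) μ := (hxm i j).integrable hp1.le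
  refine ENNReal.le_of_forall_pos_le_add fun ε hε _ => ?_
  set e : ℕ → ℝ := fun k => ε / 2 / 2 ^ k with he
  have hε' : (0 : ℝ) < ε := hε
  have he0 (k) : 0 < e k := by simp only [he]; positivity
  have he1 (k) : e (k + 1) = e k / 2 := by simp only [he, pow_succ]; field_simp
  -- The entrywise precision is divided by a multiple of n² + 1 because the crude Hölder bound sums
  -- over all n² entries.
  set ρ : ℕ → ℝ := fun k => e (k + 1) / (4 * (n * n + 1)) with hρ
  have hρ0 (k) : 0 < ρ k := div_pos (he0 _) (by positivity)
  have hnρ (k) : (n : ℝ) * n * ρ k ≤ e (k + 1) / 4 := by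
    simp only [hρ]
    rw [mul_div_assoc', div_le_div_iff₀ (by positivity) (by norm_num)]
    nlinarith [he0 (k + 1)]
  have hs (k : ℕ) (i j : Fin n) : ∃ g : SimpleFunc Ω ℂ, MemLp g p μ ∧
      (eLpNorm (fun ω => g ω - x i j ω) p μ).toReal ≤ ρ k :=
    exists_simpleFunc_toReal_sub_le hp (hxm i j) (hρ0 k)
  choose s hsm hsx using hs
  have hsx' (k i j) : MemLp (fun ω => s k i j ω - x i j ω) p μ := (hsm k i j).sub (hxm i j)
  -- Telescoping differences of the simple approximations: the first satisfies the test bound C up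
  -- to a small error, and the others have a small test form.
  let t (k : ℕ) (i j : Fin n) : SimpleFunc Ω ℂ :=
    if k = 0 then s 0 i j else s k i j - s (k - 1) i j
  have hsL (k i j) : MemLp (s k i j) 1 μ := (hsm k i j).mono_exponent hp1.le
  let σ (k : ℕ) : Fin n → Fin n → Lp ℂ 1 μ := fun i j => (hsL k i j).toLp
  let v (k : ℕ) : Fin n → Fin n → Lp ℂ 1 μ := if k = 0 then σ 0 else σ k - σ (k - 1)
  have hvt (k i j) : v k i j =ᵐ[μ] t k i j := by
    rcases k with _ | k
    · simp only [v, t, if_true]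
      exact (hsL 0 i j).coeFn_toLp
    · simp only [v, t, Nat.succ_ne_zero, if_false, Nat.add_sub_cancel]
      filter_upwards [Lp.coeFn_sub (σ (k + 1) i j) (σ k i j), (hsL (k + 1) i j).coeFn_toLp,
        (hsL k i j).coeFn_toLp] with ω h1 h2 h3
      simp only [Pi.sub_apply, SimpleFunc.coe_sub]
      rw [h1, Pi.sub_apply]
      exact congr_arg₂ _ h2 h3
  have hcard (c : ℝ) : ∑ _i : Fin n, ∑ _j : Fin n, c = n * n * c := by
    simp [mul_assoc]
  have hv (k : ℕ) : interpNorm (omN₀ μ n) (omN₁ μ n) (2 * u) (v k)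
      ≤ ENNReal.ofReal (if k = 0 then C else 0) + ENNReal.ofReal (e k) := by
    rcases k with _ | k
    · rw [if_pos rfl, ← ENNReal.ofReal_add hC (he0 _).le]
      have h1 := hx.add hxi (fun i j => (hsx' 0 i j).integrable hp1.le)
        (omTest_of_memLp hp1 hp hpu (hsx' 0))
      have h2 : OmTest μ u (C + e 0 / 2) (fun i j => t 0 i j) := by
        refine (h1.mono ?_).congr fun i j => Eventually.of_forall fun ω => ?_
        · have h3 : ∑ i, ∑ j, (eLpNorm (fun ω => s 0 i j ω - x i j ω) p μ).toReal
              ≤ ∑ _i : Fin n, ∑ _j : Fin n, ρ 0 :=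
            Finset.sum_le_sum fun i _ => Finset.sum_le_sum fun j _ => hsx 0 i j
          rw [hcard] at h3
          have h4 := hnρ 0
          have h5 := he1 0
          have h6 := he0 0
          linarith
        · simp [t]
      exact interpNorm_simple_le (t 0) hu0 hu1 (by linarith [he0 0]) (by linarith [he0 0]) h2
        (hvt 0)
    · rw [if_neg (Nat.succ_ne_zero k), ENNReal.ofReal_zero, zero_add]
      have h1 (i j) : MemLp (fun ω => t (k + 1) i j ω) p μ := by
        simp only [t, Nat.succ_ne_zero, if_false, Nat.add_sub_cancel, SimpleFunc.coe_sub]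
        exact (hsm (k + 1) i j).sub (hsm k i j)
      have h2 (i j) : (eLpNorm (fun ω => t (k + 1) i j ω) p μ).toReal ≤ 2 * ρ k := by
        have h3 : (fun ω => t (k + 1) i j ω) = (fun ω => s (k + 1) i j ω - x i j ω)
            - fun ω => s k i j ω - x i j ω := by
          funext ω
          simp [t]
        rw [h3]
        have h4 := eLpNorm_sub_le (hsx' (k + 1) i j).1 (hsx' k i j).1 hp1.le
        have h5 := ENNReal.toReal_mono
          (ENNReal.add_lt_top.2 ⟨(hsx' (k + 1) i j).2, (hsx' k i j).2⟩).ne h4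
        rw [ENNReal.toReal_add (hsx' (k + 1) i j).2.ne (hsx' k i j).2.ne] at h5
        have h6 : ρ (k + 1) ≤ ρ k := by
          simp only [hρ]
          refine div_le_div_of_nonneg_right ?_ (by positivity)
          rw [he1 (k + 1)]
          linarith [he0 (k + 1)]
        linarith [hsx (k + 1) i j, hsx k i j]
      have h7 : OmTest μ u (e (k + 1) / 2) (fun i j => t (k + 1) i j) := by
        refine (omTest_of_memLp hp1 hp hpu h1).mono ?_
        have h3 : ∑ i, ∑ j, (eLpNorm (fun ω => t (k + 1) i j ω) p μ).toReal
            ≤ ∑ _i : Fin n, ∑ _j : Fin n, 2 * ρ k :=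
          Finset.sum_le_sum fun i _ => Finset.sum_le_sum fun j _ => h2 i j
        rw [hcard] at h3
        linarith [hnρ k]
      exact interpNorm_simple_le (t (k + 1)) hu0 hu1 (half_pos (he0 _)).le (half_lt_self (he0 _))
        h7 (hvt (k + 1))
  have hsum : ∑' k, (ENNReal.ofReal (if k = 0 then C else 0) + ENNReal.ofReal (e k))
      = ENNReal.ofReal C + ε := by
    rw [ENNReal.tsum_add]
    congr 1
    · rw [tsum_eq_single 0 fun k hk => by simp [hk]]
      simp
    · rw [← ENNReal.ofReal_tsum_of_nonneg (fun k => (he0 k).le) (summable_geometric_two' _),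
        tsum_geometric_two', ENNReal.ofReal_coe_nnreal]
  have hfin : ∑' k, interpNorm (omN₀ μ n) (omN₁ μ n) (2 * u) (v k) ≤ ENNReal.ofReal C + ε :=
    (ENNReal.tsum_le_tsum hv).trans hsum.le
  have hvs : Summable v := by
    refine Summable.of_norm ?_
    have h1 : ∑' k, ‖v k‖ₑ ≠ ∞ := by
      refine ((ENNReal.tsum_le_tsum fun k => ?_).trans hfin).trans_lt
        (ENNReal.add_lt_top.2 ⟨ENNReal.ofReal_lt_top, ENNReal.coe_lt_top⟩) |>.ne
      have := enorm_le_interpNorm zero_lt_one enorm_le_omN₀ enorm_le_omN₁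
        (by linarith : 0 ≤ 2 * u) (by linarith) (v k)
      rwa [ENNReal.ofReal_one, one_mul] at this
    simpa using ENNReal.summable_toReal h1
  -- The partial sums telescope to the approximations, which converge to `x` in L^1.
  have hpart (K : ℕ) : ∑ k ∈ Finset.range (K + 1), v k = σ K := by
    induction K with
    | zero => simp [v]
    | succ K ih =>
      rw [Finset.sum_range_succ, ih]
      simp [v]
  have hxL (i j) : MemLp (x i j) 1 μ := (hxm i j).mono_exponent hp1.le
  have hρlim : Tendsto ρ atTop (𝓝 0) := by
    have : Tendsto (fun k => e (k + 1) / (4 * ((n : ℝ) * n + 1))) atTop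
        (𝓝 (0 / (4 * ((n : ℝ) * n + 1)))) :=
      ((tendsto_add_atTop_iff_nat 1).2
        (summable_geometric_two' (ε : ℝ)).tendsto_atTop_zero).div_const _
    rwa [zero_div] at this
  have hlim : Tendsto σ atTop (𝓝 fun i j => (hxL i j).toLp) := by
    refine tendsto_pi_nhds.2 fun i => tendsto_pi_nhds.2 fun j => ?_
    rw [tendsto_iff_norm_sub_tendsto_zero]
    refine squeeze_zero (fun _ => norm_nonneg _) (fun k => ?_) hρlim
    have h1 : ‖σ k i j - (hxL i j).toLp‖ = (eLpNorm (fun ω => s k i j ω - x i j ω) 1 μ).toReal := by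
      rw [Lp.norm_def]
      congr 1
      refine eLpNorm_congr_ae ?_
      filter_upwards [Lp.coeFn_sub (σ k i j) (hxL i j).toLp, (hsL k i j).coeFn_toLp,
        (hxL i j).coeFn_toLp] with ω h1 h2 h3
      rw [h1, Pi.sub_apply, h3]
      congr 1
    rw [h1]
    exact (ENNReal.toReal_mono (hsx' k i j).2.ne
      (eLpNorm_le_eLpNorm_of_exponent_le hp1.le (hsx' k i j).1)).trans (hsx k i j)
  have htsum : ∑' k, v k = fun i j => (hxL i j).toLp := by
    have h1 := (tendsto_add_atTop_iff_nat 1).2 hvs.hasSum.tendsto_sum_nat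
    simp only [hpart] at h1
    exact tendsto_nhds_unique h1 hlim
  rw [matNormLp, if_neg hp, if_neg hp1.ne', hpu]
  refine iInf_le_of_le (fun i j => (hxL i j).toLp)
    (iInf_le_of_le (fun i j => (hxL i j).coeFn_toLp) ?_)
  rw [← htsum]
  exact (interpNorm_tsum_le isGauge_omN₀ isGauge_omN₁ zero_le_one
    enorm_le_omN₀ enorm_le_omN₁ _ v).trans hfin

lemma exists_isCalderon_of_matNormLp_lt {p : ℝ≥0∞} (hp1 : p ≠ 1) (hp : p ≠ ∞)
    {x : Matrix (Fin n) (Fin n) (Lp ℂ p μ)} {η : ℝ≥0∞} (h : matNormLp μ p n x < η) :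
    ∃ f : ℂ → Fin n → Fin n → Lp ℂ 1 μ, IsCalderon (omN₀ μ n) (omN₁ μ n) f ∧
      (∀ i j, f ((p.toReal⁻¹ : ℝ) : ℂ) i j =ᵐ[μ] x i j) ∧
      (∀ t : ℝ, omN₀ μ n (f (t * Complex.I)) ≤ η) ∧
      ∀ t : ℝ, omN₁ μ n (f (1 + t * Complex.I)) ≤ η := by
  rw [matNormLp, if_neg hp, if_neg hp1] at h
  simp only [iInf_lt_iff, interpNorm] at h
  obtain ⟨v, hv, f, hf, hfv, hlt⟩ := h
  refine ⟨f, hf, fun i j => by rw [hfv]; exact hv i j, fun t => ?_, fun t => ?_⟩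
  · exact ((le_iSup (fun t : ℝ => omN₀ μ n (f (t * Complex.I))) t).trans
      (le_max_left _ _)).trans hlt.le
  · exact ((le_iSup (fun t : ℝ => omN₁ μ n (f (1 + t * Complex.I))) t).trans
      (le_max_right _ _)).trans hlt.le

lemma norm_unitary_unique {ι : Type*} [Fintype ι] [DecidableEq ι] [Unique ι] {U : Matrix ι ι ℂ}
    (hU : U ∈ Matrix.unitaryGroup ι ℂ) : ‖U default default‖ = 1 := by
  have := norm_det_of_mem_unitaryGroup hU
  rwa [Matrix.det_unique] at this

/-- For n = 1 the loss n^(2u) of scalar testing is 1, and the weight attached to the values of a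
simple function is the integral of its p-th power. -/
lemma eLpNorm_simple_le_of_omTest {p : ℝ≥0∞} (hp1 : 1 < p) (hp : p ≠ ∞) {u : ℝ}
    (hpu : p.toReal⁻¹ = 2 * u) {C : ℝ} (s : SimpleFunc Ω ℂ)
    (hs : OmTest μ u C (fun _ _ : Fin 1 => s)) : (eLpNorm s p μ).toReal ≤ C := by
  have hp0 : 0 < p.toReal := ENNReal.toReal_pos (zero_lt_one.trans hp1).ne' hp
  have hu0 : 0 < u := by
    have : 0 < p.toReal⁻¹ := by positivity
    linarith
  obtain ⟨J, _, E, w, hE, hEd, hE0, hEu, hw⟩ := exists_partition (μ := μ) fun _ _ : Fin 1 => s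
  have havg (j : J) : omAvg μ (fun _ _ : Fin 1 => s) (E j) = w j :=
    omAvg_eq_of_const (hE j) (hE0 j) (hw j)
  obtain ⟨U, V, r, hU, hV, hr, hwr⟩ := exists_family_pw w (by linarith : 0 < 2 * u)
  have h := hs J E hE hEd hE0
  simp only [havg] at h
  have key := weight_rpow_le_of_test (fun j => measureReal_nonneg) hu0 h hU hV hr hwr
  rw [Fintype.card_fin, Nat.cast_one, Real.one_rpow, mul_one] at key
  refine (le_of_eq ?_).trans key
  have hnorm (j : J) : ‖w j (0, ()) (0, ())‖ ^ p.toReal = ∑ i, r j i := by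
    let _ : Unique (Fin 1 × Unit) := ⟨⟨(0, ())⟩, fun a => Subsingleton.elim _ _⟩
    rw [hwr, pw_apply, Fintype.sum_unique, Fintype.sum_unique]
    have h1 := norm_unitary_unique (hU j)
    have h2 := norm_unitary_unique (hV j)
    rw [norm_mul, norm_mul, zp_ofReal (hr j _) (by linarith), Complex.norm_real,
      Real.norm_of_nonneg (Real.rpow_nonneg (hr j _) _)]
    have h3 : ((0, ()) : Fin 1 × Unit) = default := rfl
    rw [h3, h1, h2, one_mul, mul_one, ← Real.rpow_mul (hr j _), ← hpu, inv_mul_cancel₀ hp0.ne',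
      Real.rpow_one]
  have hmem : MemLp s p μ := s.memLp_of_isFiniteMeasure p μ
  rw [hmem.eLpNorm_eq_integral_rpow_norm (zero_lt_one.trans hp1).ne' hp, ENNReal.toReal_ofReal
      (Real.rpow_nonneg (integral_nonneg fun ω => by positivity) _), hpu]
  congr 1
  rw [← integral_step hE]
  refine integral_congr_ae ?_
  filter_upwards [hEu] with ω ⟨j, hj⟩
  rw [sum_indicator_of_mem hEd (fun j => ∑ i, r j i) hj, ← hnorm, ← hw j ω hj 0 0]

/-- For `n = 1`, the test form computes the norm of `L^p(Ω)`. -/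
lemma eLpNorm_le_of_omTest {p : ℝ≥0∞} (hp1 : 1 < p) (hp : p ≠ ∞) {u : ℝ}
    (hpu : p.toReal⁻¹ = 2 * u) {C : ℝ} {f : Ω → ℂ} (hf : MemLp f p μ)
    (h : OmTest μ u C (fun _ _ : Fin 1 => f)) : (eLpNorm f p μ).toReal ≤ C := by
  refine le_of_forall_pos_le_add fun ε hε => ?_
  obtain ⟨g, hg, hgf⟩ := exists_simpleFunc_toReal_sub_le hp hf (half_pos hε)
  have hgf' : MemLp (fun ω => g ω - f ω) p μ := hg.sub hf
  have h1 := h.add (fun _ _ => hf.integrable hp1.le) (fun _ _ => hgf'.integrable hp1.le)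
    (omTest_of_memLp hp1 hp hpu fun _ _ => hgf')
  have h2 : OmTest μ u (C + ε / 2) (fun _ _ : Fin 1 => g) := by
    refine (h1.mono ?_).congr fun _ _ => Eventually.of_forall fun ω => by simp
    simpa using hgf
  have h3 := eLpNorm_simple_le_of_omTest hp1 hp hpu g h2
  have h4 : f = ⇑g - fun ω => g ω - f ω := by funext ω; simp
  have h5 := eLpNorm_sub_le hg.1 hgf'.1 hp1.le
  rw [← h4] at h5
  have h6 := ENNReal.toReal_mono (ENNReal.add_lt_top.2 ⟨hg.2, hgf'.2⟩).ne h5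
  rw [ENNReal.toReal_add hg.2.ne hgf'.2.ne] at h6
  linarith

end OmMain

/-! ### Schatten norms -/

lemma exists_pw_schattenNorm {k : ℕ} (A : Matrix (Fin k) (Fin k) ℂ) {p : ℝ≥0∞} (hp0 : p ≠ 0)
    (hp : p ≠ ∞) {x : ℝ} (hpx : p.toReal⁻¹ = x) :
    ∃ U ∈ Matrix.unitaryGroup (Fin k) ℂ, ∃ V ∈ Matrix.unitaryGroup (Fin k) ℂ, ∃ s : Fin k → ℝ,
      (∀ i, 0 ≤ s i) ∧ A = pw U V s x ∧
        schattenNorm p A ^ p.toReal = ENNReal.ofReal (∑ i, s i) := by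
  have hp' : 0 < p.toReal := ENNReal.toReal_pos hp0 hp
  obtain ⟨U, hU, V, hV, h⟩ := exists_pw_fin A (x := x) (by rw [← hpx]; positivity)
  have hsv (i : ℕ) : 0 ≤ (Matrix.toEuclideanLin A).singularValues i :=
    LinearMap.singularValues_nonneg _ _
  refine ⟨U, hU, V, hV, _, fun i => Real.rpow_nonneg (hsv i) _, h, ?_⟩
  rw [schattenNorm, if_neg hp, ← ENNReal.rpow_mul, one_div, inv_mul_cancel₀ hp'.ne',
    ENNReal.rpow_one, ← hpx, inv_inv,
    ENNReal.ofReal_sum_of_nonneg fun (i : Fin k) _ => Real.rpow_nonneg (hsv i) p.toReal,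
    ← Fin.sum_univ_eq_sum_range (fun i =>
      ENNReal.ofReal ((Matrix.toEuclideanLin A).singularValues i) ^ p.toReal) k]
  exact Finset.sum_congr rfl fun i _ => ENNReal.ofReal_rpow_of_nonneg (hsv i) hp'.le

/-! ### Comparison of the test form with the norm of the families -/

section FamNorm

variable {S : Type*} {d : S → ℕ} {n : ℕ}

lemma exists_pw_famNorm (A : Fam d) {p : ℝ≥0∞} (hp0 : p ≠ 0) (hp : p ≠ ∞) {x : ℝ}
    (hpx : p.toReal⁻¹ = x) :
    ∃ U V : (σ : S) → Matrix (Fin (d σ)) (Fin (d σ)) ℂ, ∃ s : (σ : S) → Fin (d σ) → ℝ,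
      (∀ σ, U σ ∈ Matrix.unitaryGroup _ ℂ) ∧ (∀ σ, V σ ∈ Matrix.unitaryGroup _ ℂ) ∧
      (∀ σ i, 0 ≤ s σ i) ∧ (∀ σ, A σ = pw (U σ) (V σ) (s σ) x) ∧
      famNorm d p A = (∑' σ, ENNReal.ofReal (d σ * ∑ i, s σ i)) ^ x := by
  choose U hU V hV s hs h hn using fun σ => exists_pw_schattenNorm (A σ) hp0 hp hpx
  refine ⟨U, V, s, hU, hV, hs, h, ?_⟩
  rw [famNorm, if_neg hp, one_div, hpx]
  congr 1
  refine tsum_congr fun σ => ?_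
  rw [hn, ENNReal.ofReal_mul (Nat.cast_nonneg _), ENNReal.ofReal_natCast]

/-- The entrywise bound holds uniformly over finite sets of indices, and the total sum is the
supremum of the finite ones. -/
lemma FamTest.famNorm_le {p : ℝ≥0∞} (hp0 : p ≠ 0) (hp : p ≠ ∞) {u C : ℝ}
    (hpu : p.toReal⁻¹ = 2 * u) {x : Fin n → Fin n → Fam d} (hx : FamTest d u C x) (i j : Fin n) :
    famNorm d p (x i j) ≤ ENNReal.ofReal C := by
  have hp' : 0 < p.toReal := ENNReal.toReal_pos hp0 hp
  have hu : 0 < 2 * u := by rw [← hpu]; positivity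
  obtain ⟨U, V, s, hU, hV, hs, h, hn⟩ := exists_pw_famNorm (x i j) hp0 hp hpu
  have hpos (F : Finset S) : 0 ≤ ∑ σ ∈ F, (d σ : ℝ) * ∑ k, s σ k :=
    Finset.sum_nonneg fun σ _ =>
      mul_nonneg (Nat.cast_nonneg _) (Finset.sum_nonneg fun k _ => hs σ k)
  have key (F : Finset S) : (∑ σ ∈ F, (d σ : ℝ) * ∑ k, s σ k) ^ (2 * u) ≤ C := by
    have := hx.weight_rpow_le (by linarith) i j F (U := fun σ => U σ) (V := fun σ => V σ)
      (s := fun σ => s σ) (fun σ => hU σ) (fun σ => hV σ) (fun σ => hs σ) fun σ => h σ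
    rwa [Finset.sum_coe_sort F fun σ => (d σ : ℝ) * ∑ k, s σ k] at this
  rw [hn]
  have h1 : ∑' σ, ENNReal.ofReal (d σ * ∑ k, s σ k) ≤ ENNReal.ofReal C ^ (2 * u)⁻¹ := by
    rw [ENNReal.tsum_eq_iSup_sum]
    refine iSup_le fun F => ?_
    rw [← ENNReal.ofReal_sum_of_nonneg fun σ _ =>
      mul_nonneg (Nat.cast_nonneg _) (Finset.sum_nonneg fun k _ => hs σ k)]
    rw [ENNReal.le_rpow_inv_iff hu, ENNReal.ofReal_rpow_of_nonneg (hpos F) hu.le]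
    exact ENNReal.ofReal_le_ofReal (key F)
  rwa [ENNReal.le_rpow_inv_iff hu] at h1

lemma pw_zero_fun {ι : Type*} [Fintype ι] [DecidableEq ι] (U V : Matrix ι ι ℂ) (z : ℂ) :
    pw U V 0 z = 0 := by
  ext i j
  simp [pw_apply, zp_zero]

open Classical in
/-- The restriction of a family to a finite set of indices. -/
def famTrunc (G : Finset S) (A : Fam d) : Fam d := fun σ => if σ ∈ G then A σ else 0

lemma famTrunc_of_mem {G : Finset S} (A : Fam d) {σ : S} (h : σ ∈ G) : famTrunc G A σ = A σ :=
  if_pos h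

lemma famTrunc_of_notMem {G : Finset S} (A : Fam d) {σ : S} (h : σ ∉ G) : famTrunc G A σ = 0 :=
  if_neg h

/-- Hölder's inequality for `ℒ^p(Σ)`, in terms of the test form. -/
lemma famTest_famTrunc {u : ℝ} (hu0 : 0 < u) (hu1 : 2 * u ≤ 1) {A : Fam d}
    {U V : (σ : S) → Matrix (Fin (d σ)) (Fin (d σ)) ℂ} {s : (σ : S) → Fin (d σ) → ℝ}
    (hU : ∀ σ, U σ ∈ Matrix.unitaryGroup _ ℂ) (hV : ∀ σ, V σ ∈ Matrix.unitaryGroup _ ℂ)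
    (hs : ∀ σ i, 0 ≤ s σ i) (hA : ∀ σ, A σ = pw (U σ) (V σ) (s σ) ((2 * u : ℝ) : ℂ))
    (G : Finset S) : FamTest d u ((∑ σ ∈ G, (d σ : ℝ) * ∑ i, s σ i) ^ (2 * u))
      (fun _ _ : Fin 1 => famTrunc G A) := by
  classical
  intro F a ha b hb Y hY
  have hc (σ : F) : (0 : ℝ) ≤ d σ := Nat.cast_nonneg _
  let e (σ : S) : Fin (d σ) ≃ Fin 1 × Fin (d σ) := (Equiv.uniqueProd (Fin (d σ)) (Fin 1)).symm
  let r (σ : S) : Fin (d σ) → ℝ := if σ ∈ G then s σ else 0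
  have hr (σ : S) (i) : 0 ≤ r σ i := by
    simp only [r]
    split_ifs
    · exact hs σ i
    · exact le_rfl
  have hpw (σ : S) : famTrunc G A σ = pw (U σ) (V σ) (r σ) ((2 * u : ℝ) : ℂ) := by
    by_cases h : σ ∈ G
    · simp only [famTrunc_of_mem A h, r, if_pos h, hA]
    · simp only [famTrunc_of_notMem A h, r, if_neg h, pw_zero_fun]
  have hX (σ : F) : famBlock d (fun _ _ : Fin 1 => famTrunc G A) σ
      = pw ((U σ).submatrix (e σ).symm (e σ).symm) ((V σ).submatrix (e σ).symm (e σ).symm)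
        (r σ ∘ (e σ).symm) ((2 * u : ℝ) : ℂ) := by
    rw [← pw_submatrix, ← hpw]
    rfl
  refine (theta_le_weight_rpow hc hu0.le hu1 ha hb hY (fun σ => reindex_mem_unitaryGroup _ (hU σ))
    (fun σ => reindex_mem_unitaryGroup _ (hV σ)) (fun σ i => hr σ _) hX).trans ?_
  refine Real.rpow_le_rpow (Finset.sum_nonneg fun σ _ =>
    mul_nonneg (hc σ) (Finset.sum_nonneg fun i _ => hr _ _)) ?_ (by linarith)
  have h1 (σ : S) : ∑ i, r σ ((e σ).symm i) = ∑ i, r σ i := (e σ).symm.sum_comp (r σ)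
  simp only [h1]
  rw [Finset.sum_coe_sort F fun σ => (d σ : ℝ) * ∑ i, r σ i]
  have h2 (σ : S) : (d σ : ℝ) * ∑ i, r σ i = if σ ∈ G then (d σ : ℝ) * ∑ i, s σ i else 0 := by
    simp only [r]
    split_ifs <;> simp
  simp only [h2]
  rw [← Finset.sum_filter]
  refine Finset.sum_le_sum_of_subset_of_nonneg (fun σ hσ => (Finset.mem_filter.1 hσ).2)
    fun σ _ _ => mul_nonneg (Nat.cast_nonneg _) (Finset.sum_nonneg fun i _ => hs _ _)

end FamNorm

/-! ### The Hilbert-Schmidt ball -/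

section Half

variable {J : Type*} [Fintype J] {κ : J → Type*} [∀ j, Fintype (κ j)] [∀ j, DecidableEq (κ j)]

/-- At exponent 2 the weighted Schatten ball is the Hilbert-Schmidt ball, so membership can be read
off from the entries. -/
lemma mem_FB_half {c : J → ℝ} {Y : (j : J) → Matrix (κ j) (κ j) ℂ}
    (h : ∑ j, c j * ∑ i, ∑ k, ‖Y j i k‖ ^ 2 ≤ 1) : Y ∈ FB c (1 / 2) := by
  obtain ⟨U, V, s, hU, hV, hs, hY⟩ := exists_family_pw Y (x := 1 / 2) (by norm_num)
  refine ⟨U, V, s, hU, hV, hs, (le_of_eq ?_).trans h, hY⟩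
  refine Finset.sum_congr rfl fun j _ => ?_
  rw [← sum_norm_sq_pw (hU j) (hV j) (hs j) (z := ((1 / 2 : ℝ) : ℂ)) (Complex.ofReal_re _), ← hY]

lemma sum_norm_sq_le_of_mem_FB_half {c : J → ℝ} {Y : (j : J) → Matrix (κ j) (κ j) ℂ}
    (h : Y ∈ FB c (1 / 2)) : ∑ j, c j * ∑ i, ∑ k, ‖Y j i k‖ ^ 2 ≤ 1 := by
  obtain ⟨U, V, s, hU, hV, hs, hs1, hY⟩ := h
  refine (le_of_eq (Finset.sum_congr rfl fun j _ => ?_)).trans hs1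
  rw [hY, sum_norm_sq_pw (hU j) (hV j) (hs j) (z := ((1 / 2 : ℝ) : ℂ)) (Complex.ofReal_re _)]

end Half

/-! ### Testing against square integrable matrix functions -/

section OmHalf

variable {Ω : Type*} [MeasurableSpace Ω] {μ : Measure Ω} [IsProbabilityMeasure μ] {n : ℕ}

/-- At r = 2 the dual ball consists of step functions in the unit ball of L²(S²_n), so the test form
becomes a pairing with the simple function `g`; the radius r accounts for the scaling. -/
lemma OmTest.norm_sum_integral_simple_le {η : ℝ} {x : Fin n → Fin n → Ω → ℂ}
    (hxi : ∀ i j, Integrable (x i j) μ) (hx : OmTest μ (1 / 4) η x) {a b : Matrix (Fin n) (Fin n) ℂ}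
    (ha : a ∈ SB (Fin n) (1 / 4)) (hb : b ∈ SB (Fin n) (1 / 4))
    (g : Fin n → Fin n → SimpleFunc Ω ℂ) {r : ℝ} (hr : 0 < r)
    (hg : ∫ ω, ∑ i, ∑ j, ‖g i j ω‖ ^ 2 ∂μ ≤ r ^ 2) :
    ‖∑ p : Fin n × Fin n, ∑ q : Fin n × Fin n,
      a p.2 p.1 * (∫ ω, x p.1 q.1 ω * g q.2 p.2 ω ∂μ) * b q.1 q.2‖ ≤ η * r := by
  obtain ⟨J, _, E, w, hE, hEd, hE0, hEu, hw⟩ := exists_partition (μ := μ) g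
  have hr' : (r : ℂ) ≠ 0 := Complex.ofReal_ne_zero.2 hr.ne'
  let Y (j : J) : Matrix (Fin n × Unit) (Fin n × Unit) ℂ := (r : ℂ)⁻¹ • w j
  have hY : Y ∈ FB (κ := fun _ : J => Fin n × Unit) (fun j => μ.real (E j)) (1 - 2 * (1 / 4)) := by
    rw [show (1 : ℝ) - 2 * (1 / 4) = 1 / 2 by norm_num]
    refine mem_FB_half ?_
    have h1 (j : J) : ∑ i, ∑ k, ‖Y j i k‖ ^ 2 = (r ^ 2)⁻¹ * ∑ i, ∑ k, ‖w j (i, ()) (k, ())‖ ^ 2 := by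
      simp only [Fintype.sum_prod_type, Finset.univ_unique, Finset.sum_singleton, Finset.mul_sum, Y,
        Matrix.smul_apply, smul_eq_mul, norm_mul, mul_pow, norm_inv, Complex.norm_real,
        Real.norm_of_nonneg hr.le, inv_pow]
    have h2 : ∫ ω, ∑ i, ∑ j, ‖g i j ω‖ ^ 2 ∂μ
        = ∑ j, μ.real (E j) * ∑ i, ∑ k, ‖w j (i, ()) (k, ())‖ ^ 2 := by
      rw [← integral_step hE]
      refine integral_congr_ae ?_
      filter_upwards [hEu] with ω ⟨j, hj⟩
      rw [sum_indicator_of_mem hEd (fun j => ∑ i, ∑ k, ‖w j (i, ()) (k, ())‖ ^ 2) hj]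
      simp only [hw j ω hj]
    rw [h2] at hg
    calc ∑ j, μ.real (E j) * ∑ i, ∑ k, ‖Y j i k‖ ^ 2
        = (r ^ 2)⁻¹ * ∑ j, μ.real (E j) * ∑ i, ∑ k, ‖w j (i, ()) (k, ())‖ ^ 2 := by
          rw [Finset.mul_sum]
          exact Finset.sum_congr rfl fun j _ => by rw [h1]; ring
      _ ≤ (r ^ 2)⁻¹ * r ^ 2 := mul_le_mul_of_nonneg_left hg (by positivity)
      _ = 1 := inv_mul_cancel₀ (by positivity)
  have key := hx J E hE hEd hE0 a ha b hb Y hY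
  rw [theta_eq_sum_pairing] at key
  have h3 (p q : Fin n × Fin n) : ∫ ω, x p.1 q.1 ω * g q.2 p.2 ω ∂μ
      = r * pairing (κ := fun _ : J => Unit) (fun j => μ.real (E j)) (fun j => omAvg μ x (E j))
        (fun j => (Y j)ᵀ) p q := by
    have h4 : ∫ ω, x p.1 q.1 ω * g q.2 p.2 ω ∂μ = ∫ ω, x p.1 q.1 ω *
        ∑ j, (E j).indicator (fun _ => w j (q.2, ()) (p.2, ())) ω ∂μ := by
      refine integral_congr_ae ?_
      filter_upwards [hEu] with ω ⟨j, hj⟩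
      rw [sum_indicator_of_mem hEd (fun j => w j (q.2, ()) (p.2, ())) hj, hw j ω hj]
    rw [h4, integral_mul_sum_indicator hE (hxi _ _)]
    simp only [pairing, Matrix.of_apply, Finset.univ_unique, Finset.sum_singleton, omAvg,
      Finset.mul_sum, Y, Matrix.transpose_apply, Matrix.smul_apply, smul_eq_mul]
    refine Finset.sum_congr rfl fun j _ => ?_
    have hpos : ((μ.real (E j) : ℝ) : ℂ) ≠ 0 :=
      Complex.ofReal_ne_zero.2 (measureReal_pos (hE0 j)).ne'
    field_simp
  have h5 : ∑ p : Fin n × Fin n, ∑ q : Fin n × Fin n,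
      a p.2 p.1 * (∫ ω, x p.1 q.1 ω * g q.2 p.2 ω ∂μ) * b q.1 q.2
      = r * ∑ p : Fin n × Fin n, ∑ q : Fin n × Fin n, a p.2 p.1 *
        pairing (κ := fun _ : J => Unit) (fun j => μ.real (E j)) (fun j => omAvg μ x (E j))
          (fun j => (Y j)ᵀ) p q * b q.1 q.2 := by
    simp only [h3, Finset.mul_sum]
    exact Finset.sum_congr rfl fun p _ => Finset.sum_congr rfl fun q _ => by ring
  rw [h5, norm_mul, Complex.norm_real, Real.norm_of_nonneg hr.le, mul_comm]
  exact mul_le_mul_of_nonneg_right key hr.le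

/-- Bounded functions are limits of uniformly bounded simple ones, and dominated convergence applies
both to the pairing and to the L² norm. -/
lemma OmTest.norm_sum_integral_le {η : ℝ} {x : Fin n → Fin n → Ω → ℂ}
    (hxi : ∀ i j, Integrable (x i j) μ) (hx : OmTest μ (1 / 4) η x) {a b : Matrix (Fin n) (Fin n) ℂ}
    (ha : a ∈ SB (Fin n) (1 / 4)) (hb : b ∈ SB (Fin n) (1 / 4))
    {g : Fin n → Fin n → Ω → ℂ} (hgm : ∀ i j, Measurable (g i j)) {K : ℝ}
    (hgK : ∀ᵐ ω ∂μ, ∀ i j, ‖g i j ω‖ ≤ K) (hg : ∫ ω, ∑ i, ∑ j, ‖g i j ω‖ ^ 2 ∂μ ≤ 1) :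
    ‖∑ p : Fin n × Fin n, ∑ q : Fin n × Fin n,
      a p.2 p.1 * (∫ ω, x p.1 q.1 ω * g q.2 p.2 ω ∂μ) * b q.1 q.2‖ ≤ η := by
  rcases isEmpty_or_nonempty (Fin n) with hn | ⟨⟨i₀⟩⟩
  · have := hx.norm_sum_integral_simple_le hxi ha hb (fun _ _ => 0) zero_lt_one (by simp)
    simpa using this
  have hK : 0 ≤ K := by
    obtain ⟨ω, hω⟩ := hgK.exists
    exact (norm_nonneg _).trans (hω i₀ i₀)
  let s (k : ℕ) (i j : Fin n) : SimpleFunc Ω ℂ := (hgm i j).stronglyMeasurable.approxBounded K k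
  have hsK (k i j ω) : ‖s k i j ω‖ ≤ K := StronglyMeasurable.norm_approxBounded_le _ hK _ _
  have hslim : ∀ᵐ ω ∂μ, ∀ i j, Tendsto (fun k => s k i j ω) atTop (𝓝 (g i j ω)) := by
    filter_upwards [hgK] with ω hω i j
    exact StronglyMeasurable.tendsto_approxBounded_of_norm_le _ (hω i j)
  have h1 : Tendsto (fun k => ∫ ω, ∑ i, ∑ j, ‖s k i j ω‖ ^ 2 ∂μ) atTop
      (𝓝 (∫ ω, ∑ i, ∑ j, ‖g i j ω‖ ^ 2 ∂μ)) := by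
    refine tendsto_integral_of_dominated_convergence (fun _ => ∑ _i : Fin n, ∑ _j : Fin n, K ^ 2)
      (fun k => ?_) (integrable_const _) (fun k => Eventually.of_forall fun ω => ?_) ?_
    · exact (Finset.measurable_fun_sum _ fun i _ => Finset.measurable_fun_sum _ fun j _ =>
        ((s k i j).measurable.norm.pow_const 2)).aestronglyMeasurable
    · rw [Real.norm_of_nonneg (by positivity)]
      exact Finset.sum_le_sum fun i _ => Finset.sum_le_sum fun j _ =>
        pow_le_pow_left₀ (norm_nonneg _) (hsK k i j ω) 2
    · filter_upwards [hslim] with ω hω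
      exact tendsto_finsetSum _ fun i _ => tendsto_finsetSum _ fun j _ => (hω i j).norm.pow 2
  have h2 : Tendsto (fun k => ‖∑ p : Fin n × Fin n, ∑ q : Fin n × Fin n,
      a p.2 p.1 * (∫ ω, x p.1 q.1 ω * s k q.2 p.2 ω ∂μ) * b q.1 q.2‖) atTop
      (𝓝 ‖∑ p : Fin n × Fin n, ∑ q : Fin n × Fin n,
      a p.2 p.1 * (∫ ω, x p.1 q.1 ω * g q.2 p.2 ω ∂μ) * b q.1 q.2‖) := by
    refine (tendsto_finsetSum _ fun p _ => tendsto_finsetSum _ fun q _ =>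
      (Tendsto.const_mul _ ?_).mul_const _).norm
    refine tendsto_integral_of_dominated_convergence (fun ω => ‖x p.1 q.1 ω‖ * K)
      (fun k => ?_) ((hxi _ _).norm.mul_const _) (fun k => Eventually.of_forall fun ω => ?_) ?_
    · exact (hxi _ _).1.mul (s k q.2 p.2).measurable.aestronglyMeasurable
    · rw [norm_mul]
      exact mul_le_mul_of_nonneg_left (hsK _ _ _ _) (norm_nonneg _)
    · filter_upwards [hslim] with ω hω
      exact (hω _ _).const_mul _
  -- The approximations may leave the unit ball slightly, so a radius r > 1 is allowed and sent to 1
  -- at the end.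
  have h3 (r : ℝ) (hr : 1 < r) : ‖∑ p : Fin n × Fin n, ∑ q : Fin n × Fin n,
      a p.2 p.1 * (∫ ω, x p.1 q.1 ω * g q.2 p.2 ω ∂μ) * b q.1 q.2‖ ≤ η * r := by
    refine le_of_tendsto h2 ?_
    filter_upwards [h1.eventually (gt_mem_nhds (hg.trans_lt (by nlinarith : 1 < r ^ 2)))] with k hk
    exact hx.norm_sum_integral_simple_le hxi ha hb (s k) (by linarith) hk.le
  have h4 : Tendsto (fun r : ℝ => η * r) (𝓝[>] 1) (𝓝 (η * 1)) :=
    (tendsto_id.const_mul η).mono_left nhdsWithin_le_nhds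
  rw [mul_one] at h4
  exact ge_of_tendsto h4 (eventually_nhdsWithin_of_forall h3)

end OmHalf

/-! ### Bessel's inequality for the system -/

namespace UBQOS

variable {Ω : Type*} [MeasurableSpace Ω] {μ : Measure Ω} [IsProbabilityMeasure μ] {S : Type*}
  {d : S → ℕ} (Φ : UBQOS μ d)

/-- The normalized entries of the system. -/
def entryL2 (k : (σ : S) × (Fin (d σ) × Fin (d σ))) : Lp ℂ 2 μ :=
  ((Real.sqrt (d k.1) : ℝ) : ℂ) • (Φ.memLp_entry 2 k.1 k.2.1 k.2.2).toLp

lemma coeFn_entryL2 (k : (σ : S) × (Fin (d σ) × Fin (d σ))) :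
    Φ.entryL2 k =ᵐ[μ] fun ω => ((Real.sqrt (d k.1) : ℝ) : ℂ) * Φ.φ k.1 ω k.2.1 k.2.2 := by
  filter_upwards [Lp.coeFn_smul ((Real.sqrt (d k.1) : ℝ) : ℂ)
    (Φ.memLp_entry 2 k.1 k.2.1 k.2.2).toLp, (Φ.memLp_entry 2 k.1 k.2.1 k.2.2).coeFn_toLp]
    with ω h1 h2
  rw [entryL2, h1, Pi.smul_apply, h2, smul_eq_mul]

lemma inner_entryL2 (k : (σ : S) × (Fin (d σ) × Fin (d σ))) (f : Lp ℂ 2 μ) :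
    inner ℂ (Φ.entryL2 k) f = ((Real.sqrt (d k.1) : ℝ) : ℂ)
      * ∫ ω, f ω * starRingEnd ℂ (Φ.φ k.1 ω k.2.1 k.2.2) ∂μ := by
  rw [L2.inner_def, ← integral_const_mul]
  refine integral_congr_ae ?_
  filter_upwards [Φ.coeFn_entryL2 k] with ω h
  rw [h, RCLike.inner_apply, map_mul, Complex.conj_ofReal]
  ring

/-- The factor √d_σ compensates the norm 1/d_σ of the entries. -/
lemma orthonormal_entryL2 : Orthonormal ℂ Φ.entryL2 := by
  classical
  rw [orthonormal_iff_ite]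
  intro k l
  have h1 : ∫ ω, Φ.entryL2 l ω * starRingEnd ℂ (Φ.φ k.1 ω k.2.1 k.2.2) ∂μ
      = ((Real.sqrt (d l.1) : ℝ) : ℂ) * ∫ ω, Φ.φ l.1 ω l.2.1 l.2.2 *
        starRingEnd ℂ (Φ.φ k.1 ω k.2.1 k.2.2) ∂μ := by
    rw [← integral_const_mul]
    refine integral_congr_ae ?_
    filter_upwards [Φ.coeFn_entryL2 l] with ω h
    rw [h, mul_assoc]
  rw [inner_entryL2, h1]
  obtain ⟨σ, i, j⟩ := k
  obtain ⟨τ, i', j'⟩ := l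
  by_cases hστ : σ = τ
  · subst hστ
    rw [Φ.orthonormal]
    by_cases h : i' = i ∧ j' = j
    · obtain ⟨rfl, rfl⟩ := h
      have hd : (d σ : ℂ) ≠ 0 := Nat.cast_ne_zero.2 (Φ.d_pos σ).ne'
      simp only [and_self, if_true]
      rw [← mul_assoc, ← Complex.ofReal_mul, Real.mul_self_sqrt (Nat.cast_nonneg _),
        Complex.ofReal_natCast, mul_one_div_cancel hd]
    · rw [if_neg h, if_neg]
      · simp
      · rintro h'
        simp only [Sigma.mk.injEq, heq_eq_eq, true_and, Prod.mk.injEq] at h'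
        exact h ⟨h'.1.symm, h'.2.symm⟩
  · rw [Φ.orthogonal _ _ (Ne.symm hστ), if_neg]
    · simp
    · rintro h'
      exact hστ (congrArg Sigma.fst h')

end UBQOS

lemma norm_sq_L2 {Ω : Type*} [MeasurableSpace Ω] {μ : Measure Ω} (f : Lp ℂ 2 μ) :
    ‖f‖ ^ 2 = ∫ ω, ‖f ω‖ ^ 2 ∂μ := by
  have h : ((‖f‖ ^ 2 : ℝ) : ℂ) = ((∫ ω, ‖f ω‖ ^ 2 ∂μ : ℝ) : ℂ) := by
    rw [← integral_complex_ofReal]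
    have := inner_self_eq_norm_sq_to_K (𝕜 := ℂ) f
    push_cast
    refine this.symm.trans ?_
    rw [L2.inner_def]
    exact integral_congr_ae (Eventually.of_forall fun ω => inner_self_eq_norm_sq_to_K (𝕜 := ℂ) (f ω))
  exact_mod_cast h

namespace UBQOS

variable {Ω : Type*} [MeasurableSpace Ω] {μ : Measure Ω} [IsProbabilityMeasure μ] {S : Type*}
  {d : S → ℕ} (Φ : UBQOS μ d)

lemma orthonormal_entryL2_finset (F : Finset S) : Orthonormal ℂ
    fun k : (σ : F) × (Fin (d σ) × Fin (d σ)) => Φ.entryL2 ⟨k.1, k.2⟩ := by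
  refine Φ.orthonormal_entryL2.comp
    (fun k : (σ : F) × (Fin (d σ) × Fin (d σ)) => (⟨k.1, k.2⟩ : (σ : S) × (Fin (d σ) × Fin (d σ))))
    ?_
  rintro ⟨⟨σ, hσ⟩, k⟩ ⟨⟨τ, hτ⟩, l⟩ h
  simp only [Sigma.mk.injEq] at h
  obtain ⟨rfl, h⟩ := h
  simpa using h

lemma sqrt_mul_self_natCast (m : ℕ) : ((Real.sqrt m : ℝ) : ℂ) * ((Real.sqrt m : ℝ) : ℂ) = m := by
  rw [← Complex.ofReal_mul, Real.mul_self_sqrt (Nat.cast_nonneg _), Complex.ofReal_natCast]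

/-- Parseval for finite sums: the weight d_σ is one √d_σ from the coefficient and one from the
normalized entry. -/
lemma integral_norm_sq_sum (F : Finset S) (c : (σ : F) → Fin (d σ) → Fin (d σ) → ℂ) :
    ∫ ω, ‖∑ σ : F, (d σ : ℂ) * ∑ s, ∑ t, c σ s t * Φ.φ σ ω s t‖ ^ 2 ∂μ
      = ∑ σ : F, (d σ : ℝ) * ∑ s, ∑ t, ‖c σ s t‖ ^ 2 := by
  let l (k : (σ : F) × (Fin (d σ) × Fin (d σ))) : ℂ := ((Real.sqrt (d k.1) : ℝ) : ℂ) * c k.1 k.2.1 k.2.2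
  let v (k : (σ : F) × (Fin (d σ) × Fin (d σ))) : Lp ℂ 2 μ := Φ.entryL2 ⟨k.1, k.2⟩
  have h1 : ((‖∑ k, l k • v k‖ ^ 2 : ℝ) : ℂ) = ((∑ k, ‖l k‖ ^ 2 : ℝ) : ℂ) := by
    have h2 := (Φ.orthonormal_entryL2_finset F).inner_sum l l Finset.univ
    rw [inner_self_eq_norm_sq_to_K (𝕜 := ℂ)] at h2
    push_cast
    refine h2.trans (Finset.sum_congr rfl fun k _ => ?_)
    rw [Complex.conj_mul']
  have h3 : ∑ k, ‖l k‖ ^ 2 = ∑ σ : F, (d σ : ℝ) * ∑ s, ∑ t, ‖c σ s t‖ ^ 2 := by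
    rw [Fintype.sum_sigma]
    refine Finset.sum_congr rfl fun σ _ => ?_
    rw [Fintype.sum_prod_type, Finset.mul_sum]
    refine Finset.sum_congr rfl fun s _ => ?_
    rw [Finset.mul_sum]
    refine Finset.sum_congr rfl fun t _ => ?_
    simp only [l]
    rw [norm_mul, mul_pow, Complex.norm_real, Real.norm_of_nonneg (Real.sqrt_nonneg _),
      Real.sq_sqrt (Nat.cast_nonneg _)]
  rw [← h3, ← Complex.ofReal_injective h1, norm_sq_L2]
  refine integral_congr_ae ?_
  have h4 : ∀ᵐ ω ∂μ, ∀ k, v k ω = ((Real.sqrt (d k.1) : ℝ) : ℂ) * Φ.φ k.1 ω k.2.1 k.2.2 :=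
    ae_all_iff.2 fun k => Φ.coeFn_entryL2 ⟨k.1, k.2⟩
  have h5 : ∀ᵐ ω ∂μ, ∀ k, (l k • v k) ω = l k * v k ω := ae_all_iff.2 fun k => Lp.coeFn_smul _ _
  filter_upwards [h4, h5, Lp.coeFn_finsetSum Finset.univ fun k => l k • v k] with ω h4 h5 h6
  rw [h6, Finset.sum_apply, Fintype.sum_sigma]
  congr 2
  refine Finset.sum_congr rfl fun σ _ => ?_
  rw [Fintype.sum_prod_type, Finset.mul_sum]
  refine Finset.sum_congr rfl fun s _ => ?_
  rw [Finset.mul_sum]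
  refine Finset.sum_congr rfl fun t _ => ?_
  rw [h5, h4, ← sqrt_mul_self_natCast]
  ring

lemma sum_norm_sq_integral_le (F : Finset S) {h : Ω → ℂ} (hh : MemLp h 2 μ) :
    ∑ σ : F, (d σ : ℝ) * ∑ s, ∑ t, ‖∫ ω, h ω * Φ.φ σ ω s t ∂μ‖ ^ 2 ≤ ∫ ω, ‖h ω‖ ^ 2 ∂μ := by
  -- The integrals are taken without conjugating φ, so Bessel's inequality is applied to the
  -- conjugate of `h`.
  have hc : MemLp (fun ω => starRingEnd ℂ (h ω)) 2 μ := hh.star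
  have h1 := (Φ.orthonormal_entryL2_finset F).sum_inner_products_le (x := hc.toLp)
    (s := Finset.univ)
  rw [norm_sq_L2] at h1
  refine (le_of_eq ?_).trans (h1.trans (le_of_eq ?_))
  · rw [Fintype.sum_sigma]
    refine Finset.sum_congr rfl fun σ _ => ?_
    rw [Fintype.sum_prod_type, Finset.mul_sum]
    refine Finset.sum_congr rfl fun s _ => ?_
    rw [Finset.mul_sum]
    refine Finset.sum_congr rfl fun t _ => ?_
    have h2 : ∫ ω, (hc.toLp : Lp ℂ 2 μ) ω * starRingEnd ℂ (Φ.φ σ ω s t) ∂μ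
        = starRingEnd ℂ (∫ ω, h ω * Φ.φ σ ω s t ∂μ) := by
      rw [← integral_conj]
      refine integral_congr_ae ?_
      filter_upwards [hc.coeFn_toLp] with ω hω
      rw [hω, map_mul]
    rw [inner_entryL2, h2, norm_mul, mul_pow, Complex.norm_real,
      Real.norm_of_nonneg (Real.sqrt_nonneg _), Real.sq_sqrt (Nat.cast_nonneg _),
      RCLike.norm_conj]
  · refine integral_congr_ae ?_
    filter_upwards [hc.coeFn_toLp] with ω hω
    rw [hω, RCLike.norm_conj]

/-- The transform, on functions. -/
def transformFun (f : Ω → ℂ) : Fam d :=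
  fun σ => Matrix.of fun i j => ∫ ω, f ω * (Φ.φ σ ω)ᴴ i j ∂μ

lemma ae_norm_le {M : ℝ} (hM : Φ.M ≤ ENNReal.ofReal M) (hM0 : 0 ≤ M) (σ : S) :
    ∀ᵐ ω ∂μ, ‖Φ.φ σ ω‖ ≤ M := by
  filter_upwards [ENNReal.ae_le_essSup (μ := μ) fun ω => ‖Φ.φ σ ω‖ₑ] with ω h
  have := (h.trans (le_iSup (fun σ => essSup (fun ω => ‖Φ.φ σ ω‖ₑ) μ) σ)).trans hM
  rwa [← ofReal_norm, ENNReal.ofReal_le_ofReal_iff hM0] at this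

variable {n : ℕ} {Φ}

/-- The transform from `L^2(Ω)` to `ℒ^2(Σ)`, in terms of the test forms. -/
lemma famTest_transformFun_quarter {M : ℝ} (hM : Φ.M ≤ ENNReal.ofReal M) (hM0 : 0 ≤ M) {η : ℝ}
    {x : Fin n → Fin n → Ω → ℂ} (hxi : ∀ i j, Integrable (x i j) μ) (hx : OmTest μ (1 / 4) η x) :
    FamTest d (1 / 4) η (fun i j => Φ.transformFun (x i j)) := by
  intro F a ha b hb Y hY
  rw [show (1 : ℝ) - 2 * (1 / 4) = 1 / 2 by norm_num] at hY
  -- The adjoint of the transform applied to the dual family: pairing the transform of `x` with `Y`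
  -- is pairing `x` with `g`, and Parseval puts `g` in the unit ball of L²(S²_n).
  let g (j i : Fin n) (ω : Ω) : ℂ :=
    ∑ σ : F, (d σ : ℂ) * ∑ l, ∑ k, Y σ (j, l) (i, k) * starRingEnd ℂ (Φ.φ σ ω l k)
  have hgm (j i) : Measurable (g j i) := by
    refine Finset.measurable_fun_sum _ fun σ _ => Measurable.const_mul (Finset.measurable_fun_sum _
      fun l _ => Finset.measurable_fun_sum _ fun k _ => Measurable.const_mul ?_ _) _
    exact Complex.continuous_conj.measurable.comp (Φ.measurable_entry σ l k)
  have hφ : ∀ᵐ ω ∂μ, ∀ σ : F, ‖Φ.φ σ ω‖ ≤ M := ae_all_iff.2 fun σ => Φ.ae_norm_le hM hM0 σ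
  let K : ℝ := ∑ j, ∑ i, ∑ σ : F, (d σ : ℝ) * ∑ l, ∑ k, ‖Y σ (j, l) (i, k)‖ * M
  have hgK : ∀ᵐ ω ∂μ, ∀ j i, ‖g j i ω‖ ≤ K := by
    filter_upwards [hφ] with ω hω j i
    have h1 : ‖g j i ω‖ ≤ ∑ σ : F, (d σ : ℝ) * ∑ l, ∑ k, ‖Y σ (j, l) (i, k)‖ * M := by
      refine (norm_sum_le _ _).trans (Finset.sum_le_sum fun σ _ => ?_)
      rw [norm_mul, Complex.norm_natCast]
      refine mul_le_mul_of_nonneg_left ((norm_sum_le _ _).trans (Finset.sum_le_sum fun l _ =>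
        (norm_sum_le _ _).trans (Finset.sum_le_sum fun k _ => ?_))) (Nat.cast_nonneg _)
      rw [norm_mul, RCLike.norm_conj]
      exact mul_le_mul_of_nonneg_left ((norm_entry_le _ _ _).trans (hω σ)) (norm_nonneg _)
    refine h1.trans ?_
    have h2 (j i : Fin n) : 0 ≤ ∑ σ : F, (d σ : ℝ) * ∑ l, ∑ k, ‖Y σ (j, l) (i, k)‖ * M := by
      positivity
    exact (Finset.single_le_sum (f := fun i => ∑ σ : F, (d σ : ℝ) * ∑ l, ∑ k,
      ‖Y σ (j, l) (i, k)‖ * M) (fun i _ => h2 j i) (Finset.mem_univ i)).trans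
      (Finset.single_le_sum (f := fun j => ∑ i, ∑ σ : F, (d σ : ℝ) * ∑ l, ∑ k,
      ‖Y σ (j, l) (i, k)‖ * M) (fun j _ => Finset.sum_nonneg fun i _ => h2 j i) (Finset.mem_univ j))
  have hg2 (j i) : ∫ ω, ‖g j i ω‖ ^ 2 ∂μ
      = ∑ σ : F, (d σ : ℝ) * ∑ l, ∑ k, ‖Y σ (j, l) (i, k)‖ ^ 2 := by
    have h1 := Φ.integral_norm_sq_sum F fun σ l k => starRingEnd ℂ (Y σ (j, l) (i, k))
    simp only [RCLike.norm_conj] at h1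
    rw [← h1]
    refine integral_congr_ae (Eventually.of_forall fun ω => ?_)
    beta_reduce
    rw [← RCLike.norm_conj (g j i ω)]
    simp only [g, map_sum, map_mul, Complex.conj_conj, map_natCast]
  have hgi (j i) : Integrable (fun ω => ‖g j i ω‖ ^ 2) μ := by
    refine Integrable.of_bound ((hgm j i).norm.pow_const 2).aestronglyMeasurable (K ^ 2) ?_
    filter_upwards [hgK] with ω hω
    rw [Real.norm_of_nonneg (by positivity)]
    exact pow_le_pow_left₀ (norm_nonneg _) (hω j i) 2
  have hg : ∫ ω, ∑ j, ∑ i, ‖g j i ω‖ ^ 2 ∂μ ≤ 1 := by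
    rw [integral_finsetSum _ fun j _ => integrable_finsetSum _ fun i _ => hgi j i]
    simp only [integral_finsetSum _ fun i _ => hgi _ i, hg2]
    refine (le_of_eq ?_).trans (sum_norm_sq_le_of_mem_FB_half hY)
    simp only [Fintype.sum_prod_type, Finset.mul_sum]
    refine (Finset.sum_congr rfl fun j _ => Finset.sum_comm).trans ?_
    rw [Finset.sum_comm]
    exact Finset.sum_congr rfl fun σ _ => Finset.sum_congr rfl fun j _ => Finset.sum_comm
  have key := hx.norm_sum_integral_le hxi ha hb hgm hgK hg
  refine (le_of_eq ?_).trans key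
  rw [theta_eq_sum_pairing]
  refine congrArg _ (Finset.sum_congr rfl fun p _ => Finset.sum_congr rfl fun q _ => ?_)
  congr 2
  have hint (σ : F) (l k) : Integrable (fun ω => x p.1 q.1 ω * starRingEnd ℂ (Φ.φ σ ω l k)) μ := by
    refine (hxi _ _).mul_bdd (c := M) (Complex.continuous_conj.measurable.comp
      (Φ.measurable_entry σ l k)).aestronglyMeasurable ?_
    filter_upwards [hφ] with ω hω
    exact ((RCLike.norm_conj _).le.trans (norm_entry_le _ _ _)).trans (hω σ)
  have h1 (ω : Ω) : x p.1 q.1 ω * g q.2 p.2 ω = ∑ σ : F, ∑ l, ∑ k, (d σ : ℂ) *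
      (Y σ (q.2, l) (p.2, k) * (x p.1 q.1 ω * starRingEnd ℂ (Φ.φ σ ω l k))) := by
    simp only [g, Finset.mul_sum]
    exact Finset.sum_congr rfl fun σ _ => Finset.sum_congr rfl fun l _ =>
      Finset.sum_congr rfl fun k _ => by ring
  simp only [h1]
  rw [integral_finsetSum _ fun σ _ => integrable_finsetSum _ fun l _ => integrable_finsetSum _
    fun k _ => ((hint σ l k).const_mul _).const_mul _]
  simp only [pairing, Matrix.of_apply, Matrix.transpose_apply, Complex.ofReal_natCast]
  refine Finset.sum_congr rfl fun σ _ => ?_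
  rw [integral_finsetSum _ fun l _ => integrable_finsetSum _
    fun k _ => ((hint σ l k).const_mul _).const_mul _, Finset.sum_comm, Finset.mul_sum]
  refine Finset.sum_congr rfl fun l _ => ?_
  rw [integral_finsetSum _ fun k _ => ((hint σ l k).const_mul _).const_mul _, Finset.mul_sum]
  refine Finset.sum_congr rfl fun k _ => ?_
  rw [integral_const_mul, integral_const_mul, mul_comm (Y _ _ _)]
  rfl

/-- The transform from `L^1(Ω)` to `ℒ^∞(Σ)`. -/
lemma norm_famBlock_transformFun_le {M : ℝ} (hM : Φ.M ≤ ENNReal.ofReal M) (hM0 : 0 < M)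
    {x : Fin n → Fin n → Ω → ℂ} {η : ℝ} (hη : 0 ≤ η) (hx : matNormLone μ n x ≤ ENNReal.ofReal η)
    (σ : S) : ‖famBlock d (fun i j => Φ.transformFun (x i j)) σ‖ ≤ η * M := by
  -- The matrix (φ^σ)^* / M lies in the unit ball of M_{d_σ}(L^∞), and its pairing with `x` in the
  -- definition of the M_n(L^1) norm is the transform at σ divided by M.
  let y (k l : Fin (d σ)) (ω : Ω) : ℂ := ((M : ℝ) : ℂ)⁻¹ * (Φ.φ σ ω)ᴴ k l
  have hM' : (M : ℂ) ≠ 0 := Complex.ofReal_ne_zero.2 hM0.ne'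
  have hy (k l) : Measurable (y k l) :=
    (Complex.continuous_conj.measurable.comp (Φ.measurable_entry σ l k)).const_mul _
  have hy1 : ∀ᵐ ω ∂μ, ‖(Matrix.of fun k l => y k l ω : Matrix (Fin (d σ)) (Fin (d σ)) ℂ)‖ ≤ 1 := by
    filter_upwards [Φ.ae_norm_le hM hM0.le σ] with ω hω
    have h1 : (Matrix.of fun k l => y k l ω : Matrix (Fin (d σ)) (Fin (d σ)) ℂ)
        = ((M : ℝ) : ℂ)⁻¹ • (Φ.φ σ ω)ᴴ := by
      ext k l; rfl
    rw [h1, norm_smul, norm_inv, Complex.norm_real, Real.norm_of_nonneg hM0.le,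
      Matrix.l2_opNorm_conjTranspose]
    rw [inv_mul_le_iff₀ hM0, mul_one]
    exact hω
  have h1 := (enorm_integral_le_matNormLone x hy hy1).trans hx
  rw [← ofReal_norm, ENNReal.ofReal_le_ofReal_iff hη] at h1
  have h2 : famBlock d (fun i j => Φ.transformFun (x i j)) σ = ((M : ℝ) : ℂ) •
      (Matrix.of fun a b => ∫ ω, x a.1 b.1 ω * y a.2 b.2 ω ∂μ :
      Matrix (Fin n × Fin (d σ)) (Fin n × Fin (d σ)) ℂ) := by
    ext p q
    simp only [famBlock, transformFun, Matrix.of_apply, Matrix.smul_apply, smul_eq_mul, y]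
    rw [← integral_const_mul]
    refine integral_congr_ae (Eventually.of_forall fun ω => ?_)
    field_simp
  rw [h2, norm_smul, Complex.norm_real, Real.norm_of_nonneg hM0.le, mul_comm]
  exact mul_le_mul_of_nonneg_right h1 hM0.le

end UBQOS

/-- The map z ↦ 1/2 + z/2 carries the strip onto its right half, between the exponents 2 and 1. -/
lemma StripFn.comp_half {E : Type*} [NormedAddCommGroup E] [NormedSpace ℂ E] {f : ℂ → E}
    (hf : StripFn f) : StripFn fun z => f (1 / 2 + z / 2) := by
  obtain ⟨hd, C, hC⟩ := hf
  refine ⟨hd.comp (Differentiable.diffContOnCl (by fun_prop)) fun z hz => ?_, C, fun z h0 h1 => ?_⟩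
  · have h : (1 / 2 + z / 2 : ℂ).re = 1 / 2 + z.re / 2 := by simp
    constructor <;> rw [h] <;> linarith [hz.1, hz.2]
  · have h : (1 / 2 + z / 2 : ℂ).re = 1 / 2 + z.re / 2 := by simp
    exact hC _ (by rw [h]; linarith) (by rw [h]; linarith)

lemma IsCalderon.stripFn {V : Type*} [NormedAddCommGroup V] [NormedSpace ℂ V] {N₀ N₁ : V → ℝ≥0∞}
    {f : ℂ → V} (hf : IsCalderon N₀ N₁ f) : StripFn f := by
  have := hf.translate 0
  simpa [StripFn] using this

/-! ### Interpolation of both maps between the exponents 2 and 1 -/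

namespace UBQOS

variable {Ω : Type*} [MeasurableSpace Ω] {μ : Measure Ω} [IsProbabilityMeasure μ] {S : Type*}
  {d : S → ℕ} {Φ : UBQOS μ d} {n : ℕ}

lemma half_add_re (t : ℝ) : (1 / 2 + (t : ℂ) * Complex.I / 2 : ℂ)
    = ((1 / 2 : ℝ) : ℂ) + ((t / 2 : ℝ) : ℂ) * Complex.I := by
  push_cast; ring

lemma half_add_one_re (t : ℝ) : (1 / 2 + (1 + (t : ℂ) * Complex.I) / 2 : ℂ)
    = 1 + ((t / 2 : ℝ) : ℂ) * Complex.I := by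
  push_cast; ring

variable (Φ) in
lemma memLp_conj_entry (σ : S) (s t : Fin (d σ)) : MemLp (fun ω => (Φ.φ σ ω)ᴴ s t) ∞ μ :=
  (Φ.memLp_entry ∞ σ t s).star

lemma famBlock_transformFun_apply (w : Fin n → Fin n → Lp ℂ 1 μ) (σ : S)
    (p q : Fin n × Fin (d σ)) :
    famBlock d (fun i j => Φ.transformFun (w i j)) σ p q
      = omPair p.1 q.1 (Φ.memLp_conj_entry σ p.2 q.2).toLp w := by
  rw [omPair_apply]
  refine integral_congr_ae ?_
  filter_upwards [(Φ.memLp_conj_entry σ p.2 q.2).coeFn_toLp] with ω hω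
  rw [hω]

/-- Interpolation of the transform itself. On the left line the test form with r = 2 is bounded by
η, for every height by translation; on the right line the test form with r = ∞ is bounded by η M.
The exponents of `a`, `b` and `Y` interpolate accordingly. -/
theorem famTest_transformFun {M : ℝ} (hM : Φ.M ≤ ENNReal.ofReal M) (hM0 : 0 < M)
    {f : ℂ → Fin n → Fin n → Lp ℂ 1 μ} (hf : IsCalderon (omN₀ μ n) (omN₁ μ n) f) {η : ℝ}
    (hη : 0 ≤ η) (h0 : ∀ t : ℝ, omN₀ μ n (f (t * Complex.I)) ≤ ENNReal.ofReal η)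
    (h1 : ∀ t : ℝ, omN₁ μ n (f (1 + t * Complex.I)) ≤ ENNReal.ofReal η)
    {θ : ℝ} (hθ0 : 0 ≤ θ) (hθ1 : θ ≤ 1) :
    FamTest d ((1 - θ) / 4) (η * M ^ θ)
      (fun i j => Φ.transformFun (f ((1 / 2 + θ / 2 : ℝ) : ℂ) i j)) := by
  intro F a ha b hb Y hY
  rw [show (1 - θ) / 4 = -1 / 4 * θ + 1 / 4 by ring] at ha hb
  rw [show 1 - 2 * ((1 - θ) / 4) = 1 / 2 * θ + 1 / 2 by ring] at hY
  have hg (σ : F) : StripM fun z =>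
      famBlock d (fun i j => Φ.transformFun (f (1 / 2 + z / 2) i j)) σ := fun p q => by
    simp only [famBlock_transformFun_apply]
    exact hf.stripFn.comp_half.clm _
  have key := theta_three_lines (c := fun σ : F => (d σ : ℝ))
    (g := fun z (σ : F) => famBlock d (fun i j => Φ.transformFun (f (1 / 2 + z / 2) i j)) σ) hg
    (C₀ := η) (C₁ := η * M) (α := -1 / 4) (β := 1 / 4) (α' := 1 / 2) (β' := 1 / 2)
    ?_ ?_ hθ0 hθ1 ha hb hY
  · have h2 : ((1 / 2 + θ / 2 : ℝ) : ℂ) = 1 / 2 + (θ : ℂ) / 2 := by push_cast; ring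
    rw [h2]
    refine key.trans (le_of_eq ?_)
    rw [Real.mul_rpow hη hM0.le, ← mul_assoc, ← Real.rpow_add_of_nonneg hη (by linarith) hθ0,
      sub_add_cancel, Real.rpow_one]
  · intro t a ha b hb Y hY
    have h2 := omTest_of_isCalderon hf hη h0 h1 (θ := 1 / 2) (by norm_num) (by norm_num) (t / 2)
    rw [show (1 : ℝ) / 2 / 2 = 1 / 4 by norm_num] at h2
    have h3 := famTest_transformFun_quarter hM hM0.le (fun i j => integrable_Lp 1 _) h2 F a ha b hb
      Y (by rwa [show (1 : ℝ) - 2 * (1 / 4) = 1 / 2 by norm_num])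
    simpa only [half_add_re] using h3
  · intro t a ha b hb Y hY
    rw [show (-1 : ℝ) / 4 + 1 / 4 = 0 by norm_num] at ha hb
    rw [show (1 : ℝ) / 2 + 1 / 2 = 1 by norm_num] at hY
    refine norm_theta_le_of_norm_le (fun j => Nat.cast_nonneg _) ha hb hY (by positivity)
      fun σ => ?_
    rw [half_add_one_re]
    exact norm_famBlock_transformFun_le hM hM0 hη (h1 (t / 2)) σ

/-! ### The inverse transform -/

variable (Φ) in
/-- The partial sums of the inverse transform. -/
def partialSum (G : Finset S) (A : Fam d) (ω : Ω) : ℂ :=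
  ∑ σ ∈ G, (d σ : ℂ) * Matrix.trace (A σ * Φ.φ σ ω)

variable (Φ) in
lemma memLp_partialSum (q : ℝ≥0∞) (G : Finset S) (A : Fam d) : MemLp (Φ.partialSum G A) q μ :=
  memLp_finsetSum _ fun σ _ => Φ.memLp_term q A σ

lemma partialSum_eq (G : Finset S) (A : Fam d) (ω : Ω) : Φ.partialSum G A ω
    = ∑ σ : G, (d σ : ℂ) * ∑ s, ∑ t, A σ s t * Φ.φ σ ω t s := by
  rw [partialSum, ← Finset.sum_coe_sort G]
  simp only [Matrix.trace, Matrix.diag_apply, Matrix.mul_apply]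

lemma setIntegral_partialSum (G : Finset S) (A : Fam d) (E : Set Ω) :
    ∫ ω in E, Φ.partialSum G A ω ∂μ
      = ∑ σ : G, (d σ : ℂ) * ∑ s, ∑ t, A σ s t * ∫ ω in E, Φ.φ σ ω t s ∂μ := by
  have hi (σ : G) (s t : Fin (d σ)) :
      Integrable (fun ω => A σ s t * Φ.φ σ ω t s) (μ.restrict E) :=
    (((Φ.memLp_entry 1 σ t s).integrable le_rfl).restrict).const_mul _
  simp only [partialSum_eq]
  rw [integral_finsetSum Finset.univ fun (σ : G) _ => (integrable_finsetSum Finset.univ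
    fun s _ => integrable_finsetSum Finset.univ fun t _ => hi σ s t).const_mul _]
  refine Finset.sum_congr rfl fun σ _ => ?_
  rw [integral_const_mul, integral_finsetSum Finset.univ
    fun s _ => integrable_finsetSum Finset.univ fun t _ => hi σ s t]
  refine congrArg _ (Finset.sum_congr rfl fun s _ => ?_)
  rw [integral_finsetSum Finset.univ fun t _ => hi σ s t]
  exact Finset.sum_congr rfl fun t _ => integral_const_mul _ _

/-- The inverse transform from `ℒ^2(Σ)` to `L^2(Ω)`, in terms of the test forms. -/
lemma omTest_partialSum_quarter {η : ℝ} {x : Fin n → Fin n → Fam d} (hx : FamTest d (1 / 4) η x)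
    (G : Finset S) : OmTest μ (1 / 4) η (fun i j => Φ.partialSum G (x i j)) := by
  intro J _ E hE hEd hE0 a ha b hb Y hY
  rw [show (1 : ℝ) - 2 * (1 / 4) = 1 / 2 by norm_num] at hY
  let h (j i : Fin n) (ω : Ω) : ℂ := ∑ m, (E m).indicator (fun _ => Y m (j, ()) (i, ())) ω
  have hhm (j i) : Measurable (h j i) :=
    Finset.measurable_fun_sum _ fun m _ => measurable_const.indicator (hE m)
  have hh (j i) : MemLp (h j i) 2 μ :=
    memLp_finsetSum _ fun m _ => (memLp_const _).indicator (hE m)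
  -- The coefficient family of the step function built from `Y`. Bessel's inequality puts it in the
  -- unit Hilbert-Schmidt ball, and the test form on Ω becomes the test form on Σ with `Z` in place
  -- of `Y`.
  let Z (σ : G) : Matrix (Fin n × Fin (d σ)) (Fin n × Fin (d σ)) ℂ :=
    Matrix.of fun p q => ∫ ω, h p.1 q.1 ω * Φ.φ σ ω p.2 q.2 ∂μ
  have hφi (σ : S) (s t) : Integrable (fun ω => Φ.φ σ ω s t) μ :=
    (Φ.memLp_entry 1 σ s t).integrable le_rfl
  have hZ (σ : G) (p q) : Z σ p q
      = ∑ m, (∫ ω in E m, Φ.φ σ ω p.2 q.2 ∂μ) * Y m (p.1, ()) (q.1, ()) := by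
    simp only [Z, Matrix.of_apply, h]
    rw [← integral_mul_sum_indicator hE (hφi σ p.2 q.2)]
    exact integral_congr_ae (Eventually.of_forall fun ω => mul_comm _ _)
  have hh2 (j i) : ∫ ω, ‖h j i ω‖ ^ 2 ∂μ = ∑ m, μ.real (E m) * ‖Y m (j, ()) (i, ())‖ ^ 2 := by
    rw [← integral_step hE]
    refine integral_congr_ae (Eventually.of_forall fun ω => ?_)
    by_cases hω : ∃ m, ω ∈ E m
    · obtain ⟨m, hm⟩ := hω
      simp only [h]
      rw [sum_indicator_of_mem hEd (fun m => Y m (j, ()) (i, ())) hm,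
        sum_indicator_of_mem hEd (fun m => ‖Y m (j, ()) (i, ())‖ ^ 2) hm]
    · push Not at hω
      simp only [h]
      rw [sum_indicator_of_notMem (fun m => Y m (j, ()) (i, ())) hω,
        sum_indicator_of_notMem (fun m => ‖Y m (j, ()) (i, ())‖ ^ 2) hω, norm_zero,
        zero_pow two_ne_zero]
  have hZF : Z ∈ FB (κ := fun σ : G => Fin n × Fin (d σ)) (fun σ : G => (d σ : ℝ)) (1 / 2) := by
    refine mem_FB_half ?_
    calc ∑ σ : G, (d σ : ℝ) * ∑ p, ∑ q, ‖Z σ p q‖ ^ 2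
        = ∑ j, ∑ i, ∑ σ : G, (d σ : ℝ) * ∑ s, ∑ t, ‖∫ ω, h j i ω * Φ.φ σ ω s t ∂μ‖ ^ 2 := by
          simp only [Fintype.sum_prod_type, Finset.mul_sum, Z, Matrix.of_apply]
          rw [Finset.sum_comm]
          refine Finset.sum_congr rfl fun j _ => ?_
          rw [Finset.sum_comm (s := Finset.univ (α := Fin n))]
          exact Finset.sum_congr rfl fun σ _ => Finset.sum_comm
      _ ≤ ∑ j, ∑ i, ∫ ω, ‖h j i ω‖ ^ 2 ∂μ := Finset.sum_le_sum fun j _ =>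
          Finset.sum_le_sum fun i _ => Φ.sum_norm_sq_integral_le G (hh j i)
      _ = ∑ m, μ.real (E m) * ∑ p, ∑ q, ‖Y m p q‖ ^ 2 := by
          simp only [hh2, Fintype.sum_prod_type, Finset.mul_sum, Finset.univ_unique,
            Finset.sum_singleton]
          refine (Finset.sum_congr rfl fun j _ => Finset.sum_comm).trans ?_
          rw [Finset.sum_comm]
      _ ≤ 1 := sum_norm_sq_le_of_mem_FB_half hY
  have key := hx G a ha b hb Z (by rwa [show (1 : ℝ) - 2 * (1 / 4) = 1 / 2 by norm_num])
  refine (le_of_eq ?_).trans key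
  rw [theta_eq_sum_pairing, theta_eq_sum_pairing]
  refine congrArg _ (Finset.sum_congr rfl fun p _ => Finset.sum_congr rfl fun q _ => ?_)
  congr 2
  have h1 (m : J) : ((μ.real (E m) : ℝ) : ℂ) * ∑ _k : Unit, ∑ _l : Unit,
      omAvg μ (fun i j => Φ.partialSum G (x i j)) (E m) (p.1, ()) (q.1, ()) * Y m (q.2, ()) (p.2, ())
      = ∑ σ : G, (d σ : ℂ) * ∑ s, ∑ t, x p.1 q.1 σ s t *
        ((∫ ω in E m, Φ.φ σ ω t s ∂μ) * Y m (q.2, ()) (p.2, ())) := by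
    have hpos : ((μ.real (E m) : ℝ) : ℂ) ≠ 0 :=
      Complex.ofReal_ne_zero.2 (measureReal_pos (hE0 m)).ne'
    simp only [Finset.univ_unique, Finset.sum_singleton, omAvg, Matrix.of_apply]
    rw [← mul_assoc, ← mul_assoc, mul_inv_cancel₀ hpos, one_mul, setIntegral_partialSum]
    simp only [Finset.sum_mul, mul_assoc]
  simp only [pairing, Matrix.of_apply, Matrix.transpose_apply, Complex.ofReal_natCast, famBlock, hZ]
  refine (Finset.sum_congr rfl fun m _ => h1 m).trans ?_
  rw [Finset.sum_comm]
  refine Finset.sum_congr rfl fun σ _ => ?_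
  rw [← Finset.mul_sum, Finset.sum_comm]
  refine congrArg _ (Finset.sum_congr rfl fun s _ => ?_)
  rw [Finset.sum_comm]
  exact Finset.sum_congr rfl fun t _ => (Finset.mul_sum _ _ _).symm

/-- The inverse transform from `ℒ^1(Σ)` to `L^∞(Ω)`. -/
lemma ae_norm_partialSum_le {M : ℝ} (hM : Φ.M ≤ ENNReal.ofReal M) (hM0 : 0 < M)
    {x : Fin n → Fin n → Fam d} {η : ℝ} (hη : 0 ≤ η) (hx : matNormFamOne d n x ≤ ENNReal.ofReal η)
    (G : Finset S) : ∀ᵐ ω ∂μ, ‖(Matrix.of fun i j => Φ.partialSum G (x i j) ω :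
      Matrix (Fin n) (Fin n) ℂ)‖ ≤ η * M := by
  classical
  have hφ : ∀ᵐ ω ∂μ, ∀ σ : G, ‖Φ.φ σ ω‖ ≤ M := ae_all_iff.2 fun σ => Φ.ae_norm_le hM hM0.le σ
  filter_upwards [hφ] with ω hω
  have hM' : (M : ℂ) ≠ 0 := Complex.ofReal_ne_zero.2 hM0.ne'
  -- For fixed ω the 1 × 1 test family φ^T / M, cut off outside `G`, makes the parallel pairing
  -- equal to the partial sum at ω divided by M.
  let y (_ _ : Fin 1) : Fam d := famTrunc G fun σ => ((M : ℝ) : ℂ)⁻¹ • (Φ.φ σ ω)ᵀ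
  have hy : matNormFamInf d 1 y ≤ 1 := by
    refine iSup_le fun σ => ?_
    let e : Fin 1 × Fin (d σ) ≃ Fin (d σ) := Equiv.uniqueProd (Fin (d σ)) (Fin 1)
    change ‖(y 0 0 σ).submatrix e e‖ₑ ≤ 1
    rw [← ofReal_norm, ← ENNReal.ofReal_one]
    refine ENNReal.ofReal_le_ofReal ((norm_le_of_submatrix e _).trans ?_)
    by_cases hσ : σ ∈ G
    · simp only [y]
      rw [famTrunc_of_mem _ hσ, norm_smul, norm_inv, Complex.norm_real, Real.norm_of_nonneg hM0.le,
        inv_mul_le_iff₀ hM0, mul_one]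
      exact (opNorm_transpose_le _).trans (hω ⟨σ, hσ⟩)
    · simp only [y]
      rw [famTrunc_of_notMem _ hσ, norm_zero]
      exact zero_le_one
  have h1 : ‖(Matrix.of fun a b => ∑ σ ∈ G, (d σ : ℂ) * ∑ s, ∑ t, x a.1 b.1 σ s t * y a.2 b.2 σ s t :
      Matrix (Fin n × Fin 1) (Fin n × Fin 1) ℂ)‖ₑ ≤ ENNReal.ofReal η := by
    refine le_trans ?_ hx
    exact le_iSup_of_le G (le_iSup_of_le 1 (le_iSup_of_le y (le_iSup_of_le hy le_rfl)))
  rw [← ofReal_norm, ENNReal.ofReal_le_ofReal_iff hη] at h1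
  let e : Fin n ≃ Fin n × Fin 1 := (Equiv.prodUnique (Fin n) (Fin 1)).symm
  have h2 : (Matrix.of fun i j => Φ.partialSum G (x i j) ω : Matrix (Fin n) (Fin n) ℂ)
      = ((M : ℝ) : ℂ) • (Matrix.of fun a b => ∑ σ ∈ G, (d σ : ℂ) *
        ∑ s, ∑ t, x a.1 b.1 σ s t * y a.2 b.2 σ s t :
          Matrix (Fin n × Fin 1) (Fin n × Fin 1) ℂ).submatrix e e := by
    ext i j
    rw [Matrix.of_apply, partialSum_eq, Matrix.smul_apply, Matrix.submatrix_apply, Matrix.of_apply,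
      smul_eq_mul, Finset.mul_sum, ← Finset.sum_coe_sort G]
    refine Finset.sum_congr rfl fun σ _ => ?_
    simp only [y, famTrunc_of_mem _ σ.2, Matrix.smul_apply, Matrix.transpose_apply, smul_eq_mul]
    simp only [Finset.mul_sum]
    refine Finset.sum_congr rfl fun s _ => Finset.sum_congr rfl fun t _ => ?_
    change _ = _ * (_ * (x i j σ s t * _))
    field_simp
  rw [h2, norm_smul, Complex.norm_real, Real.norm_of_nonneg hM0.le, mul_comm]
  exact mul_le_mul_of_nonneg_right ((norm_le_of_submatrix e _).trans h1) hM0.le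

/-- The same interpolation for the inverse transform. Partial sums depend on finitely many
coordinates, so holomorphy is immediate, and the bound does not depend on `G`; this uniformity later
gives the estimate for the full series. -/
theorem omTest_partialSum {M : ℝ} (hM : Φ.M ≤ ENNReal.ofReal M) (hM0 : 0 < M)
    {f : ℂ → Fin n → Fin n → FamInf d} (hf : IsCalderon (famN₀ d n) (famN₁ d n) f) {η : ℝ}
    (hη : 0 ≤ η) (h0 : ∀ t : ℝ, famN₀ d n (f (t * Complex.I)) ≤ ENNReal.ofReal η)
    (h1 : ∀ t : ℝ, famN₁ d n (f (1 + t * Complex.I)) ≤ ENNReal.ofReal η)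
    {θ : ℝ} (hθ0 : 0 ≤ θ) (hθ1 : θ ≤ 1) (G : Finset S) :
    OmTest μ ((1 - θ) / 4) (η * M ^ θ)
      (fun i j => Φ.partialSum G (f ((1 / 2 + θ / 2 : ℝ) : ℂ) i j)) := by
  intro J _ E hE hEd hE0 a ha b hb Y hY
  rw [show (1 - θ) / 4 = -1 / 4 * θ + 1 / 4 by ring] at ha hb
  rw [show 1 - 2 * ((1 - θ) / 4) = 1 / 2 * θ + 1 / 2 by ring] at hY
  have hg (m : J) : StripM fun z =>
      omAvg μ (fun i j => Φ.partialSum G (f (1 / 2 + z / 2) i j)) (E m) := fun p q => by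
    simp only [omAvg, Matrix.of_apply, setIntegral_partialSum]
    exact (StripFn.const _).mul (StripFn.sum _ fun σ => (StripFn.const _).mul (StripFn.sum _ fun s =>
      StripFn.sum _ fun t => StripFn.mul (hf.stripFn.comp_half.clm (famEntry d p.1 q.1 σ s t))
        (StripFn.const _)))
  have key := theta_three_lines (κ := fun _ : J => Unit) (c := fun m => μ.real (E m))
    (g := fun z m => omAvg μ (fun i j => Φ.partialSum G (f (1 / 2 + z / 2) i j)) (E m)) hg
    (C₀ := η) (C₁ := η * M) (α := -1 / 4) (β := 1 / 4) (α' := 1 / 2) (β' := 1 / 2)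
    ?_ ?_ hθ0 hθ1 ha hb hY
  · have h2 : ((1 / 2 + θ / 2 : ℝ) : ℂ) = 1 / 2 + (θ : ℂ) / 2 := by push_cast; ring
    rw [h2]
    refine key.trans (le_of_eq ?_)
    rw [Real.mul_rpow hη hM0.le, ← mul_assoc, ← Real.rpow_add_of_nonneg hη (by linarith) hθ0,
      sub_add_cancel, Real.rpow_one]
  · intro t a ha b hb Y hY
    have h2 := famTest_of_isCalderon hf hη h0 h1 (θ := 1 / 2) (by norm_num) (by norm_num) (t / 2)
    rw [show (1 : ℝ) / 2 / 2 = 1 / 4 by norm_num] at h2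
    have h3 := omTest_partialSum_quarter (Φ := Φ) h2 G J E hE hEd hE0 a ha b hb
      Y (by rwa [show (1 : ℝ) - 2 * (1 / 4) = 1 / 2 by norm_num])
    simpa only [half_add_re] using h3
  · intro t a ha b hb Y hY
    rw [show (-1 : ℝ) / 4 + 1 / 4 = 0 by norm_num] at ha hb
    rw [show (1 : ℝ) / 2 + 1 / 2 = 1 by norm_num] at hY
    refine norm_theta_le_of_norm_le (fun j => measureReal_nonneg) ha hb hY (by positivity)
      fun m => ?_
    rw [half_add_one_re]
    exact norm_omAvg_le (fun i j => (Φ.memLp_partialSum 1 G _).integrable le_rfl) (by positivity)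
      (ae_norm_partialSum_le hM hM0 hη (h1 (t / 2)) G) (hE0 m)

end UBQOS

/-- The parameter θ = 2/p - 1 solves 1/p = 1/2 + θ/2, and then the test exponent 1/(2q) is (1 -
θ)/4. -/
lemma holderConjugate_exponents {p q : ℝ≥0∞} [ENNReal.HolderConjugate p q] (hp1 : p ≠ 1)
    (hp : p ≤ 2) : 1 < p ∧ p ≠ ∞ ∧ 1 < q ∧ q ≠ ∞ ∧ 0 ≤ 2 / p.toReal - 1 ∧ 2 / p.toReal - 1 < 1 ∧
      p.toReal⁻¹ = 1 / 2 + (2 / p.toReal - 1) / 2 ∧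
      q.toReal⁻¹ = 2 * ((1 - (2 / p.toReal - 1)) / 4) := by
  have h1 : 1 < p := lt_of_le_of_ne (ENNReal.HolderConjugate.one_le p q) hp1.symm
  have h2 : p ≠ ∞ := (hp.trans_lt (by norm_num)).ne
  have h3 : 1 < q := (ENNReal.HolderConjugate.lt_top_iff_one_lt p q).1 h2.lt_top
  have h4 : q ≠ ∞ := ((ENNReal.HolderConjugate.lt_top_iff_one_lt q p).2 h1).ne
  have h5 : 1 < p.toReal := by
    rw [← ENNReal.toReal_one]
    exact (ENNReal.toReal_lt_toReal ENNReal.one_ne_top h2).2 h1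
  have h6 : p.toReal ≤ 2 := by
    simpa using ENNReal.toReal_mono (by norm_num) hp
  have h7 : p.toReal⁻¹ + q.toReal⁻¹ = 1 := by
    rw [← ENNReal.toReal_inv, ← ENNReal.toReal_inv, ← ENNReal.toReal_add
      (ENNReal.inv_ne_top.2 (zero_lt_one.trans h1).ne') (ENNReal.inv_ne_top.2 (zero_lt_one.trans h3).ne'),
      ENNReal.HolderConjugate.inv_add_inv_eq_one p q, ENNReal.toReal_one]
  refine ⟨h1, h2, h3, h4, ?_, ?_, by field_simp; ring, ?_⟩
  · rw [sub_nonneg, le_div_iff₀ (by linarith)]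
    linarith
  · rw [sub_lt_iff_lt_add, div_lt_iff₀ (by linarith)]
    linarith
  · rw [div_eq_mul_inv 2 p.toReal]
    linarith

/-- One ε makes the Calderon function almost optimal; the other makes the bound on φ strictly
positive, so that one may divide by it even when M vanishes, as it does for an empty index set. -/
lemma le_rpow_of_forall_le {N M : ℝ≥0∞} (hM : M ≠ ∞) {θ : ℝ} (hθ : 0 ≤ θ)
    (h : ∀ ε : ℝ, 0 < ε → N ≤ ENNReal.ofReal ((1 + ε) * (M.toReal + ε) ^ θ)) : N ≤ M ^ θ := by
  have h1 : Tendsto (fun ε : ℝ => ENNReal.ofReal ((1 + ε) * (M.toReal + ε) ^ θ)) (𝓝[>] 0)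
      (𝓝 (ENNReal.ofReal ((1 + 0) * (M.toReal + 0) ^ θ))) := by
    refine (ENNReal.continuous_ofReal.tendsto _).comp (Tendsto.mono_left ?_ nhdsWithin_le_nhds)
    exact Continuous.tendsto ((by fun_prop : Continuous fun ε : ℝ => 1 + ε).mul
      (Continuous.rpow_const (by fun_prop) fun _ => Or.inr hθ)) 0
  rw [add_zero, add_zero, one_mul, ← ENNReal.ofReal_rpow_of_nonneg ENNReal.toReal_nonneg hθ,
    ENNReal.ofReal_toReal hM] at h1
  exact ge_of_tendsto h1 (eventually_nhdsWithin_of_forall h)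

/-! ### The bounds for the transform and its inverse -/

namespace UBQOS

variable {Ω : Type*} [MeasurableSpace Ω] {μ : Measure Ω} [IsProbabilityMeasure μ] {S : Type*}
  {d : S → ℕ} {Φ : UBQOS μ d} {n : ℕ}

lemma transform_eq (p : ℝ≥0∞) (f : Lp ℂ p μ) : Φ.transform p f = Φ.transformFun f := rfl

lemma transformFun_congr {f g : Ω → ℂ} (h : f =ᵐ[μ] g) : Φ.transformFun f = Φ.transformFun g := by
  funext σ
  ext i j
  refine integral_congr_ae ?_
  filter_upwards [h] with ω hω
  rw [hω]

lemma le_ofReal_toReal_add {ε : ℝ} (hε : 0 < ε) : Φ.M ≤ ENNReal.ofReal (Φ.M.toReal + ε) := by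
  have hM : Φ.M ≠ ∞ := Φ.bounded.ne
  rw [ENNReal.ofReal_add ENNReal.toReal_nonneg hε.le, ENNReal.ofReal_toReal hM]
  exact le_self_add

lemma toReal_add_pos {ε : ℝ} (hε : 0 < ε) : 0 < Φ.M.toReal + ε :=
  add_pos_of_nonneg_of_pos ENNReal.toReal_nonneg hε

/-- The transform, in terms of the test form of `ℒ^q(Σ)`. -/
lemma famTest_transform {p : ℝ≥0∞} (hp1 : p ≠ 1) (hp : p ≠ ∞) {M : ℝ}
    (hM : Φ.M ≤ ENNReal.ofReal M) (hM0 : 0 < M) {θ : ℝ} (hθ0 : 0 ≤ θ) (hθ1 : θ ≤ 1)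
    (hpθ : p.toReal⁻¹ = 1 / 2 + θ / 2) {x : Matrix (Fin n) (Fin n) (Lp ℂ p μ)} {η : ℝ} (hη : 0 ≤ η)
    (hx : matNormLp μ p n x < ENNReal.ofReal η) :
    FamTest d ((1 - θ) / 4) (η * M ^ θ) (fun i j => Φ.transform p (x i j)) := by
  obtain ⟨f, hf, hfx, h0, h1⟩ := exists_isCalderon_of_matNormLp_lt hp1 hp hx
  have key := famTest_transformFun hM hM0 hf hη h0 h1 hθ0 hθ1
  have h2 : (fun i j => Φ.transformFun (f ((1 / 2 + θ / 2 : ℝ) : ℂ) i j))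
      = fun i j => Φ.transform p (x i j) := by
    funext i j
    rw [← hpθ, transformFun_congr (hfx i j), transform_eq]
  rwa [h2] at key

lemma famNorm_transform_lt_top {p q : ℝ≥0∞} [Fact (1 ≤ p)] [ENNReal.HolderConjugate p q]
    (hp : p ≤ 2) (f : Lp ℂ p μ) : famNorm d q (Φ.transform p f) < ∞ := by
  by_cases hp1 : p = 1
  · have hq : q = ∞ := (ENNReal.HolderConjugate.eq_top_iff_eq_one q p).2 hp1
    rw [hq, famNorm, if_pos rfl]
    set M : ℝ := Φ.M.toReal + 1
    have hM := le_ofReal_toReal_add (Φ := Φ) zero_lt_one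
    have hM0 : 0 < M := toReal_add_pos zero_lt_one
    have hf : Integrable f μ := integrable_Lp p f
    refine lt_of_le_of_lt (b := ENNReal.ofReal ((∫ ω, ‖f ω‖ ∂μ) * M)) ?_ ENNReal.ofReal_lt_top
    refine iSup_le fun σ => ?_
    rw [schattenNorm, if_pos rfl, ← ofReal_norm]
    refine ENNReal.ofReal_le_ofReal (opNorm_le_of_bilin _
      (mul_nonneg (integral_nonneg fun _ => norm_nonneg _) hM0.le) fun ξ ζ => ?_)
    have hφ := Φ.ae_norm_le hM hM0.le σ
    have hi (i j : Fin (d σ)) : Integrable (fun ω => ξ i * (f ω * (Φ.φ σ ω)ᴴ i j) * ζ j) μ := by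
      refine ((hf.mul_bdd (c := M) (Complex.continuous_conj.measurable.comp
        (Φ.measurable_entry σ j i)).aestronglyMeasurable ?_).const_mul _).mul_const _
      filter_upwards [hφ] with ω hω
      exact ((RCLike.norm_conj _).le.trans (norm_entry_le _ _ _)).trans hω
    have h1 : ∑ i, ∑ j, ξ i * Φ.transform p f σ i j * ζ j
        = ∫ ω, ∑ i, ∑ j, ξ i * (f ω * (Φ.φ σ ω)ᴴ i j) * ζ j ∂μ := by
      rw [integral_finsetSum _ fun i _ => integrable_finsetSum _ fun j _ => hi i j]
      refine Finset.sum_congr rfl fun i _ => ?_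
      rw [integral_finsetSum _ fun j _ => hi i j]
      refine Finset.sum_congr rfl fun j _ => ?_
      rw [integral_mul_const, integral_const_mul]
      rfl
    rw [h1, ← integral_mul_const, ← integral_mul_const]
    refine norm_integral_le_of_norm_le ((hf.norm.mul_const _).mul_const _) ?_
    filter_upwards [hφ] with ω hω
    have h2 : ∑ i, ∑ j, ξ i * (f ω * (Φ.φ σ ω)ᴴ i j) * ζ j
        = f ω * ∑ i, ∑ j, ξ i * (Φ.φ σ ω)ᴴ i j * ζ j := by
      simp only [Finset.mul_sum]
      exact Finset.sum_congr rfl fun i _ => Finset.sum_congr rfl fun j _ => by ring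
    rw [h2, norm_mul, mul_assoc]
    refine mul_le_mul_of_nonneg_left ((norm_bilin_le _ _ _).trans ?_) (norm_nonneg _)
    rw [Matrix.l2_opNorm_conjTranspose]
    exact mul_le_mul_of_nonneg_right hω (mul_nonneg (l2_nonneg _) (l2_nonneg _))
  · obtain ⟨hp1', hp', hq1, hq, hθ0, hθ1, hpθ, hqθ⟩ := holderConjugate_exponents (q := q) hp1 hp
    have hpu : p.toReal⁻¹ = 2 * (p.toReal⁻¹ / 2) := by ring
    -- A single function is a 1 × 1 matrix, for which Hölder's inequality gives a finite matrix
    -- norm; only finiteness is needed here.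
    have h1 := omTest_of_memLp hp1' hp' hpu (x := fun _ _ : Fin 1 => f) fun _ _ => Lp.memLp f
    simp only [Finset.univ_unique, Finset.sum_singleton] at h1
    have h2 : matNormLp μ p 1 (Matrix.of fun _ _ => f) ≤ ENNReal.ofReal (eLpNorm f p μ).toReal :=
      OmTest.matNormLp_le hp1' hp' hpu ENNReal.toReal_nonneg h1
    have h3 := h2.trans_lt ((ENNReal.ofReal_lt_ofReal_iff (by positivity)).2 (lt_add_one _))
    have h4 := famTest_transform hp1 hp' (le_ofReal_toReal_add (Φ := Φ) zero_lt_one)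
      (toReal_add_pos zero_lt_one) hθ0 hθ1.le hpθ (by positivity) h3
    exact (h4.famNorm_le (zero_lt_one.trans hq1).ne' hq hqθ 0 0).trans_lt ENNReal.ofReal_lt_top

/-- For p > 1 the easy half of the characterization, the interpolated transform and the hard half
are combined for each n. At p = 1 the norm at σ is read off directly from the duality. -/
lemma cbNorm_transform_le {p q : ℝ≥0∞} [Fact (1 ≤ p)] [ENNReal.HolderConjugate p q]
    (hp : p ≤ 2) : cbNorm (matNormLp μ p) (matNormFam d q) (Φ.transform p)
      ≤ Φ.M ^ (2 / p.toReal - 1) := by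
  refine iSup_le fun n => iSup_le fun x => iSup_le fun hx => ?_
  by_cases hp1 : p = 1
  · have hq : q = ∞ := (ENNReal.HolderConjugate.eq_top_iff_eq_one q p).2 hp1
    have he : 2 / p.toReal - 1 = 1 := by rw [hp1]; norm_num
    rw [he]
    refine le_rpow_of_forall_le Φ.bounded.ne zero_le_one fun ε hε => ?_
    rw [matNormLp, if_neg (by rw [hp1]; exact ENNReal.one_ne_top), if_pos hp1,
      ← ENNReal.ofReal_one] at hx
    rw [matNormFam, if_pos hq]
    refine iSup_le fun σ => ?_
    have h1 := norm_famBlock_transformFun_le (le_ofReal_toReal_add (Φ := Φ) hε) (toReal_add_pos hε)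
      zero_le_one hx σ
    rw [← ofReal_norm, Real.rpow_one]
    refine ENNReal.ofReal_le_ofReal (h1.trans ?_)
    exact mul_le_mul_of_nonneg_right (by linarith) (toReal_add_pos hε).le
  · obtain ⟨hp1', hp', hq1, hq, hθ0, hθ1, hpθ, hqθ⟩ := holderConjugate_exponents (q := q) hp1 hp
    refine le_rpow_of_forall_le Φ.bounded.ne hθ0 fun ε hε => ?_
    have h1 : matNormLp μ p n x < ENNReal.ofReal (1 + ε) := by
      refine hx.trans_lt ?_
      rw [← ENNReal.ofReal_one]
      exact (ENNReal.ofReal_lt_ofReal_iff (by positivity)).2 (by linarith)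
    have h2 := famTest_transform hp1 hp' (le_ofReal_toReal_add (Φ := Φ) hε) (toReal_add_pos hε)
      hθ0 hθ1.le hpθ (by positivity) h1
    exact FamTest.matNormFam_le Φ.d_pos hq1.ne' hq (by linarith) (by linarith) hqθ
      (mul_nonneg (by positivity) (Real.rpow_nonneg (toReal_add_pos hε).le _)) h2

/-! ### The inverse transform on `ℒ^p(Σ)` -/

lemma coeFn_sum_term (q : ℝ≥0∞) (A : Fam d) (G : Finset S) :
    (∑ σ ∈ G, Φ.term q A σ : Lp ℂ q μ) =ᵐ[μ] Φ.partialSum G A := by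
  have h : ∀ᵐ ω ∂μ, ∀ σ : G, Φ.term q A σ ω = (d σ : ℂ) * Matrix.trace (A σ * Φ.φ σ ω) :=
    ae_all_iff.2 fun σ => (Φ.memLp_term q A σ).coeFn_toLp
  filter_upwards [h, Lp.coeFn_finsetSum G (Φ.term q A)] with ω h1 h2
  rw [h2, Finset.sum_apply, partialSum]
  exact Finset.sum_congr rfl fun σ hσ => h1 ⟨σ, hσ⟩

lemma partialSum_famTrunc (G : Finset S) (A : Fam d) :
    Φ.partialSum G (famTrunc G A) = Φ.partialSum G A := by
  funext ω
  exact Finset.sum_congr rfl fun σ hσ => by rw [famTrunc_of_mem A hσ]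

/-- The inverse transform, in terms of the test form of `L^q(Ω)`. -/
lemma omTest_partialSum_of_matNormFam_lt {p : ℝ≥0∞} (hp1 : p ≠ 1) (hp : p ≠ ∞) {M : ℝ}
    (hM : Φ.M ≤ ENNReal.ofReal M) (hM0 : 0 < M) {θ : ℝ} (hθ0 : 0 ≤ θ) (hθ1 : θ ≤ 1)
    (hpθ : p.toReal⁻¹ = 1 / 2 + θ / 2) {x : Matrix (Fin n) (Fin n) (Fam d)} {η : ℝ} (hη : 0 ≤ η)
    (hx : matNormFam d p n x < ENNReal.ofReal η) (G : Finset S) :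
    OmTest μ ((1 - θ) / 4) (η * M ^ θ) (fun i j => Φ.partialSum G (x i j)) := by
  obtain ⟨f, hf, hfx, h0, h1⟩ := exists_isCalderon_of_matNormFam_lt hp1 hp hx
  have key := omTest_partialSum hM hM0 hf hη h0 h1 hθ0 hθ1 G
  have h2 (i j) : ⇑(f ((1 / 2 + θ / 2 : ℝ) : ℂ) i j) = x i j := by
    funext σ
    rw [← hpθ, hfx]
  simpa only [h2] using key

/-- A finite matrix norm forces every entry into ℒ^p, so the series defining its inverse transform
converges. -/
lemma famNorm_lt_top_of_matNormFam_lt {p : ℝ≥0∞} (hp0 : p ≠ 0) (hp1 : p ≠ 1) (hp : p ≠ ∞)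
    (hp2 : p.toReal⁻¹ ≤ 1) {x : Matrix (Fin n) (Fin n) (Fam d)} {η : ℝ} (hη : 0 ≤ η)
    (hx : matNormFam d p n x < ENNReal.ofReal η) (i j : Fin n) : famNorm d p (x i j) < ∞ := by
  obtain ⟨f, hf, hfx, h0, h1⟩ := exists_isCalderon_of_matNormFam_lt hp1 hp hx
  have key := famTest_of_isCalderon hf hη h0 h1 (θ := p.toReal⁻¹)
    (inv_nonneg.2 ENNReal.toReal_nonneg) hp2 0
  have h3 := key.famNorm_le hp0 hp (by ring) i j
  have h2 : (fun σ => f (((p.toReal⁻¹ : ℝ) : ℂ) + ((0 : ℝ) : ℂ) * Complex.I) i j σ) = x i j := by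
    funext σ
    rw [Complex.ofReal_zero, zero_mul, add_zero, hfx]
  rw [h2] at h3
  exact h3.trans_lt ENNReal.ofReal_lt_top

lemma summable_term {p q : ℝ≥0∞} [Fact (1 ≤ q)] [ENNReal.HolderConjugate p q]
    (hp : p ≤ 2) {A : Fam d} (hA : famNorm d p A < ∞) : Summable (Φ.term q A) := by
  have hp0 : p ≠ 0 := ENNReal.HolderConjugate.ne_zero p q
  have hp' : p ≠ ∞ := (hp.trans_lt (by norm_num)).ne
  have hp'' : 0 < p.toReal := ENNReal.toReal_pos hp0 hp'
  obtain ⟨U, V, s, hU, hV, hs, h, hn⟩ := exists_pw_famNorm A hp0 hp' rfl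
  set M : ℝ := Φ.M.toReal + 1
  have hM := le_ofReal_toReal_add (Φ := Φ) zero_lt_one
  have hM0 : 0 < M := toReal_add_pos zero_lt_one
  have hT0 (σ : S) : 0 ≤ (d σ : ℝ) * ∑ i, s σ i :=
    mul_nonneg (Nat.cast_nonneg _) (Finset.sum_nonneg fun i _ => hs σ i)
  have hT : Summable fun σ => (d σ : ℝ) * ∑ i, s σ i := by
    have h1 : ∑' σ, ENNReal.ofReal (d σ * ∑ i, s σ i) ≠ ∞ := fun h1 => by
      rw [hn, h1, ENNReal.top_rpow_of_pos (inv_pos.2 hp'')] at hA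
      exact lt_irrefl _ hA
    have h2 := ENNReal.summable_toReal h1
    simpa only [ENNReal.toReal_ofReal (hT0 _)] using h2
  by_cases hp1 : p = 1
  · have hq : q = ∞ := (ENNReal.HolderConjugate.eq_top_iff_eq_one q p).2 hp1
    refine Summable.of_norm_bounded (hT.mul_left M) fun σ => ?_
    have hb : ∀ᵐ ω ∂μ, ‖Φ.term q A σ ω‖ ≤ M * (d σ * ∑ i, s σ i) := by
      filter_upwards [(Φ.memLp_term q A σ).coeFn_toLp, Φ.ae_norm_le hM hM0.le σ] with ω h1 h2
      rw [term, h1, norm_mul, Complex.norm_natCast, Matrix.trace_mul_comm, h, hp1,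
        ENNReal.toReal_one, inv_one]
      calc (d σ : ℝ) * ‖(Φ.φ σ ω * pw (U σ) (V σ) (s σ) ((1 : ℝ) : ℂ)).trace‖
          ≤ d σ * (‖Φ.φ σ ω‖ * ∑ i, s σ i) := mul_le_mul_of_nonneg_left
            (norm_trace_mul_pw_le (hU σ) (hV σ) (hs σ) (by simp) _) (Nat.cast_nonneg _)
        _ = ‖Φ.φ σ ω‖ * (d σ * ∑ i, s σ i) := by ring
        _ ≤ M * (d σ * ∑ i, s σ i) := mul_le_mul_of_nonneg_right h2 (hT0 σ)
    refine (Lp.norm_le_of_ae_bound (mul_nonneg hM0.le (hT0 σ)) hb).trans (le_of_eq ?_)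
    rw [hq]
    simp
  · obtain ⟨hp1', -, hq1, hq, hθ0, hθ1, hpθ, hqθ⟩ := holderConjugate_exponents (q := q) hp1 hp
    set θ : ℝ := 2 / p.toReal - 1
    have hpu : p.toReal⁻¹ = 2 * (p.toReal⁻¹ / 2) := by ring
    have hpos : 0 < p.toReal⁻¹ := inv_pos.2 hp''
    have hle : p.toReal⁻¹ < 1 := by linarith
    -- The inequality for 1 × 1 matrices, applied to the truncation of `A` to `G`: a finite block of
    -- terms is bounded by the ℒ^p norm of that block. Summability is then the Cauchy criterion over
    -- finite sets, hence unconditional.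
    have key (G : Finset S) : ‖∑ σ ∈ G, Φ.term q A σ‖
        ≤ (∑ σ ∈ G, (d σ : ℝ) * ∑ i, s σ i) ^ p.toReal⁻¹ * M ^ θ := by
      set C : ℝ := (∑ σ ∈ G, (d σ : ℝ) * ∑ i, s σ i) ^ p.toReal⁻¹
      have hC : 0 ≤ C := Real.rpow_nonneg (Finset.sum_nonneg fun σ _ => hT0 σ) _
      have h1 : FamTest d (p.toReal⁻¹ / 2) C (fun _ _ : Fin 1 => famTrunc G A) := by
        have h2 := famTest_famTrunc (A := A) (u := p.toReal⁻¹ / 2) (by linarith) (by linarith) hU hV hs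
          (fun σ => by rw [h σ, ← hpu]) G
        rwa [← hpu] at h2
      have h2 : matNormFam d p 1 (Matrix.of fun _ _ => famTrunc G A) ≤ ENNReal.ofReal C :=
        FamTest.matNormFam_le Φ.d_pos hp1 hp' (by linarith) (by linarith) hpu hC h1
      have h3 (ε : ℝ) (hε : 0 < ε) : ‖∑ σ ∈ G, Φ.term q A σ‖ ≤ (C + ε) * M ^ θ := by
        have h4 := h2.trans_lt ((ENNReal.ofReal_lt_ofReal_iff (by positivity)).2
          (lt_add_of_pos_right C hε))
        have h5 := omTest_partialSum_of_matNormFam_lt hp1 hp' hM hM0 hθ0 hθ1.le hpθ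
          (by positivity) h4 G
        simp only [Matrix.of_apply, partialSum_famTrunc] at h5
        have h6 := eLpNorm_le_of_omTest hq1 hq hqθ (Φ.memLp_partialSum q G A) h5
        rwa [Lp.norm_def, eLpNorm_congr_ae (coeFn_sum_term q A G)]
      have h4 : Tendsto (fun ε : ℝ => (C + ε) * M ^ θ) (𝓝[>] 0) (𝓝 ((C + 0) * M ^ θ)) :=
        Tendsto.mono_left (Continuous.tendsto (by fun_prop) 0) nhdsWithin_le_nhds
      rw [add_zero] at h4
      exact ge_of_tendsto h4 (eventually_nhdsWithin_of_forall h3)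
    rw [summable_iff_vanishing_norm]
    intro ε hε
    have hMθ : 0 < M ^ θ := Real.rpow_pos_of_pos hM0 _
    set δ : ℝ := (ε / M ^ θ) ^ p.toReal with hδ
    obtain ⟨G, hG⟩ := summable_iff_vanishing_norm.1 hT δ (Real.rpow_pos_of_pos (div_pos hε hMθ) _)
    refine ⟨G, fun t ht => (key t).trans_lt ?_⟩
    have h1 := hG t ht
    have h0 : 0 ≤ ∑ σ ∈ t, (d σ : ℝ) * ∑ i, s σ i := Finset.sum_nonneg fun σ _ => hT0 σ
    rw [Real.norm_of_nonneg h0] at h1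
    have h2 := Real.rpow_lt_rpow h0 h1 hpos
    rw [hδ, Real.rpow_rpow_inv (div_pos hε hMθ).le hp''.ne', lt_div_iff₀ hMθ] at h2
    exact h2

lemma exists_finset_norm_sub_lt {q : ℝ≥0∞} [Fact (1 ≤ q)] {x : Matrix (Fin n) (Fin n) (Fam d)}
    (hx : ∀ i j, Summable (Φ.term q (x i j))) {δ : ℝ} (hδ : 0 < δ) :
    ∃ G : Finset S, ∀ i j, ‖Φ.invTransform q (x i j) - ∑ σ ∈ G, Φ.term q (x i j) σ‖ < δ := by
  have h (i j) : ∀ᶠ G : Finset S in atTop,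
      ‖Φ.invTransform q (x i j) - ∑ σ ∈ G, Φ.term q (x i j) σ‖ < δ := by
    have h1 := (tendsto_const_nhds (x := Φ.invTransform q (x i j))).sub (hx i j).hasSum
    have h2 := h1.norm
    rw [invTransform, sub_self, norm_zero] at h2
    exact h2.eventually (gt_mem_nhds hδ)
  exact (eventually_all.2 fun i => eventually_all.2 fun j => h i j).exists

/-- The estimate is known for all finite partial sums with one constant. It passes to the sum
because the entries converge in L^q: almost uniformly in ω for q = ∞, and inside the test form
otherwise. -/
lemma cbNorm_invTransform_le {p q : ℝ≥0∞} [Fact (1 ≤ q)] [ENNReal.HolderConjugate p q]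
    (hp : p ≤ 2) : cbNorm (matNormFam d p) (matNormLp μ q) (Φ.invTransform q)
      ≤ Φ.M ^ (2 / p.toReal - 1) := by
  have hp0 : p ≠ 0 := ENNReal.HolderConjugate.ne_zero p q
  refine iSup_le fun n => iSup_le fun x => iSup_le fun hx => ?_
  by_cases hp1 : p = 1
  · have hq : q = ∞ := (ENNReal.HolderConjugate.eq_top_iff_eq_one q p).2 hp1
    have he : 2 / p.toReal - 1 = 1 := by rw [hp1]; norm_num
    rw [he]
    have hp' : p ≠ ∞ := by rw [hp1]; exact ENNReal.one_ne_top
    rw [matNormFam, if_neg hp', if_pos hp1, ← ENNReal.ofReal_one] at hx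
    have hs (i j) : Summable (Φ.term q (x i j)) := summable_term hp <|
      ((famTest_half_of_matNormFamOne_le d zero_le_one hx).famNorm_le hp0 hp'
        (by rw [hp1]; norm_num) i j).trans_lt ENNReal.ofReal_lt_top
    refine le_rpow_of_forall_le Φ.bounded.ne zero_le_one fun ε hε => ?_
    have hM0 := toReal_add_pos (Φ := Φ) hε
    rw [matNormLp, if_pos hq, Real.rpow_one, matNormLinf_le_iff (by positivity)]
    -- A sequence of finite sets suffices, and being countable it allows one exceptional null set
    -- for all the approximations.
    choose G hG using fun k : ℕ => exists_finset_norm_sub_lt hs (Nat.one_div_pos_of_nat (α := ℝ) (n := k))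
    have h1 : ∀ᵐ ω ∂μ, ∀ k i j,
        ‖Φ.invTransform q (x i j) ω - Φ.partialSum (G k) (x i j) ω‖ ≤ 1 / ((k : ℝ) + 1) := by
      refine ae_all_iff.2 fun k => ae_all_iff.2 fun i => ae_all_iff.2 fun j => ?_
      subst hq
      set g := Φ.invTransform ∞ (x i j) - ∑ σ ∈ G k, Φ.term ∞ (x i j) σ
      filter_upwards [Lp.coeFn_sub (Φ.invTransform ∞ (x i j)) (∑ σ ∈ G k, Φ.term ∞ (x i j) σ),
        coeFn_sum_term ∞ (x i j) (G k), ae_le_eLpNormEssSup (f := g) (μ := μ)] with ω h2 h3 h4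
      have h5 : ‖g ω‖ ≤ ‖g‖ := by
        have h6 := ENNReal.toReal_mono (by
          rw [← eLpNorm_exponent_top]; exact (Lp.memLp g).2.ne) h4
        rwa [toReal_enorm, ← eLpNorm_exponent_top, ← Lp.norm_def] at h6
      rw [h2, Pi.sub_apply, h3] at h5
      exact h5.trans (hG k i j).le
    have h2 : ∀ᵐ ω ∂μ, ∀ k, ‖(Matrix.of fun i j => Φ.partialSum (G k) (x i j) ω :
        Matrix (Fin n) (Fin n) ℂ)‖ ≤ 1 * (Φ.M.toReal + ε) :=
      ae_all_iff.2 fun k => ae_norm_partialSum_le (le_ofReal_toReal_add hε) hM0 zero_le_one hx (G k)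
    filter_upwards [h1, h2] with ω h1 h2
    have h3 : Tendsto (fun k => (Matrix.of fun i j => Φ.partialSum (G k) (x i j) ω :
        Matrix (Fin n) (Fin n) ℂ)) atTop
        (𝓝 (Matrix.of fun i j => Φ.invTransform q (x i j) ω)) := by
      refine tendsto_pi_nhds.2 fun i => tendsto_pi_nhds.2 fun j => ?_
      rw [tendsto_iff_norm_sub_tendsto_zero]
      refine squeeze_zero (fun _ => norm_nonneg _) (fun k => ?_)
        tendsto_one_div_add_atTop_nhds_zero_nat
      rw [norm_sub_rev]
      exact h1 k i j
    refine (le_of_tendsto' h3.norm h2).trans ?_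
    exact mul_le_mul_of_nonneg_right (by linarith) hM0.le
  · obtain ⟨hp1', hp', hq1, hq, hθ0, hθ1, hpθ, hqθ⟩ := holderConjugate_exponents (q := q) hp1 hp
    refine le_rpow_of_forall_le Φ.bounded.ne hθ0 fun ε hε => ?_
    set θ : ℝ := 2 / p.toReal - 1
    have hM0 := toReal_add_pos (Φ := Φ) hε
    have h1 : matNormFam d p n x < ENNReal.ofReal (1 + ε) := by
      refine hx.trans_lt ?_
      rw [← ENNReal.ofReal_one]
      exact (ENNReal.ofReal_lt_ofReal_iff (by positivity)).2 (by linarith)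
    have hs (i j) : Summable (Φ.term q (x i j)) := summable_term hp <|
      famNorm_lt_top_of_matNormFam_lt hp0 hp1 hp' (by linarith) (by positivity) h1 i j
    have hC : 0 ≤ (1 + ε) * (Φ.M.toReal + ε) ^ θ :=
      mul_nonneg (by positivity) (Real.rpow_nonneg hM0.le _)
    refine OmTest.matNormLp_le hq1 hq hqθ hC ?_
    intro J _ E hE hEd hE0 a ha b hb Y hY
    -- The finite set may depend on δ: the remainder has entries so small in L^q that by the crude
    -- Hölder bound its test form is at most δ.
    refine le_of_forall_pos_le_add fun δ hδ => ?_
    obtain ⟨G, hG⟩ := exists_finset_norm_sub_lt hs (δ := δ / (n * n + 1)) (by positivity)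
    have h2 := omTest_partialSum_of_matNormFam_lt hp1 hp' (le_ofReal_toReal_add hε) hM0 hθ0 hθ1.le
      hpθ (by positivity) h1 G
    let g (i j : Fin n) : Lp ℂ q μ := Φ.invTransform q (x i j) - ∑ σ ∈ G, Φ.term q (x i j) σ
    have h3 := omTest_of_memLp hq1 hq hqθ (x := fun i j => g i j) fun i j => Lp.memLp (g i j)
    have h4 : ∑ i, ∑ j, (eLpNorm (g i j) q μ).toReal ≤ δ := by
      calc ∑ i, ∑ j, (eLpNorm (g i j) q μ).toReal
          ≤ ∑ _i : Fin n, ∑ _j : Fin n, δ / (n * n + 1) := Finset.sum_le_sum fun i _ =>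
            Finset.sum_le_sum fun j _ => by rw [← Lp.norm_def]; exact (hG i j).le
        _ = n * n * (δ / (n * n + 1)) := by simp [mul_assoc]
        _ ≤ δ := by
          rw [mul_div_assoc', div_le_iff₀ (by positivity)]
          nlinarith
    have h5 := (h2.add (fun i j => (Φ.memLp_partialSum 1 G (x i j)).integrable le_rfl)
      (fun i j => integrable_Lp q (g i j)) (h3.mono h4)).congr
      (y := fun i j => Φ.invTransform q (x i j)) fun i j => by
        filter_upwards [Lp.coeFn_sub (Φ.invTransform q (x i j)) (∑ σ ∈ G, Φ.term q (x i j) σ),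
          coeFn_sum_term q (x i j) G] with ω h6 h7
        simp only [g]
        rw [h6, Pi.sub_apply, h7]
        ring
    exact h5 J E hE hEd hE0 a ha b hb Y hY

end UBQOS

end QOS

end

theorem lemma2p2 {Ω : Type*} [MeasurableSpace Ω] (μ : Measure Ω) [IsProbabilityMeasure μ]
    {S : Type*} {d : S → ℕ} (Φ : QOS.UBQOS μ d)
    (p q : ℝ≥0∞) [Fact (1 ≤ p)] [Fact (1 ≤ q)] [ENNReal.HolderConjugate p q] (hp : p ≤ 2) :
    ((∀ f : Lp ℂ p μ, QOS.famNorm d q (Φ.transform p f) < ∞) ∧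
      QOS.cbNorm (QOS.matNormLp μ p) (QOS.matNormFam d q) (Φ.transform p)
        ≤ Φ.M ^ (2 / p.toReal - 1)) ∧
    ((∀ A : QOS.Fam d, QOS.famNorm d p A < ∞ → Summable (Φ.term q A)) ∧
      QOS.cbNorm (QOS.matNormFam d p) (QOS.matNormLp μ q) (Φ.invTransform q)
        ≤ Φ.M ^ (2 / p.toReal - 1)) := by
  exact ⟨⟨fun f => QOS.UBQOS.famNorm_transform_lt_top hp f, QOS.UBQOS.cbNorm_transform_le hp⟩,
    ⟨fun A hA => QOS.UBQOS.summable_term hp hA, QOS.UBQOS.cbNorm_invTransform_le hp⟩⟩
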